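/- **Setting.** Let $\Delta$ be the degree of a smooth toric del Pezzo surface (all sides of the polygon of positive length), i.e. one of the following multisets of vectors in $\mathbb Z^2$: (1) *degree $d$*: $(-1,0),(0,-1),(1,1)$, each $d$ times; (2) *bidegree $(a_1,a_2)$*: $(\pm1,0)$ each $a_1$ times, $(0,\pm1)$ each $a_2$ times; (3) $(d;a_1)$: $(-1,0)^{d},(0,-1)^{d-a_1},(1,1)^{d-a_1},(1,0)^{a_1}$; (4) $(d;a_1,a_2)$: $(-1,0)^{d-a_2},(-1,-1)^{a_2},(0,-1)^{d-a_1-a_2},(1,0)^{a_1},(1,1)^{d-a_1}$; (5) $(d;a_1,a_2,a_3)$: $(-1,0)^{d-a_2-a_3},(-1,-1)^{a_2},(0,-1)^{d-a_1-a_2},(1,0)^{a_1},(1,1)^{d-a_1-a_3},(0,1)^{a_3}$. These are the outer normals, repeated according to lattice length, of the sides of the polygon, also denoted $\Delta$. Put $n(\Delta)=\#\Delta-1=\#(\partial\Delta\cap\mathbb Z^2)-1$, and let $r,s\ge 0$ with $r+2s=n(\Delta)$. Let $k$ be a field with $\operatorname{char}k=0$, or $\operatorname{char}k>3$ and $\operatorname{char}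 k$ greater than the diameter of the polygon, and let $d_1,\dots,d_s\in k^\times$. In $\mathrm{GW}(k)$ put $h=\langle1\rangle+\langle-1\rangle$, $\beta_i=\langle 2\rangle+\langle 2d_i\rangle$, and for an integer $m\geq 1$ - $m^{\mathbb A^1}=\langle m\rangle+\frac{m-1}2h$ ($m$ odd), $\frac m2h$ ($m$ even); - $\gamma(m,d)=\langle1\rangle+\frac{m-1}2(\langle2\rangle+\langle-2d\rangle)+\frac{m(m-1)}2h$ ($m$ odd), $\frac{m^2}2h$ ($m$ even); - $\tau(m,d)=\langle1\rangle+\frac{m^2-1}2(\langle1\rangle+\langle-d\rangle)+\frac{m^4-m^2}2h$ ($m$ odd), $\frac{m^2}2(\langle1\rangle+\langle-d\rangle)+\frac{m^4-m^2}2h$ ($m$ even). A *twin tree* $\mathcal T$ (defined below on both sides) has a set $T$ of double points on it, a subset $E\subset T$ of those on twin elevators (pairs of exchanged elevators), weights $m_j$ of the twin elevators ($j\in E$), and a root twin elevator of weight $m_{\rm root}$. With $m_\circ=m_{\rm root}+\#\{\text{unbounded twin elevators of }\mathcal T\}$, put $$\operatorname{mult}^{\mathbb A^1}(\mathcal T)=\prod_{j\in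 E}\tau(m_j,d_j)\cdot\langle 2^{|T|-1}\rangle\cdot\sum_{I\subset T,\ |I|\equiv m_\circ\,(2)}\Big\langle\prod_{i\in I}d_i\Big\rangle .$$ **Tropical count.** Consider rational tropical stable maps $(\Gamma,f)$ to $\mathbb R^2$ of degree $\Delta$ with contracted marked ends $x_1,\dots,x_r,y_1,\dots,y_s,z_1,\dots,z_s$. Let $MC$ be the support of the tropical pull-back of $0$ under $(\mathrm{ev}_{y_j}-\mathrm{ev}_{z_j})_{j}$, that is: the set of $(\Gamma,f)$ with $f(y_j)=f(z_j)$ for all $j$, such that every sufficiently small vector in $(\mathbb R^2)^s$ is attained by $(\mathrm{ev}_{y_j}-\mathrm{ev}_{z_j})_j$ at stable maps arbitrarily close to $(\Gamma,f)$. Given simple points $p_1,\dots,p_r$ and double points $q_1,\dots,q_s$ in $\mathbb R^2$, $(\Gamma,f)\in MC$ *satisfies the point conditions* if $f(x_i)=p_i$ and $f(y_j)=f(z_j)=q_j$. The configuration is in *general position* if every such $(\Gamma,f)$ lies in the relative interior of a cell of $MC$ of the top dimension $2(r+s)$ on which the evaluation at $x_1,\dots,x_r,y_1,\dots,y_s$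 is injective. It is *vertically stretched with constant $C$* if the difference of the $y$-coordinates of any two of the $r+s$ points is, in absolute value, greater than $C$ times the difference of the $x$-coordinates of any two of them. Solutions are counted up to isomorphism, where $y_j$ and $z_j$ are not distinguished. Vertical edges and ends are called elevator edges; an elevator consists of the two elevator edges (or ends) at a marked point on them. A twin tree of $(\Gamma,f)$ with root vertex $v$ consists of two branches of $\Gamma$ at $v$, starting with the edges from $v$ to the vertices carrying $y_j$ and $z_j$ for some $j$, which are exchanged by an automorphism of $(\Gamma,f)$; the edges to $y_j,z_j$ belong to the root twin elevator. Then $$\operatorname{mult}^{\mathbb A^1}(\Gamma,f)=\prod_{\mathcal T}\operatorname{mult}^{\mathbb A^1}(\mathcal T)\prod_{j\in A}\gamma(m_j,d_j)\prod_{j\in R}\beta_j\prod_{v}m_v^{\mathbb A^1}\prod_{v}\big(m_v^{\mathbb A^1}m_v'^{\,\mathbb A^1}\big),$$ where $A$ is the set of $j$ such that $y_j,z_j$ are attached to the same vertex, with three further edges, $m_j$ being the weight of its elevator edge; $R$ is the set of $j\notin A$ such that $q_j$ is not on a twin tree; the next product is over the unmarked $3$-valent vertices which are not on a twin tree and not joined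 by an elevator edge to a vertex belonging to $A$, $m_v$ being the weight of the elevator edge at $v$; the last product is over the unmarked $4$-valent vertices with two parallel elevator edges (of weights $m_v,m'_v$) not belonging to a twin tree as a vertex or as its root. Let $N^{\mathbb A^1,\mathrm{trop}}_\Delta(r,(d_1,\dots,d_s))$ be the sum of $\operatorname{mult}^{\mathbb A^1}(\Gamma,f)$ over all solutions. **Floor diagram count.** A rational floor diagram of degree $\Delta$ is a bipartite tree with $n(\Delta)$ linearly ordered black and white vertices, with positive integer weights on its edges (oriented from the smaller to the larger vertex) and with incoming and outgoing ends of weight $1$. Every vertex may carry a leak $1$ and a leak $-1$ (at most one of each), black vertices carry none, and the weight of the incoming edges and ends minus that of the outgoing ones is the sum of the leaks. The numbers of (white vertices; leaks $1$; leaks $-1$; incoming ends; outgoing ends) are: (1) $(d;d;0;d;0)$; (2) $(a_1;0;0;a_2;a_2)$; (3) $(d;d-a_1;0;d-a_1;0)$; (4) $(d;d-a_1;a_2;d-a_1-a_2;0)$; (5) $(d-a_3;d-a_1-a_3;a_2;d-a_1-a_2;a_3)$. Merge $s$ disjoint pairs of neighbouring vertices, labelled by $1,\dots,s$; floor diagrams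 are then identified if they are isomorphic by a permutation that only exchanges merged vertices. A twin tree with white root $v$ consists of two branches at $v$, starting at two merged black neighbours of $v$ which are exchanged by such an automorphism. Each black vertex of it lies on an elevator (its incoming and outgoing edge or end). Put $$\operatorname{mult}^{\mathbb A^1}(\mathcal D)=\prod_{\mathcal T}\operatorname{mult}^{\mathbb A^1}(\mathcal T)\prod_{j\in A}\gamma(m_j,d_j)\prod_{j\in R}\beta_j\prod_e m_e^{\mathbb A^1},$$ where $A$ is the set of merged pairs consisting of a white vertex and an adjacent black vertex, $m_j$ being the weight of the edge joining them, $R$ is the set of merged pairs not in $A$ and not on a twin tree, and $e$ runs over the bounded edges that are neither contained in a twin tree nor adjacent to a black vertex of a pair in $A$. Let $N^{\mathbb A^1,\mathrm{floor}}_\Delta(r,(d_1,\dots,d_s))$ be the sum of $\operatorname{mult}^{\mathbb A^1}(\mathcal D)$ over all rational floor diagrams of degree $\Delta$ with these $s$ merged pairs. **Theorem.** For every $\Delta$ there is a constant $C$, depending only on $\Delta$, such that for all $r,s$ with $r+2s=n(\Delta)$, all configurations of $r$ simple and $s$ double points which are in general position and vertically stretched with constant $C$, and all $k$ and $d_1,\dots,d_s$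 as above, the set of solutions and the set of floor diagrams with merged points are finite and $$N^{\mathbb A^1,\mathrm{floor}}_\Delta(r,(d_1,\dots,d_s))=N^{\mathbb A^1,\mathrm{trop}}_\Delta(r,(d_1,\dots,d_s))\in \mathrm{GW}(k),$$ where the merged pairs of the floor diagrams are in the same positions in the linear order, and with the same labels, as the double points in the configuration ordered by increasing $y$-coordinate. -/

import Mathlib

open scoped TensorProduct

universe u

noncomputable section

/-! ### The Grothendieck-Witt ring of a field

A non-degenerate symmetric bilinear form on a finite dimensional `k`-vector space is, after a choice
of basis, given by an invertible symmetric Gram matrix. -/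

namespace GrothendieckWitt

/-- Isometry of the bilinear forms with Gram matrices `A` and `B`. -/
def Isometric {k : Type u} [Field k] {ι κ : Type} [Fintype ι] [DecidableEq ι] [Fintype κ]
    [DecidableEq κ] (A : Matrix ι ι k) (B : Matrix κ κ k) : Prop :=
  ∃ (P : Matrix ι κ k) (Q : Matrix κ ι k), P * Q = 1 ∧ Q * P = 1 ∧ P.transpose * A * P = B

section Isometric

variable {k : Type u} [Field k] {ι κ μ ν : Type} [Fintype ι] [DecidableEq ι] [Fintype κ]
  [DecidableEq κ] [Fintype μ] [DecidableEq μ] [Fintype ν] [DecidableEq ν]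

theorem Isometric.refl (A : Matrix ι ι k) : Isometric A A := ⟨1, 1, by simp⟩

theorem Isometric.symm {A : Matrix ι ι k} {B : Matrix κ κ k} (h : Isometric A B) :
    Isometric B A := by
  obtain ⟨P, Q, h1, h2, rfl⟩ := h
  refine ⟨Q, P, h2, h1, ?_⟩
  have h3 : Q.transpose * P.transpose = 1 := by rw [← Matrix.transpose_mul, h1]; simp
  calc Q.transpose * (P.transpose * A * P) * Q
      = (Q.transpose * P.transpose) * A * (P * Q) := by simp only [Matrix.mul_assoc]
    _ = A := by simp [h1, h3]

theorem Isometric.trans {A : Matrix ι ι k} {B : Matrix κ κ k} {C : Matrix μ μ k}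
    (h : Isometric A B) (h' : Isometric B C) : Isometric A C := by
  obtain ⟨P, Q, h1, h2, rfl⟩ := h
  obtain ⟨R, S, h3, h4, rfl⟩ := h'
  refine ⟨P * R, S * Q, ?_, ?_, ?_⟩
  · calc P * R * (S * Q) = P * (R * S) * Q := by simp only [Matrix.mul_assoc]
      _ = 1 := by simp [h3, h1]
  · calc S * Q * (P * R) = S * (Q * P) * R := by simp only [Matrix.mul_assoc]
      _ = 1 := by simp [h2, h4]
  · simp only [Matrix.transpose_mul, Matrix.mul_assoc]

theorem Isometric.of_equiv {A : Matrix ι ι k} {B : Matrix κ κ k} (e : ι ≃ κ)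
    (h : ∀ i j, A i j = B (e i) (e j)) : Isometric A B := by
  have hB : B = A.submatrix e.symm e.symm := by ext i j; simp [h]
  subst hB
  refine ⟨(1 : Matrix ι ι k).submatrix id e.symm, (1 : Matrix ι ι k).submatrix e.symm id,
    ?_, ?_, ?_⟩
  · rw [Matrix.submatrix_mul_equiv]; simp
  · ext i j
    simp [Matrix.mul_apply, Matrix.one_apply]
  · ext i j
    simp [Matrix.mul_apply, Matrix.one_apply]

theorem Isometric.submatrix (e : ι ≃ κ) (A : Matrix ι ι k) :
    Isometric A (A.submatrix e.symm e.symm) :=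
  Isometric.of_equiv e (by intro i j; simp)

theorem Isometric.fromBlocks {A : Matrix ι ι k} {B : Matrix κ κ k} {C : Matrix μ μ k}
    {D : Matrix ν ν k} (h : Isometric A B) (h' : Isometric C D) :
    Isometric (Matrix.fromBlocks A 0 0 C) (Matrix.fromBlocks B 0 0 D) := by
  obtain ⟨P, Q, h1, h2, rfl⟩ := h
  obtain ⟨R, S, h3, h4, rfl⟩ := h'
  refine ⟨Matrix.fromBlocks P 0 0 R, Matrix.fromBlocks Q 0 0 S, ?_, ?_, ?_⟩
  · simp [Matrix.fromBlocks_multiply, h1, h3]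
  · simp [Matrix.fromBlocks_multiply, h2, h4]
  · simp [Matrix.fromBlocks_multiply, Matrix.fromBlocks_transpose]

theorem Isometric.kronecker {A : Matrix ι ι k} {B : Matrix κ κ k} {C : Matrix μ μ k}
    {D : Matrix ν ν k} (h : Isometric A B) (h' : Isometric C D) :
    Isometric (Matrix.kroneckerMap (· * ·) A C) (Matrix.kroneckerMap (· * ·) B D) := by
  obtain ⟨P, Q, h1, h2, rfl⟩ := h
  obtain ⟨R, S, h3, h4, rfl⟩ := h'
  refine ⟨Matrix.kroneckerMap (· * ·) P R, Matrix.kroneckerMap (· * ·) Q S, ?_, ?_, ?_⟩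
  · rw [← Matrix.mul_kronecker_mul, h1, h3]; exact Matrix.one_kronecker_one
  · rw [← Matrix.mul_kronecker_mul, h2, h4]; exact Matrix.one_kronecker_one
  · rw [← Matrix.kroneckerMap_transpose, ← Matrix.mul_kronecker_mul, ← Matrix.mul_kronecker_mul]

end Isometric

/-- A non-degenerate symmetric bilinear form on `k ^ n`, given by its Gram matrix. -/
structure Form (k : Type u) [Field k] where
  n : ℕ
  gram : Matrix (Fin n) (Fin n) k
  symm : gram.IsSymm
  nondeg : gram.det ≠ 0

variable {k : Type u} [Field k]

/-- Orthogonal direct sum. -/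
def Form.sum (a b : Form k) : Form k where
  n := a.n + b.n
  gram := (Matrix.fromBlocks a.gram 0 0 b.gram).submatrix finSumFinEquiv.symm finSumFinEquiv.symm
  symm := (Matrix.IsSymm.fromBlocks a.symm (by simp) b.symm).submatrix _
  nondeg := by
    rw [Matrix.det_submatrix_equiv_self, Matrix.det_fromBlocks_zero₂₁]
    exact mul_ne_zero a.nondeg b.nondeg

/-- Tensor product of forms. -/
def Form.tensor (a b : Form k) : Form k where
  n := a.n * b.n
  gram := (Matrix.kroneckerMap (· * ·) a.gram b.gram).submatrix
    finProdFinEquiv.symm finProdFinEquiv.symm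
  symm := by
    have h : (Matrix.kroneckerMap (· * ·) a.gram b.gram).IsSymm := by
      unfold Matrix.IsSymm
      rw [← Matrix.kroneckerMap_transpose, a.symm.eq, b.symm.eq]
    exact h.submatrix _
  nondeg := by
    rw [Matrix.det_submatrix_equiv_self, Matrix.det_kronecker]
    exact mul_ne_zero (pow_ne_zero _ a.nondeg) (pow_ne_zero _ b.nondeg)

/-- The rank one form `(x, y) ↦ a x y`. -/
def Form.unary (a : k) (ha : a ≠ 0) : Form k where
  n := 1
  gram := Matrix.of fun _ _ => a
  symm := rfl
  nondeg := by simpa using ha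

/-- The form on the zero space. -/
def Form.zero (k : Type u) [Field k] : Form k where
  n := 0
  gram := 0
  symm := by ext i; exact i.elim0
  nondeg := by simp

theorem Form.isom_sum (a b : Form k) :
    Isometric (Matrix.fromBlocks a.gram 0 0 b.gram) (a.sum b).gram :=
  Isometric.submatrix finSumFinEquiv _

theorem Form.isom_tensor (a b : Form k) :
    Isometric (Matrix.kroneckerMap (· * ·) a.gram b.gram) (a.tensor b).gram :=
  Isometric.submatrix finProdFinEquiv _

instance formSetoid (k : Type u) [Field k] : Setoid (Form k) where
  r a b := Isometric a.gram b.gram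
  iseqv := ⟨fun _ => Isometric.refl _, Isometric.symm, Isometric.trans⟩

/-- Isometry classes of non-degenerate symmetric bilinear forms over `k`. -/
def FormClass (k : Type u) [Field k] : Type u := Quotient (formSetoid k)

instance (k : Type u) [Field k] : Add (FormClass k) :=
  ⟨Quotient.map₂ Form.sum (fun a a' h b b' h' =>
    ((Form.isom_sum a b).symm.trans (Isometric.fromBlocks h h')).trans (Form.isom_sum a' b'))⟩

instance (k : Type u) [Field k] : Mul (FormClass k) :=
  ⟨Quotient.map₂ Form.tensor (fun a a' h b b' h' =>
    ((Form.isom_tensor a b).symm.trans (Isometric.kronecker h h')).trans (Form.isom_tensor a' b'))⟩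

instance (k : Type u) [Field k] : Zero (FormClass k) := ⟨Quotient.mk _ (Form.zero k)⟩

instance (k : Type u) [Field k] : One (FormClass k) := ⟨Quotient.mk _ (Form.unary 1 one_ne_zero)⟩

/-- The isometry classes form a commutative semiring under direct sum and tensor product. -/
instance (k : Type u) [Field k] : CommSemiring (FormClass k) where
  nsmul := nsmulRec
  add_assoc := by
    rintro ⟨a⟩ ⟨b⟩ ⟨c⟩
    refine Quotient.sound ?_
    refine Isometric.trans ((Form.isom_sum _ _).symm.trans (Isometric.fromBlocks
      (Form.isom_sum _ _).symm (Isometric.refl _))) (Isometric.trans ?_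
      ((Isometric.fromBlocks (Isometric.refl _) (Form.isom_sum _ _)).trans (Form.isom_sum _ _)))
    refine Isometric.of_equiv (Equiv.sumAssoc _ _ _) ?_
    rintro ((i | i) | i) ((j | j) | j) <;> simp
  zero_add := by
    rintro ⟨a⟩
    refine Quotient.sound ?_
    refine (Form.isom_sum _ _).symm.trans ?_
    refine Isometric.of_equiv (Equiv.emptySum (Fin 0) _) ?_
    rintro (i | i) (j | j)
    · exact i.elim0
    · exact i.elim0
    · exact j.elim0
    · rfl
  add_zero := by
    rintro ⟨a⟩
    refine Quotient.sound ?_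
    refine (Form.isom_sum _ _).symm.trans ?_
    refine Isometric.of_equiv (Equiv.sumEmpty _ (Fin 0)) ?_
    rintro (i | i) (j | j)
    · rfl
    · exact j.elim0
    · exact i.elim0
    · exact i.elim0
  add_comm := by
    rintro ⟨a⟩ ⟨b⟩
    refine Quotient.sound ?_
    refine (Form.isom_sum _ _).symm.trans (Isometric.trans ?_ (Form.isom_sum _ _))
    refine Isometric.of_equiv (Equiv.sumComm _ _) ?_
    rintro (i | i) (j | j) <;> simp
  mul_assoc := by
    rintro ⟨a⟩ ⟨b⟩ ⟨c⟩
    refine Quotient.sound ?_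
    refine Isometric.trans ((Form.isom_tensor _ _).symm.trans (Isometric.kronecker
      (Form.isom_tensor _ _).symm (Isometric.refl _))) (Isometric.trans ?_
      ((Isometric.kronecker (Isometric.refl _) (Form.isom_tensor _ _)).trans
        (Form.isom_tensor _ _)))
    refine Isometric.of_equiv (Equiv.prodAssoc _ _ _) ?_
    rintro ⟨⟨i, i'⟩, i''⟩ ⟨⟨j, j'⟩, j''⟩
    simp [mul_assoc]
  one_mul := by
    rintro ⟨a⟩
    refine Quotient.sound ?_
    refine (Form.isom_tensor _ _).symm.trans ?_
    refine Isometric.of_equiv (Equiv.uniqueProd _ (Fin 1)) ?_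
    rintro ⟨i, i'⟩ ⟨j, j'⟩
    exact one_mul _
  mul_one := by
    rintro ⟨a⟩
    refine Quotient.sound ?_
    refine (Form.isom_tensor _ _).symm.trans ?_
    refine Isometric.of_equiv (Equiv.prodUnique _ (Fin 1)) ?_
    rintro ⟨i, i'⟩ ⟨j, j'⟩
    exact mul_one _
  mul_comm := by
    rintro ⟨a⟩ ⟨b⟩
    refine Quotient.sound ?_
    refine (Form.isom_tensor _ _).symm.trans (Isometric.trans ?_ (Form.isom_tensor _ _))
    refine Isometric.of_equiv (Equiv.prodComm _ _) ?_
    rintro ⟨i, i'⟩ ⟨j, j'⟩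
    simp [mul_comm]
  zero_mul := by
    rintro ⟨a⟩
    refine Quotient.sound ?_
    refine (Form.isom_tensor _ _).symm.trans ?_
    exact Isometric.of_equiv ⟨fun i => i.1, fun i => i.elim0, fun i => i.1.elim0,
      fun i => i.elim0⟩ (fun i => i.1.elim0)
  mul_zero := by
    rintro ⟨a⟩
    refine Quotient.sound ?_
    refine (Form.isom_tensor _ _).symm.trans ?_
    exact Isometric.of_equiv ⟨fun i => i.2, fun i => i.elim0, fun i => i.2.elim0,
      fun i => i.elim0⟩ (fun i => i.2.elim0)
  left_distrib := by
    rintro ⟨a⟩ ⟨b⟩ ⟨c⟩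
    refine Quotient.sound ?_
    refine Isometric.trans ((Form.isom_tensor _ _).symm.trans (Isometric.kronecker
      (Isometric.refl _) (Form.isom_sum _ _).symm)) (Isometric.trans ?_
      ((Isometric.fromBlocks (Form.isom_tensor _ _) (Form.isom_tensor _ _)).trans
        (Form.isom_sum _ _)))
    refine Isometric.of_equiv (Equiv.prodSumDistrib _ _ _) ?_
    rintro ⟨i, i' | i'⟩ ⟨j, j' | j'⟩ <;> simp
  right_distrib := by
    rintro ⟨a⟩ ⟨b⟩ ⟨c⟩
    refine Quotient.sound ?_
    refine Isometric.trans ((Form.isom_tensor _ _).symm.trans (Isometric.kronecker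
      (Form.isom_sum _ _).symm (Isometric.refl _))) (Isometric.trans ?_
      ((Isometric.fromBlocks (Form.isom_tensor _ _) (Form.isom_tensor _ _)).trans
        (Form.isom_sum _ _)))
    refine Isometric.of_equiv (Equiv.sumProdDistrib _ _ _) ?_
    rintro ⟨i | i, i'⟩ ⟨j | j, j'⟩ <;> simp

end GrothendieckWitt

/-- The Grothendieck-Witt ring: the group completion of the semiring `S` of isometry classes of
non-degenerate symmetric bilinear forms. The group completion of `(S, +)`, with its ring structure,
is `ℤ ⊗[ℕ] S`. -/
abbrev GW (k : Type u) [Field k] : Type u := ℤ ⊗[ℕ] GrothendieckWitt.FormClass k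

namespace GW

open Classical in
/-- The class `⟨a⟩` of the form `(x, y) ↦ a x y`, for `a ≠ 0` (and `0` for `a = 0`). -/
def symb {k : Type u} [Field k] (a : k) : GW k :=
  if ha : a ≠ 0 then 1 ⊗ₜ[ℕ] (Quotient.mk _ (GrothendieckWitt.Form.unary a ha) :
    GrothendieckWitt.FormClass k) else 0

variable (k : Type u) [Field k]

/-- The hyperbolic form `h = ⟨1⟩ + ⟨-1⟩`. -/
def hyp : GW k := symb 1 + symb (-1)

/-- `m ^ 𝔸¹`. -/
def natA1 (m : ℕ) : GW k :=
  if Odd m then symb (m : k) + ((m - 1) / 2) • hyp k else (m / 2) • hyp k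

variable {k}

/-- Multiplicity of a twin elevator of weight `m` carrying the double point belonging to
`k(√d)`. -/
def twinEdge (m : ℕ) (d : kˣ) : GW k :=
  if Odd m then
    symb 1 + ((m ^ 2 - 1) / 2) • (symb 1 + symb (-(d : k))) + ((m ^ 4 - m ^ 2) / 2) • hyp k
  else (m ^ 2 / 2) • (symb 1 + symb (-(d : k))) + ((m ^ 4 - m ^ 2) / 2) • hyp k

/-- The factor `γ` of a double point on a vertex whose elevator has weight `m`. -/
def gamma (m : ℕ) (d : kˣ) : GW k :=
  if Odd m then
    symb 1 + ((m - 1) / 2) • (symb 2 + symb (-(2 * (d : k)))) + (m * (m - 1) / 2) • hyp k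
  else (m ^ 2 / 2) • hyp k

/-- The factor `β`. -/
def beta (d : kˣ) : GW k := symb 2 + symb (2 * (d : k))

/-- Multiplicity of a twin tree: `T` is the set of (indices of) double points on the twin tree, `E`
is the set of those which lie on a twin elevator, `m j` is the weight of the twin elevator through
the `j`-th double point, and `m₀` is the weight of the root plus the number of unbounded twin
elevators. -/
def twinTree {s : ℕ} (d : Fin s → kˣ) (T E : Finset (Fin s)) (m : Fin s → ℕ) (m₀ : ℕ) : GW k :=
  (∏ j ∈ E, twinEdge (m j) (d j)) * symb ((2 : k) ^ (T.card - 1)) *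
    ∑ I ∈ T.powerset.filter (fun I => I.card ≡ m₀ [MOD 2]), symb (∏ i ∈ I, (d i : k))

end GW

/-! ### Degrees -/

/-- The degrees belonging to smooth toric del Pezzo surfaces: degree `d` in the plane, bidegree
`(a₁, a₂)` in `ℙ¹ × ℙ¹`, and the blow-ups of the plane in one, two and three points. -/
inductive DelPezzoDegree : Type
  | plane (d : ℕ)
  | quadric (a₁ a₂ : ℕ)
  | blowup1 (d a₁ : ℕ)
  | blowup2 (d a₁ a₂ : ℕ)
  | blowup3 (d a₁ a₂ a₃ : ℕ)

namespace DelPezzoDegree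

/-- All sides of the polygon have positive length. -/
def Valid : DelPezzoDegree → Prop
  | plane d => 0 < d
  | quadric a₁ a₂ => 0 < a₁ ∧ 0 < a₂
  | blowup1 d a₁ => 0 < a₁ ∧ a₁ < d
  | blowup2 d a₁ a₂ => 0 < a₁ ∧ 0 < a₂ ∧ a₁ + a₂ < d
  | blowup3 d a₁ a₂ a₃ => 0 < a₁ ∧ 0 < a₂ ∧ 0 < a₃ ∧ a₁ + a₂ < d ∧ a₁ + a₃ < d ∧ a₂ + a₃ < d

/-- The multiset of directions of the (unmarked) ends. -/
def ends : DelPezzoDegree → Multiset (ℤ × ℤ)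
  | plane d => .replicate d (-1, 0) + .replicate d (0, -1) + .replicate d (1, 1)
  | quadric a₁ a₂ => .replicate a₁ (-1, 0) + .replicate a₁ (1, 0) + .replicate a₂ (0, -1) +
      .replicate a₂ (0, 1)
  | blowup1 d a₁ => .replicate d (-1, 0) + .replicate (d - a₁) (0, -1) +
      .replicate (d - a₁) (1, 1) + .replicate a₁ (1, 0)
  | blowup2 d a₁ a₂ => .replicate (d - a₂) (-1, 0) + .replicate a₂ (-1, -1) +
      .replicate (d - a₁ - a₂) (0, -1) + .replicate a₁ (1, 0) + .replicate (d - a₁) (1, 1)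
  | blowup3 d a₁ a₂ a₃ => .replicate (d - a₂ - a₃) (-1, 0) + .replicate a₂ (-1, -1) +
      .replicate (d - a₁ - a₂) (0, -1) + .replicate a₁ (1, 0) + .replicate (d - a₁ - a₃) (1, 1) +
      .replicate a₃ (0, 1)

/-- The number of point conditions: the number of ends (that is, of lattice points on the boundary
of the polygon) minus one. -/
def n (Δ : DelPezzoDegree) : ℕ := Multiset.card Δ.ends - 1

/-- The vertices of the polygon; its outer normal vectors are the directions in `ends`. -/
def vertices : DelPezzoDegree → Set (EuclideanSpace ℝ (Fin 2))
  | plane d => {!₂[0, 0], !₂[(d : ℝ), 0], !₂[0, (d : ℝ)]}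
  | quadric a₁ a₂ => {!₂[0, 0], !₂[(a₂ : ℝ), 0], !₂[(a₂ : ℝ), (a₁ : ℝ)], !₂[0, (a₁ : ℝ)]}
  | blowup1 d a₁ => {!₂[0, 0], !₂[(d : ℝ) - a₁, 0], !₂[(d : ℝ) - a₁, (a₁ : ℝ)], !₂[0, (d : ℝ)]}
  | blowup2 d a₁ a₂ => {!₂[0, (a₂ : ℝ)], !₂[(a₂ : ℝ), 0], !₂[(d : ℝ) - a₁, 0],
      !₂[(d : ℝ) - a₁, (a₁ : ℝ)], !₂[0, (d : ℝ)]}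
  | blowup3 d a₁ a₂ a₃ => {!₂[0, (a₂ : ℝ)], !₂[(a₂ : ℝ), 0], !₂[(d : ℝ) - a₁, 0],
      !₂[(d : ℝ) - a₁, (a₁ : ℝ)], !₂[(a₃ : ℝ), (d : ℝ) - a₃], !₂[0, (d : ℝ) - a₃]}

/-- The Newton polygon. -/
def polygon (Δ : DelPezzoDegree) : Set (EuclideanSpace ℝ (Fin 2)) := convexHull ℝ Δ.vertices

/-- The number of white vertices (floors) of a floor diagram. -/
def numWhite : DelPezzoDegree → ℕ
  | plane d => d
  | quadric a₁ _ => a₁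
  | blowup1 d _ => d
  | blowup2 d _ _ => d
  | blowup3 d _ _ a₃ => d - a₃

/-- The number of leaks `1` of a floor diagram. -/
def numLeakPos : DelPezzoDegree → ℕ
  | plane d => d
  | quadric _ _ => 0
  | blowup1 d a₁ => d - a₁
  | blowup2 d a₁ _ => d - a₁
  | blowup3 d a₁ _ a₃ => d - a₁ - a₃

/-- The number of leaks `-1` of a floor diagram. -/
def numLeakNeg : DelPezzoDegree → ℕ
  | plane _ => 0
  | quadric _ _ => 0
  | blowup1 _ _ => 0
  | blowup2 _ _ a₂ => a₂
  | blowup3 _ _ a₂ _ => a₂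

/-- The number of incoming ends of a floor diagram. -/
def numIn : DelPezzoDegree → ℕ
  | plane d => d
  | quadric _ a₂ => a₂
  | blowup1 d a₁ => d - a₁
  | blowup2 d a₁ a₂ => d - a₁ - a₂
  | blowup3 d a₁ a₂ _ => d - a₁ - a₂

/-- The number of outgoing ends of a floor diagram. -/
def numOut : DelPezzoDegree → ℕ
  | plane _ => 0
  | quadric _ a₂ => a₂
  | blowup1 _ _ => 0
  | blowup2 _ _ _ => 0
  | blowup3 _ _ _ a₃ => a₃

end DelPezzoDegree

/-! ### Marked trees and their twin trees -/

/-- The labels `x_1, …, x_r`, `y_1, …, y_s`, `z_1, …, z_s` of the marked points; `y_j` and `z_j`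
together form the `j`-th double point. -/
inductive Mark (r s : ℕ) : Type
  | x (i : Fin r)
  | y (j : Fin s)
  | z (j : Fin s)

/-- The map `φ` is compatible with markings, where the two marked points which form a double point
are not distinguished from each other. -/
def RespectsMarks {r s : ℕ} {V W : Type} (a : Mark r s → V) (b : Mark r s → W) (φ : V → W) : Prop :=
  (∀ i, φ (a (.x i)) = b (.x i)) ∧
    ∀ j, (φ (a (.y j)) = b (.y j) ∧ φ (a (.z j)) = b (.z j)) ∨
      (φ (a (.y j)) = b (.z j) ∧ φ (a (.z j)) = b (.y j))

theorem RespectsMarks.refl {r s : ℕ} {V : Type} (a : Mark r s → V) : RespectsMarks a a id :=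
  ⟨fun _ => rfl, fun _ => Or.inl ⟨rfl, rfl⟩⟩

theorem RespectsMarks.symm {r s : ℕ} {V W : Type} {a : Mark r s → V} {b : Mark r s → W} {φ : V ≃ W}
    (h : RespectsMarks a b φ) : RespectsMarks b a φ.symm := by
  refine ⟨fun i => by simp [← h.1 i], fun j => ?_⟩
  rcases h.2 j with ⟨h1, h2⟩ | ⟨h1, h2⟩
  · left; simp [← h1, ← h2]
  · right; simp [← h1, ← h2]

theorem RespectsMarks.trans {r s : ℕ} {V W X : Type} {a : Mark r s → V} {b : Mark r s → W}
    {c : Mark r s → X} {φ : V → W} {ψ : W → X} (h : RespectsMarks a b φ)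
    (h' : RespectsMarks b c ψ) : RespectsMarks a c (ψ ∘ φ) := by
  refine ⟨fun i => by simp [h.1 i, h'.1 i], fun j => ?_⟩
  rcases h.2 j with ⟨h1, h2⟩ | ⟨h1, h2⟩ <;> rcases h'.2 j with ⟨h3, h4⟩ | ⟨h3, h4⟩ <;>
    simp [h1, h2, h3, h4]

/-- For adjacent vertices `v`, `a` of a tree: the vertices which lie beyond `a` as seen from `v`. -/
def branch {V : Type} (G : SimpleGraph V) (v a : V) : Set V := {u | G.dist v u = G.dist a u + 1}

/-- `G` is a tree with marked points `a`, and `Aut` is the set of its automorphisms. A twin tree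
with root `v` and root double point `j`: the two marked points of the `j`-th double point are
distinct neighbours of `v` which are exchanged by an automorphism. The automorphism then
exchanges the two branches of `G` at `v` through these two neighbours, and these two identical
branches (together with the two edges joining them to `v`) are the twin tree. -/
def IsTwinRoot {r s : ℕ} {V : Type} (G : SimpleGraph V) (a : Mark r s → V)
    (Aut : Set (Equiv.Perm V)) (j : Fin s) (v : V) : Prop :=
  a (.y j) ≠ a (.z j) ∧ G.Adj v (a (.y j)) ∧ G.Adj v (a (.z j)) ∧
    ∃ φ ∈ Aut, φ (a (.y j)) = a (.z j)

/-- The set of vertices of the twin tree with root double point `j` (empty, if `j` is not the root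
double point of a twin tree). The root itself does not belong to it. -/
def twinVertices {r s : ℕ} {V : Type} (G : SimpleGraph V) (a : Mark r s → V)
    (Aut : Set (Equiv.Perm V)) (j : Fin s) : Set V :=
  {u | ∃ v, IsTwinRoot G a Aut j v ∧ u ∈ branch G v (a (.y j)) ∪ branch G v (a (.z j))}

/-! ### Floor diagrams -/

/-- The undirected graph with an edge for each nonzero weight. -/
def weightGraph {V : Type} (w : V → V → ℕ) : SimpleGraph V := SimpleGraph.fromRel fun u v => w u v ≠ 0

/-- A rational floor diagram of degree `Δ`. The vertices are `0 < 1 < ⋯ < n(Δ) - 1`; those which are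
not white are black. `weight u v` is the weight of the edge from `u` to `v`, and `0` if there is no
such edge. Ends have weight one, so it suffices to record their number at every vertex. The leaks
at a vertex, recorded up to leaks `0`, are: a leak `1` if the vertex is in `leakPos`, and a
leak `-1` if it is in `leakNeg`. -/
structure FloorDiagram (Δ : DelPezzoDegree) where
  white : Finset (Fin Δ.n)
  weight : Fin Δ.n → Fin Δ.n → ℕ
  inEnds : Fin Δ.n → ℕ
  outEnds : Fin Δ.n → ℕ
  leakPos : Finset (Fin Δ.n)
  leakNeg : Finset (Fin Δ.n)
  oriented : ∀ u v, weight u v ≠ 0 → u < v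
  bipartite : ∀ u v, weight u v ≠ 0 → (u ∈ white ↔ v ∉ white)
  isTree : (weightGraph weight).IsTree
  leakPos_white : leakPos ⊆ white
  leakNeg_white : leakNeg ⊆ white
  divergence : ∀ v, ((∑ u, weight u v + inEnds v : ℕ) : ℤ) - ((∑ u, weight v u + outEnds v : ℕ) : ℤ)
    = (if v ∈ leakPos then 1 else 0) - (if v ∈ leakNeg then 1 else 0)
  card_white : white.card = Δ.numWhite
  card_leakPos : leakPos.card = Δ.numLeakPos
  card_leakNeg : leakNeg.card = Δ.numLeakNeg
  sum_inEnds : ∑ v, inEnds v = Δ.numIn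
  sum_outEnds : ∑ v, outEnds v = Δ.numOut

/-- A way of merging `s` disjoint pairs of neighbouring points among `n` linearly ordered points: the
`j`-th merged point consists of the neighbouring points `slot (y j)` and `slot (z j)`. -/
structure Merging (n r s : ℕ) where
  slot : Mark r s ≃ Fin n
  consecutive : ∀ j, (slot (.y j) : ℕ) + 1 = slot (.z j)

namespace FloorDiagram

variable {Δ : DelPezzoDegree} {r s : ℕ}

/-- The underlying tree. -/
def graph (D : FloorDiagram Δ) : SimpleGraph (Fin Δ.n) := weightGraph D.weight

/-- `τ` is an isomorphism from `D` to `E` which respects the partial order obtained by merging,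
that is, up to exchanging points which are merged. -/
structure IsIso (M : Merging Δ.n r s) (D E : FloorDiagram Δ) (τ : Equiv.Perm (Fin Δ.n)) : Prop where
  marks : RespectsMarks M.slot M.slot τ
  white : ∀ v, τ v ∈ E.white ↔ v ∈ D.white
  weight : ∀ u v, E.weight (τ u) (τ v) = D.weight u v
  inEnds : ∀ v, E.inEnds (τ v) = D.inEnds v
  outEnds : ∀ v, E.outEnds (τ v) = D.outEnds v
  leakPos : ∀ v, τ v ∈ E.leakPos ↔ v ∈ D.leakPos
  leakNeg : ∀ v, τ v ∈ E.leakNeg ↔ v ∈ D.leakNeg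

/-- Two floor diagrams are identified if they become equal after merging. -/
def mergeSetoid (Δ : DelPezzoDegree) (M : Merging Δ.n r s) : Setoid (FloorDiagram Δ) where
  r D E := ∃ τ, IsIso M D E τ
  iseqv := by
    refine ⟨fun D => ⟨1, ?_⟩, ?_, ?_⟩
    · exact ⟨RespectsMarks.refl _, by simp, by simp, by simp, by simp, by simp, by simp⟩
    · rintro D E ⟨τ, h⟩
      refine ⟨τ.symm, h.marks.symm, ?_, ?_, ?_, ?_, ?_, ?_⟩
      · intro v; simp [← h.white]
      · intro u v; simp [← h.weight]
      · intro v; simp [← h.inEnds]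
      · intro v; simp [← h.outEnds]
      · intro v; simp [← h.leakPos]
      · intro v; simp [← h.leakNeg]
    · rintro D E F ⟨τ, h⟩ ⟨σ, h'⟩
      refine ⟨τ.trans σ, h.marks.trans h'.marks, ?_, ?_, ?_, ?_, ?_, ?_⟩
      · intro v; simp [← h.white, ← h'.white]
      · intro u v; simp [← h.weight, ← h'.weight]
      · intro v; simp [← h.inEnds, ← h'.inEnds]
      · intro v; simp [← h.outEnds, ← h'.outEnds]
      · intro v; simp [← h.leakPos, ← h'.leakPos]
      · intro v; simp [← h.leakNeg, ← h'.leakNeg]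

/-- The weight of the elevator through a black vertex, that is, of its incoming (and also of its
outgoing) edge or end. -/
def elevatorWeight (D : FloorDiagram Δ) (v : Fin Δ.n) : ℕ := ∑ u, D.weight u v + D.inEnds v

/-- The automorphisms of the floor diagram with merged points. -/
def aut (D : FloorDiagram Δ) (M : Merging Δ.n r s) : Set (Equiv.Perm (Fin Δ.n)) :=
  {τ | IsIso M D D τ}

/-- The merged point `j` is the root of a twin tree. -/
def IsRoot (D : FloorDiagram Δ) (M : Merging Δ.n r s) (j : Fin s) : Prop :=
  ∃ v, IsTwinRoot D.graph M.slot (D.aut M) j v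

/-- The vertices of the twin tree with root `j`. -/
def twin (D : FloorDiagram Δ) (M : Merging Δ.n r s) (j : Fin s) : Set (Fin Δ.n) :=
  twinVertices D.graph M.slot (D.aut M) j

/-- At the merged point `j` a white vertex and an adjacent black vertex have been merged. -/
def OnVertex (D : FloorDiagram Δ) (M : Merging Δ.n r s) (j : Fin s) : Prop :=
  D.graph.Adj (M.slot (.y j)) (M.slot (.z j))

open Classical in
/-- The multiplicity of the twin tree with root `j`. -/
def twinMult {k : Type u} [Field k] (D : FloorDiagram Δ) (M : Merging Δ.n r s) (d : Fin s → kˣ)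
    (j : Fin s) : GW k :=
  let T := Finset.univ.filter fun i => M.slot (.y i) ∈ D.twin M j
  let E := T.filter fun i => M.slot (.y i) ∉ D.white
  let m := fun i => D.elevatorWeight (M.slot (.y i))
  GW.twinTree d T E m (m j + (E.filter fun i =>
    D.inEnds (M.slot (.y i)) + D.outEnds (M.slot (.y i)) ≠ 0).card)

open Classical in
/-- The quadratically enriched multiplicity of a floor diagram with merged points. The last product
is over the bounded edges which are neither contained in a twin tree nor adjacent to a black vertex
that has been merged with an adjacent white vertex. -/
def mult {k : Type u} [Field k] (D : FloorDiagram Δ) (M : Merging Δ.n r s) (d : Fin s → kˣ) :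
    GW k :=
  (∏ j ∈ Finset.univ.filter (fun j => D.IsRoot M j), D.twinMult M d j) *
  (∏ j ∈ Finset.univ.filter (fun j => D.OnVertex M j),
    GW.gamma (D.weight (M.slot (.y j)) (M.slot (.z j))) (d j)) *
  (∏ j ∈ Finset.univ.filter (fun j => ¬ D.OnVertex M j ∧ ∀ i, M.slot (.y j) ∉ D.twin M i),
    GW.beta (d j)) *
  ∏ e ∈ Finset.univ.filter (fun e : Fin Δ.n × Fin Δ.n => D.weight e.1 e.2 ≠ 0 ∧
      ∀ v, (v = e.1 ∨ v = e.2) → (∀ j, v ∉ D.twin M j) ∧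
        ¬ (v ∉ D.white ∧ ∃ j, D.OnVertex M j ∧ (v = M.slot (.y j) ∨ v = M.slot (.z j)))),
    GW.natA1 k (D.weight e.1 e.2)

end FloorDiagram

/-- The set of rational floor diagrams of degree `Δ` with `s` merged points. -/
def MergedFloorDiagram (Δ : DelPezzoDegree) {r s : ℕ} (M : Merging Δ.n r s) : Type :=
  Quotient (FloorDiagram.mergeSetoid Δ M)

/-- The count of rational floor diagrams of degree `Δ` with `s` merged points. (The multiplicity does
not depend on the representative.) -/
def floorCount (Δ : DelPezzoDegree) {r s : ℕ} (M : Merging Δ.n r s) {k : Type u} [Field k]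
    (d : Fin s → kˣ) : GW k :=
  ∑ᶠ D : MergedFloorDiagram Δ M, (Quotient.out D).mult M d

/-! ### Tropical stable maps -/

/-- A direction, as a real vector. -/
def realDir (w : ℤ × ℤ) : ℝ × ℝ := ((w.1 : ℝ), (w.2 : ℝ))

/-- The weight of a direction. -/
def dirWeight (w : ℤ × ℤ) : ℕ := Int.gcd w.1 w.2

/-- The primitive direction is `(0, ±1)`. -/
def IsVertical (w : ℤ × ℤ) : Prop := w.1 = 0 ∧ w.2 ≠ 0

/-- A rational tropical stable map to `ℝ²` with contracted ends marked by `Mark r s`. The underlying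
graph of bounded edges is a finite tree; `len` and `dir` are the lengths and directions of the
bounded edges (`dir u v` is the direction at `u` of the edge `uv`, and the values of `len` and `dir`
at non-adjacent vertices are irrelevant), `pos` is the map on vertices, `ends v` is the multiset of
directions of the non-contracted ends at `v` and `mark` gives the vertex to which a contracted end
is attached. -/
structure TropicalMap (r s : ℕ) where
  nv : ℕ
  graph : SimpleGraph (Fin nv)
  isTree : graph.IsTree
  len : Fin nv → Fin nv → ℝ
  dir : Fin nv → Fin nv → ℤ × ℤ
  pos : Fin nv → ℝ × ℝ
  ends : Fin nv → Multiset (ℤ × ℤ)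
  mark : Mark r s → Fin nv
  len_symm : ∀ u v, graph.Adj u v → len u v = len v u
  len_pos : ∀ u v, graph.Adj u v → 0 < len u v
  dir_symm : ∀ u v, graph.Adj u v → dir u v = -dir v u
  affine : ∀ u v, graph.Adj u v → pos v = pos u + len u v • realDir (dir u v)
  ends_ne : ∀ v, (0, 0) ∉ ends v
  balanced : ∀ v, (∑ᶠ u ∈ graph.neighborSet v, dir v u) + (ends v).sum = 0
  stable : ∀ v, 3 ≤ (graph.neighborSet v).ncard + Multiset.card (ends v) + {a | mark a = v}.ncard

namespace TropicalMap

variable {r s : ℕ}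

/-- The degree: the multiset of nonzero directions of the ends. -/
def degree (Γ : TropicalMap r s) : Multiset (ℤ × ℤ) := ∑ v, Γ.ends v

/-- The valence of a vertex, counting bounded edges, ends and contracted ends. -/
def valence (Γ : TropicalMap r s) (v : Fin Γ.nv) : ℕ :=
  (Γ.graph.neighborSet v).ncard + Multiset.card (Γ.ends v) + {a | Γ.mark a = v}.ncard

/-- `φ` is an isomorphism of tropical stable maps, where the marked points `y_j` and `z_j` are not
distinguished from each other. -/
structure IsIso (Γ Γ' : TropicalMap r s) (φ : Fin Γ.nv ≃ Fin Γ'.nv) : Prop where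
  adj : ∀ u v, Γ'.graph.Adj (φ u) (φ v) ↔ Γ.graph.Adj u v
  len : ∀ u v, Γ.graph.Adj u v → Γ'.len (φ u) (φ v) = Γ.len u v
  dir : ∀ u v, Γ.graph.Adj u v → Γ'.dir (φ u) (φ v) = Γ.dir u v
  pos : ∀ v, Γ'.pos (φ v) = Γ.pos v
  ends : ∀ v, Γ'.ends (φ v) = Γ.ends v
  marks : RespectsMarks Γ.mark Γ'.mark φ

theorem IsIso.refl (Γ : TropicalMap r s) : IsIso Γ Γ (Equiv.refl _) :=
  ⟨by simp, by simp, by simp, by simp, by simp, RespectsMarks.refl _⟩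

theorem IsIso.symm {Γ Γ' : TropicalMap r s} {φ : Fin Γ.nv ≃ Fin Γ'.nv} (h : IsIso Γ Γ' φ) :
    IsIso Γ' Γ φ.symm where
  adj u v := by simp [← h.adj]
  len u v huv := by
    have := h.len (φ.symm u) (φ.symm v) (by simpa [← h.adj] using huv)
    simpa using this.symm
  dir u v huv := by
    have := h.dir (φ.symm u) (φ.symm v) (by simpa [← h.adj] using huv)
    simpa using this.symm
  pos v := by simp [← h.pos]
  ends v := by simp [← h.ends]
  marks := h.marks.symm

theorem IsIso.trans {Γ Γ' Γ'' : TropicalMap r s} {φ : Fin Γ.nv ≃ Fin Γ'.nv}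
    {ψ : Fin Γ'.nv ≃ Fin Γ''.nv} (h : IsIso Γ Γ' φ) (h' : IsIso Γ' Γ'' ψ) :
    IsIso Γ Γ'' (φ.trans ψ) where
  adj u v := by simp [h.adj, h'.adj]
  len u v huv := by
    rw [← h.len u v huv, ← h'.len _ _ ((h.adj u v).2 huv)]; rfl
  dir u v huv := by
    rw [← h.dir u v huv, ← h'.dir _ _ ((h.adj u v).2 huv)]; rfl
  pos v := by simp [← h.pos, ← h'.pos]
  ends v := by simp [← h.ends, ← h'.ends]
  marks := h.marks.trans h'.marks

/-- `Γ'` is `η`-close to `Γ` in the moduli space of tropical stable maps: `Γ` arises from `Γ'` by the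
contraction `π` of some bounded edges shorter than `η`, all other lengths change by less than
`η`, and vertices move by less than `η`. -/
def IsClose (η : ℝ) (Γ' Γ : TropicalMap r s) : Prop :=
  ∃ π : Fin Γ'.nv → Fin Γ.nv,
    (∀ v, (Γ'.graph.induce {u | π u = v}).Connected) ∧
    (∀ u v, Γ'.graph.Adj u v → π u ≠ π v → Γ.graph.Adj (π u) (π v) ∧
      Γ'.dir u v = Γ.dir (π u) (π v) ∧ |Γ'.len u v - Γ.len (π u) (π v)| < η) ∧
    (∀ u v, Γ'.graph.Adj u v → π u = π v → Γ'.len u v < η) ∧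
    (∀ v, Γ.ends v = ∑ u ∈ Finset.univ.filter (fun u => π u = v), Γ'.ends u) ∧
    (∀ a, π (Γ'.mark a) = Γ.mark a) ∧
    ∀ u, dist (Γ'.pos u) (Γ.pos (π u)) < η

/-- The space of tropical stable maps which can meet `s` double points: the (support of the)
tropical pull-back of zero under `δ = (ev_{y_j} - ev_{z_j})_j`. The tropical pull-back of a
point is the limit of the fibres over generic nearby points, so `Γ` belongs to it iff
`δ(Γ) = 0` and every small vector is the value of `δ` at stable maps close to `Γ`. -/
def InMC (Γ : TropicalMap r s) : Prop :=
  (∀ j, Γ.pos (Γ.mark (.y j)) = Γ.pos (Γ.mark (.z j))) ∧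
  ∀ η > 0, ∃ ρ > 0, ∀ ε : Fin s → ℝ × ℝ, (∀ j, ‖ε j‖ < ρ) →
    ∃ Γ' : TropicalMap r s, IsClose η Γ' Γ ∧
      ∀ j, Γ'.pos (Γ'.mark (.y j)) - Γ'.pos (Γ'.mark (.z j)) = ε j

/-- `Γ` meets the simple points `p` and the double points `q`. -/
def Meets (Γ : TropicalMap r s) (p : Fin r → ℝ × ℝ) (q : Fin s → ℝ × ℝ) : Prop :=
  (∀ i, Γ.pos (Γ.mark (.x i)) = p i) ∧
    ∀ j, Γ.pos (Γ.mark (.y j)) = q j ∧ Γ.pos (Γ.mark (.z j)) = q j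

/-- The tangent space of the cell of the space of tropical stable maps meeting `s` double points
which contains `Γ` in its relative interior: the infinitesimal changes `t.1` of the positions of the
vertices and `t.2` of the lengths of the bounded edges, with fixed combinatorial type, such that
`y_j` and `z_j` still have the same image. -/
def cellTangent (Γ : TropicalMap r s) :
    Set ((Fin Γ.nv → ℝ × ℝ) × (Fin Γ.nv → Fin Γ.nv → ℝ)) :=
  {t | (∀ u v, t.2 u v = t.2 v u) ∧ (∀ u v, ¬ Γ.graph.Adj u v → t.2 u v = 0) ∧
    (∀ u v, Γ.graph.Adj u v → t.1 v = t.1 u + t.2 u v • realDir (Γ.dir u v)) ∧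
    ∀ j, t.1 (Γ.mark (.y j)) = t.1 (Γ.mark (.z j))}

/-- The evaluation at the simple and double points on the tangent space of a cell. -/
def evalTangent (Γ : TropicalMap r s) (t : (Fin Γ.nv → ℝ × ℝ) × (Fin Γ.nv → Fin Γ.nv → ℝ)) :
    (Fin r → ℝ × ℝ) × (Fin s → ℝ × ℝ) :=
  (fun i => t.1 (Γ.mark (.x i)), fun j => t.1 (Γ.mark (.y j)))

open Classical in
/-- The weights of the elevator edges (and elevator ends) at a vertex. -/
def elevatorWeights (Γ : TropicalMap r s) (v : Fin Γ.nv) : Multiset ℕ :=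
  ((Finset.univ.filter fun u => Γ.graph.Adj v u ∧ IsVertical (Γ.dir v u)).val.map
    fun u => dirWeight (Γ.dir v u)) + ((Γ.ends v).filter IsVertical).map dirWeight

/-- The weight of the elevator edge at a vertex with one elevator edge, and also of the elevator
through a marked point which lies on an elevator. -/
def elevatorWeight (Γ : TropicalMap r s) (v : Fin Γ.nv) : ℕ := (Γ.elevatorWeights v).sup

/-- The vertex `v` is adjacent to two elevator edges of the same direction. -/
def HasDoubleEdge (Γ : TropicalMap r s) (v : Fin Γ.nv) : Prop :=
  ∃ u u', u ≠ u' ∧ Γ.graph.Adj v u ∧ Γ.graph.Adj v u' ∧ IsVertical (Γ.dir v u) ∧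
    IsVertical (Γ.dir v u') ∧ 0 < (Γ.dir v u).2 * (Γ.dir v u').2

/-- No contracted end is attached to `v`. -/
def Unmarked (Γ : TropicalMap r s) (v : Fin Γ.nv) : Prop := ∀ a, Γ.mark a ≠ v

/-- The automorphisms of `Γ`. -/
def aut (Γ : TropicalMap r s) : Set (Equiv.Perm (Fin Γ.nv)) := {φ | IsIso Γ Γ φ}

/-- The double point `j` is the root of a twin tree. -/
def IsRoot (Γ : TropicalMap r s) (j : Fin s) : Prop := ∃ v, IsTwinRoot Γ.graph Γ.mark Γ.aut j v

/-- The vertices of the twin tree with root double point `j`. -/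
def twin (Γ : TropicalMap r s) (j : Fin s) : Set (Fin Γ.nv) :=
  twinVertices Γ.graph Γ.mark Γ.aut j

/-- The vertex `v` belongs to a twin tree, possibly as its root. -/
def OnTwinTree (Γ : TropicalMap r s) (v : Fin Γ.nv) : Prop :=
  ∃ j, v ∈ Γ.twin j ∨ IsTwinRoot Γ.graph Γ.mark Γ.aut j v

/-- The `j`-th double point lies on a `3`-valent vertex of the image: both of its marked points are
attached to the same vertex, with three further edges or ends. -/
def OnVertex (Γ : TropicalMap r s) (j : Fin s) : Prop :=
  Γ.mark (.y j) = Γ.mark (.z j) ∧ Γ.valence (Γ.mark (.y j)) = 5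

open Classical in
/-- The multiplicity of the twin tree with root double point `j`. -/
def twinMult {k : Type u} [Field k] (Γ : TropicalMap r s) (d : Fin s → kˣ) (j : Fin s) : GW k :=
  let T := Finset.univ.filter fun i => Γ.mark (.y i) ∈ Γ.twin j
  let E := T.filter fun i => Γ.elevatorWeights (Γ.mark (.y i)) ≠ 0
  let m := fun i => Γ.elevatorWeight (Γ.mark (.y i))
  GW.twinTree d T E m (m j + (E.filter fun i =>
    (Γ.ends (Γ.mark (.y i))).filter IsVertical ≠ 0).card)

open Classical in
/-- The quadratically enriched multiplicity of a tropical stable map. -/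
def mult {k : Type u} [Field k] (Γ : TropicalMap r s) (d : Fin s → kˣ) : GW k :=
  (∏ j ∈ Finset.univ.filter (fun j => Γ.IsRoot j), Γ.twinMult d j) *
  (∏ j ∈ Finset.univ.filter (fun j => Γ.OnVertex j),
    GW.gamma (Γ.elevatorWeight (Γ.mark (.y j))) (d j)) *
  (∏ j ∈ Finset.univ.filter (fun j => ¬ Γ.OnVertex j ∧ ∀ i, Γ.mark (.y j) ∉ Γ.twin i),
    GW.beta (d j)) *
  (∏ v ∈ Finset.univ.filter (fun v => Γ.valence v = 3 ∧ Γ.Unmarked v ∧ ¬ Γ.OnTwinTree v ∧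
      ¬ ∃ j, Γ.OnVertex j ∧ Γ.graph.Adj v (Γ.mark (.y j)) ∧ IsVertical (Γ.dir v (Γ.mark (.y j)))),
    GW.natA1 k (Γ.elevatorWeight v)) *
  ∏ v ∈ Finset.univ.filter (fun v => Γ.valence v = 4 ∧ Γ.Unmarked v ∧ Γ.HasDoubleEdge v ∧
      ¬ Γ.OnTwinTree v),
    ((Γ.elevatorWeights v).map (GW.natA1 k)).prod

end TropicalMap

/-! ### Point configurations and the tropical count -/

section Configurations

variable {r s : ℕ}

/-- The point of a configuration at which the marked point is placed. -/
def markedPoint (p : Fin r → ℝ × ℝ) (q : Fin s → ℝ × ℝ) : Mark r s → ℝ × ℝ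
  | .x i => p i
  | .y j => q j
  | .z j => q j

/-- The simple points `p` and double points `q` are vertically stretched, with constant `C`: the
vertical distance between any two of the points is more than `C` times the width of the
configuration. -/
def VerticallyStretched (C : ℝ) (p : Fin r → ℝ × ℝ) (q : Fin s → ℝ × ℝ) : Prop :=
  ∀ a b a' b' : Fin r ⊕ Fin s, a ≠ b →
    C * |(Sum.elim p q a').1 - (Sum.elim p q b').1| < |(Sum.elim p q a).2 - (Sum.elim p q b).2|

/-- The configuration is in general position for degree `Δ`: every tropical stable map of degree `Δ`
which meets it (and can meet `s` double points) lies in the interior of a top-dimensional cell, of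
dimension `2 (r + s)`, on which the evaluation at the points is injective. -/
def GeneralPosition (Δ : DelPezzoDegree) (p : Fin r → ℝ × ℝ) (q : Fin s → ℝ × ℝ) : Prop :=
  ∀ Γ : TropicalMap r s, Γ.degree = Δ.ends → Γ.InMC → Γ.Meets p q →
    Set.BijOn Γ.evalTangent Γ.cellTangent Set.univ

/-- The merging pattern given by the heights of the points, ordered from bottom to top. -/
def Merging.Fits {n : ℕ} (M : Merging n r s) (p : Fin r → ℝ × ℝ) (q : Fin s → ℝ × ℝ) : Prop :=
  ∀ a b, M.slot a ≤ M.slot b → (markedPoint p q a).2 ≤ (markedPoint p q b).2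

/-- The tropical stable maps of degree `Δ` satisfying the simple and double point conditions. -/
def TropicalSolution (Δ : DelPezzoDegree) (p : Fin r → ℝ × ℝ) (q : Fin s → ℝ × ℝ) : Type :=
  {Γ : TropicalMap r s // Γ.degree = Δ.ends ∧ Γ.InMC ∧ Γ.Meets p q}

/-- Isomorphism of tropical stable maps satisfying the point conditions. -/
def tropicalSetoid (Δ : DelPezzoDegree) (p : Fin r → ℝ × ℝ) (q : Fin s → ℝ × ℝ) :
    Setoid (TropicalSolution Δ p q) where
  r Γ Γ' := ∃ φ, TropicalMap.IsIso Γ.1 Γ'.1 φ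
  iseqv := ⟨fun Γ => ⟨_, .refl Γ.1⟩, fun ⟨_, h⟩ => ⟨_, h.symm⟩,
    fun ⟨_, h⟩ ⟨_, h'⟩ => ⟨_, h.trans h'⟩⟩

/-- The set of isomorphism classes of tropical stable maps satisfying the point conditions. -/
def TropicalSolutionClass (Δ : DelPezzoDegree) (p : Fin r → ℝ × ℝ) (q : Fin s → ℝ × ℝ) : Type :=
  Quotient (tropicalSetoid Δ p q)

/-- The quadratically enriched tropical count. (The multiplicity does not depend on the
representative.) -/
def tropicalCount (Δ : DelPezzoDegree) (p : Fin r → ℝ × ℝ) (q : Fin s → ℝ × ℝ) {k : Type u}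
    [Field k] (d : Fin s → kˣ) : GW k :=
  ∑ᶠ c : TropicalSolutionClass Δ p q, (Quotient.out c).1.mult d

end Configurations

end

noncomputable section
open scoped Classical Finset
open Finset Relation SimpleGraph Function

/-! ### Contractions of trees -/

section TreeContraction

variable {V Q : Type} {T : SimpleGraph V} {G : SimpleGraph Q} {π : V → Q}

/-- The map `π` contracts connected subgraphs of `T` to the vertices of `G`. -/
structure IsContraction (T : SimpleGraph V) (G : SimpleGraph Q) (π : V → Q) : Prop where
  conn : ∀ c, (T.induce {u | π u = c}).Connected
  adj : ∀ u v, T.Adj u v → π u ≠ π v → G.Adj (π u) (π v)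
  lift : ∀ c c', G.Adj c c' → ∃ u v, π u = c ∧ π v = c' ∧ T.Adj u v

theorem reachable_iff_of_adj_iff {g : V → Prop} (h : ∀ a b, T.Adj a b → (g a ↔ g b)) {u v : V}
    (huv : T.Reachable u v) : g u ↔ g v := by
  obtain ⟨p⟩ := huv
  induction p with
  | nil => rfl
  | cons hadj _ ih => exact (h _ _ hadj).trans ih

theorem SimpleGraph.IsAcyclic.exists_cut (hT : T.IsAcyclic) {u v : V} (huv : T.Adj u v) :
    ∃ g : V → Prop, g u ∧ ¬ g v ∧ ∀ a b, T.Adj a b → s(a, b) ≠ s(u, v) → (g a ↔ g b) := by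
  have hb := (isAcyclic_iff_forall_isBridge.1 hT) (T.mem_edgeSet.2 huv); rw [isBridge_iff] at hb
  refine ⟨fun a => (T.deleteEdges {s(u, v)}).Reachable u a, .refl _, hb, fun a b hab hne => ?_⟩
  have h : (T.deleteEdges {s(u, v)}).Adj a b := by
    rw [deleteEdges_adj]; exact ⟨hab, by simpa using hne⟩
  exact ⟨fun h' => h'.trans h.reachable, fun h' => h'.trans h.symm.reachable⟩

theorem SimpleGraph.isAcyclic_of_forall_cut (h : ∀ u v, T.Adj u v → ∃ g : V → Prop, g u ∧ ¬ g v ∧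
      ∀ a b, T.Adj a b → s(a, b) ≠ s(u, v) → (g a ↔ g b)) : T.IsAcyclic := by
  rw [isAcyclic_iff_forall_adj_isBridge]; intro u v huv; obtain ⟨g, hu, hv, hg⟩ := h u v huv
  rw [isBridge_iff]; intro hr; refine hv ((reachable_iff_of_adj_iff (g := g) ?_ hr).1 hu)
  intro a b hab; rw [deleteEdges_adj] at hab; exact hg a b hab.1 (by simpa using hab.2)

theorem SimpleGraph.Walk.le_length_of_cut {g : V → Prop} {v a : V}
    (hg : ∀ x y, T.Adj x y → s(x, y) ≠ s(a, v) → (g x ↔ g y)) (ha : g a) (hv : ¬ g v) {x y : V}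
    (p : T.Walk x y) (hx : ¬ g x) (hy : g y) : 1 + T.dist a y ≤ p.length := by
  induction p with
  | nil => exact absurd hy hx
  | @cons x z y hadj q ih =>
    rw [Walk.length_cons]; by_cases hz : g z
    · have : s(x, z) = s(a, v) := by
        by_contra hne; exact hx ((hg _ _ hadj hne).2 hz)
      rw [Sym2.eq_iff] at this; rcases this with ⟨rfl, rfl⟩ | ⟨rfl, rfl⟩
      · exact absurd ha hx
      · have := dist_le q; omega
    · have := ih hz hy; omega

theorem mem_branch_iff {g : V → Prop} {v a : V} (hT : T.Connected) (hva : T.Adj v a)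
    (hg : ∀ x y, T.Adj x y → s(x, y) ≠ s(a, v) → (g x ↔ g y)) (ha : g a) (hv : ¬ g v) (u : V) :
    u ∈ branch T v a ↔ g u := by
  unfold branch; rw [Set.mem_ofPred_eq]; by_cases hu : g u
  · simp only [hu, iff_true]; obtain ⟨p, hp⟩ := hT.exists_walk_length_eq_dist v u
    have h1 := p.le_length_of_cut hg ha hv hv hu
    have h2 := hT.dist_triangle (u := v) (v := a) (w := u); rw [dist_eq_one_iff_adj.2 hva] at h2
    omega
  · simp only [hu, iff_false]; obtain ⟨p, hp⟩ := hT.exists_walk_length_eq_dist a u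
    have h1 := p.le_length_of_cut (g := fun x => ¬ g x) (a := v) (v := a)
      (fun x y h1 h2 => not_congr (hg x y h1 (by rwa [Sym2.eq_swap (a := v)] at h2))) hv
      (by simpa using ha) (by simpa using ha) hu
    omega

namespace IsContraction

theorem surjective (h : IsContraction T G π) : Surjective π := fun c => by
  obtain ⟨⟨u, hu⟩⟩ := (h.conn c).nonempty; exact ⟨u, hu⟩

theorem fiber_iff (h : IsContraction T G π) {g : V → Prop}
    (hg : ∀ a b, T.Adj a b → π a = π b → (g a ↔ g b)) {u v : V} (huv : π u = π v) :
    g u ↔ g v := by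
  have hr := (h.conn (π u)).preconnected ⟨u, rfl⟩ ⟨v, huv.symm⟩
  exact reachable_iff_of_adj_iff (T := T.induce {x | π x = π u}) (g := fun x => g x.1)
    (fun a b hab => hg _ _ hab (a.2.trans b.2.symm)) hr

theorem reachable (h : IsContraction T G π) {u v : V} (huv : T.Reachable u v) :
    G.Reachable (π u) (π v) := by
  obtain ⟨p⟩ := huv
  induction p with
  | nil => rfl
  | @cons a b c hadj _ ih =>
    by_cases hab : π a = π b
    · rwa [hab]
    · exact (h.adj _ _ hadj hab).reachable.trans ih

theorem isTree (h : IsContraction T G π) (hT : T.IsTree) : G.IsTree := by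
  have hne : Nonempty Q := hT.1.nonempty.map π
  refine ⟨⟨fun c c' => ?_⟩, SimpleGraph.isAcyclic_of_forall_cut fun c c' hc => ?_⟩
  · obtain ⟨u, rfl⟩ := h.surjective c; obtain ⟨v, rfl⟩ := h.surjective c'
    exact h.reachable (hT.1.preconnected u v)
  · obtain ⟨u, v, rfl, rfl, huv⟩ := h.lift _ _ hc; have hne : π u ≠ π v := hc.ne
    obtain ⟨g, hu, hv, hg⟩ := hT.2.exists_cut huv
    have hfib : ∀ a b, π a = π b → (g a ↔ g b) := fun a b => h.fiber_iff fun a b hab hπ =>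
      hg a b hab fun he => by
        rcases Sym2.eq_iff.1 he with ⟨rfl, rfl⟩ | ⟨rfl, rfl⟩
        · exact hne hπ
        · exact hne hπ.symm
    refine ⟨fun c => ∃ x, π x = c ∧ g x, ⟨u, rfl, hu⟩, ?_, ?_⟩
    · rintro ⟨x, hx, hgx⟩; exact hv ((hfib x v hx).1 hgx)
    · intro c1 c2 h12 hne12; obtain ⟨a, b, rfl, rfl, hab⟩ := h.lift _ _ h12
      have : s(a, b) ≠ s(u, v) := fun he => hne12 (by
        rcases Sym2.eq_iff.1 he with ⟨rfl, rfl⟩ | ⟨rfl, rfl⟩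
        · rfl
        · exact Sym2.eq_swap)
      have hgab := hg a b hab this; constructor
      · rintro ⟨x, hx, hgx⟩; exact ⟨b, rfl, hgab.1 ((hfib x a hx).1 hgx)⟩
      · rintro ⟨x, hx, hgx⟩; exact ⟨a, rfl, hgab.2 ((hfib x b hx).1 hgx)⟩

theorem lift_unique (h : IsContraction T G π) (hT : T.IsTree) {u v u' v' : V} (huv : T.Adj u v)
    (huv' : T.Adj u' v') (hne : π u ≠ π v) (hu : π u = π u') (hv : π v = π v') :
    u = u' ∧ v = v' := by
  obtain ⟨g, hgu, hgv, hg⟩ := hT.2.exists_cut huv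
  have hfib : ∀ a b, π a = π b → (g a ↔ g b) := fun a b => h.fiber_iff fun a b hab hπ =>
    hg a b hab fun he => by
      rcases Sym2.eq_iff.1 he with ⟨rfl, rfl⟩ | ⟨rfl, rfl⟩
      · exact hne hπ
      · exact hne hπ.symm
  by_contra hcon; have h1 : s(u', v') ≠ s(u, v) := fun he => by
    rcases Sym2.eq_iff.1 he with ⟨rfl, rfl⟩ | ⟨rfl, rfl⟩
    · exact hcon ⟨rfl, rfl⟩
    · exact hne hu
  have h2 := hg _ _ huv' h1; exact hgv ((hfib v v' hv).2 (h2.1 ((hfib u u' hu).1 hgu)))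

theorem of_isTree (hT : T.Connected) (hG : G.IsTree)
    (hconn : ∀ c, (T.induce {u | π u = c}).Connected)
    (hadj : ∀ u v, T.Adj u v → π u ≠ π v → G.Adj (π u) (π v)) : IsContraction T G π := by
  refine ⟨hconn, hadj, fun c c' hc => ?_⟩; by_contra! hcon
  obtain ⟨g, hgc, hgc', hg⟩ := hG.2.exists_cut hc; obtain ⟨⟨u, rfl⟩⟩ := (hconn c).nonempty
  obtain ⟨⟨v, rfl⟩⟩ := (hconn c').nonempty
  refine hgc' ((reachable_iff_of_adj_iff (T := T) (g := fun x => g (π x)) ?_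
    (hT.preconnected u v)).1 hgc)
  intro a b hab; by_cases hπ : π a = π b
  · rw [hπ]
  · refine hg _ _ (hadj _ _ hab hπ) fun he => ?_; rcases Sym2.eq_iff.1 he with ⟨h1, h2⟩ | ⟨h1, h2⟩
    · exact hcon _ _ h1 h2 hab
    · exact hcon _ _ h2 h1 hab.symm

variable [Fintype V] [DecidableEq Q]

theorem sum_adj [Fintype Q] {M : Type} [AddCommMonoid M] (h : IsContraction T G π) (hT : T.IsTree)
    (F : Q → Q → M) (f : V → V → M)
    (hF : ∀ u v, T.Adj u v → π u ≠ π v → F (π u) (π v) = f u v) (c : Q) :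
    (∑ c', if G.Adj c c' then F c c' else 0) =
      ∑ u, ∑ v, if π u = c ∧ π v ≠ c ∧ T.Adj u v then f u v else 0 := by
  rw [← sum_product', ← sum_filter, ← sum_filter]; symm
  refine sum_bij (fun x _ => π x.2) ?_ ?_ ?_ ?_
  · rintro ⟨u, v⟩ hx; simp only [mem_filter, mem_product, mem_univ, true_and] at hx ⊢
    obtain ⟨rfl, h1, h2⟩ := hx; exact h.adj _ _ h2 h1.symm
  · rintro ⟨u, v⟩ hx ⟨u', v'⟩ hx' he
    simp only [mem_filter, mem_product, mem_univ, true_and] at hx hx' he; obtain ⟨rfl, h1, h2⟩ := hx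
    obtain ⟨h3, h4, h5⟩ := hx'; obtain ⟨rfl, rfl⟩ := h.lift_unique hT h2 h5 h1.symm h3.symm he; rfl
  · intro c' hc'; simp only [mem_filter_univ] at hc'; obtain ⟨u, v, rfl, rfl, huv⟩ := h.lift _ _ hc'
    exact ⟨(u, v), by simp [huv, hc'.ne.symm], rfl⟩
  · rintro ⟨u, v⟩ hx; simp only [mem_filter, mem_product, mem_univ, true_and] at hx
    obtain ⟨rfl, h1, h2⟩ := hx; exact (hF u v h2 h1.symm).symm

theorem sum_adj_fiber [Fintype Q] (h : IsContraction T G π) (hT : T.IsTree)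
    (F : Q → Q → ℤ × ℤ) (f : V → V → ℤ × ℤ) (hf : ∀ u v, T.Adj u v → f u v = -f v u)
    (hF : ∀ u v, T.Adj u v → π u ≠ π v → F (π u) (π v) = f u v) (c : Q) :
    (∑ c', if G.Adj c c' then F c c' else 0) =
      ∑ u with π u = c, ∑ v, if T.Adj u v then f u v else 0 := by
  rw [h.sum_adj hT F f hF, sum_filter]
  have h0 : (∑ u, ∑ v, if π u = c ∧ π v = c ∧ T.Adj u v then f u v else 0) = 0 := by
    have hneg : (∑ u, ∑ v, if π u = c ∧ π v = c ∧ T.Adj u v then f u v else 0) =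
        -(∑ u, ∑ v, if π u = c ∧ π v = c ∧ T.Adj u v then f u v else 0) := by
      conv_lhs => rw [sum_comm]
      rw [← sum_neg_distrib]; refine sum_congr rfl fun u _ => ?_; rw [← sum_neg_distrib]
      refine sum_congr rfl fun v _ => ?_; by_cases h1 : T.Adj u v
      · by_cases h2 : π u = c <;> by_cases h3 : π v = c <;> simp [h1, h1.symm, h2, h3]
        rw [hf _ _ h1]; simp
      · have : ¬ T.Adj v u := fun h => h1 h.symm; simp [h1, this]
    set x := (∑ u, ∑ v, if π u = c ∧ π v = c ∧ T.Adj u v then f u v else 0)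
    have h1 := congrArg Prod.fst hneg; have h2 := congrArg Prod.snd hneg
    simp only [Prod.fst_neg, Prod.snd_neg] at h1 h2; ext <;> simp <;> omega
  refine (add_zero _).symm.trans ?_; refine (congrArg _ h0.symm).trans ?_; rw [← sum_add_distrib]
  refine sum_congr rfl fun u _ => ?_; rw [← sum_add_distrib]; by_cases h1 : π u = c
  · simp only [h1, true_and, if_true]; refine sum_congr rfl fun v _ => ?_
    by_cases h2 : π v = c <;> simp [h2]
  · simp [h1]

theorem sum_internal (h : IsContraction T G π) (hT : T.IsTree) (c : Q) :
    (∑ u, ∑ v, if π u = c ∧ π v = c ∧ T.Adj u v then 1 else 0) + 2 = 2 * #{u | π u = c} := by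
  have hS : (T.induce {u | π u = c}).IsTree := ⟨h.conn c, hT.2.induce _⟩
  have h1 := hS.card_edgeFinset; have h2 := (T.induce {u | π u = c}).sum_degrees_eq_twice_card_edges
  have h3 : Fintype.card {u | π u = c} = #{u | π u = c} := by rw [Fintype.card_subtype]; simp
  have h4 : (∑ u, ∑ v, if π u = c ∧ π v = c ∧ T.Adj u v then 1 else 0) =
      ∑ u, (T.induce {u | π u = c}).degree u := by
    have : ∀ u : {u | π u = c}, (T.induce {u | π u = c}).degree u =
        ∑ v, if π v = c ∧ T.Adj u v then 1 else 0 := by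
      intro u; rw [← card_neighborFinset_eq_degree, card_eq_sum_ones, ← sum_filter]
      refine sum_bij (fun v _ => v.1) ?_ ?_ ?_ ?_
      · intro v hv; simp at hv; simp [hv]; exact v.2
      · intro v _ v' _ h; exact Subtype.ext h
      · intro v hv; simp at hv; exact ⟨⟨v, hv.1⟩, by simp [hv.2], rfl⟩
      · intros; rfl
    rw [sum_congr rfl (fun u _ => this u)]; simp_rw [ite_and]
    rw [← sum_filter_add_sum_filter_not univ (fun u => π u = c)]
    rw [sum_eq_zero (s := univ.filter fun u => ¬ π u = c) (fun u hu => by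
      simp only [mem_filter] at hu; simp [hu.2]), add_zero]
    refine sum_bij (fun u hu => ⟨u, by simpa using hu⟩) (by simp) ?_ ?_ ?_
    · intro a _ b _ hab; simpa using hab
    · intro b _; exact ⟨b.1, mem_filter.2 ⟨mem_univ _, b.2⟩, rfl⟩
    · intro a ha; simp only [mem_filter_univ] at ha; simp [ha]
  omega

theorem card_adj [Fintype Q] (h : IsContraction T G π) (hT : T.IsTree) (c : Q) :
    (∑ c', if G.Adj c c' then 1 else 0) + 2 * #{u | π u = c} =
      (∑ u with π u = c, ∑ v, if T.Adj u v then 1 else 0) + 2 := by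
  rw [h.sum_adj hT (fun _ _ => 1) (fun _ _ => 1) (fun _ _ _ _ => rfl), ← h.sum_internal hT c,
    ← add_assoc, ← sum_add_distrib, sum_filter]
  congr 1; refine sum_congr rfl fun u _ => ?_; rw [← sum_add_distrib]; by_cases h1 : π u = c
  · simp only [h1, true_and, if_true]; refine sum_congr rfl fun v _ => ?_
    by_cases h2 : π v = c <;> simp [h2]
  · simp [h1]

end IsContraction

end TreeContraction

/-! ### Tropical maps with edges of length zero -/

section PreMaps

/-- The marked points, sorted by their kinds. -/
def Mark.equivSum (r s : ℕ) : Mark r s ≃ Fin r ⊕ (Fin s ⊕ Fin s) where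
  toFun
    | .x i => .inl i
    | .y j => .inr (.inl j)
    | .z j => .inr (.inr j)
  invFun
    | .inl i => .x i
    | .inr (.inl j) => .y j
    | .inr (.inr j) => .z j
  left_inv a := by cases a <;> rfl
  right_inv a := by rcases a with a | a | a <;> rfl

instance Mark.instFintype (r s : ℕ) : Fintype (Mark r s) := Fintype.ofEquiv _ (Mark.equivSum r s).symm

theorem Mark.card (r s : ℕ) : Fintype.card (Mark r s) = r + 2 * s := by
  rw [Fintype.card_congr (Mark.equivSum r s)]; simp; ring

theorem finsum_neighborSet {V M : Type} [Fintype V] [AddCommMonoid M] (G : SimpleGraph V) (v : V)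
    (f : V → M) : ∑ᶠ u ∈ G.neighborSet v, f u = ∑ u, if G.Adj v u then f u else 0 := by
  rw [finsum_eq_sum_of_fintype]; refine sum_congr rfl fun u _ => ?_
  by_cases h : G.Adj v u <;> simp [h]

theorem ncard_neighborSet {V : Type} [Fintype V] (G : SimpleGraph V) (v : V) :
    (G.neighborSet v).ncard = ∑ u, if G.Adj v u then 1 else 0 := by
  rw [Set.ncard_eq_toFinset_card', card_eq_sum_ones, ← sum_filter]
  refine sum_congr ?_ fun _ _ => rfl; ext u; simp

theorem ncard_fiber_comp {ι V Q : Type} [Fintype ι] [Fintype V] [DecidableEq Q] (m : ι → V) (π : V → Q) (c : Q) :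
    {a | π (m a) = c}.ncard = ∑ u with π u = c, {a | m a = u}.ncard := by
  have h1 : ∀ p : ι → Prop, {a | p a}.ncard = (univ.filter p).card := fun p => by
    rw [Set.ncard_eq_toFinset_card']; congr 1; ext; simp
  simp_rw [h1]; rw [card_eq_sum_card_fiberwise (f := m) (t := univ.filter fun u => π u = c)]
  · refine sum_congr rfl fun u hu => ?_; congr 1; ext a
    simp only [mem_filter, mem_univ, true_and] at hu ⊢; constructor
    · exact fun h => h.2
    · rintro rfl; exact ⟨hu, rfl⟩
  · intro a ha; simpa using ha

/-- A tropical stable map with vertex set `V`, where edges may have length zero. -/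
structure PreMap (r s : ℕ) (V : Type) [Fintype V] where
  graph : SimpleGraph V
  isTree : graph.IsTree
  len : V → V → ℝ
  dir : V → V → ℤ × ℤ
  pos : V → ℝ × ℝ
  ends : V → Multiset (ℤ × ℤ)
  mark : Mark r s → V
  len_symm : ∀ u v, graph.Adj u v → len u v = len v u
  len_nonneg : ∀ u v, graph.Adj u v → 0 ≤ len u v
  dir_symm : ∀ u v, graph.Adj u v → dir u v = -dir v u
  dir_ne : ∀ u v, graph.Adj u v → dir u v ≠ 0
  affine : ∀ u v, graph.Adj u v → pos v = pos u + len u v • realDir (dir u v)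
  ends_ne : ∀ v, (0, 0) ∉ ends v
  balanced : ∀ v, (∑ u, if graph.Adj v u then dir v u else 0) + (ends v).sum = 0
  stable : ∀ v, 3 ≤ (∑ u, if graph.Adj v u then 1 else 0) + (ends v).card +
    {a | mark a = v}.ncard

variable {r s : ℕ} {V : Type} [Fintype V]

theorem realDir_eq_zero {w : ℤ × ℤ} (h : realDir w = 0) : w = 0 := by
  unfold realDir at h; rw [Prod.mk_eq_zero] at h; ext
  · exact_mod_cast h.1
  · exact_mod_cast h.2

/-- The tropical stable map `Γ` arises from `A` by the contraction `π` of the edges of length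
zero. -/
structure Contracts (A : PreMap r s V) (Γ : TropicalMap r s) (π : V → Fin Γ.nv) : Prop where
  graph : IsContraction A.graph Γ.graph π
  len : ∀ u v, A.graph.Adj u v → π u ≠ π v → Γ.len (π u) (π v) = A.len u v
  len_zero : ∀ u v, A.graph.Adj u v → π u = π v → A.len u v = 0
  dir : ∀ u v, A.graph.Adj u v → π u ≠ π v → Γ.dir (π u) (π v) = A.dir u v
  pos : ∀ u, Γ.pos (π u) = A.pos u
  ends : ∀ c, Γ.ends c = ∑ u with π u = c, A.ends u
  mark : ∀ a, π (A.mark a) = Γ.mark a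

theorem valence_of_contraction {Q : Type} [Fintype Q] [DecidableEq Q] {T : SimpleGraph V} {G : SimpleGraph Q}
    {π : V → Q} (h : IsContraction T G π) (hT : T.IsTree) (ends : V → Multiset (ℤ × ℤ))
    (mark : Mark r s → V) (c : Q) :
    (G.neighborSet c).ncard + (∑ u with π u = c, ends u).card +
      {a | π (mark a) = c}.ncard + 2 * #{u | π u = c} =
    (∑ u with π u = c, ((∑ v, if T.Adj u v then 1 else 0) +
      (ends u).card + {a | mark a = u}.ncard)) + 2 := by
  have h1 := h.card_adj hT c; rw [← ncard_neighborSet] at h1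
  have h2 : (∑ u with π u = c, ends u).card = ∑ u with π u = c, (ends u).card :=
    map_sum Multiset.cardHom _ _
  rw [ncard_fiber_comp, h2, sum_add_distrib, sum_add_distrib]; omega

/-- The subgraph of edges of length zero. -/
def PreMap.zeroGraph (A : PreMap r s V) : SimpleGraph V where
  Adj u v := A.graph.Adj u v ∧ A.len u v = 0
  symm := ⟨fun u v h => ⟨h.1.symm, by rw [← A.len_symm _ _ h.1, h.2]⟩⟩
  loopless := ⟨fun u h => A.graph.loopless.irrefl u h.1⟩

theorem PreMap.pos_eq_of_zero (A : PreMap r s V) {u v : V} (h : A.zeroGraph.Reachable u v) :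
    A.pos u = A.pos v := by
  obtain ⟨p⟩ := h
  induction p with
  | nil => rfl
  | cons hadj _ ih => rw [← ih, A.affine _ _ hadj.1, hadj.2]; simp

theorem Contracts.eq_iff {A : PreMap r s V} {Γ : TropicalMap r s} {π : V → Fin Γ.nv}
    (h : Contracts A Γ π) (u v : V) : π u = π v ↔ A.zeroGraph.Reachable u v := by
  constructor
  · intro huv; have hr := (h.graph.conn (π u)).preconnected ⟨u, rfl⟩ ⟨v, huv.symm⟩
    refine hr.map (⟨fun x => x.1, fun {a b} hab => ⟨hab, ?_⟩⟩ :
      (A.graph.induce {x | π x = π u}) →g A.zeroGraph)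
    exact h.len_zero _ _ hab (a.2.trans b.2.symm)
  · rintro ⟨p⟩
    induction p with
    | nil => rfl
    | cons hadj _ ih =>
      rw [← ih]; by_contra hne; have h1 := h.len _ _ hadj.1 hne
      have h2 := Γ.len_pos _ _ (h.graph.adj _ _ hadj.1 hne); rw [h1, hadj.2] at h2
      exact lt_irrefl _ h2

theorem Contracts.degree {A : PreMap r s V} {Γ : TropicalMap r s} {π : V → Fin Γ.nv}
    (h : Contracts A Γ π) : Γ.degree = ∑ u, A.ends u := by
  rw [← sum_fiberwise univ π A.ends]; exact sum_congr rfl fun c _ => h.ends c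

theorem Contracts.valence {A : PreMap r s V} {Γ : TropicalMap r s} {π : V → Fin Γ.nv}
    (h : Contracts A Γ π) (c : Fin Γ.nv) :
    Γ.valence c + 2 * #{u | π u = c} =
    (∑ u with π u = c, ((∑ v, if A.graph.Adj u v then 1 else 0) +
      (A.ends u).card + {a | A.mark a = u}.ncard)) + 2 := by
  rw [← valence_of_contraction h.graph A.isTree A.ends A.mark c, TropicalMap.valence, h.ends]
  simp only [h.mark]

theorem PreMap.exists_contracts (A : PreMap r s V) :
    ∃ (Γ : TropicalMap r s) (π : V → Fin Γ.nv), Contracts A Γ π := by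
  have : Fintype A.zeroGraph.ConnectedComponent := Fintype.ofFinite _
  let e := Fintype.equivFin A.zeroGraph.ConnectedComponent
  let N := Fintype.card A.zeroGraph.ConnectedComponent
  let π : V → Fin N := fun u => e (A.zeroGraph.connectedComponentMk u)
  have hπ : ∀ u v, π u = π v ↔ A.zeroGraph.Reachable u v := fun u v => by
    simp only [π, e.apply_eq_iff_eq, ConnectedComponent.eq]
  have hpos : ∀ u v, π u = π v → A.pos u = A.pos v := fun u v h => A.pos_eq_of_zero ((hπ u v).1 h)
  have hlen : ∀ u v, A.graph.Adj u v → (π u = π v ↔ A.len u v = 0) := fun u v huv => by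
    constructor
    · intro h; have h1 := A.affine u v huv; rw [hpos u v h, left_eq_add, smul_eq_zero] at h1
      exact h1.resolve_right fun h2 => A.dir_ne _ _ huv (realDir_eq_zero h2)
    · intro h; have hz : A.zeroGraph.Adj u v := ⟨huv, h⟩; exact (hπ u v).2 hz.reachable
  let G : SimpleGraph (Fin N) :=
    { Adj := fun c c' => c ≠ c' ∧ ∃ u v, π u = c ∧ π v = c' ∧ A.graph.Adj u v
      symm := ⟨fun c c' ⟨h, u, v, hu, hv, huv⟩ => ⟨h.symm, v, u, hv, hu, huv.symm⟩⟩
      loopless := ⟨fun c h => h.1 rfl⟩ }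
  have hsurj : Surjective π := fun c => by
    obtain ⟨u, hu⟩ := (e.symm c).exists_rep
    exact ⟨u, by simp only [π]; rw [← e.apply_symm_apply c, ← hu]; rfl⟩
  have hG : IsContraction A.graph G π := by
    refine ⟨fun c => ?_, fun u v huv hne => ⟨hne, u, v, rfl, rfl, huv⟩, fun c c' h => h.2⟩
    obtain ⟨u0, hu0⟩ := hsurj c; have : Nonempty {u | π u = c} := ⟨⟨u0, hu0⟩⟩; refine ⟨?_⟩
    have key : ∀ (u v : V) (p : A.zeroGraph.Walk u v) (hu : π u = c) (hv : π v = c),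
        (A.graph.induce {u | π u = c}).Reachable ⟨u, hu⟩ ⟨v, hv⟩ := by
      intro u v p
      induction p with
      | nil => intro _ _; rfl
      | @cons a b w hadj q ih =>
        intro hu hv; have hb : π b = c := by rw [← hu]; exact ((hlen _ _ hadj.1).2 hadj.2).symm
        have hab : (A.graph.induce {u | π u = c}).Adj ⟨a, hu⟩ ⟨b, hb⟩ := hadj.1
        exact hab.reachable.trans (ih hb hv)
    rintro ⟨u, hu⟩ ⟨v, hv⟩; obtain ⟨p⟩ := (hπ u v).1 (hu.trans hv.symm); exact key u v p hu hv
  let rep : Fin N → Fin N → V × V := fun c c' =>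
    if h : ∃ p : V × V, π p.1 = c ∧ π p.2 = c' ∧ A.graph.Adj p.1 p.2 then h.choose else
      ((surjInv hsurj c), (surjInv hsurj c'))
  have hrep : ∀ u v, A.graph.Adj u v → π u ≠ π v → rep (π u) (π v) = (u, v) := by
    intro u v huv hne
    have h : ∃ p : V × V, π p.1 = π u ∧ π p.2 = π v ∧ A.graph.Adj p.1 p.2 := ⟨(u, v), rfl, rfl, huv⟩
    simp only [rep, dif_pos h]; obtain ⟨h1, h2, h3⟩ := h.choose_spec
    obtain ⟨h4, h5⟩ := hG.lift_unique A.isTree huv h3 hne h1.symm h2.symm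
    exact Prod.ext h4.symm h5.symm
  have hval := fun c => valence_of_contraction hG A.isTree A.ends A.mark c
  refine ⟨{ nv := N, graph := G, isTree := hG.isTree A.isTree,
            len := fun c c' => A.len (rep c c').1 (rep c c').2
            dir := fun c c' => A.dir (rep c c').1 (rep c c').2
            pos := fun c => A.pos (surjInv hsurj c)
            ends := fun c => ∑ u with π u = c, A.ends u
            mark := fun a => π (A.mark a)
            len_symm := ?_, len_pos := ?_, dir_symm := ?_, affine := ?_, ends_ne := ?_,
            balanced := ?_, stable := ?_ }, π, ?_⟩
  · rintro _ _ ⟨hne, u, v, rfl, rfl, huv⟩; rw [hrep u v huv hne, hrep v u huv.symm hne.symm]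
    exact A.len_symm _ _ huv
  · rintro _ _ ⟨hne, u, v, rfl, rfl, huv⟩; rw [hrep u v huv hne]
    exact lt_of_le_of_ne (A.len_nonneg _ _ huv) fun h => hne ((hlen _ _ huv).2 h.symm)
  · rintro _ _ ⟨hne, u, v, rfl, rfl, huv⟩; rw [hrep u v huv hne, hrep v u huv.symm hne.symm]
    exact A.dir_symm _ _ huv
  · rintro _ _ ⟨hne, u, v, rfl, rfl, huv⟩
    rw [hrep u v huv hne, hpos _ _ (surjInv_eq hsurj (π u)), hpos _ _ (surjInv_eq hsurj (π v))]
    exact A.affine _ _ huv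
  · intro c hc; rw [Multiset.mem_sum] at hc; obtain ⟨u, _, hu⟩ := hc; exact A.ends_ne u hu
  · intro c
    rw [finsum_neighborSet, hG.sum_adj_fiber A.isTree (fun c c' => A.dir (rep c c').1 (rep c c').2) A.dir A.dir_symm, Multiset.sum_sum,
      ← sum_add_distrib]
    · exact sum_eq_zero fun u _ => A.balanced u
    · intro u v huv hne; rw [hrep u v huv hne]
  · intro c
    have h1 : ∑ u with π u = c, 3 ≤ ∑ u with π u = c, ((∑ v, if A.graph.Adj u v then 1 else 0) +
      (A.ends u).card + {a | A.mark a = u}.ncard) :=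
      sum_le_sum fun u _ => A.stable u
    have h2 : 0 < #{u | π u = c} := by
      obtain ⟨u, hu⟩ := hsurj c; exact card_pos.2 ⟨u, by simp [hu]⟩
    rw [sum_const, smul_eq_mul] at h1; have := hval c; omega
  · refine ⟨hG, ?_, ?_, ?_, ?_, fun _ => rfl, fun _ => rfl⟩
    · intro u v huv hne; simp only [hrep u v huv hne]
    · exact fun u v huv h => (hlen u v huv).1 h
    · intro u v huv hne; simp only [hrep u v huv hne]
    · intro u; exact hpos _ _ (surjInv_eq hsurj (π u))

theorem Contracts.isClose {A A' : PreMap r s V} {Γ Γ' : TropicalMap r s} {π : V → Fin Γ.nv}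
    {π' : V → Fin Γ'.nv} (h : Contracts A Γ π) (h' : Contracts A' Γ' π') {η : ℝ}
    (hgraph : A'.graph = A.graph) (hdir : A'.dir = A.dir) (hends : A'.ends = A.ends)
    (hmark : ∀ a, π (A'.mark a) = π (A.mark a))
    (hlen : ∀ u v, A.graph.Adj u v → |A'.len u v - A.len u v| < η)
    (hzero : ∀ u v, A.graph.Adj u v → A'.len u v = 0 → A.len u v = 0)
    (hpos : ∀ u, dist (A'.pos u) (A.pos u) < η) : TropicalMap.IsClose η Γ' Γ := by
  have hz : ∀ u v, π' u = π' v → π u = π v := by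
    intro u v huv; rw [h'.eq_iff] at huv; rw [h.eq_iff]; refine huv.mono fun a b hab => ?_
    have h1 : A.graph.Adj a b := hgraph ▸ hab.1; exact ⟨h1, hzero _ _ h1 hab.2⟩
  let ρ : Fin Γ'.nv → Fin Γ.nv := fun c => π (surjInv h'.graph.surjective c)
  have hρ : ∀ u, ρ (π' u) = π u := fun u => hz _ _ (surjInv_eq h'.graph.surjective _)
  have hs := h'.graph.surjective; refine ⟨ρ, ?_, ?_, ?_, ?_, ?_, ?_⟩
  · intro c; have hc := h.graph.conn c; obtain ⟨⟨u0, hu0⟩⟩ := hc.nonempty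
    have : Nonempty {u | ρ u = c} := ⟨⟨π' u0, by rw [Set.mem_ofPred_eq, hρ]; exact hu0⟩⟩
    refine ⟨?_⟩; rintro ⟨x, hx⟩ ⟨y, hy⟩; obtain ⟨u, rfl⟩ := hs x; obtain ⟨v, rfl⟩ := hs y
    have hu : π u = c := by rw [← hρ]; exact hx
    have hv : π v = c := by rw [← hρ]; exact hy
    have key : ∀ (a b : {u | π u = c}) (p : (A.graph.induce {u | π u = c}).Walk a b)
        (ha : ρ (π' a) = c) (hb : ρ (π' b) = c),
        (Γ'.graph.induce {u | ρ u = c}).Reachable ⟨π' a, ha⟩ ⟨π' b, hb⟩ := by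
      intro a b p
      induction p with
      | nil => intro _ _; rfl
      | @cons a b w hadj q ih =>
        intro ha hw; have hb : ρ (π' b) = c := by rw [hρ]; exact b.2
        by_cases hab : π' a = π' b
        · have := ih hb hw; simpa only [hab] using this
        · have : (Γ'.graph.induce {u | ρ u = c}).Adj ⟨π' a, ha⟩ ⟨π' b, hb⟩ :=
            h'.graph.adj _ _ (hgraph ▸ hadj) hab
          exact this.reachable.trans (ih hb hw)
    obtain ⟨p⟩ := hc.preconnected ⟨u, hu⟩ ⟨v, hv⟩; exact key _ _ p hx hy
  · intro c c' hcc hne; obtain ⟨u, v, rfl, rfl, huv⟩ := h'.graph.lift _ _ hcc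
    have huv' : A.graph.Adj u v := hgraph ▸ huv; have hne' : π' u ≠ π' v := hcc.ne
    simp only [hρ] at hne ⊢
    rw [h.len _ _ huv' hne, h'.len _ _ huv hne', h.dir _ _ huv' hne, h'.dir _ _ huv hne', hdir]
    exact ⟨h.graph.adj _ _ huv' hne, rfl, hlen _ _ huv'⟩
  · intro c c' hcc he; obtain ⟨u, v, rfl, rfl, huv⟩ := h'.graph.lift _ _ hcc
    have huv' : A.graph.Adj u v := hgraph ▸ huv; have hne' : π' u ≠ π' v := hcc.ne
    simp only [hρ] at he; have h1 := hlen _ _ huv'; rw [h.len_zero _ _ huv' he, sub_zero] at h1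
    rw [h'.len _ _ huv hne']; exact (le_abs_self _).trans_lt h1
  · intro c; rw [h.ends, ← hends]; simp_rw [h'.ends]
    rw [← sum_fiberwise_of_maps_to (s := univ.filter fun u => π u = c)
      (t := univ.filter fun u => ρ u = c) (g := π')]
    · refine sum_congr rfl fun x hx => sum_congr ?_ fun _ _ => rfl; ext u
      simp only [mem_filter, mem_univ, true_and] at hx ⊢; constructor
      · exact fun h => h.2
      · rintro rfl; exact ⟨by rw [← hρ, hx], rfl⟩
    · intro u hu; simp only [mem_filter_univ, hρ] at hu ⊢; exact hu
  · intro a; rw [← h'.mark, hρ, hmark, h.mark]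
  · intro x; obtain ⟨u, rfl⟩ := hs x; rw [hρ, h.pos, h'.pos]; exact hpos u

end PreMaps

/-! ### Combinatorics of floor diagrams -/

namespace DelPezzoDegree

theorem numLeakPos_le {Δ : DelPezzoDegree} (_ : Δ.Valid) : Δ.numLeakPos ≤ Δ.numWhite := by
  cases Δ <;> simp [numLeakPos, numWhite]; omega

theorem numLeakNeg_le {Δ : DelPezzoDegree} (h : Δ.Valid) : Δ.numLeakNeg ≤ Δ.numWhite := by
  cases Δ <;> simp [numLeakNeg, numWhite, Valid] at * <;> omega

theorem ends_eq {Δ : DelPezzoDegree} (h : Δ.Valid) : Δ.ends =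
    .replicate (Δ.numWhite - Δ.numLeakNeg) (-1, 0) + .replicate Δ.numLeakNeg (-1, -1) +
    (.replicate (Δ.numWhite - Δ.numLeakPos) (1, 0) + .replicate Δ.numLeakPos (1, 1)) +
    (.replicate Δ.numIn (0, -1) + .replicate Δ.numOut (0, 1)) := by
  ext x; cases Δ <;> simp only [ends, numWhite, numLeakNeg, numLeakPos, numIn, numOut, Valid,
    Multiset.count_add, Multiset.count_replicate] at * <;> split_ifs <;> omega

theorem card_ends {Δ : DelPezzoDegree} (h : Δ.Valid) :
    Multiset.card Δ.ends = 2 * Δ.numWhite + Δ.numIn + Δ.numOut := by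
  have h1 := numLeakPos_le h; have h2 := numLeakNeg_le h; rw [ends_eq h]
  simp only [Multiset.card_add, Multiset.card_replicate]; omega

theorem n_add_one {Δ : DelPezzoDegree} (h : Δ.Valid) :
    Δ.n + 1 = 2 * Δ.numWhite + Δ.numIn + Δ.numOut := by
  rw [← card_ends h, n]; have : 0 < Multiset.card Δ.ends := by
    rw [card_ends h]; cases Δ <;> simp only [numWhite, numIn, numOut, Valid] at * <;> omega
  omega

theorem two_le_n {Δ : DelPezzoDegree} (h : Δ.Valid) : 2 ≤ Δ.n := by
  have := n_add_one h; cases Δ <;> simp only [numWhite, numIn, numOut, Valid] at * <;> omega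

end DelPezzoDegree

namespace FloorDiagram

variable {Δ : DelPezzoDegree} (D : FloorDiagram Δ)

/-- The change of the slope of the floor `w` at the elevator `b`. -/
def jump (w b : Fin Δ.n) : ℤ := (D.weight b w : ℤ) - D.weight w b

theorem weight_self (u : Fin Δ.n) : D.weight u u = 0 := by
  by_contra h; exact lt_irrefl _ (D.oriented _ _ h)

theorem weight_eq_zero_of_lt {u v : Fin Δ.n} (h : v ≤ u) : D.weight u v = 0 := by
  by_contra h'; exact absurd (D.oriented _ _ h') (not_lt.2 h)

theorem adj_iff {u v : Fin Δ.n} : D.graph.Adj u v ↔ D.weight u v ≠ 0 ∨ D.weight v u ≠ 0 := by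
  rw [graph, weightGraph, fromRel_adj, and_iff_right_iff_imp]; rintro h rfl; simp [weight_self] at h

theorem color {u v : Fin Δ.n} (h : D.graph.Adj u v) : u ∈ D.white ↔ v ∉ D.white := by
  have := D.bipartite u v; have := D.bipartite v u; have := D.adj_iff.1 h; tauto

theorem jump_ne_zero_iff {w b : Fin Δ.n} : D.jump w b ≠ 0 ↔ D.graph.Adj w b := by
  rw [adj_iff]; unfold jump; rcases le_total w b with h | h <;> simp [D.weight_eq_zero_of_lt h]

theorem jump_eq_zero {w b : Fin Δ.n} (h : ¬ D.graph.Adj w b) : D.jump w b = 0 := by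
  by_contra h'; exact h (D.jump_ne_zero_iff.1 h')

theorem jump_symm (w b : Fin Δ.n) : D.jump b w = - D.jump w b := by unfold jump; ring

theorem jump_pos_iff {w b : Fin Δ.n} (h : D.graph.Adj w b) : 0 < D.jump w b ↔ b < w := by
  rw [adj_iff] at h; unfold jump; refine ⟨fun h' => D.oriented _ _ (by omega), fun h' => ?_⟩
  have := D.weight_eq_zero_of_lt h'.le; omega

theorem jump_neg_iff {w b : Fin Δ.n} (h : D.graph.Adj w b) : D.jump w b < 0 ↔ w < b := by
  rw [← D.jump_pos_iff h.symm, jump_symm, neg_lt_zero]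

/-- The number of edges which end at `v` from below. -/
def inDeg (v : Fin Δ.n) : ℕ := #{u | D.weight u v ≠ 0}

/-- The number of edges which start at `v`. -/
def outDeg (v : Fin Δ.n) : ℕ := #{u | D.weight v u ≠ 0}

theorem sum_inDeg_add_one : (∑ v, D.inDeg v) + 1 = Δ.n := by
  have h1 := D.isTree.card_edgeFinset; rw [Fintype.card_fin] at h1
  have h2 : ∑ v, D.inDeg v = (weightGraph D.weight).edgeFinset.card := by
    unfold inDeg; rw [← card_sigma]; refine card_bij (fun x _ => s(x.2, x.1)) ?_ ?_ ?_
    · rintro ⟨v, u⟩ h; exact mem_edgeFinset.2 (D.adj_iff.2 (.inl (by simpa using h)))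
    · rintro ⟨v, u⟩ h ⟨v', u'⟩ h' he
      simp only [mem_sigma, mem_univ, true_and, mem_filter] at h h' he
      rcases Sym2.eq_iff.1 he with ⟨rfl, rfl⟩ | ⟨rfl, rfl⟩
      · rfl
      · exact absurd (D.oriented _ _ h) (not_lt.2 (D.oriented _ _ h').le)
    · intro e he
      induction e with
      | h u v =>
        rw [mem_edgeFinset, mem_edgeSet] at he; rcases D.adj_iff.1 he with h | h
        · exact ⟨⟨v, u⟩, by simpa using h, rfl⟩
        · exact ⟨⟨u, v⟩, by simpa using h, Sym2.eq_swap⟩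
  omega

theorem sum_black_deg : ∑ b with b ∉ D.white, (D.inDeg b + D.outDeg b) = ∑ v, D.inDeg v := by
  simp_rw [inDeg, outDeg, card_filter, sum_add_distrib]
  rw [sum_comm (s := univ.filter _) (f := fun b u => if D.weight b u ≠ 0 then 1 else 0)]
  simp_rw [sum_filter]; rw [← sum_add_distrib]; refine sum_congr rfl fun a _ => ?_
  have : ∀ F : Fin Δ.n → ℕ, (if a ∉ D.white then ∑ u, F u else 0) =
    ∑ u, if a ∉ D.white then F u else 0 := fun F => by split_ifs <;> simp
  rw [this, ← sum_add_distrib]; exact sum_congr rfl fun u _ => by have := D.bipartite u a; grind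

theorem exists_adj (hΔ : Δ.Valid) (v : Fin Δ.n) : ∃ u, D.graph.Adj v u := by
  have : Nontrivial (Fin Δ.n) := Fin.nontrivial_iff_two_le.2 (DelPezzoDegree.two_le_n hΔ)
  obtain ⟨u, hu⟩ := exists_ne v; obtain ⟨p⟩ := D.isTree.1.preconnected v u; cases p with
  | nil => exact absurd rfl hu
  | cons h _ => exact ⟨_, h⟩

theorem leak_black {b : Fin Δ.n} (hb : b ∉ D.white) : b ∉ D.leakPos ∧ b ∉ D.leakNeg :=
  ⟨fun h => hb (D.leakPos_white h), fun h => hb (D.leakNeg_white h)⟩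

theorem black_balance {b : Fin Δ.n} (hb : b ∉ D.white) :
    ∑ u, D.weight u b + D.inEnds b = ∑ u, D.weight b u + D.outEnds b := by
  have := D.divergence b; rw [if_neg (D.leak_black hb).1, if_neg (D.leak_black hb).2] at this; omega

theorem inDeg_eq_zero {v : Fin Δ.n} (h : D.inDeg v = 0) (u : Fin Δ.n) : D.weight u v = 0 := by
  rw [inDeg, card_eq_zero, filter_eq_empty_iff] at h; simpa using h (mem_univ u)

theorem outDeg_eq_zero {v : Fin Δ.n} (h : D.outDeg v = 0) (u : Fin Δ.n) : D.weight v u = 0 := by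
  rw [outDeg, card_eq_zero, filter_eq_empty_iff] at h; simpa using h (mem_univ u)

theorem sum_black_ends_le : ∑ b with b ∉ D.white,
    (D.inEnds b + D.outEnds b) + ∑ b ∈ D.white, (D.inEnds b + D.outEnds b) =
    Δ.numIn + Δ.numOut := by
  rw [← D.sum_inEnds, ← D.sum_outEnds, ← sum_add_distrib,
    ← sum_filter_add_sum_filter_not univ (fun b => b ∉ D.white)]
  congr 1; refine sum_congr ?_ fun _ _ => rfl
  ext; simp

theorem one_le_in (hΔ : Δ.Valid) {b : Fin Δ.n} (hb : b ∉ D.white) :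
    1 ≤ D.inDeg b + D.inEnds b ∧ 1 ≤ D.outDeg b + D.outEnds b := by
  obtain ⟨u, hu⟩ := D.exists_adj hΔ b; have hbal := D.black_balance hb; by_contra h
  have h1 : ∑ u, D.weight u b = 0 ∧ ∑ u, D.weight b u = 0 := by
    rcases not_and_or.1 h with h | h
    · have := sum_eq_zero fun u (_ : u ∈ univ) => D.inDeg_eq_zero (v := b) (by omega) u; omega
    · have := sum_eq_zero fun u (_ : u ∈ univ) => D.outDeg_eq_zero (v := b) (by omega) u; omega
  simp only [sum_eq_zero_iff, mem_univ, true_imp_iff] at h1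
  exact (D.adj_iff.1 hu).elim (· (h1.2 u)) (· (h1.1 u))

theorem black_white_structure (hΔ : Δ.Valid) :
    (∀ b ∉ D.white, D.inDeg b + D.inEnds b = 1 ∧ D.outDeg b + D.outEnds b = 1) ∧
      ∀ w ∈ D.white, D.inEnds w = 0 ∧ D.outEnds w = 0 := by
  have h1 := D.sum_inDeg_add_one; have h2 := D.sum_black_deg; have h3 := D.sum_black_ends_le
  have h4 := DelPezzoDegree.n_add_one hΔ; have h5 : #{b | b ∉ D.white} + Δ.numWhite = Δ.n := by
    rw [← D.card_white]
    simpa using card_filter_add_card_filter_not (s := (univ : Finset (Fin Δ.n))) (· ∉ D.white)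
  have h6 : ∑ b with b ∉ D.white, ((D.inDeg b + D.outDeg b) + (D.inEnds b + D.outEnds b)) +
      ∑ b ∈ D.white, (D.inEnds b + D.outEnds b) =
      2 * #{b | b ∉ D.white} := by
    rw [sum_add_distrib]; omega
  have h7 : ∀ b ∈ univ.filter (fun b => b ∉ D.white), 2 ≤
      ((D.inDeg b + D.outDeg b) + (D.inEnds b + D.outEnds b)) := fun b hb => by
    have := D.one_le_in hΔ (mem_filter.1 hb).2; omega
  have h8 := sum_le_sum h7; rw [sum_const, smul_eq_mul] at h8
  have h9 : ∑ b ∈ D.white, (D.inEnds b + D.outEnds b) = 0 := by omega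
  have h10 : ∑ b with b ∉ D.white, 2 = ∑ b with b ∉ D.white,
      ((D.inDeg b + D.outDeg b) + (D.inEnds b + D.outEnds b)) := by
    rw [sum_const, smul_eq_mul]; omega
  rw [sum_eq_sum_iff_of_le h7] at h10
  refine ⟨fun b hb => ?_, fun w hw => by have := sum_eq_zero_iff.1 h9 w hw; omega⟩
  have h11 := h10 b (by simpa using hb); have h12 := D.one_le_in hΔ hb; omega

theorem white_balance (hΔ : Δ.Valid) {w : Fin Δ.n} (hw : w ∈ D.white) :
    (if w ∈ D.leakNeg then 1 else 0) + ∑ b, D.jump w b = if w ∈ D.leakPos then 1 else 0 := by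
  have h1 := D.divergence w; have h2 := (D.black_white_structure hΔ).2 w hw
  simp only [h2.1, h2.2] at h1; unfold jump; rw [sum_sub_distrib]; push_cast at h1
  linarith

theorem black_jump {b : Fin Δ.n} (hb : b ∉ D.white) :
    ∑ w, D.jump w b = D.inEnds b - D.outEnds b := by
  have := D.black_balance hb; unfold jump; rw [sum_sub_distrib]
  zify at this
  linarith

theorem card_adj (b : Fin Δ.n) : #{w | D.graph.Adj w b} = D.inDeg b + D.outDeg b := by
  unfold inDeg outDeg; rw [← card_union_of_disjoint]
  · congr 1; ext w; simp [D.adj_iff]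
  · exact disjoint_filter.2 fun w _ h h' => (D.oriented _ _ h).not_gt (D.oriented _ _ h')

theorem black_valence (hΔ : Δ.Valid) {b : Fin Δ.n} (hb : b ∉ D.white) :
    #{w | D.graph.Adj w b} + D.inEnds b + D.outEnds b = 2 := by
  have h1 := (D.black_white_structure hΔ).1 b hb; rw [D.card_adj]; omega

theorem weight_eq_elevatorWeight (hΔ : Δ.Valid) {b : Fin Δ.n} (hb : b ∉ D.white) :
    (∀ w, D.weight w b ≠ 0 → D.weight w b = D.elevatorWeight b) ∧
    (∀ w, D.weight b w ≠ 0 → D.weight b w = D.elevatorWeight b) ∧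
    (D.inEnds b ≠ 0 → D.elevatorWeight b = 1) ∧ (D.outEnds b ≠ 0 → D.elevatorWeight b = 1) := by
  have h1 := (D.black_white_structure hΔ).1 b hb; have hbal := D.black_balance hb
  unfold elevatorWeight
  have key : ∀ f : Fin Δ.n → ℕ, #{u | f u ≠ 0} ≤ 1 → ∀ w, f w ≠ 0 → ∑ u, f u = f w := by
    intro f hf w hw; refine sum_eq_single w (fun u _ hu => ?_) (by simp); by_contra hfu
    exact hu (card_le_one.1 hf u (by simpa using hfu) w (by simpa using hw))
  have key0 : ∀ f : Fin Δ.n → ℕ, #{u | f u ≠ 0} = 0 → ∑ u, f u = 0 := by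
    intro f hf; rw [card_eq_zero, filter_eq_empty_iff] at hf
    exact sum_eq_zero fun u hu => by simpa using hf hu
  have pos : ∀ f : Fin Δ.n → ℕ, ∀ w, f w ≠ 0 → 1 ≤ #{u | f u ≠ 0} := by
    intro f w hw; exact card_pos.2 ⟨w, by simpa using hw⟩
  unfold inDeg outDeg at h1; refine ⟨fun w hw => ?_, fun w hw => ?_, fun h => ?_, fun h => ?_⟩
  · have := pos (fun u => D.weight u b) w hw
    rw [key (fun u => D.weight u b) (by omega) w hw]; omega
  · have := pos (fun u => D.weight b u) w hw
    rw [key (fun u => D.weight b u) (by omega) w hw] at hbal; omega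
  · rw [key0 (fun u => D.weight u b) (by omega)]; omega
  · rw [key0 (fun u => D.weight b u) (by omega)] at hbal; omega

theorem natAbs_jump (hΔ : Δ.Valid) {w b : Fin Δ.n} (hb : b ∉ D.white) (h : D.graph.Adj w b) :
    (D.jump w b).natAbs = D.elevatorWeight b := by
  obtain ⟨h1, h2, -⟩ := D.weight_eq_elevatorWeight hΔ hb; unfold jump; have h4 := h1 w
  have h5 := h2 w; have h6 := D.adj_iff.1 h
  rcases le_total w b with hl | hl <;> have h3 := D.weight_eq_zero_of_lt hl <;> omega

theorem weight_le (a b : Fin Δ.n) : D.weight a b ≤ Δ.numIn + Δ.n := by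
  by_cases hab : D.weight a b = 0
  · omega
  have hlt := D.oriented _ _ hab
  have hdiv : ∀ v, (∑ u, (D.weight v u : ℤ)) - ∑ u, (D.weight u v : ℤ) ≤ D.inEnds v + 1 := by
    intro v; have := D.divergence v; push_cast at this
    have h1 : (0 : ℤ) ≤ if v ∈ D.leakPos then 1 else 0 := by split_ifs <;> simp
    have h2 : (if v ∈ D.leakNeg then (1 : ℤ) else 0) ≤ 1 := by split_ifs <;> simp
    have h3 : (0 : ℤ) ≤ D.outEnds v := by positivity
    linarith
  have hS := sum_le_sum (s := Iic a) fun v _ => hdiv v; rw [sum_sub_distrib] at hS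
  have h1 : ∑ v ∈ Iic a, ∑ u, (D.weight u v : ℤ) =
      ∑ v ∈ Iic a, ∑ u ∈ Iic a, (D.weight v u : ℤ) := by
    rw [sum_comm (s := Iic a) (t := Iic a)]; refine sum_congr rfl fun v hv => ?_; symm
    refine sum_subset (subset_univ _) fun u _ hu => ?_; rw [mem_Iic] at hu hv
    rw [D.weight_eq_zero_of_lt (hv.trans (not_le.1 hu).le)]; simp
  rw [h1, ← sum_sub_distrib] at hS
  have h2 : (D.weight a b : ℤ) ≤ ∑ v ∈ Iic a, ((∑ u, (D.weight v u : ℤ)) -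
      ∑ u ∈ Iic a, (D.weight v u : ℤ)) := by
    have h3 : ∀ v, (∑ u, (D.weight v u : ℤ)) - ∑ u ∈ Iic a, (D.weight v u : ℤ) =
        ∑ u ∈ univ \ Iic a, (D.weight v u : ℤ) := fun v => by
      rw [sub_eq_iff_eq_add, sum_sdiff (subset_univ _)]
    simp_rw [h3]; refine le_trans ?_ (single_le_sum (f := fun v =>
      ∑ u ∈ univ \ Iic a, (D.weight v u : ℤ)) (fun v _ => by positivity)
      (mem_Iic.2 le_rfl))
    exact single_le_sum (f := fun u => (D.weight a u : ℤ)) (fun v _ => by positivity)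
      (by simpa using hlt)
  have h4 : ∑ v ∈ Iic a, ((D.inEnds v : ℤ) + 1) ≤ ∑ v, ((D.inEnds v : ℤ) + 1) :=
    sum_le_sum_of_subset_of_nonneg (subset_univ _) fun v _ _ => by positivity
  have h5 : ∑ v, ((D.inEnds v : ℤ) + 1) = Δ.numIn + Δ.n := by
    rw [sum_add_distrib, ← D.sum_inEnds]; simp
  linarith

theorem abs_jump_le (w b : Fin Δ.n) : |D.jump w b| ≤ (Δ.numIn + Δ.n : ℕ) := by
  have h1 := D.weight_le w b; have h2 := D.weight_le b w; unfold jump; rw [abs_le]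
  omega

theorem finite (Δ : DelPezzoDegree) : Finite (FloorDiagram Δ) := by
  let B := Δ.numIn + Δ.n + 1; let C := Δ.numIn + Δ.numOut + 1
  let f : FloorDiagram Δ → Finset (Fin Δ.n) × (Fin Δ.n → Fin Δ.n → Fin B) × (Fin Δ.n → Fin C) ×
      (Fin Δ.n → Fin C) × Finset (Fin Δ.n) × Finset (Fin Δ.n) := fun D =>
    (D.white, fun a b => ⟨D.weight a b, Nat.lt_succ_of_le (D.weight_le a b)⟩,
      fun a => ⟨D.inEnds a, Nat.lt_succ_of_le (by
        rw [← D.sum_inEnds]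
        exact le_add_right (single_le_sum (f := D.inEnds) (fun _ _ => by positivity)
          (mem_univ a)))⟩,
      fun a => ⟨D.outEnds a, Nat.lt_succ_of_le (by
        rw [← D.sum_outEnds]
        exact le_add_left (single_le_sum (f := D.outEnds) (fun _ _ => by positivity)
          (mem_univ a)))⟩, D.leakPos, D.leakNeg)
  refine Finite.of_injective f fun D E h => ?_; simp only [f, Prod.mk.injEq] at h; cases D; cases E
  simp_all [funext_iff]

end FloorDiagram

/-! ### The tropical map of a floor diagram: combinatorial structure -/

/-- A pair of vertices of a floor diagram is a node if it is a pair `(v, v)` (the marked point `v`),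
or a pair `(w, b)` consisting of a floor and an adjacent elevator (their intersection point). -/
def FloorDiagram.IsNode {Δ : DelPezzoDegree} (D : FloorDiagram Δ) (e : Fin Δ.n × Fin Δ.n) : Prop :=
  e.1 = e.2 ∨ (e.1 ∈ D.white ∧ D.graph.Adj e.1 e.2)

/-- A floor diagram together with an order of the nodes on every floor. The mark of the elevator `b`
lies on the adjacent floor `host b` if `host b ≠ b`. -/
structure FloorPlan (Δ : DelPezzoDegree) (K : Type) [LinearOrder K] where
  D : FloorDiagram Δ
  host : Fin Δ.n → Fin Δ.n
  host_spec : ∀ v, host v = v ∨ (v ∉ D.white ∧ host v ∈ D.white ∧ D.graph.Adj (host v) v)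
  key : Fin Δ.n × Fin Δ.n → K
  key_inj : Injective key

namespace FloorPlan

variable {Δ : DelPezzoDegree} {K : Type} [LinearOrder K] (F : FloorPlan Δ K)

/-- The nodes of the floor diagram. -/
abbrev Node : Type := {e : Fin Δ.n × Fin Δ.n // F.D.IsNode e}

/-- The floor of a node (or the elevator, if the node is not on a floor). -/
def fl (e : Fin Δ.n × Fin Δ.n) : Fin Δ.n := if e.1 = e.2 then F.host e.1 else e.1

/-- The nodes `e` and `e'` are neighbours on a floor, with `e` on the left. -/
def Next (e e' : F.Node) : Prop :=
  F.fl e.1 = F.fl e'.1 ∧ F.key e.1 < F.key e'.1 ∧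
    ∀ e'' : F.Node, F.fl e''.1 = F.fl e.1 → F.key e.1 < F.key e''.1 → F.key e'.1 ≤ F.key e''.1

/-- The node `e` is joined by an edge of an elevator to the node `e'` at which the elevator is
marked. -/
def Vert (e e' : F.Node) : Prop := e.1.1 ≠ e.1.2 ∧ e'.1.1 = F.host e.1.2 ∧ e'.1.2 = e.1.2 ∧ e ≠ e'

def First (e : F.Node) : Prop := ∀ e' : F.Node, F.fl e'.1 = F.fl e.1 → F.key e.1 ≤ F.key e'.1

def Last (e : F.Node) : Prop := ∀ e' : F.Node, F.fl e'.1 = F.fl e.1 → F.key e'.1 ≤ F.key e.1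

theorem host_white {w : Fin Δ.n} (hw : w ∈ F.D.white) : F.host w = w := by
  exact (F.host_spec w).resolve_right fun h => h.1 hw

/-- The marked node. -/
def markNode (v : Fin Δ.n) : F.Node := ⟨(v, v), .inl rfl⟩

/-- The intersection of a floor and an elevator. -/
def attNode {w b : Fin Δ.n} (hw : w ∈ F.D.white) (h : F.D.graph.Adj w b) : F.Node :=
  ⟨(w, b), .inr ⟨hw, h⟩⟩

/-- The node at which the elevator `b` is marked, or at which its mark is attached. -/
def hub (b : Fin Δ.n) : F.Node := ⟨(F.host b, b), (F.host_spec b).imp_right And.right⟩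

theorem fl_hub (b : Fin Δ.n) : F.fl (F.hub b).1 = F.host b := by
  unfold fl hub; grind

theorem fl_markNode (v : Fin Δ.n) : F.fl (F.markNode v).1 = F.host v := by simp [fl, markNode]

theorem fl_att {w b : Fin Δ.n} (h : w ≠ b) : F.fl (w, b) = w := by simp [fl, h]

theorem eq_of_not_white {e : F.Node} (h : F.fl e.1 ∉ F.D.white) :
    e = F.markNode (F.fl e.1) ∧ F.host (F.fl e.1) = F.fl e.1 := by
  obtain ⟨⟨a, b⟩, he⟩ := e; rcases he with he | he
  · obtain rfl : a = b := he; simp only [fl, if_true] at h ⊢; rcases F.host_spec a with h1 | h1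
    · rw [h1, h1]; exact ⟨rfl, rfl⟩
    · exact absurd h1.2.1 h
  · rw [F.fl_att he.2.ne] at h; exact absurd he.1 h

theorem eq_of_fl_eq {e e' : F.Node} (h : F.fl e.1 ∉ F.D.white) (h' : F.fl e'.1 = F.fl e.1) :
    e' = e := by
  rw [(F.eq_of_not_white h).1, (F.eq_of_not_white (e := e') (h' ▸ h)).1, h']

theorem fl_white_of_next {e e' : F.Node} (h : F.Next e e') : F.fl e.1 ∈ F.D.white := by
  by_contra hw; obtain rfl := F.eq_of_fl_eq hw h.1.symm; exact lt_irrefl _ h.2.1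

theorem ext_key {e e' : F.Node} (h : F.key e.1 = F.key e'.1) : e = e' := Subtype.ext (F.key_inj h)

theorem exists_next {e : F.Node} (h : ¬ F.Last e) : ∃ e', F.Next e e' := by
  unfold Last at h; push Not at h; obtain ⟨e1, h1, h2⟩ := h
  obtain ⟨e', he', hmin⟩ := exists_min_image
    (univ.filter fun e' : F.Node => F.fl e'.1 = F.fl e.1 ∧ F.key e.1 < F.key e'.1)
    (fun e' => F.key e'.1) ⟨e1, by simp [h1, h2]⟩
  simp only [mem_filter_univ] at he' hmin
  exact ⟨e', he'.1.symm, he'.2, fun e'' h3 h4 => hmin e'' ⟨h3, h4⟩⟩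

theorem exists_prev {e : F.Node} (h : ¬ F.First e) : ∃ e', F.Next e' e := by
  unfold First at h; push Not at h; obtain ⟨e1, h1, h2⟩ := h
  obtain ⟨e', he', hmax⟩ := exists_max_image
    (univ.filter fun e' : F.Node => F.fl e'.1 = F.fl e.1 ∧ F.key e'.1 < F.key e.1)
    (fun e' => F.key e'.1) ⟨e1, by simp [h1, h2]⟩
  simp only [mem_filter_univ] at he' hmax
  exact ⟨e', he'.1, he'.2, fun e'' h3 h4 => not_lt.1 fun h5 =>
    h4.not_ge (hmax e'' ⟨h3.trans he'.1, h5⟩)⟩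

theorem next_right_unique {e e' e'' : F.Node} (h : F.Next e e') (h' : F.Next e e'') : e' = e'' :=
  F.ext_key (le_antisymm (h.2.2 _ (h'.1.symm) h'.2.1) (h'.2.2 _ (h.1.symm) h.2.1))

theorem next_left_unique {e e' e'' : F.Node} (h : F.Next e' e) (h' : F.Next e'' e) : e' = e'' := by
  refine F.ext_key (le_antisymm (not_lt.1 fun hl => ?_) (not_lt.1 fun hl => ?_))
  exacts [h.2.1.not_ge (h'.2.2 _ (h.1.trans h'.1.symm) hl),
    h'.2.1.not_ge (h.2.2 _ (h'.1.trans h.1.symm) hl)]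

theorem not_last_of_next {e e' : F.Node} (h : F.Next e e') : ¬ F.Last e := fun hl =>
  h.2.1.not_ge (hl _ h.1.symm)

theorem not_first_of_next {e e' : F.Node} (h : F.Next e e') : ¬ F.First e' := fun hl =>
  h.2.1.not_ge (hl _ h.1)

theorem chain {e e' : F.Node} (h : F.fl e.1 = F.fl e'.1) (hk : F.key e.1 ≤ F.key e'.1) :
    ReflTransGen (fun a b => F.Next a b ∧ F.key e.1 ≤ F.key a.1 ∧ F.key b.1 ≤ F.key e'.1) e e' := by
  generalize hm : (univ.filter fun e'' : F.Node =>
    F.fl e''.1 = F.fl e.1 ∧ F.key e.1 < F.key e''.1).card = m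
  induction m using Nat.strong_induction_on generalizing e with
  | _ m ih =>
    rcases hk.eq_or_lt with hk | hk
    · rw [F.ext_key hk]
    · obtain ⟨e1, h1⟩ := F.exists_next (e := e) fun hl => absurd hk (not_lt.2 (hl _ h.symm))
      have h2 : F.key e1.1 ≤ F.key e'.1 := h1.2.2 _ h.symm hk; have h3 := ih _ (by
        rw [← hm]; refine card_lt_card ((ssubset_iff_of_subset fun x hx => ?_).2
          ⟨e1, by simp [h1.1, h1.2.1], by simp⟩)
        simp only [mem_filter_univ] at hx ⊢
        exact ⟨hx.1.trans h1.1.symm, h1.2.1.trans hx.2⟩) (h1.1.symm.trans h) h2 rfl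
      exact ReflTransGen.head ⟨h1, le_rfl, h2⟩ (ReflTransGen.mono (fun a b hab =>
        ⟨hab.1, h1.2.1.le.trans hab.2.1, hab.2.2⟩) _ _ h3)

/-! #### The graph -/

theorem vert_fl_ne {e e' : F.Node} (h : F.Vert e e') : F.fl e.1 ≠ F.fl e'.1 := by
  obtain ⟨h1, h2, h3, h4⟩ := h; have h5 : e' = F.hub e.1.2 := Subtype.ext (Prod.ext h2 h3)
  rw [h5, fl_hub, fl, if_neg h1]
  exact fun h6 => h4 (Subtype.ext (Prod.ext (h6.trans h2.symm) h3.symm))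

theorem vert_asymm {e e' : F.Node} (h : F.Vert e e') : ¬ F.Vert e' e := by
  rintro ⟨h1, h2, h3, h4⟩; obtain ⟨h5, h6, h7, h8⟩ := h
  exact h8 (Subtype.ext (Prod.ext (by rw [h2, h6, h7]) h3))

theorem next_asymm {e e' : F.Node} (h : F.Next e e') : ¬ F.Next e' e := fun h' =>
  lt_asymm h.2.1 h'.2.1

/-- The underlying graph. -/
def graph : SimpleGraph F.Node where
  Adj e e' := F.Next e e' ∨ F.Next e' e ∨ F.Vert e e' ∨ F.Vert e' e
  symm := ⟨fun e e' h => by tauto⟩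
  loopless := ⟨fun e h => by
    rcases h with h | h | h | h
    exacts [lt_irrefl _ h.2.1, lt_irrefl _ h.2.1, h.2.2.2 rfl, h.2.2.2 rfl]⟩

theorem sum_adj {M : Type} [AddCommMonoid M] (e : F.Node) (f : F.Node → M) :
    (∑ e', if F.graph.Adj e e' then f e' else 0) =
      (∑ e', if F.Next e e' then f e' else 0) + (∑ e', if F.Next e' e then f e' else 0) +
      ((∑ e', if F.Vert e e' then f e' else 0) + ∑ e', if F.Vert e' e then f e' else 0) := by
  rw [← sum_add_distrib, ← sum_add_distrib, ← sum_add_distrib]; refine sum_congr rfl fun e' _ => ?_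
  have hG : F.graph.Adj e e' ↔ F.Next e e' ∨ F.Next e' e ∨ F.Vert e e' ∨ F.Vert e' e := Iff.rfl
  have h1 : F.Next e e' → ¬ F.Next e' e := F.next_asymm
  have h2 : F.Vert e e' → ¬ F.Vert e' e := F.vert_asymm
  have h3 : F.Next e e' ∨ F.Next e' e → ¬ F.Vert e e' ∧ ¬ F.Vert e' e := fun h =>
    ⟨fun h' => F.vert_fl_ne h' (h.elim (·.1) (·.1.symm)),
      fun h' => F.vert_fl_ne h' (h.elim (·.1.symm) (·.1))⟩
  by_cases F.Next e e' <;> by_cases F.Next e' e <;> by_cases F.Vert e e' <;> simp_all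

theorem sum_next {M : Type} [AddCommMonoid M] (e : F.Node) (c : M) :
    (∑ e', if F.Next e e' then c else 0) = if F.Last e then 0 else c := by
  split_ifs with h
  · exact sum_eq_zero fun e' _ => if_neg fun h' => F.not_last_of_next h' h
  · obtain ⟨e1, h1⟩ := F.exists_next h
    rw [sum_eq_single e1 (fun e' _ hne => if_neg fun h' => hne (F.next_right_unique h' h1))
      (by simp), if_pos h1]

theorem sum_prev {M : Type} [AddCommMonoid M] (e : F.Node) (c : M) :
    (∑ e', if F.Next e' e then c else 0) = if F.First e then 0 else c := by
  split_ifs with h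
  · exact sum_eq_zero fun e' _ => if_neg fun h' => F.not_first_of_next h' h
  · obtain ⟨e1, h1⟩ := F.exists_prev h
    rw [sum_eq_single e1 (fun e' _ hne => if_neg fun h' => hne (F.next_left_unique h' h1))
      (by simp), if_pos h1]

theorem sum_vert {M : Type} [AddCommMonoid M] (e : F.Node) (c : M) :
    (∑ e', if F.Vert e e' then c else 0) =
      if e.1.1 ≠ e.1.2 ∧ e.1.1 ≠ F.host e.1.2 then c else 0 := by
  split_ifs with h
  · have h1 : F.Vert e (F.hub e.1.2) := ⟨h.1, rfl, rfl, fun he => h.2 (by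
      conv_lhs => rw [he]
      rfl)⟩
    rw [sum_eq_single (F.hub e.1.2) (fun e' _ hne => if_neg fun h' => hne
      (Subtype.ext (Prod.ext h'.2.1 h'.2.2.1))) (by simp), if_pos h1]
  · refine sum_eq_zero fun e' _ => if_neg fun h' => h ⟨h'.1, fun he => ?_⟩
    exact h'.2.2.2 (Subtype.ext (Prod.ext (he.trans h'.2.1.symm) h'.2.2.1.symm))

theorem sum_vert' {M : Type} [AddCommMonoid M] (e : F.Node) (g : Fin Δ.n → M) :
    (∑ e', if F.Vert e' e then g e'.1.1 else 0) = if e.1.1 = F.host e.1.2 ∧ e.1.2 ∉ F.D.white then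
        ∑ w, if F.D.graph.Adj w e.1.2 ∧ w ≠ e.1.1 then g w else 0 else 0 := by
  split_ifs with h
  · rw [← sum_filter, ← sum_filter]; refine sum_bij (fun e' _ => e'.1.1) ?_ ?_ ?_ ?_
    · intro e' he'; simp only [mem_filter_univ] at he' ⊢; obtain ⟨h1, h2, h3, h4⟩ := he'; rw [h3]
      exact ⟨(e'.2.resolve_left h1).2, fun h6 => h4 (Subtype.ext (Prod.ext h6 h3.symm))⟩
    · intro e1 h1 e2 h2 he; simp only [mem_filter_univ] at h1 h2
      exact Subtype.ext (Prod.ext he (h1.2.2.1.symm.trans h2.2.2.1))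
    · intro w hw; simp only [mem_filter_univ] at hw
      have hww : w ∈ F.D.white := (F.D.color hw.1).2 h.2
      refine ⟨F.attNode hww hw.1, (mem_filter_univ _).2 ⟨hw.1.ne, h.1, rfl, fun he => hw.2 ?_⟩, rfl⟩
      rw [← he]; rfl
    · intros; rfl
  · refine sum_eq_zero fun e' _ => if_neg fun h' => h ⟨?_, ?_⟩
    · rw [h'.2.1, h'.2.2.1]
    · have h5 := e'.2.resolve_left h'.1; rw [h'.2.2.1]; exact (F.D.color h5.2).1 h5.1

/-! #### Slopes and directions -/

def leakL (w : Fin Δ.n) : ℤ := if w ∈ F.D.leakNeg then 1 else 0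

def leakR (w : Fin Δ.n) : ℤ := if w ∈ F.D.leakPos then 1 else 0

/-- The slope of a floor on the right of a node. -/
def slopeR (e : F.Node) : ℤ :=
  F.leakL (F.fl e.1) + ∑ b, if F.key (F.fl e.1, b) ≤ F.key e.1 then F.D.jump (F.fl e.1) b else 0

/-- The slope of a floor on the left of a node. -/
def slopeL (e : F.Node) : ℤ :=
  F.leakL (F.fl e.1) + ∑ b, if F.key (F.fl e.1, b) < F.key e.1 then F.D.jump (F.fl e.1) b else 0

theorem slopeR_eq (e : F.Node) :
    F.slopeR e = F.slopeL e + if F.fl e.1 = e.1.1 then F.D.jump e.1.1 e.1.2 else 0 := by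
  unfold slopeR slopeL; rw [add_assoc, add_right_inj, ← sub_eq_iff_eq_add', ← sum_sub_distrib]
  have h1 : ∀ b, ((if F.key (F.fl e.1, b) ≤ F.key e.1 then F.D.jump (F.fl e.1) b else 0) -
      if F.key (F.fl e.1, b) < F.key e.1 then F.D.jump (F.fl e.1) b else 0) =
      if (F.fl e.1, b) = e.1 then F.D.jump (F.fl e.1) b else 0 := by
    intro b; simp only [← F.key_inj.eq_iff (a := (_, b))]
    rcases lt_trichotomy (F.key (F.fl e.1, b)) (F.key e.1) with h | h | h
    · simp [h, h.le, h.ne]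
    · simp [h]
    · simp [h.not_ge, h.not_gt, h.ne']
  rw [sum_congr rfl fun b _ => h1 b]; split_ifs with h
  · rw [sum_eq_single e.1.2 (fun b _ hb => if_neg fun h' => hb (by rw [← h']))
      (by simp), if_pos (show (F.fl e.1, e.1.2) = e.1 from Prod.ext h rfl), h]
  · exact sum_eq_zero fun b _ => if_neg fun h' => h (by conv_rhs => rw [← h'])

theorem node_of_jump {w b : Fin Δ.n} (hw : w ∈ F.D.white) (h : F.D.jump w b ≠ 0) :
    ∃ e : F.Node, e.1 = (w, b) ∧ F.fl e.1 = w := by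
  have h1 := F.D.jump_ne_zero_iff.1 h; exact ⟨F.attNode hw h1, rfl, F.fl_att h1.ne⟩

theorem slopeL_of_next {e e' : F.Node} (h : F.Next e e') : F.slopeL e' = F.slopeR e := by
  unfold slopeR slopeL; rw [← h.1]; congr 1; refine sum_congr rfl fun b _ => ?_
  by_cases hj : F.D.jump (F.fl e.1) b = 0
  · simp [hj]
  obtain ⟨e'', he, hfl⟩ := F.node_of_jump (F.fl_white_of_next h) hj; rw [← he]; congr 1
  rw [eq_iff_iff]
  exact ⟨fun h1 => not_lt.1 fun h2 => h1.not_ge (h.2.2 e'' hfl h2), fun h1 => h1.trans_lt h.2.1⟩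

theorem slopeL_of_first {e : F.Node} (hw : F.fl e.1 ∈ F.D.white) (h : F.First e) :
    F.slopeL e = F.leakL (F.fl e.1) := by
  unfold slopeL; rw [sum_eq_zero, add_zero]; intro b _; by_cases hj : F.D.jump (F.fl e.1) b = 0
  · simp [hj]
  obtain ⟨e'', he, hfl⟩ := F.node_of_jump hw hj; rw [← he, if_neg (not_lt.2 (h e'' hfl))]

theorem slopeR_of_last (hΔ : Δ.Valid) {e : F.Node} (hw : F.fl e.1 ∈ F.D.white) (h : F.Last e) :
    F.slopeR e = F.leakR (F.fl e.1) := by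
  unfold slopeR leakR leakL; rw [← F.D.white_balance hΔ hw]; congr 1
  refine sum_congr rfl fun b _ => ?_; by_cases hj : F.D.jump (F.fl e.1) b = 0
  · simp [hj]
  obtain ⟨e'', he, hfl⟩ := F.node_of_jump hw hj; rw [← he, if_pos (h e'' hfl)]

/-- The directions of the edges. -/
def dir (e e' : F.Node) : ℤ × ℤ :=
  if F.fl e.1 = F.fl e'.1 then
    (if F.key e.1 < F.key e'.1 then (1, F.slopeR e) else (-1, -F.slopeR e'))
  else if e'.1.1 = F.host e.1.2 ∧ e'.1.2 = e.1.2 then (0, -F.D.jump e.1.1 e.1.2)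
  else (0, F.D.jump e'.1.1 e'.1.2)

theorem dir_next {e e' : F.Node} (h : F.Next e e') : F.dir e e' = (1, F.slopeR e) := by
  simp [dir, h.1, h.2.1]

theorem dir_prev {e e' : F.Node} (h : F.Next e' e) : F.dir e e' = (-1, -F.slopeR e') := by
  simp [dir, h.1, h.2.1.not_gt]

theorem dir_vert {e e' : F.Node} (h : F.Vert e e') : F.dir e e' = (0, -F.D.jump e.1.1 e.1.2) := by
  simp [dir, F.vert_fl_ne h, h.2.1, h.2.2.1]

theorem dir_vert' {e e' : F.Node} (h : F.Vert e' e) : F.dir e e' = (0, F.D.jump e'.1.1 e'.1.2) := by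
  have h1 := F.vert_fl_ne h; have h2 : ¬ (e'.1.1 = F.host e.1.2 ∧ e'.1.2 = e.1.2) := by
    rintro ⟨h3, h4⟩; exact h.2.2.2 (Subtype.ext (Prod.ext (by rw [h3, h.2.1, h4]) h4))
  unfold dir; rw [if_neg h1.symm, if_neg h2]

theorem adj_of_vert {e e' : F.Node} (h : F.Vert e e') : F.D.graph.Adj e.1.1 e.1.2 := by
  exact (e.2.resolve_left h.1).2

/-- The ends. -/
def ends (e : F.Node) : Multiset (ℤ × ℤ) :=
  (if F.fl e.1 ∈ F.D.white ∧ F.First e then {(-1, -F.leakL (F.fl e.1))} else 0) +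
  (if F.fl e.1 ∈ F.D.white ∧ F.Last e then {(1, F.leakR (F.fl e.1))} else 0) +
  (if e.1.1 = F.host e.1.2 ∧ e.1.2 ∉ F.D.white then
    .replicate (F.D.inEnds e.1.2) (0, -1) + .replicate (F.D.outEnds e.1.2) (0, 1) else 0)

theorem dir_symm {e e' : F.Node} (h : F.graph.Adj e e') : F.dir e e' = -F.dir e' e := by
  rcases h with h | h | h | h
  iterate 2 rw [F.dir_next h, F.dir_prev h]; simp
  iterate 2 rw [F.dir_vert h, F.dir_vert' h]; simp

theorem dir_ne {e e' : F.Node} (h : F.graph.Adj e e') : F.dir e e' ≠ 0 := by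
  rcases h with h | h | h | h
  · rw [F.dir_next h]; simp
  · rw [F.dir_prev h]; simp
  · rw [F.dir_vert h]; simpa using F.D.jump_ne_zero_iff.2 (F.adj_of_vert h)
  · rw [F.dir_vert' h]; simpa using F.D.jump_ne_zero_iff.2 (F.adj_of_vert h)

theorem ends_ne (e : F.Node) : (0, 0) ∉ F.ends e := by
  unfold ends; split_ifs <;> simp [Multiset.mem_replicate]

theorem black_of_hub {e : F.Node} (h : F.fl e.1 ∉ F.D.white) :
    e.1.1 = e.1.2 ∧ e.1.1 = F.host e.1.2 ∧ e.1.2 ∉ F.D.white := by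
  have h1 := F.eq_of_not_white h
  have h2 : e.1.1 = F.fl e.1 := congrArg (fun x : F.Node => x.1.1) h1.1
  have h3 : e.1.2 = F.fl e.1 := congrArg (fun x : F.Node => x.1.2) h1.1; rw [h2, h3]
  exact ⟨rfl, h1.2.symm, h⟩

theorem balanced (hΔ : Δ.Valid) (e : F.Node) :
    (∑ e', if F.graph.Adj e e' then F.dir e e' else 0) + (F.ends e).sum = 0 := by
  rw [F.sum_adj]; have h1 : (∑ e', if F.Next e e' then F.dir e e' else 0) =
      ∑ e', if F.Next e e' then ((1, F.slopeR e) : ℤ × ℤ) else 0 :=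
    sum_congr rfl fun e' _ => by split_ifs with h <;> [exact F.dir_next h; rfl]
  have h2 : (∑ e', if F.Next e' e then F.dir e e' else 0) =
      ∑ e', if F.Next e' e then ((-1, -F.slopeL e) : ℤ × ℤ) else 0 :=
    sum_congr rfl fun e' _ => by split_ifs with h <;> [rw [F.dir_prev h, F.slopeL_of_next h]; rfl]
  have h3 : (∑ e', if F.Vert e e' then F.dir e e' else 0) =
      ∑ e', if F.Vert e e' then ((0, -F.D.jump e.1.1 e.1.2) : ℤ × ℤ) else 0 :=
    sum_congr rfl fun e' _ => by split_ifs with h <;> [exact F.dir_vert h; rfl]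
  have h4 : (∑ e', if F.Vert e' e then F.dir e e' else 0) =
      ∑ e', if F.Vert e' e then ((0, F.D.jump e'.1.1 e.1.2) : ℤ × ℤ) else 0 :=
    sum_congr rfl fun e' _ => by split_ifs with h <;> [rw [F.dir_vert' h, h.2.2.1]; rfl]
  rw [h1, h2, h3, h4, F.sum_next, F.sum_prev, F.sum_vert,
    F.sum_vert' e (fun w => ((0, F.D.jump w e.1.2) : ℤ × ℤ))]
  unfold ends; simp only [Multiset.sum_add]
  have hR : (if F.Last e then 0 else ((1, F.slopeR e) : ℤ × ℤ)) +
      (if F.fl e.1 ∈ F.D.white ∧ F.Last e then {(1, F.leakR (F.fl e.1))} else 0 :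
        Multiset (ℤ × ℤ)).sum = if F.fl e.1 ∈ F.D.white then (1, F.slopeR e) else 0 := by
    by_cases hw : F.fl e.1 ∈ F.D.white
    · by_cases hl : F.Last e <;> simp [hw, hl, F.slopeR_of_last hΔ hw]
    · have hl : F.Last e := fun e' he' => by rw [F.eq_of_fl_eq hw he']
      simp [hw, hl]
  have hL : (if F.First e then 0 else ((-1, -F.slopeL e) : ℤ × ℤ)) +
      (if F.fl e.1 ∈ F.D.white ∧ F.First e then {(-1, -F.leakL (F.fl e.1))} else 0 :
        Multiset (ℤ × ℤ)).sum = if F.fl e.1 ∈ F.D.white then (-1, -F.slopeL e) else 0 := by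
    by_cases hw : F.fl e.1 ∈ F.D.white
    · by_cases hl : F.First e <;> simp [hw, hl, F.slopeL_of_first hw]
    · have hl : F.First e := fun e' he' => by rw [F.eq_of_fl_eq hw he']
      simp [hw, hl]
  have hE : (if e.1.1 = F.host e.1.2 ∧ e.1.2 ∉ F.D.white then
      .replicate (F.D.inEnds e.1.2) (0, -1) + .replicate (F.D.outEnds e.1.2) (0, 1) else 0 :
        Multiset (ℤ × ℤ)).sum = if e.1.1 = F.host e.1.2 ∧ e.1.2 ∉ F.D.white then
        ((0, (F.D.outEnds e.1.2 : ℤ) - F.D.inEnds e.1.2) : ℤ × ℤ) else 0 := by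
    split_ifs
    · simp [Multiset.sum_replicate]; ring
    · simp
  have hV : e.1.2 ∉ F.D.white → (∑ w, if F.D.graph.Adj w e.1.2 ∧ w ≠ e.1.1 then
      ((0, F.D.jump w e.1.2) : ℤ × ℤ) else 0) =
      (0, (F.D.inEnds e.1.2 : ℤ) - F.D.outEnds e.1.2 - F.D.jump e.1.1 e.1.2) := by
    intro hb; rw [← F.D.black_jump hb, ← sum_erase_eq_sub (mem_univ e.1.1), ← sum_filter]; ext
    · simp [Prod.fst_sum]
    · simp only [Prod.snd_sum]; refine sum_subset_zero_on_sdiff ?_ ?_ (fun _ _ => rfl)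
      · intro w hw; simp at hw ⊢; exact hw.2
      · intro w hw; simp only [mem_sdiff, mem_erase, mem_univ, mem_filter, true_and, and_true] at hw
        exact F.D.jump_eq_zero fun h => hw.2 ⟨h, hw.1⟩
  rw [hE]; have key : ∀ A B C D E F G : ℤ × ℤ, A + B + (C + D) + (E + F + G) =
    (A + F) + (B + E) + (C + D + G) := by intros; abel
  rw [key, hR, hL, F.slopeR_eq]; by_cases hw : F.fl e.1 ∈ F.D.white
  · simp only [hw, if_true]; by_cases hh : e.1.1 = F.host e.1.2 ∧ e.1.2 ∉ F.D.white
    · have h6 : ¬ (e.1.1 ≠ e.1.2 ∧ e.1.1 ≠ F.host e.1.2) := fun h => h.2 hh.1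
      rw [if_pos hh, if_pos hh, if_neg h6, hV hh.2]; have h7 : F.fl e.1 = e.1.1 := by
        unfold fl; split_ifs with h <;> [exact (congrArg F.host h).trans hh.1.symm; rfl]
      rw [if_pos h7]; ext <;> simp; ring
    · rw [if_neg hh, if_neg hh]; by_cases h8 : e.1.1 = e.1.2
      · have h6 : ¬ (e.1.1 ≠ e.1.2 ∧ e.1.1 ≠ F.host e.1.2) := fun h => h.1 h8
        rw [if_neg h6, h8, FloorDiagram.jump]; simp
      · have h9 : F.fl e.1 = e.1.1 := by simp [fl, h8]
        have h10 : e.1.1 ≠ F.host e.1.2 := fun h =>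
          have h11 := e.2.resolve_left h8
          hh ⟨h, (F.D.color h11.2).1 h11.1⟩
        rw [if_pos h9, if_pos (⟨h8, h10⟩)]; ext <;> simp
  · obtain ⟨h8, h9, h10⟩ := F.black_of_hub hw
    have h6 : ¬ (e.1.1 ≠ e.1.2 ∧ e.1.1 ≠ F.host e.1.2) := fun h => h.1 h8
    rw [if_neg hw, if_neg hw, if_neg h6, if_pos ⟨h9, h10⟩, if_pos ⟨h9, h10⟩, hV h10, h8]
    ext <;> simp [FloorDiagram.jump]

end FloorPlan

namespace FloorPlan

variable {Δ : DelPezzoDegree} {K : Type} [LinearOrder K] (F : FloorPlan Δ K)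

theorem valence (hΔ : Δ.Valid) (e : F.Node) :
    (∑ e', if F.graph.Adj e e' then 1 else 0) + (F.ends e).card +
      (if e.1.1 = e.1.2 then 1 else 0) = 3 := by
  rw [F.sum_adj, F.sum_next, F.sum_prev, F.sum_vert, F.sum_vert' e (fun _ => 1)]; unfold ends
  simp only [Multiset.card_add]; have hR : (if F.Last e then 0 else 1) + Multiset.card
      (if F.fl e.1 ∈ F.D.white ∧ F.Last e then {(1, F.leakR (F.fl e.1))} else 0 :
        Multiset (ℤ × ℤ)) = if F.fl e.1 ∈ F.D.white then 1 else 0 := by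
    by_cases hw : F.fl e.1 ∈ F.D.white
    · by_cases hl : F.Last e <;> simp [hw, hl]
    · have hl : F.Last e := fun e' he' => by rw [F.eq_of_fl_eq hw he']
      simp [hw, hl]
  have hL : (if F.First e then 0 else 1) + Multiset.card
      (if F.fl e.1 ∈ F.D.white ∧ F.First e then {(-1, -F.leakL (F.fl e.1))} else 0 :
        Multiset (ℤ × ℤ)) = if F.fl e.1 ∈ F.D.white then 1 else 0 := by
    by_cases hw : F.fl e.1 ∈ F.D.white
    · by_cases hl : F.First e <;> simp [hw, hl]
    · have hl : F.First e := fun e' he' => by rw [F.eq_of_fl_eq hw he']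
      simp [hw, hl]
  have hE : Multiset.card (if e.1.1 = F.host e.1.2 ∧ e.1.2 ∉ F.D.white then
      .replicate (F.D.inEnds e.1.2) (0, -1) + .replicate (F.D.outEnds e.1.2) (0, 1) else 0 :
        Multiset (ℤ × ℤ)) = if e.1.1 = F.host e.1.2 ∧ e.1.2 ∉ F.D.white then
        F.D.inEnds e.1.2 + F.D.outEnds e.1.2 else 0 := by
    split_ifs <;> simp
  have hV : e.1.2 ∉ F.D.white → (∑ w, if F.D.graph.Adj w e.1.2 ∧ w ≠ e.1.1 then 1 else 0) +
      (F.D.inEnds e.1.2 + F.D.outEnds e.1.2) + (if F.D.graph.Adj e.1.1 e.1.2 then 1 else 0) = 2 := by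
    intro hb; have h5 := F.D.black_valence hΔ hb
    rw [card_filter, ← add_sum_erase _ _ (mem_univ e.1.1)] at h5
    have h6 : (∑ w, if F.D.graph.Adj w e.1.2 ∧ w ≠ e.1.1 then 1 else 0) =
        ∑ w ∈ univ.erase e.1.1, if F.D.graph.Adj w e.1.2 then 1 else 0 := by
      rw [← add_sum_erase _ _ (mem_univ e.1.1)]
      simp only [ne_eq, not_true, and_false, if_false, zero_add]
      refine sum_congr rfl fun w hw => ?_; simp [ne_of_mem_erase hw]
    omega
  rw [hE]; have key : ∀ (A B C D E F G H : ℕ), A + B + (C + D) + (E + F + G) + H =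
      (A + F) + (B + E) + (C + D + G) + H := by
    intros; ring
  rw [key, hR, hL]; have h1 := fun h => F.black_of_hub (e := e) h
  have h2 : e.1.1 ≠ e.1.2 → F.D.graph.Adj e.1.1 e.1.2 ∧ e.1.2 ∉ F.D.white := fun h =>
    have h' := e.2.resolve_left h
    ⟨h'.2, (F.D.color h'.2).1 h'.1⟩
  have h3 : F.D.graph.Adj e.1.1 e.1.2 → e.1.1 ≠ e.1.2 := Adj.ne
  have h4 : F.fl e.1 ∈ F.D.white → e.1.1 = e.1.2 → ¬ (e.1.1 = F.host e.1.2 ∧ e.1.2 ∉ F.D.white) :=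
    fun hw h hh => by
      have : F.fl e.1 = e.1.2 := by rw [fl, if_pos h, h, ← hh.1, h]
      exact hh.2 (this ▸ hw)
  grind

theorem exists_first (w : Fin Δ.n) (hw : w ∈ F.D.white) : ∃ e : F.Node, F.fl e.1 = w ∧ F.First e := by
  obtain ⟨e', he', hmin⟩ := exists_min_image {e' : F.Node | F.fl e'.1 = w} (fun e' => F.key e'.1)
    ⟨F.markNode w, by simp [fl_markNode, F.host_white hw]⟩
  simp only [mem_filter_univ] at he' hmin; exact ⟨e', he', fun e'' h => hmin e'' (h.trans he')⟩

theorem exists_last (w : Fin Δ.n) (hw : w ∈ F.D.white) : ∃ e : F.Node, F.fl e.1 = w ∧ F.Last e := by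
  obtain ⟨e', he', hmax⟩ := exists_max_image {e' : F.Node | F.fl e'.1 = w} (fun e' => F.key e'.1)
    ⟨F.markNode w, by simp [fl_markNode, F.host_white hw]⟩
  simp only [mem_filter_univ] at he' hmax; exact ⟨e', he', fun e'' h => hmax e'' (h.trans he')⟩

theorem sum_floor {M : Type} [AddCommMonoid M] {p : F.Node → Prop}
    (hp : ∀ e e', p e → p e' → F.fl e.1 = F.fl e'.1 → F.key e.1 ≤ F.key e'.1)
    (hex : ∀ w ∈ F.D.white, ∃ e : F.Node, F.fl e.1 = w ∧ p e) (g : Fin Δ.n → M) :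
    (∑ e : F.Node, if F.fl e.1 ∈ F.D.white ∧ p e then g (F.fl e.1) else 0) =
      ∑ w ∈ F.D.white, g w := by
  rw [← sum_filter]
  refine sum_bij (fun e _ => F.fl e.1) (fun e he => by simpa using (mem_filter.1 he).2.1)
    (fun e he e' he' h => ?_) (fun w hw => ?_) (fun _ _ => rfl)
  · simp only [mem_filter_univ] at he he'
    exact F.ext_key ((hp _ _ he.2 he'.2 h).antisymm (hp _ _ he'.2 he.2 h.symm))
  · obtain ⟨e, rfl, h⟩ := hex w hw; exact ⟨e, by simp [hw, h], rfl⟩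

theorem sum_hub {M : Type} [AddCommMonoid M] (g : Fin Δ.n → M) :
    (∑ e : F.Node, if e.1.1 = F.host e.1.2 ∧ e.1.2 ∉ F.D.white then g e.1.2 else 0) =
      ∑ b with b ∉ F.D.white, g b := by
  rw [← sum_filter]; refine sum_bij (fun e _ => e.1.2) ?_ ?_ ?_ (fun _ _ => rfl)
  · intro e he; simpa using (mem_filter.1 he).2.2
  · intro e he e' he' h; simp only [mem_filter_univ] at he he'
    exact Subtype.ext (Prod.ext (by rw [he.1, he'.1, h]) h)
  · intro b hb; exact ⟨F.hub b, by simpa [hub] using hb, rfl⟩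

theorem sum_leak_multiset {ι α : Type} (S T : Finset ι) (hTS : T ⊆ S) (x y : α) :
    (∑ w ∈ S, ({if w ∈ T then x else y} : Multiset α)) =
      .replicate (S.card - T.card) y + .replicate T.card x := by
  rw [← sum_sdiff hTS, sum_congr rfl (g := fun _ => ({y} : Multiset α)),
    sum_congr rfl (s₁ := T) (g := fun _ => ({x} : Multiset α))]
  · rw [sum_const, sum_const, Multiset.nsmul_singleton, Multiset.nsmul_singleton,
      card_sdiff_of_subset hTS]
  · intro w hw; simp [hw]
  · intro w hw; simp [(mem_sdiff.1 hw).2]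

theorem sum_ends (hΔ : Δ.Valid) : ∑ e, F.ends e = Δ.ends := by
  unfold ends
  rw [sum_add_distrib, sum_add_distrib, F.sum_floor (fun _ e' h _ he => h e' he.symm) F.exists_first
      (fun w => ({(-1, -F.leakL w)} : Multiset (ℤ × ℤ))),
    F.sum_floor (fun e _ _ h he => h e he) F.exists_last
      (fun w => ({(1, F.leakR w)} : Multiset (ℤ × ℤ))),
    F.sum_hub (fun b => Multiset.replicate (F.D.inEnds b) ((0, -1) : ℤ × ℤ) +
      Multiset.replicate (F.D.outEnds b) (0, 1)), DelPezzoDegree.ends_eq hΔ]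
  congr 1
  · congr 1
    · rw [← F.D.card_white, ← F.D.card_leakNeg, ← sum_leak_multiset _ _ F.D.leakNeg_white]
      refine sum_congr rfl fun w _ => ?_; unfold leakL; split_ifs <;> rfl
    · rw [← F.D.card_white, ← F.D.card_leakPos, ← sum_leak_multiset _ _ F.D.leakPos_white]
      refine sum_congr rfl fun w _ => ?_; unfold leakR; split_ifs <;> rfl
  · have h1 := (F.D.black_white_structure hΔ).2
    have h2 : ∀ f : Fin Δ.n → ℕ, (∀ w ∈ F.D.white, f w = 0) → ∀ x : ℤ × ℤ,
        ∑ b with b ∉ F.D.white, Multiset.replicate (f b) x =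
        Multiset.replicate (∑ b, f b) x := by
      intro f hf x
      rw [← sum_subset (filter_subset (· ∉ F.D.white) _) fun b _ hb => hf b (by simpa using hb)]
      exact (map_sum (Multiset.replicateAddMonoidHom x) f _).symm
    rw [sum_add_distrib, h2 _ (fun w hw => (h1 w hw).1), h2 _ (fun w hw => (h1 w hw).2),
      F.D.sum_inEnds, F.D.sum_outEnds]

theorem card_node : Fintype.card F.Node + 1 = 2 * Δ.n := by
  have h1 : Fintype.card F.Node = ∑ b : Fin Δ.n, #{e : F.Node | e.1.2 = b} := by
    rw [← card_univ]; exact card_eq_sum_card_fiberwise (fun _ _ => mem_univ _)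
  have h2 : ∀ b, #{e : F.Node | e.1.2 = b} =
      1 + if b ∉ F.D.white then F.D.inDeg b + F.D.outDeg b else 0 := by
    intro b; have h3 : (univ.filter fun e : F.Node => e.1.2 = b) =
        insert (F.markNode b) (univ.filter fun e : F.Node => e.1.1 ≠ b ∧ e.1.2 = b) := by
      ext e; simp only [mem_filter_univ, mem_insert, Subtype.ext_iff, Prod.ext_iff, markNode]; tauto
    rw [h3, card_insert_of_notMem (by simp [markNode]), add_comm]; congr 1
    by_cases hb : b ∈ F.D.white
    · rw [if_neg (not_not.2 hb), card_eq_zero, filter_eq_empty_iff]; rintro e _ ⟨h5, rfl⟩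
      have h7 := e.2.resolve_left h5; exact (F.D.color h7.2).1 h7.1 hb
    · rw [if_pos hb, ← F.D.card_adj]; refine card_bij (fun e _ => e.1.1) ?_ ?_ ?_
      · intro e he; simp only [mem_filter_univ] at he ⊢; obtain ⟨h5, rfl⟩ := he
        exact (e.2.resolve_left h5).2
      · intro e he e' he' h; simp only [mem_filter_univ] at he he'
        exact Subtype.ext (Prod.ext h (he.2.trans he'.2.symm))
      · intro w hw; simp only [mem_filter_univ] at hw
        exact ⟨F.attNode ((F.D.color hw).2 hb) hw, by simp [attNode, hw.ne], rfl⟩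
  rw [h1, sum_congr rfl fun b _ => h2 b, sum_add_distrib, ← sum_filter, F.D.sum_black_deg]
  have := F.D.sum_inDeg_add_one
  simp only [sum_const, card_univ, Fintype.card_fin, smul_eq_mul, mul_one]; omega

theorem reachable_of_fl_eq {e e' : F.Node} (h : F.fl e.1 = F.fl e'.1) : F.graph.Reachable e e' := by
  have key : ∀ {a b : F.Node}, F.fl a.1 = F.fl b.1 → F.key a.1 ≤ F.key b.1 →
      F.graph.Reachable a b := by
    intro a b h hk; have h1 : ReflTransGen F.Next a b :=
      ReflTransGen.mono (fun _ _ hab => hab.1) _ _ (F.chain h hk)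
    clear h hk
    induction h1 with
    | refl => rfl
    | tail _ h' ih => exact ih.trans (Adj.reachable (.inl h'))
  rcases le_total (F.key e.1) (F.key e'.1) with hk | hk
  exacts [key h hk, (key h.symm hk).symm]

theorem reachable_hub {e : F.Node} (h : e.1.1 ≠ e.1.2) : F.graph.Reachable e (F.hub e.1.2) := by
  by_cases he : e = F.hub e.1.2
  · rw [← he]
  · exact Adj.reachable (.inr (.inr (.inl ⟨h, rfl, rfl, he⟩)))

theorem fl_eq_markNode (e : F.Node) : F.fl (F.markNode e.1.1).1 = F.fl e.1 := by
  rw [fl_markNode]; unfold fl; split_ifs with h <;> [rfl; exact F.host_white (e.2.resolve_left h).1]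

theorem connected (hΔ : Δ.Valid) : F.graph.Connected := by
  have hadj : ∀ u v, F.D.graph.Adj u v → F.graph.Reachable (F.markNode u) (F.markNode v) := by
    have key : ∀ w b, w ∈ F.D.white → F.D.graph.Adj w b →
        F.graph.Reachable (F.markNode w) (F.markNode b) := by
      intro w b hw h; exact ((F.reachable_of_fl_eq (F.fl_eq_markNode (F.attNode hw h))).trans
        (F.reachable_hub (e := F.attNode hw h) h.ne)).trans
        (F.reachable_of_fl_eq ((F.fl_hub b).trans (F.fl_markNode b).symm))
    intro u v h; by_cases hu : u ∈ F.D.white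
    exacts [key u v hu h, (key v u (not_not.1 fun hv => hu ((F.D.color h).2 hv)) h.symm).symm]
  have hmark : ∀ u v, F.graph.Reachable (F.markNode u) (F.markNode v) := by
    intro u v; obtain ⟨p⟩ := F.D.isTree.1.preconnected u v
    induction p with
    | nil => rfl
    | cons h _ ih => exact (hadj _ _ h).trans ih
  have hn := DelPezzoDegree.two_le_n hΔ; have : Nonempty F.Node := ⟨F.markNode ⟨0, by omega⟩⟩
  exact ⟨fun e e' => ((F.reachable_of_fl_eq (F.fl_eq_markNode e)).symm.trans (hmark _ _)).trans
    (F.reachable_of_fl_eq (F.fl_eq_markNode e'))⟩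

theorem card_diag : #{e : F.Node | e.1.1 = e.1.2} = Δ.n := by
  refine Eq.trans ?_ (card_fin Δ.n)
  refine card_bij (fun e _ => e.1.1) (fun _ _ => mem_univ _) ?_ ?_
  · intro e he e' he' h; simp only [mem_filter_univ] at he he'
    exact Subtype.ext (Prod.ext h (by rw [← he, ← he', h]))
  · exact fun v _ => ⟨F.markNode v, by simp [markNode], rfl⟩

theorem isTree (hΔ : Δ.Valid) : F.graph.IsTree := by
  rw [isTree_iff_connected_and_card]; refine ⟨F.connected hΔ, ?_⟩
  have h1 := F.graph.sum_degrees_eq_twice_card_edges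
  have h2 : ∀ e, F.graph.degree e = ∑ e', if F.graph.Adj e e' then 1 else 0 := by
    intro e; rw [← card_neighborFinset_eq_degree, card_eq_sum_ones, ← sum_filter]
    exact sum_congr (by ext; simp) fun _ _ => rfl
  have h3 := sum_congr (s₁ := univ) rfl fun e _ => F.valence hΔ e
  have h4 : ∑ e, (F.ends e).card = Δ.n + 1 := by
    have h5 : (∑ e, F.ends e).card = ∑ e, (F.ends e).card :=
      map_sum Multiset.cardHom _ _
    rw [← h5, F.sum_ends hΔ, DelPezzoDegree.card_ends hΔ, DelPezzoDegree.n_add_one hΔ]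
  have h6 := F.card_node; have h7 := F.card_diag; rw [card_filter] at h7
  rw [sum_add_distrib, sum_add_distrib, h4, h7, sum_const, card_univ, smul_eq_mul] at h3
  rw [sum_congr rfl fun e _ => h2 e] at h1
  rw [Nat.card_eq_fintype_card, Nat.card_eq_fintype_card, ← edgeFinset_card]; omega

end FloorPlan

/-! ### The tropical map of a floor diagram: positions -/

/-- Position parameters: the first coordinates `X` of the elevators, a point `(xr, yr)` on every
floor, the first coordinates `xm` of the marked points, and the second coordinates `η` of the marked
points on elevators. -/
structure FloorParams (n : ℕ) where
  X : Fin n → ℝ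
  xr : Fin n → ℝ
  yr : Fin n → ℝ
  xm : Fin n → ℝ
  η : Fin n → ℝ

/-- The slope of a floor as a function of the first coordinate. -/
def FloorDiagram.height {Δ : DelPezzoDegree} (D : FloorDiagram Δ) (Q : FloorParams Δ.n)
    (w : Fin Δ.n) (x : ℝ) : ℝ :=
  Q.yr w + (if w ∈ D.leakNeg then 1 else 0) * (x - Q.xr w) +
    ∑ b, (D.jump w b : ℝ) * (max (x - Q.X b) 0 - max (Q.xr w - Q.X b) 0)

namespace FloorPlan

variable {Δ : DelPezzoDegree} {K : Type} [LinearOrder K] (F : FloorPlan Δ K)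

def xnode (Q : FloorParams Δ.n) (e : F.Node) : ℝ := if e.1.1 = e.1.2 then Q.xm e.1.1 else Q.X e.1.2

def nodePos (Q : FloorParams Δ.n) (e : F.Node) : ℝ × ℝ :=
  (F.xnode Q e, if F.fl e.1 ∈ F.D.white then F.D.height Q (F.fl e.1) (F.xnode Q e) else Q.η e.1.1)

/-- The position parameters are compatible with the floor plan. -/
structure Admissible (Q : FloorParams Δ.n) : Prop where
  mono : ∀ e e' : F.Node, F.fl e.1 = F.fl e'.1 → F.key e.1 ≤ F.key e'.1 → F.xnode Q e ≤ F.xnode Q e'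
  hub : ∀ b, b ∉ F.D.white → F.host b = b → Q.xm b = Q.X b
  vert : ∀ e e' : F.Node, F.Vert e e' →
    0 ≤ -(F.D.jump e.1.1 e.1.2 : ℝ) * ((F.nodePos Q e').2 - (F.nodePos Q e).2)

def nodeLen (Q : FloorParams Δ.n) (e e' : F.Node) : ℝ :=
  if F.fl e.1 = F.fl e'.1 then |F.xnode Q e - F.xnode Q e'|
  else |(F.nodePos Q e).2 - (F.nodePos Q e').2| / |((F.dir e e').2 : ℝ)|

variable {F} {Q : FloorParams Δ.n}

theorem xnode_hub (h : F.Admissible Q) {b : Fin Δ.n} (hb : b ∉ F.D.white) :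
    F.xnode Q (F.hub b) = Q.X b := by
  unfold xnode hub; grind [h.hub b hb]

theorem height_next (h : F.Admissible Q) {e e' : F.Node} (hn : F.Next e e') :
    F.D.height Q (F.fl e.1) (F.xnode Q e') =
      F.D.height Q (F.fl e.1) (F.xnode Q e) + (F.xnode Q e' - F.xnode Q e) * F.slopeR e := by
  have hw := F.fl_white_of_next hn; have hx := h.mono e e' hn.1 hn.2.1.le
  unfold FloorDiagram.height slopeR leakL; have h1 : ∀ b, (F.D.jump (F.fl e.1) b : ℝ) *
      (max (F.xnode Q e' - Q.X b) 0 - max (Q.xr (F.fl e.1) - Q.X b) 0) =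
      F.D.jump (F.fl e.1) b * (max (F.xnode Q e - Q.X b) 0 - max (Q.xr (F.fl e.1) - Q.X b) 0) +
      (F.xnode Q e' - F.xnode Q e) *
        ((if F.key (F.fl e.1, b) ≤ F.key e.1 then F.D.jump (F.fl e.1) b else 0 : ℤ) : ℝ) := by
    intro b; by_cases hj : F.D.jump (F.fl e.1) b = 0
    · simp [hj]
    obtain ⟨e'', he, hfl⟩ := F.node_of_jump hw hj; have hadj := F.D.jump_ne_zero_iff.1 hj
    have hX : F.xnode Q e'' = Q.X b := by unfold xnode; rw [he]; simp [hadj.ne]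
    rw [← he]; split_ifs with hk
    · have h2 := h.mono e'' e hfl hk; rw [hX] at h2
      rw [max_eq_left (by linarith), max_eq_left (a := F.xnode Q e - Q.X b) (by linarith)]; ring
    · have h2 := h.mono e' e'' (hn.1.symm.trans hfl.symm) (hn.2.2 e'' hfl (not_le.1 hk))
      rw [hX] at h2
      rw [max_eq_right (by linarith), max_eq_right (a := F.xnode Q e - Q.X b) (by linarith)]; simp
  rw [sum_congr rfl fun b _ => h1 b, sum_add_distrib, ← mul_sum]; push_cast; ring

theorem nodeLen_symm {e e' : F.Node} (h : F.graph.Adj e e') :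
    F.nodeLen Q e e' = F.nodeLen Q e' e := by
  unfold nodeLen; rw [abs_sub_comm, abs_sub_comm (F.nodePos Q e).2, F.dir_symm h]
  simp only [Prod.snd_neg, Int.cast_neg, abs_neg, eq_comm]

theorem nodePos_affine (h : F.Admissible Q) {e e' : F.Node} (hadj : F.graph.Adj e e') :
    F.nodePos Q e' = F.nodePos Q e + F.nodeLen Q e e' • realDir (F.dir e e') := by
  have key : ∀ {e e' : F.Node}, F.Next e e' ∨ F.Vert e e' →
      F.nodePos Q e' = F.nodePos Q e + F.nodeLen Q e e' • realDir (F.dir e e') := by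
    intro e e' hee; rcases hee with hn | hv
    · have hw := F.fl_white_of_next hn; have hx := h.mono e e' hn.1 hn.2.1.le; rw [F.dir_next hn]
      unfold nodeLen nodePos realDir
      rw [if_pos hn.1, ← hn.1, if_pos hw, if_pos hw, height_next h hn, abs_sub_comm,
        abs_of_nonneg (by linarith)]
      ext <;> simp
    · have h1 := h.vert _ _ hv; have h2 := F.vert_fl_ne hv; have hadj := F.adj_of_vert hv
      have hj : (F.D.jump e.1.1 e.1.2 : ℝ) ≠ 0 := by exact_mod_cast F.D.jump_ne_zero_iff.2 hadj
      have hb : e.1.2 ∉ F.D.white := (F.D.color hadj).1 (e.2.resolve_left hv.1).1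
      have h3 : e' = F.hub e.1.2 := Subtype.ext (Prod.ext hv.2.1 hv.2.2.1); unfold nodeLen
      rw [if_neg h2, F.dir_vert hv]; ext
      · simp only [nodePos, realDir, Prod.fst_add, Prod.smul_mk, Int.cast_zero, smul_zero, add_zero]
        rw [h3, xnode_hub h hb, xnode, if_neg hv.1]
      · simp only [realDir, Prod.snd_add, Prod.smul_mk, Int.cast_neg, abs_neg, smul_eq_mul]
        have h4 : |(F.nodePos Q e).2 - (F.nodePos Q e').2| * |(F.D.jump e.1.1 e.1.2 : ℝ)| =
            -(F.D.jump e.1.1 e.1.2 : ℝ) * ((F.nodePos Q e').2 - (F.nodePos Q e).2) := by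
          rw [← abs_of_nonneg h1, abs_mul, abs_neg, abs_sub_comm, mul_comm]
        have h5 : |(F.D.jump e.1.1 e.1.2 : ℝ)| ^ 2 = (F.D.jump e.1.1 e.1.2 : ℝ) ^ 2 := sq_abs _
        rw [div_mul_eq_mul_div, ← sub_eq_iff_eq_add', eq_div_iff (abs_ne_zero.2 hj)]
        apply mul_right_cancel₀ (abs_ne_zero.2 hj)
        linear_combination (F.D.jump e.1.1 e.1.2 : ℝ) * h4 +
          ((F.nodePos Q e').2 - (F.nodePos Q e).2) * h5
  have key' : F.Next e' e ∨ F.Vert e' e →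
      F.nodePos Q e' = F.nodePos Q e + F.nodeLen Q e e' • realDir (F.dir e e') := fun h1 => by
    rw [nodeLen_symm hadj, F.dir_symm hadj, key h1, realDir, realDir]; ext <;> simp
  rcases hadj with h1 | h1 | h1 | h1
  exacts [key (.inl h1), key' (.inl h1), key (.inr h1), key' (.inr h1)]

theorem ncard_markNode (F : FloorPlan Δ K) {r s : ℕ} (S : Mark r s ≃ Fin Δ.n) (e : F.Node) :
    {a | F.markNode (S a) = e}.ncard = if e.1.1 = e.1.2 then 1 else 0 := by
  split_ifs with he
  · rw [Set.ncard_eq_one]; refine ⟨S.symm e.1.1, ?_⟩; ext a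
    simp only [Set.mem_ofPred_eq, Set.mem_singleton_iff, Equiv.eq_symm_apply]
    exact ⟨fun h => by rw [← h]; rfl, fun h => Subtype.ext (Prod.ext h (h.trans he))⟩
  · rw [Set.ncard_eq_zero]; ext a; simp only [Set.mem_ofPred_eq, Set.mem_empty_iff_false, iff_false]
    rintro rfl; exact he rfl

/-- The tropical map of a floor diagram. -/
def preMap (F : FloorPlan Δ K) (hΔ : Δ.Valid) {r s : ℕ} (Q : FloorParams Δ.n) (h : F.Admissible Q)
    (S : Mark r s ≃ Fin Δ.n) : PreMap r s F.Node where
  graph := F.graph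
  isTree := F.isTree hΔ
  len := F.nodeLen Q
  dir := F.dir
  pos := F.nodePos Q
  ends := F.ends
  mark := fun a => F.markNode (S a)
  len_symm := fun _ _ h => nodeLen_symm h
  len_nonneg := fun e e' _ => by unfold nodeLen; split_ifs <;> positivity
  dir_symm := fun _ _ h => F.dir_symm h
  dir_ne := fun _ _ h => F.dir_ne h
  affine := fun _ _ hadj => nodePos_affine h hadj
  ends_ne := F.ends_ne
  balanced := F.balanced hΔ
  stable := fun e => by
    have h1 := F.valence hΔ e; rw [F.ncard_markNode]; omega

end FloorPlan

/-! ### The canonical form of the tropical map of a floor diagram -/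

theorem Relation.ReflTransGen.exists_crossing {α : Type} {r : α → α → Prop} {p : α → Prop} {a b : α}
    (h : ReflTransGen r a b) (ha : p a) (hb : ¬ p b) :
    ∃ c d, r c d ∧ p c ∧ ¬ p d := by
  induction h with
  | refl => exact absurd ha hb
  | @tail c d _ hcd ih =>
    by_cases hc : p c; exacts [⟨c, d, hcd, hc, hb⟩, ih hc]

theorem induce_fiber_connected {V Q : Type} {T Z : SimpleGraph V} (hZ : ∀ u v, Z.Adj u v → T.Adj u v)
    {π : V → Q} (h : ∀ u v, π u = π v ↔ Z.Reachable u v) (c : Q) (hc : ∃ u, π u = c) :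
    (T.induce {u | π u = c}).Connected := by
  obtain ⟨u0, hu0⟩ := hc; have : Nonempty {u | π u = c} := ⟨⟨u0, hu0⟩⟩; refine ⟨?_⟩
  have key : ∀ (u v : V) (_ : Z.Walk u v) (hu : π u = c) (hv : π v = c),
      (T.induce {u | π u = c}).Reachable ⟨u, hu⟩ ⟨v, hv⟩ := by
    intro u v p
    induction p with
    | nil => intro _ _; rfl
    | @cons a b w hadj q ih =>
      intro hu hv; have hb : π b = c := ((h _ _).2 hadj.reachable).symm.trans hu
      have hab : (T.induce {u | π u = c}).Adj ⟨a, hu⟩ ⟨b, hb⟩ := hZ _ _ hadj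
      exact hab.reachable.trans (ih hb hv)
  rintro ⟨u, hu⟩ ⟨v, hv⟩; obtain ⟨p⟩ := (h u v).1 (hu.trans hv.symm); exact key u v p hu hv

/-- The position parameters of a floor diagram whose vertices are placed at the points `P`. -/
def FloorParams.ofPoints {n : ℕ} (P : Fin n → ℝ × ℝ) : FloorParams n where
  X := fun v => (P v).1
  xr := fun v => (P v).1
  yr := fun v => (P v).2
  xm := fun v => (P v).1
  η := fun v => (P v).2

theorem FloorDiagram.height_ofPoints {Δ : DelPezzoDegree} (D : FloorDiagram Δ) (P : Fin Δ.n → ℝ × ℝ)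
    (w : Fin Δ.n) : D.height (.ofPoints P) w (P w).1 = (P w).2 := by
  simp [FloorDiagram.height, FloorParams.ofPoints]

/-- The vertices of a floor diagram are placed at points of the plane, such that elevators have the
right direction. If an elevator `b` is marked at the same point as an adjacent floor, then `ov b`
may be this floor. -/
structure Layout {Δ : DelPezzoDegree} (D : FloorDiagram Δ) where
  P : Fin Δ.n → ℝ × ℝ
  ov : Fin Δ.n → Fin Δ.n
  ov_spec : ∀ v, ov v = v ∨ (v ∉ D.white ∧ ov v ∈ D.white ∧ D.graph.Adj (ov v) v ∧ P (ov v) = P v)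
  vert : ∀ w b, w ∈ D.white → D.graph.Adj w b → w ≠ ov b →
    0 < -(D.jump w b : ℝ) * ((P b).2 - D.height (.ofPoints P) w (P b).1)

namespace Layout

variable {Δ : DelPezzoDegree} {D : FloorDiagram Δ} (L : Layout D)

theorem ov_white {w : Fin Δ.n} (hw : w ∈ D.white) : L.ov w = w := by
  exact (L.ov_spec w).resolve_right fun h => h.1 hw

theorem ov_black {b : Fin Δ.n} (h : L.ov b ∉ D.white) : L.ov b = b := by
  exact (L.ov_spec b).resolve_right fun h' => h h'.2.1

def H (w : Fin Δ.n) (x : ℝ) : ℝ := D.height (.ofPoints L.P) w x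

theorem H_self (w : Fin Δ.n) : L.H w (L.P w).1 = (L.P w).2 := D.height_ofPoints L.P w

/-- The label of a node: its floor and its first coordinate. -/
def label (e : Fin Δ.n × Fin Δ.n) : Fin Δ.n × ℝ := (if e.1 = e.2 then L.ov e.1 else e.1, (L.P e.2).1)

def labels : Set (Fin Δ.n × ℝ) := {l | ∃ e, D.IsNode e ∧ L.label e = l}

def labelPos (l : Fin Δ.n × ℝ) : ℝ × ℝ := (l.2, if l.1 ∈ D.white then L.H l.1 l.2 else (L.P l.1).2)

def IsFirst (l : Fin Δ.n × ℝ) : Prop := ∀ l' ∈ L.labels, l'.1 = l.1 → l.2 ≤ l'.2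

def IsLast (l : Fin Δ.n × ℝ) : Prop := ∀ l' ∈ L.labels, l'.1 = l.1 → l'.2 ≤ l.2

/-- Neighbours on a floor. -/
def FloorEdge (l l' : Fin Δ.n × ℝ) : Prop :=
  l.1 = l'.1 ∧ l.1 ∈ D.white ∧ l ∈ L.labels ∧ l' ∈ L.labels ∧ l.2 < l'.2 ∧
    ∀ l'' ∈ L.labels, l''.1 = l.1 → l.2 < l''.2 → l'.2 ≤ l''.2

/-- The edge of the elevator `b` which ends on the floor `w`. -/
def VertEdge (w b : Fin Δ.n) (l l' : Fin Δ.n × ℝ) : Prop :=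
  w ∈ D.white ∧ D.graph.Adj w b ∧ w ≠ L.ov b ∧ l = (w, (L.P b).1) ∧ l' = L.label (b, b)

def LabelAdj (l l' : Fin Δ.n × ℝ) : Prop :=
  L.FloorEdge l l' ∨ L.FloorEdge l' l ∨ (∃ w b, L.VertEdge w b l l') ∨ ∃ w b, L.VertEdge w b l' l

def slope (l : Fin Δ.n × ℝ) : ℤ :=
  (if l.1 ∈ D.leakNeg then 1 else 0) + ∑ b, if (L.P b).1 ≤ l.2 then D.jump l.1 b else 0

def labelEnds (l : Fin Δ.n × ℝ) : Multiset (ℤ × ℤ) :=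
  (if l.1 ∈ D.white ∧ L.IsFirst l then {(-1, -(if l.1 ∈ D.leakNeg then 1 else 0))} else 0) +
  (if l.1 ∈ D.white ∧ L.IsLast l then {(1, if l.1 ∈ D.leakPos then 1 else 0)} else 0) +
  ∑ b, if b ∉ D.white ∧ L.label (b, b) = l then
    .replicate (D.inEnds b) (0, -1) + .replicate (D.outEnds b) (0, 1) else 0

/-- The tropical map `Γ` is the tropical map of the floor diagram `D`, where the vertex `c` has the
label `e c`. -/
structure Realizes {r s : ℕ} (S : Mark r s ≃ Fin Δ.n) (Γ : TropicalMap r s)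
    (e : Fin Γ.nv → Fin Δ.n × ℝ) : Prop where
  inj : Injective e
  range : ∀ l, (∃ c, e c = l) ↔ l ∈ L.labels
  adj : ∀ c c', Γ.graph.Adj c c' ↔ L.LabelAdj (e c) (e c')
  dir_floor : ∀ c c', L.FloorEdge (e c) (e c') → Γ.dir c c' = (1, L.slope (e c))
  dir_vert : ∀ c c' w b, L.VertEdge w b (e c) (e c') → Γ.dir c c' = (0, -D.jump w b)
  pos : ∀ c, Γ.pos c = L.labelPos (e c)
  ends : ∀ c, Γ.ends c = L.labelEnds (e c)
  mark : ∀ a, e (Γ.mark a) = L.label (S a, S a)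

theorem label_diag (v : Fin Δ.n) : L.label (v, v) = (L.ov v, (L.P v).1) := by simp [label]

theorem label_att {w b : Fin Δ.n} (h : w ≠ b) : L.label (w, b) = (w, (L.P b).1) := by simp [label, h]

theorem labelPos_diag (v : Fin Δ.n) : L.labelPos (L.label (v, v)) = L.P v := by
  rw [label_diag, labelPos]; rcases L.ov_spec v with h | h
  · rw [h]; split_ifs <;> [rw [L.H_self]; rfl]
  · have := L.H_self (L.ov v); rw [h.2.2.2] at this; rw [if_pos h.2.1, this]

theorem vertEdge_ne {w b : Fin Δ.n} {l l' : Fin Δ.n × ℝ} (h : L.VertEdge w b l l') : l ≠ l' := by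
  obtain ⟨_, _, h, rfl, rfl⟩ := h; rw [label_diag]; exact fun h' => h (congrArg Prod.fst h')

theorem labelAdj_symm {l l' : Fin Δ.n × ℝ} (h : L.LabelAdj l l') : L.LabelAdj l' l := by
  unfold LabelAdj at *
  rcases h with h | h | h | h <;> simp only [h, true_or, or_true]

theorem labelAdj_ne {l l' : Fin Δ.n × ℝ} (h : L.LabelAdj l l') : l ≠ l' := by
  rcases h with h | h | ⟨w, b, h⟩ | ⟨w, b, h⟩
  exacts [fun he => h.2.2.2.2.1.ne (by rw [he]), fun he => h.2.2.2.2.1.ne (by rw [he]),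
    L.vertEdge_ne h, (L.vertEdge_ne h).symm]

end Layout

/-- A floor plan is compatible with a placement of its vertices. -/
structure FloorPlan.Compatible {Δ : DelPezzoDegree} {K : Type} [LinearOrder K] (F : FloorPlan Δ K)
    (L : Layout F.D) : Prop where
  host : ∀ b, F.host b = b ∨ F.host b = L.ov b
  mono : ∀ e e' : F.Node, F.fl e.1 = F.fl e'.1 → F.key e.1 ≤ F.key e'.1 →
    (L.P e.1.2).1 ≤ (L.P e'.1.2).1

namespace FloorPlan

variable {Δ : DelPezzoDegree} {K : Type} [LinearOrder K] {F : FloorPlan Δ K} {L : Layout F.D}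

theorem xnode_ofPoints (e : F.Node) : F.xnode (.ofPoints L.P) e = (L.P e.1.2).1 := by
  unfold xnode FloorParams.ofPoints; grind

theorem exists_node_of_label {l : Fin Δ.n × ℝ} (hl : l ∈ L.labels)
    (hw : l.1 ∈ F.D.white) : ∃ e : F.Node, L.label e.1 = l ∧ F.fl e.1 = l.1 := by
  obtain ⟨a, ha, rfl⟩ := hl; by_cases ha' : a.1 = a.2
  · rcases L.ov_spec a.1 with h5 | h5
    · have h6 : a.1 ∈ F.D.white := by simpa only [Layout.label, if_pos ha', h5] using hw
      exact ⟨⟨a, ha⟩, rfl, by simp only [fl, Layout.label, if_pos ha', h5, F.host_white h6]⟩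
    · exact ⟨F.attNode h5.2.1 h5.2.2.1, (L.label_att h5.2.2.1.ne).trans (by simp [Layout.label, ha']),
        (F.fl_att h5.2.2.1.ne).trans (by simp [Layout.label, ha'])⟩
  · exact ⟨⟨a, ha⟩, rfl, by simp [fl, Layout.label, ha']⟩

variable (hc : F.Compatible L)
include hc

theorem label_fst_of_white {e : F.Node} (h : F.fl e.1 ∈ F.D.white) :
    (L.label e.1).1 = F.fl e.1 := by
  unfold Layout.label fl at *
  split_ifs with he
  · rw [if_pos he] at h; have := hc.host e.1.1; grind [L.ov_white]
  · rfl

theorem label_hub (b : Fin Δ.n) : L.label (F.hub b).1 = L.label (b, b) := by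
  rw [L.label_diag]; have := hc.host b; unfold Layout.label hub; grind

theorem nodePos_eq (e : F.Node) : F.nodePos (.ofPoints L.P) e = L.labelPos (L.label e.1) := by
  unfold nodePos; rw [xnode_ofPoints]; by_cases hw : F.fl e.1 ∈ F.D.white
  · rw [if_pos hw, Layout.labelPos, label_fst_of_white hc hw, if_pos hw]; rfl
  · obtain ⟨h1, h2, h3⟩ := F.black_of_hub hw
    have h4 : L.label e.1 = L.label (e.1.2, e.1.2) := congrArg L.label (Prod.ext h1 rfl)
    rw [if_neg hw, h1]; exact (h4 ▸ L.labelPos_diag e.1.2).symm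

theorem vert_pos {e e' : F.Node} (h : F.Vert e e') :
    (e.1.1 ≠ L.ov e.1.2 → 0 < -(F.D.jump e.1.1 e.1.2 : ℝ) *
      ((F.nodePos (.ofPoints L.P) e').2 - (F.nodePos (.ofPoints L.P) e).2)) ∧
    (e.1.1 = L.ov e.1.2 → (F.nodePos (.ofPoints L.P) e').2 = (F.nodePos (.ofPoints L.P) e).2) := by
  have h1 := F.adj_of_vert h; have hw : e.1.1 ∈ F.D.white := (e.2.resolve_left h.1).1
  have h3 : e' = F.hub e.1.2 := Subtype.ext (Prod.ext h.2.1 h.2.2.1)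
  have h4 : L.label e.1 = (e.1.1, (L.P e.1.2).1) := L.label_att h.1
  rw [nodePos_eq hc, nodePos_eq hc, h3, label_hub hc, L.labelPos_diag, h4]
  refine ⟨fun hne => ?_, fun he => by rw [he, ← L.label_diag, L.labelPos_diag]⟩
  rw [Layout.labelPos, if_pos hw]; exact L.vert _ _ hw h1 hne

theorem Compatible.admissible : F.Admissible (.ofPoints L.P) where
  mono e e' h hk := by rw [xnode_ofPoints, xnode_ofPoints]; exact hc.mono e e' h hk
  hub _ _ _ := rfl
  vert e e' h := by
    by_cases h1 : e.1.1 = L.ov e.1.2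
    · rw [(vert_pos hc h).2 h1]; simp
    · exact ((vert_pos hc h).1 h1).le

theorem next_label {e e' : F.Node} (h : F.Next e e') :
    L.label e.1 = L.label e'.1 ∨ (L.FloorEdge (L.label e.1) (L.label e'.1) ∧
      F.dir e e' = (1, L.slope (L.label e.1))) := by
  have hw := F.fl_white_of_next h; have h1 := label_fst_of_white hc hw
  have h2 := label_fst_of_white hc (h.1 ▸ hw)
  have hx : (L.P e.1.2).1 ≤ (L.P e'.1.2).1 := hc.mono e e' h.1 h.2.1.le
  rcases hx.eq_or_lt with hx | hx
  · exact .inl (Prod.ext (h1.trans (h.1.trans h2.symm)) hx)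
  right; have hstep : ∀ e'' : F.Node, F.fl e''.1 = F.fl e.1 → (L.P e''.1.2).1 ≤ (L.P e.1.2).1 ∨
      (L.P e'.1.2).1 ≤ (L.P e''.1.2).1 := by
    intro e'' h3; rcases le_or_gt (F.key e''.1) (F.key e.1) with h4 | h4
    exacts [.inl (hc.mono _ _ h3 h4), .inr (hc.mono _ _ (h.1.symm.trans h3.symm) (h.2.2 _ h3 h4))]
  refine ⟨⟨h1.trans (h.1.trans h2.symm), h1 ▸ hw, ⟨_, e.2, rfl⟩, ⟨_, e'.2, rfl⟩, hx, ?_⟩, ?_⟩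
  · intro l'' hl h4 h5; obtain ⟨e'', rfl, h6⟩ := exists_node_of_label hl (by rw [h4, h1]; exact hw)
    exact (hstep e'' (h6.trans (h4.trans h1))).resolve_left h5.not_ge
  · rw [F.dir_next h]; unfold slopeR leakL Layout.slope; rw [h1]; congr 2
    refine sum_congr rfl fun b _ => ?_; by_cases hj : F.D.jump (F.fl e.1) b = 0
    · simp [hj]
    obtain ⟨e'', he, hfl⟩ := F.node_of_jump hw hj
    have h6 : (L.P b).1 = (L.P e''.1.2).1 := by rw [he]
    have h7 : (L.label e.1).2 = (L.P e.1.2).1 := rfl; rw [← he, h6, h7]; congr 1; rw [eq_iff_iff]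
    refine ⟨fun h8 => hc.mono _ _ hfl h8, fun h8 => not_lt.1 fun h9 => ?_⟩
    have h10 := hc.mono _ _ (h.1.symm.trans hfl.symm) (h.2.2 _ hfl h9); linarith

theorem vert_label {e e' : F.Node} (h : F.Vert e e') :
    L.label e.1 = L.label e'.1 ∨ (L.VertEdge e.1.1 e.1.2 (L.label e.1) (L.label e'.1) ∧
      F.dir e e' = (0, -F.D.jump e.1.1 e.1.2)) := by
  have h1 := F.adj_of_vert h; have hw : e.1.1 ∈ F.D.white := (e.2.resolve_left h.1).1
  have h3 : e' = F.hub e.1.2 := Subtype.ext (Prod.ext h.2.1 h.2.2.1)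
  have h4 : L.label e.1 = (e.1.1, (L.P e.1.2).1) := L.label_att h.1; rw [h3, label_hub hc, ← h3, h4]
  by_cases h5 : e.1.1 = L.ov e.1.2
  · left; rw [L.label_diag, h5]
  · right; exact ⟨⟨hw, h1, h5, rfl, rfl⟩, F.dir_vert h⟩

theorem exists_next_of_floorEdge {l l' : Fin Δ.n × ℝ} (h : L.FloorEdge l l') :
    ∃ e e' : F.Node, F.Next e e' ∧ L.label e.1 = l ∧ L.label e'.1 = l' := by
  obtain ⟨h1, hw, hl, hl', hlt, hmin⟩ := h; obtain ⟨e, he, hfe⟩ := exists_node_of_label hl hw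
  obtain ⟨e', he', hfe'⟩ := exists_node_of_label hl' (h1 ▸ hw)
  have hfl : F.fl e.1 = F.fl e'.1 := by rw [hfe, hfe', h1]
  have hx : (L.P e.1.2).1 = l.2 := congrArg Prod.snd he
  have hx' : (L.P e'.1.2).1 = l'.2 := congrArg Prod.snd he'; have hk : F.key e.1 ≤ F.key e'.1 := by
    refine not_lt.1 fun hk => ?_; have := hc.mono e' e hfl.symm hk.le; linarith
  obtain ⟨a, b, ⟨hab, hka, hkb⟩, ⟨hfa, hpa⟩, hpb⟩ := (F.chain hfl hk).exists_crossing
    (p := fun a => F.fl a.1 = F.fl e.1 ∧ (L.P a.1.2).1 ≤ l.2) ⟨rfl, hx.le⟩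
    (by rw [hx']; exact fun h => hlt.not_ge h.2)
  have hfb : F.fl b.1 = F.fl e.1 := hab.1.symm.trans hfa; have h3 := hc.mono _ _ hfa.symm hka
  have h4 := hc.mono _ _ (hfb.trans hfl) hkb
  have hla : (L.label a.1).1 = l.1 := (label_fst_of_white hc (by rw [hfa, hfe]; exact hw)).trans
    (hfa.trans hfe)
  have hlb : (L.label b.1).1 = l.1 := (label_fst_of_white hc (by rw [hfb, hfe]; exact hw)).trans
    (hfb.trans hfe)
  refine ⟨a, b, hab, Prod.ext hla ?_, Prod.ext (hlb.trans h1) ?_⟩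
  · exact le_antisymm hpa (hx ▸ h3)
  · exact le_antisymm (hx' ▸ h4) (hmin _ ⟨_, b.2, rfl⟩ hlb (not_le.1 fun h => hpb ⟨hfb, h⟩))

theorem exists_vert_of_vertEdge {w b : Fin Δ.n} {l l' : Fin Δ.n × ℝ} (h : L.VertEdge w b l l') :
    ∃ e e' : F.Node, F.Vert e e' ∧ e.1 = (w, b) ∧ L.label e.1 = l ∧ L.label e'.1 = l' := by
  have hne := L.vertEdge_ne h; obtain ⟨hw, hadj, hov, rfl, rfl⟩ := h
  refine ⟨F.attNode hw hadj, F.hub b, ⟨hadj.ne, rfl, rfl, fun he => hov ?_⟩, rfl,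
    L.label_att hadj.ne, label_hub hc b⟩
  have h1 : w = F.host b := congrArg (fun x : F.Node => x.1.1) he; rcases hc.host b with h2 | h2
  · exact absurd (h1.trans h2) hadj.ne
  · rw [h1, h2]

theorem adj_label {e e' : F.Node} (h : F.graph.Adj e e') :
    L.label e.1 = L.label e'.1 ∨ L.LabelAdj (L.label e.1) (L.label e'.1) := by
  rcases h with h | h | h | h
  · exact (next_label hc h).imp id fun h => .inl h.1
  · exact (next_label hc h).imp Eq.symm fun h => .inr (.inl h.1)
  · exact (vert_label hc h).imp id fun h => .inr (.inr (.inl ⟨_, _, h.1⟩))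
  · exact (vert_label hc h).imp Eq.symm fun h => .inr (.inr (.inr ⟨_, _, h.1⟩))

theorem exists_adj_of_labelAdj {l l' : Fin Δ.n × ℝ} (h : L.LabelAdj l l') :
    ∃ e e' : F.Node, F.graph.Adj e e' ∧ L.label e.1 = l ∧ L.label e'.1 = l' := by
  rcases h with h | h | ⟨w, b, h⟩ | ⟨w, b, h⟩
  · obtain ⟨e, e', h1, h2, h3⟩ := exists_next_of_floorEdge hc h; exact ⟨e, e', .inl h1, h2, h3⟩
  · obtain ⟨e, e', h1, h2, h3⟩ := exists_next_of_floorEdge hc h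
    exact ⟨e', e, .inr (.inl h1), h3, h2⟩
  · obtain ⟨e, e', h1, -, h2, h3⟩ := exists_vert_of_vertEdge hc h
    exact ⟨e, e', .inr (.inr (.inl h1)), h2, h3⟩
  · obtain ⟨e, e', h1, -, h2, h3⟩ := exists_vert_of_vertEdge hc h
    exact ⟨e', e, .inr (.inr (.inr h1)), h3, h2⟩

theorem label_eq_iff (hΔ : Δ.Valid) {r s : ℕ} (S : Mark r s ≃ Fin Δ.n)
    (e e' : F.Node) : L.label e.1 = L.label e'.1 ↔
      (F.preMap hΔ _ hc.admissible S).zeroGraph.Reachable e e' := by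
  constructor
  · have hfloor : ∀ a b : F.Node, F.fl a.1 = F.fl b.1 → (L.P a.1.2).1 = (L.P b.1.2).1 →
        (F.preMap hΔ _ hc.admissible S).zeroGraph.Reachable a b := by
      have key : ∀ a b : F.Node, F.fl a.1 = F.fl b.1 → F.key a.1 ≤ F.key b.1 →
          (L.P a.1.2).1 = (L.P b.1.2).1 →
          (F.preMap hΔ _ hc.admissible S).zeroGraph.Reachable a b := by
        intro a b hab hk hx; have h1 := F.chain hab hk
        have h2 : ∀ c, ReflTransGen (fun x y => F.Next x y ∧ F.key a.1 ≤ F.key x.1 ∧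
            F.key y.1 ≤ F.key b.1) a c → F.fl c.1 = F.fl a.1 ∧
            (F.preMap hΔ _ hc.admissible S).zeroGraph.Reachable a c := by
          intro c h
          induction h with
          | refl => exact ⟨rfl, .refl _⟩
          | @tail c d _ h' ih =>
            have hfd : F.fl d.1 = F.fl a.1 := h'.1.1.symm.trans ih.1
            refine ⟨hfd, ih.2.trans (Adj.reachable ⟨.inl h'.1, ?_⟩)⟩
            have h3 := hc.mono _ _ ih.1.symm h'.2.1; have h4 := hc.mono _ _ (hfd.trans hab) h'.2.2
            have h5 := hc.mono _ _ h'.1.1 h'.1.2.1.le; show F.nodeLen _ c d = 0; unfold nodeLen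
            rw [if_pos h'.1.1, xnode_ofPoints, xnode_ofPoints, abs_eq_zero, sub_eq_zero]; linarith
        exact (h2 b h1).2
      intro a b hab hx; rcases le_total (F.key a.1) (F.key b.1) with hk | hk
      exacts [key a b hab hk hx, (key b a hab.symm hk hx.symm).symm]
    have hwhite : ∀ a : F.Node, (L.label a.1).1 ∈ F.D.white → ∃ b : F.Node,
        F.fl b.1 = (L.label a.1).1 ∧ L.label b.1 = L.label a.1 ∧
        (F.preMap hΔ _ hc.admissible S).zeroGraph.Reachable a b := by
      intro a hw; by_cases ha : F.fl a.1 ∈ F.D.white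
      · exact ⟨a, (label_fst_of_white hc ha).symm, rfl, .refl _⟩
      · obtain ⟨h1, h2, h3⟩ := F.black_of_hub ha
        have h4 : L.label a.1 = (L.ov a.1.2, (L.P a.1.2).1) := by simp [Layout.label, h1]
        rw [h4] at hw ⊢; rcases L.ov_spec a.1.2 with h5 | h5
        · simp only [h5] at hw; exact absurd hw h3
        · refine ⟨F.attNode h5.2.1 h5.2.2.1, F.fl_att h5.2.2.1.ne, L.label_att h5.2.2.1.ne, ?_⟩
          have hv : F.Vert (F.attNode h5.2.1 h5.2.2.1) a :=
            ⟨h5.2.2.1.ne, h2, rfl, fun he => by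
              have : L.ov a.1.2 = a.1.1 := congrArg (fun x : F.Node => x.1.1) he
              exact h5.2.2.1.ne (this.trans h1)⟩
          refine Adj.reachable ⟨.inr (.inr (.inr hv)), ?_⟩; have h6 := (vert_pos hc hv).2 rfl
          show F.nodeLen _ a _ = 0; unfold nodeLen; rw [if_neg (F.vert_fl_ne hv).symm, h6]; simp
    intro h; by_cases hw : (L.label e.1).1 ∈ F.D.white
    · obtain ⟨b, hb1, hb2, hb3⟩ := hwhite e hw; obtain ⟨b', hb1', hb2', hb3'⟩ := hwhite e' (h ▸ hw)
      refine (hb3.trans (hfloor b b' ?_ ?_)).trans hb3'.symm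
      · rw [hb1, hb1', h]
      · exact congrArg Prod.snd (hb2.trans (h.trans hb2'.symm))
    · have h1 : ∀ a : F.Node, (L.label a.1).1 ∉ F.D.white → a = F.markNode (L.label a.1).1 := by
        intro a ha; by_cases h2 : a.1.1 = a.1.2
        · simp only [Layout.label, if_pos h2] at ha ⊢; rw [L.ov_black ha]
          exact Subtype.ext (Prod.ext rfl h2.symm)
        · simp only [Layout.label, if_neg h2] at ha; exact absurd (a.2.resolve_left h2).1 ha
      rw [h1 e hw, h1 e' (h ▸ hw), h]
  · rintro ⟨p⟩
    induction p with
    | nil => rfl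
    | @cons a b c hab _ ih =>
      rw [← ih]; rcases adj_label hc hab.1 with h | h
      · exact h
      exfalso; have h0 : F.nodeLen (.ofPoints L.P) a b = 0 := hab.2
      have key : ∀ a b : F.Node, L.LabelAdj (L.label a.1) (L.label b.1) →
          F.nodeLen (.ofPoints L.P) a b = 0 → ¬ (F.Next a b ∨ F.Vert a b) := by
        rintro a b hl h0 (h | h)
        · have h1 : (L.label a.1).1 = (L.label b.1).1 := by
            rw [label_fst_of_white hc (F.fl_white_of_next h),
              label_fst_of_white hc (h.1 ▸ F.fl_white_of_next h), h.1]
          unfold nodeLen at h0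
          rw [if_pos h.1, xnode_ofPoints, xnode_ofPoints, abs_eq_zero, sub_eq_zero] at h0
          exact L.labelAdj_ne hl (Prod.ext h1 h0)
        · rcases vert_label hc h with h1 | h1
          · exact L.labelAdj_ne hl h1
          · have h2 := (vert_pos hc h).1 h1.1.2.2.1; unfold nodeLen at h0
            rw [if_neg (F.vert_fl_ne h), F.dir_vert h, div_eq_zero_iff] at h0
            rcases h0 with h0 | h0
            · rw [abs_eq_zero, sub_eq_zero] at h0; simp [h0] at h2
            · simp_all
      have h0' := (nodeLen_symm hab.1).symm.trans h0; have h' := L.labelAdj_symm h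
      rcases hab.1 with h1 | h1 | h1 | h1
      exacts [key a b h h0 (.inl h1), key b a h' h0' (.inl h1), key a b h h0 (.inr h1),
        key b a h' h0' (.inr h1)]

end FloorPlan

namespace FloorPlan

variable {Δ : DelPezzoDegree} {K : Type} [LinearOrder K] {F : FloorPlan Δ K} {L : Layout F.D}

theorem sum_floor_label (hc : F.Compatible L) {p : F.Node → Prop} {q : Fin Δ.n × ℝ → Prop}
    (hp : ∀ e e', p e → p e' → F.fl e.1 = F.fl e'.1 → F.key e.1 ≤ F.key e'.1)
    (hex : ∀ w ∈ F.D.white, ∃ e : F.Node, F.fl e.1 = w ∧ p e)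
    (hpq : ∀ e : F.Node, F.fl e.1 ∈ F.D.white → p e → q (L.label e.1))
    (hq : ∀ l ∈ L.labels, ∀ l' ∈ L.labels, l.1 = l'.1 → q l → q l' → l.2 ≤ l'.2)
    {M : Type} [AddCommMonoid M] (g : Fin Δ.n → M) {l : Fin Δ.n × ℝ} (hl : l ∈ L.labels) :
    (∑ e ∈ univ.filter (fun e : F.Node => L.label e.1 = l),
      if F.fl e.1 ∈ F.D.white ∧ p e then g (F.fl e.1) else 0) =
      if l.1 ∈ F.D.white ∧ q l then g l.1 else 0 := by
  split_ifs with h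
  · obtain ⟨e0, h0, h1⟩ := hex l.1 h.1; have hw : F.fl e0.1 ∈ F.D.white := h0 ▸ h.1
    have h2 : (L.label e0.1).1 = l.1 := (label_fst_of_white hc hw).trans h0; have h3 := hpq e0 hw h1
    have h4 : L.label e0.1 = l := Prod.ext h2 ((hq _ ⟨_, e0.2, rfl⟩ _ hl h2 h3 h.2).antisymm
      (hq _ hl _ ⟨_, e0.2, rfl⟩ h2.symm h.2 h3))
    rw [sum_eq_single e0, if_pos ⟨hw, h1⟩, h0]
    · refine fun e he hne => if_neg fun h5 => hne ?_
      have h6 : F.fl e.1 = F.fl e0.1 := by rw [← label_fst_of_white hc h5.1, (mem_filter.1 he).2, h0]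
      exact F.ext_key ((hp _ _ h5.2 h1 h6).antisymm (hp _ _ h1 h5.2 h6.symm))
    · exact fun h5 => absurd (by simp [h4]) h5
  · refine sum_eq_zero fun e he => if_neg fun h3 => h ?_
    rw [← (mem_filter.1 he).2, label_fst_of_white hc h3.1]; exact ⟨h3.1, hpq e h3.1 h3.2⟩

theorem isFirst_label (hc : F.Compatible L) (e : F.Node) (hw : F.fl e.1 ∈ F.D.white)
    (h : F.First e) : L.IsFirst (L.label e.1) := by
  intro l' hl' h5; rw [label_fst_of_white hc hw] at h5
  obtain ⟨e1, rfl, h7⟩ := exists_node_of_label (F := F) hl' (h5 ▸ hw); have h8 := h7.trans h5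
  exact hc.mono _ _ h8.symm (h _ h8)

theorem isLast_label (hc : F.Compatible L) (e : F.Node) (hw : F.fl e.1 ∈ F.D.white)
    (h : F.Last e) : L.IsLast (L.label e.1) := by
  intro l' hl' h5; rw [label_fst_of_white hc hw] at h5
  obtain ⟨e1, rfl, h7⟩ := exists_node_of_label (F := F) hl' (h5 ▸ hw); have h8 := h7.trans h5
  exact hc.mono _ _ h8 (h _ h8)

theorem sum_ends_label (hc : F.Compatible L) {l : Fin Δ.n × ℝ} (hl : l ∈ L.labels) :
    ∑ e ∈ univ.filter (fun e : F.Node => L.label e.1 = l), F.ends e = L.labelEnds l := by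
  unfold ends Layout.labelEnds; rw [sum_add_distrib, sum_add_distrib,
    sum_floor_label hc (fun _ e' h _ he => h e' he.symm) F.exists_first (isFirst_label hc)
      (fun _ _ l' hl' he h _ => h l' hl' he.symm)
      (fun w => ({(-1, -F.leakL w)} : Multiset (ℤ × ℤ))) hl,
    sum_floor_label hc (fun e _ _ h he => h e he) F.exists_last (isLast_label hc)
      (fun l hl _ _ he _ h => h l hl he) (fun w => ({(1, F.leakR w)} : Multiset (ℤ × ℤ))) hl]
  congr 1; have h1 := F.sum_hub (fun b => if L.label (b, b) = l then
    Multiset.replicate (F.D.inEnds b) ((0, -1) : ℤ × ℤ) + .replicate (F.D.outEnds b) (0, 1) else 0)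
  rw [sum_filter] at h1 ⊢
  refine Eq.trans (sum_congr rfl fun e _ => ?_) (h1.trans (sum_congr rfl fun b _ => ?_))
  · by_cases h2 : e.1.1 = F.host e.1.2 ∧ e.1.2 ∉ F.D.white
    · have h3 : L.label (e.1.2, e.1.2) = L.label e.1 := by
        rw [← label_hub hc]; exact congrArg L.label (Prod.ext h2.1.symm rfl)
      rw [if_pos h2, if_pos h2, h3]
    · rw [if_neg h2, if_neg h2]; simp
  · by_cases h2 : b ∉ F.D.white <;> simp [h2]

theorem _root_.Contracts.realizes {hΔ : Δ.Valid} {r s : ℕ} {S : Mark r s ≃ Fin Δ.n}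
    {hc : F.Compatible L} {Γ : TropicalMap r s} {π : F.Node → Fin Γ.nv}
    (h : Contracts (F.preMap hΔ _ hc.admissible S) Γ π) :
    ∃ e, L.Realizes S Γ e ∧ ∀ u : F.Node, e (π u) = L.label u.1 := by
  have hs := h.graph.surjective
  have heq : ∀ u v, π u = π v ↔ L.label u.1 = L.label v.1 := fun u v =>
    (h.eq_iff u v).trans (label_eq_iff hc hΔ S u v).symm
  let e : Fin Γ.nv → Fin Δ.n × ℝ := fun c => L.label (surjInv hs c).1
  have he : ∀ u : F.Node, e (π u) = L.label u.1 := fun u => (heq _ _).1 (surjInv_eq hs _)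
  have hinj : Injective e := by
    refine hs.forall₂.2 fun u v hcc => (heq u v).2 ?_; rwa [he, he] at hcc
  have hπ : ∀ u c, L.label u.1 = e c → π u = c := fun u c huc => hinj ((he u).trans huc)
  refine ⟨e, ⟨hinj, ?_, ?_, ?_, ?_, ?_, ?_, ?_⟩, he⟩
  · rintro l
    exact ⟨fun ⟨c, hc⟩ => ⟨_, (surjInv hs c).2, hc⟩, fun ⟨a, ha, h⟩ => ⟨π ⟨a, ha⟩, (he _).trans h⟩⟩
  · refine fun c c' => ⟨fun hcc => ?_, fun hcc => ?_⟩
    · obtain ⟨u, v, rfl, rfl, huv⟩ := h.graph.lift _ _ hcc; rw [he, he]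
      exact (adj_label hc huv).resolve_left fun h1 => hcc.ne ((heq _ _).2 h1)
    · obtain ⟨u, v, huv, hu, hv⟩ := exists_adj_of_labelAdj hc hcc; obtain rfl := hπ _ _ hu
      obtain rfl := hπ _ _ hv; exact h.graph.adj u v huv fun h3 => L.labelAdj_ne hcc (by rw [h3])
  · intro c c' hcc; obtain ⟨u, v, huv, hu, hv⟩ := exists_next_of_floorEdge hc hcc
    have hne := L.labelAdj_ne (.inl hcc); obtain rfl := hπ _ _ hu; obtain rfl := hπ _ _ hv
    rw [h.dir u v (.inl huv) (fun h3 => hne (by rw [h3])), ← hu]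
    exact ((next_label hc huv).resolve_left (by rw [hu, hv]; exact hne)).2
  · intro c c' w b hcc; obtain ⟨u, v, huv, hub, hu, hv⟩ := exists_vert_of_vertEdge hc hcc
    have hne := L.vertEdge_ne hcc; obtain rfl := hπ _ _ hu; obtain rfl := hπ _ _ hv
    rw [h.dir u v (.inr (.inr (.inl huv))) (fun h3 => hne (by rw [h3]))]
    exact (F.dir_vert huv).trans (by rw [hub])
  · intro c; obtain ⟨u, rfl⟩ := hs c; rw [he, h.pos]; exact nodePos_eq hc u
  · intro c; rw [h.ends, ← sum_ends_label hc ((surjInv hs c).2 |> fun h => ⟨_, h, rfl⟩)]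
    refine sum_congr (filter_congr fun u _ => ?_) fun _ _ => rfl
    exact ⟨fun h => h ▸ (he u).symm, hπ u c⟩
  · exact fun a => h.mark a ▸ he _

theorem _root_.Layout.Realizes.contracts (hΔ : Δ.Valid) {r s : ℕ} {S : Mark r s ≃ Fin Δ.n}
    (hc : F.Compatible L) {Γ : TropicalMap r s} {e : Fin Γ.nv → Fin Δ.n × ℝ}
    (h : L.Realizes S Γ e) :
    ∃ π, Contracts (F.preMap hΔ _ hc.admissible S) Γ π ∧ ∀ u : F.Node, e (π u) = L.label u.1 := by
  have hex : ∀ u : F.Node, ∃ c, e c = L.label u.1 := fun u => (h.range _).2 ⟨_, u.2, rfl⟩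
  choose π hπ using hex; have heq : ∀ u v, π u = π v ↔ L.label u.1 = L.label v.1 := fun u v => by
    rw [← hπ, ← hπ, h.inj.eq_iff]
  have hz : ∀ u v, π u = π v ↔ (F.preMap hΔ _ hc.admissible S).zeroGraph.Reachable u v :=
    fun u v => (heq u v).trans (label_eq_iff hc hΔ S u v)
  have hsurj : ∀ c, ∃ u, π u = c := fun c => by
    obtain ⟨a, ha, hac⟩ := (h.range (e c)).1 ⟨c, rfl⟩; exact ⟨⟨a, ha⟩, h.inj ((hπ _).trans hac)⟩
  have hlen0 : ∀ u v, F.graph.Adj u v → π u = π v → F.nodeLen (.ofPoints L.P) u v = 0 := by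
    intro u v huv huv'; have h1 := nodePos_affine hc.admissible huv
    rw [nodePos_eq hc, nodePos_eq hc, (heq u v).1 huv', left_eq_add, smul_eq_zero] at h1
    exact h1.resolve_right fun h2 => F.dir_ne huv (realDir_eq_zero h2)
  have hadj : ∀ u v, F.graph.Adj u v → π u ≠ π v → Γ.graph.Adj (π u) (π v) := by
    intro u v huv hne; rw [h.adj, hπ, hπ]
    exact (adj_label hc huv).resolve_left fun h3 => hne ((heq _ _).2 h3)
  have hdir : ∀ u v, F.graph.Adj u v → π u ≠ π v → Γ.dir (π u) (π v) = F.dir u v := by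
    have key : ∀ u v, F.Next u v ∨ F.Vert u v → π u ≠ π v → Γ.dir (π u) (π v) = F.dir u v := by
      rintro u v (huv | huv) hne
      · obtain ⟨h1, h2⟩ := (next_label hc huv).resolve_left fun h3 => hne ((heq _ _).2 h3)
        rw [h2, ← hπ u, h.dir_floor _ _ (by rwa [hπ, hπ])]
      · obtain ⟨h1, h2⟩ := (vert_label hc huv).resolve_left fun h3 => hne ((heq _ _).2 h3)
        rw [h2, h.dir_vert _ _ u.1.1 u.1.2 (by rwa [hπ, hπ])]
    intro u v huv hne; have key' := fun h => key v u h hne.symm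
    rw [← neg_inj, ← F.dir_symm huv, ← Γ.dir_symm _ _ (hadj u v huv hne)] at key'
    rcases huv with h1 | h1 | h1 | h1
    exacts [key u v (.inl h1) hne, key' (.inl h1), key u v (.inr h1) hne, key' (.inr h1)]
  refine ⟨π, ⟨⟨fun c => induce_fiber_connected (Z := (F.preMap hΔ _ hc.admissible S).zeroGraph)
    (fun _ _ h => h.1) hz c (hsurj c), hadj, ?_⟩, ?_, hlen0, hdir, ?_, ?_, ?_⟩, hπ⟩
  · intro c c' hcc; obtain ⟨u, v, huv, hu, hv⟩ := exists_adj_of_labelAdj hc ((h.adj _ _).1 hcc)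
    exact ⟨u, v, h.inj ((hπ u).trans hu), h.inj ((hπ v).trans hv), huv⟩
  · intro u v huv hne; have h1 := Γ.affine _ _ (hadj u v huv hne)
    have h2 := nodePos_affine hc.admissible huv
    rw [h.pos, h.pos, hπ, hπ, ← nodePos_eq hc, ← nodePos_eq hc, hdir u v huv hne, h2] at h1
    have h4 : realDir (F.dir u v) ≠ 0 := fun h4 => F.dir_ne huv (realDir_eq_zero h4)
    exact (smul_left_injective ℝ h4 (add_left_cancel h1)).symm
  · intro u; rw [h.pos, hπ]; exact (nodePos_eq hc u).symm
  · intro c; rw [h.ends, ← sum_ends_label hc ((h.range _).1 ⟨c, rfl⟩)]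
    refine sum_congr (filter_congr fun u _ => ?_) fun _ _ => rfl
    exact ⟨fun h1 => h.inj ((hπ u).trans h1), fun h => h ▸ (hπ u).symm⟩
  · exact fun a => h.inj ((hπ _).trans (h.mark a).symm)

theorem exists_realizes (hΔ : Δ.Valid) {r s : ℕ} (S : Mark r s ≃ Fin Δ.n) (hc : F.Compatible L) :
    ∃ (Γ : TropicalMap r s) (e : Fin Γ.nv → Fin Δ.n × ℝ), L.Realizes S Γ e := by
  obtain ⟨Γ, π, h⟩ := (F.preMap hΔ _ hc.admissible S).exists_contracts
  obtain ⟨e, he, -⟩ := h.realizes (hc := hc); exact ⟨Γ, e, he⟩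

end FloorPlan

/-! ### Merged floor diagrams as layouts -/

/-- Exchange of the two marked points belonging to a double point. -/
def Mark.swap {r s : ℕ} : Mark r s → Mark r s
  | .x i => .x i
  | .y j => .z j
  | .z j => .y j

theorem Mark.swap_swap {r s : ℕ} (a : Mark r s) : a.swap.swap = a := by cases a <;> rfl

namespace Merging

variable {n r s : ℕ} (M : Merging n r s)

/-- The vertex which is merged with a given vertex. -/
def partner (v : Fin n) : Fin n := M.slot (M.slot.symm v).swap

theorem partner_slot (a : Mark r s) : M.partner (M.slot a) = M.slot a.swap := by simp [partner]

theorem partner_y (j : Fin s) : M.partner (M.slot (.y j)) = M.slot (.z j) := M.partner_slot _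

theorem partner_z (j : Fin s) : M.partner (M.slot (.z j)) = M.slot (.y j) := M.partner_slot _

theorem partner_partner (v : Fin n) : M.partner (M.partner v) = v := by
  simp [partner, Mark.swap_swap]

theorem slot_cases (v : Fin n) : (∃ i, v = M.slot (.x i)) ∨ (∃ j, v = M.slot (.y j)) ∨
    ∃ j, v = M.slot (.z j) := by
  obtain ⟨a, rfl⟩ := M.slot.surjective v; cases a <;> simp

theorem partner_cases {v : Fin n} (h : M.partner v ≠ v) : ∃ j, (v = M.slot (.y j) ∧
    M.partner v = M.slot (.z j)) ∨ (v = M.slot (.z j) ∧ M.partner v = M.slot (.y j)) := by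
  rcases M.slot_cases v with ⟨i, rfl⟩ | ⟨j, rfl⟩ | ⟨j, rfl⟩
  exacts [absurd (M.partner_slot _) h, ⟨j, .inl ⟨rfl, M.partner_y j⟩⟩,
    ⟨j, .inr ⟨rfl, M.partner_z j⟩⟩]

theorem slot_lt (j : Fin s) : M.slot (.y j) < M.slot (.z j) := by
  rw [Fin.lt_def, ← M.consecutive j]; omega

theorem not_between (j : Fin s) {v : Fin n} (h : M.slot (.y j) < v) (h' : v < M.slot (.z j)) :
    False := by
  rw [Fin.lt_def] at h h'; have := M.consecutive j; omega

/-- The points at which the vertices are placed. -/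
def point (p : Fin r → ℝ × ℝ) (q : Fin s → ℝ × ℝ) (v : Fin n) : ℝ × ℝ :=
  markedPoint p q (M.slot.symm v)

theorem point_slot (p : Fin r → ℝ × ℝ) (q : Fin s → ℝ × ℝ) (a : Mark r s) :
    M.point p q (M.slot a) = markedPoint p q a := by simp [point]

theorem point_partner (p : Fin r → ℝ × ℝ) (q : Fin s → ℝ × ℝ) (v : Fin n) :
    M.point p q (M.partner v) = M.point p q v := by
  obtain ⟨a, rfl⟩ := M.slot.surjective v; rw [partner_slot, point_slot, point_slot]; cases a <;> rfl

theorem point_stretched {p : Fin r → ℝ × ℝ} {q : Fin s → ℝ × ℝ} {C : ℝ} (hM : M.Fits p q)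
    (h : VerticallyStretched C p q) {u v : Fin n} (huv : u < v) (hne : v ≠ M.partner u)
    (a b : Fin n) : C * |(M.point p q a).1 - (M.point p q b).1| <
      (M.point p q v).2 - (M.point p q u).2 := by
  let σ : Mark r s → Fin r ⊕ Fin s := fun a => match a with
    | .x i => .inl i
    | .y j => .inr j
    | .z j => .inr j
  have hσ : ∀ a, Sum.elim p q (σ a) = markedPoint p q a := fun a => by cases a <;> rfl
  obtain ⟨u, rfl⟩ := M.slot.surjective u; obtain ⟨v, rfl⟩ := M.slot.surjective v
  obtain ⟨a, rfl⟩ := M.slot.surjective a; obtain ⟨b, rfl⟩ := M.slot.surjective b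
  rw [partner_slot, Ne, M.slot.apply_eq_iff_eq] at hne; simp only [point_slot]
  have h1 : σ v ≠ σ u := by
    have h2 : v ≠ u := fun h => lt_irrefl _ (h ▸ huv)
    cases u <;> cases v <;> simp_all [Mark.swap, σ]
  have h3 := h _ _ (σ a) (σ b) h1; simp only [hσ] at h3
  rwa [abs_of_nonneg (sub_nonneg.2 (hM _ _ huv.le))] at h3

end Merging

namespace FloorDiagram

variable {Δ : DelPezzoDegree} (D : FloorDiagram Δ)

/-- A bound for the slopes of floors. -/
def _root_.DelPezzoDegree.slopeBound (Δ : DelPezzoDegree) : ℝ := 1 + Δ.n * (Δ.numIn + Δ.n)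

theorem height_lipschitz (Q : FloorParams Δ.n) (w : Fin Δ.n) (x x' : ℝ) :
    |D.height Q w x - D.height Q w x'| ≤ Δ.slopeBound * |x - x'| := by
  unfold height; rw [add_sub_add_comm, add_sub_add_left_eq_sub, ← mul_sub, ← sum_sub_distrib,
    sub_sub_sub_cancel_right, DelPezzoDegree.slopeBound, add_mul]
  simp only [← mul_sub, sub_sub_sub_cancel_right]; refine (abs_add_le _ _).trans (add_le_add ?_ ?_)
  · split_ifs <;> simp
  · refine (abs_sum_le_sum_abs _ _).trans ?_
    have h2 : ∀ b ∈ univ, |(D.jump w b : ℝ) * (max (x - Q.X b) 0 - max (x' - Q.X b) 0)| ≤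
        (Δ.numIn + Δ.n) * |x - x'| := by
      intro b _; rw [abs_mul]; have h3 := D.abs_jump_le w b
      have h4 : |(D.jump w b : ℝ)| ≤ Δ.numIn + Δ.n := by exact_mod_cast h3
      refine mul_le_mul h4 ?_ (abs_nonneg _) (by positivity)
      simpa using abs_max_sub_max_le_abs (x - Q.X b) (x' - Q.X b) 0
    refine (sum_le_sum h2).trans_eq ?_
    simp only [sum_const, card_univ, Fintype.card_fin, nsmul_eq_mul]; ring

/-- An elevator which is merged with an adjacent floor is placed on this floor. -/
def ov {r s : ℕ} (M : Merging Δ.n r s) (v : Fin Δ.n) : Fin Δ.n :=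
  if v ∉ D.white ∧ D.graph.Adj (M.partner v) v then M.partner v else v

theorem ov_of_not_adj {r s : ℕ} {M : Merging Δ.n r s} {v : Fin Δ.n}
    (h : ¬ D.graph.Adj (M.partner v) v) : D.ov M v = v := if_neg fun h' => h h'.2

theorem ov_cases {r s : ℕ} (M : Merging Δ.n r s) (v : Fin Δ.n) : D.ov M v = v ∨
    (v ∉ D.white ∧ D.ov M v ∈ D.white ∧ D.graph.Adj (D.ov M v) v ∧ D.ov M v = M.partner v) := by
  unfold ov; split_ifs with h; exacts [.inr ⟨h.1, (D.color h.2).2 h.1, h.2, rfl⟩, .inl rfl]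

/-- The placement of a merged floor diagram at a vertically stretched point configuration. -/
def layout {r s : ℕ} (M : Merging Δ.n r s) {p : Fin r → ℝ × ℝ} {q : Fin s → ℝ × ℝ} {C : ℝ}
    (hC : Δ.slopeBound ≤ C) (hM : M.Fits p q) (h : VerticallyStretched C p q) : Layout D where
  P := M.point p q
  ov := D.ov M
  ov_spec v := (D.ov_cases M v).imp_right fun h =>
    ⟨h.1, h.2.1, h.2.2.1, by rw [h.2.2.2, M.point_partner]⟩
  vert := by
    intro w b hw hadj hov; have hb : b ∉ D.white := (D.color hadj).1 hw
    have hwb : w ≠ M.partner b := by rintro rfl; exact hov (if_pos ⟨hb, hadj⟩).symm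
    have hbw : b ≠ M.partner w := by rintro rfl; exact hwb (M.partner_partner w).symm
    have h1 := D.height_lipschitz (.ofPoints (M.point p q)) w (M.point p q b).1 (M.point p q w).1
    rw [D.height_ofPoints] at h1; have h2 : Δ.slopeBound * |(M.point p q b).1 - (M.point p q w).1| ≤
        C * |(M.point p q b).1 - (M.point p q w).1| := mul_le_mul_of_nonneg_right hC (abs_nonneg _)
    have h3 := abs_le.1 h1; rcases lt_trichotomy w b with hlt | heq | hlt
    · have h4 := M.point_stretched hM h hlt hbw b w
      have h5 : (D.jump w b : ℝ) < 0 := by exact_mod_cast (D.jump_neg_iff hadj).2 hlt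
      exact mul_pos (by linarith) (by linarith)
    · exact absurd heq hadj.ne
    · have h4 := M.point_stretched hM h hlt hwb b w
      have h5 : (0 : ℝ) < D.jump w b := by exact_mod_cast (D.jump_pos_iff hadj).2 hlt
      exact mul_pos_of_neg_of_neg (by linarith) (by linarith)

end FloorDiagram

namespace Layout

variable {Δ : DelPezzoDegree} {D : FloorDiagram Δ} (L : Layout D)

/-- A floor plan, where nodes on floors are ordered by their first coordinates `x`. -/
def planOfCoord {Δ : DelPezzoDegree} (D : FloorDiagram Δ) (x : Fin Δ.n × Fin Δ.n → ℝ)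
    (host : Fin Δ.n → Fin Δ.n)
    (hhost : ∀ v, host v = v ∨ (v ∉ D.white ∧ host v ∈ D.white ∧ D.graph.Adj (host v) v)) :
    FloorPlan Δ (ℝ ×ₗ (Fin Δ.n ×ₗ Fin Δ.n)) where
  D := D
  host := host
  host_spec := hhost
  key e := toLex (x e, toLex e)
  key_inj e e' h := toLex.injective (congrArg (fun z => (ofLex z).2) h)

theorem planOfCoord_le {Δ : DelPezzoDegree} {D : FloorDiagram Δ} {x : Fin Δ.n × Fin Δ.n → ℝ}
    {host : Fin Δ.n → Fin Δ.n} {hhost} {e e' : Fin Δ.n × Fin Δ.n}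
    (h : (planOfCoord D x host hhost).key e ≤ (planOfCoord D x host hhost).key e') :
    x e ≤ x e' := by
  have h1 : toLex (x e, toLex e) ≤ toLex (x e', toLex e') := h
  exact (Prod.Lex.toLex_le_toLex.1 h1).elim le_of_lt fun h => h.1.le

def basePlan : FloorPlan Δ (ℝ ×ₗ (Fin Δ.n ×ₗ Fin Δ.n)) :=
  planOfCoord D (fun e => (L.P e.2).1) id fun _ => .inl rfl

theorem basePlan_compatible : (L.basePlan).Compatible (L := L) where
  host _ := .inl rfl
  mono _ _ _ h := planOfCoord_le h

end Layout

namespace Layout.Realizes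

variable {Δ : DelPezzoDegree} {D : FloorDiagram Δ} {L : Layout D} {r s : ℕ} {S : Mark r s ≃ Fin Δ.n}
  {Γ : TropicalMap r s} {e : Fin Γ.nv → Fin Δ.n × ℝ}

theorem len_smul (h : L.Realizes S Γ e) {c c' : Fin Γ.nv} (hcc : Γ.graph.Adj c c') :
    realDir (Γ.dir c c') ≠ 0 := by
  rcases (h.adj _ _).1 hcc with h1 | h1 | ⟨w, b, h1⟩ | ⟨w, b, h1⟩
  · rw [h.dir_floor _ _ h1]; simp [realDir]
  · rw [Γ.dir_symm _ _ hcc, h.dir_floor _ _ h1]; simp [realDir]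
  · rw [h.dir_vert _ _ _ _ h1]; simpa [realDir] using D.jump_ne_zero_iff.2 h1.2.1
  · rw [Γ.dir_symm _ _ hcc, h.dir_vert _ _ _ _ h1]
    simpa [realDir] using D.jump_ne_zero_iff.2 h1.2.1

theorem exists_isIso (h : L.Realizes S Γ e) {S' : Mark r s ≃ Fin Δ.n} {Γ' : TropicalMap r s}
    {e' : Fin Γ'.nv → Fin Δ.n × ℝ} (h' : L.Realizes S' Γ' e') (hS : RespectsMarks S S' id) :
    ∃ φ, TropicalMap.IsIso Γ Γ' φ ∧ ∀ c, e' (φ c) = e c := by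
  choose f hf using fun c => (h'.range _).2 ((h.range _).1 ⟨c, rfl⟩)
  choose g hg using fun c => (h.range _).2 ((h'.range _).1 ⟨c, rfl⟩)
  let φ : Fin Γ.nv ≃ Fin Γ'.nv :=
    ⟨f, g, fun c => h.inj (by rw [hg, hf]), fun c => h'.inj (by rw [hf, hg])⟩
  have hφ : ∀ c, e' (φ c) = e c := hf
  have hadj : ∀ u v, Γ'.graph.Adj (φ u) (φ v) ↔ Γ.graph.Adj u v := fun u v => by
    rw [h'.adj, h.adj, hφ, hφ]
  have hdir : ∀ u v, Γ.graph.Adj u v → Γ'.dir (φ u) (φ v) = Γ.dir u v := by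
    intro u v huv; have huv' := (hadj u v).2 huv
    rcases (h.adj _ _).1 huv with h1 | h1 | ⟨w, b, h1⟩ | ⟨w, b, h1⟩
    · rw [h.dir_floor _ _ h1, h'.dir_floor _ _ (by rwa [hφ, hφ]), hφ]
    · rw [Γ.dir_symm _ _ huv, Γ'.dir_symm _ _ huv', h.dir_floor _ _ h1,
        h'.dir_floor _ _ (by rwa [hφ, hφ]), hφ]
    · rw [h.dir_vert _ _ _ _ h1, h'.dir_vert _ _ w b (by rwa [hφ, hφ])]
    · rw [Γ.dir_symm _ _ huv, Γ'.dir_symm _ _ huv', h.dir_vert _ _ _ _ h1,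
        h'.dir_vert _ _ w b (by rwa [hφ, hφ])]
  have hpos : ∀ v, Γ'.pos (φ v) = Γ.pos v := fun v => by rw [h.pos, h'.pos, hφ]
  have hmark : ∀ a a', S a = S' a' → φ (Γ.mark a) = Γ'.mark a' := fun a a' haa =>
    h'.inj (by rw [hφ, h.mark, h'.mark, haa])
  refine ⟨φ, ⟨hadj, ?_, hdir, hpos, fun v => by rw [h.ends, h'.ends, hφ], ?_⟩, hφ⟩
  · intro u v huv; have h1 := Γ.affine u v huv; have h2 := Γ'.affine _ _ ((hadj u v).2 huv)
    rw [hpos, hpos, hdir u v huv, h1] at h2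
    exact (smul_left_injective ℝ (h.len_smul huv) (add_left_cancel h2)).symm
  · exact ⟨fun i => hmark _ _ (hS.1 i), fun j => (hS.2 j).imp
      (fun h => ⟨hmark _ _ h.1, hmark _ _ h.2⟩) fun h => ⟨hmark _ _ h.1, hmark _ _ h.2⟩⟩

end Layout.Realizes

/-! ### Functoriality -/

namespace FloorDiagram.IsIso

variable {Δ : DelPezzoDegree} {r s : ℕ} {M : Merging Δ.n r s} {D E : FloorDiagram Δ}
  {τ : Equiv.Perm (Fin Δ.n)}

theorem jump (h : IsIso M D E τ) (u v : Fin Δ.n) : E.jump (τ u) (τ v) = D.jump u v := by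
  simp [FloorDiagram.jump, h.weight]

theorem adj (h : IsIso M D E τ) (u v : Fin Δ.n) : E.graph.Adj (τ u) (τ v) ↔ D.graph.Adj u v := by
  rw [← jump_ne_zero_iff, ← jump_ne_zero_iff, h.jump]

theorem isNode (h : IsIso M D E τ) (a : Fin Δ.n × Fin Δ.n) :
    E.IsNode (τ a.1, τ a.2) ↔ D.IsNode a := by
  simp [IsNode, h.white, h.adj]

theorem partner (h : IsIso M D E τ) (v : Fin Δ.n) : M.partner (τ v) = τ (M.partner v) := by
  rcases M.slot_cases v with ⟨i, rfl⟩ | ⟨j, rfl⟩ | ⟨j, rfl⟩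
  · have := h.marks.1 i; rw [this, M.partner_slot]; exact this.symm
  all_goals rcases h.marks.2 j with ⟨h1, h2⟩ | ⟨h1, h2⟩ <;>
    simp only [h1, h2, M.partner_y, M.partner_z]

theorem ov (h : IsIso M D E τ) (v : Fin Δ.n) : E.ov M (τ v) = τ (D.ov M v) := by
  unfold FloorDiagram.ov; simp only [h.partner, h.white, h.adj]; split_ifs <;> rfl

theorem point (h : IsIso M D E τ) (p : Fin r → ℝ × ℝ) (q : Fin s → ℝ × ℝ) (v : Fin Δ.n) :
    M.point p q (τ v) = M.point p q v := by
  rcases M.slot_cases v with ⟨i, rfl⟩ | ⟨j, rfl⟩ | ⟨j, rfl⟩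
  · rw [h.marks.1 i]
  all_goals rcases h.marks.2 j with ⟨h1, h2⟩ | ⟨h1, h2⟩
  exacts [by rw [h1], by rw [h1, ← M.partner_y, M.point_partner], by rw [h2],
    by rw [h2, ← M.partner_z, M.point_partner]]

theorem realizes (h : IsIso M D E τ) {L : Layout D} {L' : Layout E}
    (hP : ∀ v, L'.P (τ v) = L.P v) (hov : ∀ v, L'.ov (τ v) = τ (L.ov v)) {S : Mark r s ≃ Fin Δ.n}
    {Γ : TropicalMap r s} {e : Fin Γ.nv → Fin Δ.n × ℝ} (he : L.Realizes S Γ e) :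
    L'.Realizes (S.trans τ) Γ (fun c => (τ (e c).1, (e c).2)) := by
  let t : Fin Δ.n × ℝ → Fin Δ.n × ℝ := fun l => (τ l.1, l.2)
  have ht : Injective t := fun l l' hl =>
    Prod.ext (τ.injective (congrArg Prod.fst hl)) (congrArg (fun z => z.2) hl)
  have hts : ∀ l, ∃ l', t l' = l := fun l => ⟨(τ.symm l.1, l.2), by simp [t]⟩
  have hlabel : ∀ a, L'.label (τ a.1, τ a.2) = t (L.label a) := by
    intro a; simp only [Layout.label, τ.apply_eq_iff_eq, hP, hov, t]; split_ifs <;> rfl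
  have hlabels : ∀ l, t l ∈ L'.labels ↔ l ∈ L.labels := by
    refine fun l => ⟨fun ⟨a, ha, hl⟩ => ⟨(τ.symm a.1, τ.symm a.2), ?_, ht ?_⟩,
      fun ⟨a, ha, hl⟩ => ⟨_, (h.isNode a).2 ha, hl ▸ hlabel a⟩⟩
    · rw [← h.isNode]; simpa using ha
    · rw [← hlabel]; simpa using hl
  have hforall : ∀ (Q : Fin Δ.n × ℝ → Prop), (∀ l ∈ L'.labels, Q l) ↔ ∀ l ∈ L.labels, Q (t l) := by
    refine fun Q => ⟨fun h1 l hl => h1 _ ((hlabels l).2 hl), fun h1 l hl => ?_⟩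
    obtain ⟨l, rfl⟩ := hts l; exact h1 l ((hlabels l).1 hl)
  have hfe : ∀ l l', L'.FloorEdge (t l) (t l') ↔ L.FloorEdge l l' := by
    intro l l'; unfold Layout.FloorEdge; rw [hforall, hlabels, hlabels]
    simp only [t, h.white, τ.apply_eq_iff_eq]
  have hve : ∀ w b l l', L'.VertEdge (τ w) (τ b) (t l) (t l') ↔ L.VertEdge w b l l' := by
    intro w b l l'; unfold Layout.VertEdge
    rw [hlabel (b, b), h.white, h.adj, hov, hP, ht.eq_iff, Ne, τ.apply_eq_iff_eq]
    have : t l = (τ w, (L.P b).1) ↔ l = (w, (L.P b).1) := by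
      rw [show (τ w, (L.P b).1) = t (w, (L.P b).1) from rfl, ht.eq_iff]
    rw [this]
  have hve' : ∀ l l', (∃ w b, L'.VertEdge w b (t l) (t l')) ↔ ∃ w b, L.VertEdge w b l l' := by
    exact fun l l' => ⟨fun ⟨w, b, hv⟩ => ⟨τ.symm w, τ.symm b, (hve _ _ _ _).1 (by simpa using hv)⟩,
      fun ⟨w, b, hv⟩ => ⟨_, _, (hve _ _ _ _).2 hv⟩⟩
  have hslope : ∀ l, L'.slope (t l) = L.slope l := by
    intro l; unfold Layout.slope; rw [← Equiv.sum_comp τ]; simp only [t, hP, h.jump, h.leakNeg]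
  have hpos : ∀ l, L'.labelPos (t l) = L.labelPos l := by
    intro l; unfold Layout.labelPos Layout.H FloorDiagram.height FloorParams.ofPoints
    rw [← Equiv.sum_comp τ]; simp only [t, hP, h.jump, h.leakNeg, h.white]
  have hends : ∀ l, L'.labelEnds (t l) = L.labelEnds l := by
    intro l; have h1 : L'.IsFirst (t l) ↔ L.IsFirst l := by
      unfold Layout.IsFirst; rw [hforall]; simp only [t, τ.apply_eq_iff_eq]
    have h2 : L'.IsLast (t l) ↔ L.IsLast l := by
      unfold Layout.IsLast; rw [hforall]; simp only [t, τ.apply_eq_iff_eq]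
    unfold Layout.labelEnds; have h0 : (t l).1 = τ l.1 := rfl; congr 1
    · simp only [h.leakNeg, h.leakPos, h.white, h0, h1, h2]
    · rw [← Equiv.sum_comp τ]; refine sum_congr rfl fun b _ => ?_
      simp only [hlabel (b, b), ht.eq_iff, h.white, h.inEnds, h.outEnds]
  refine ⟨ht.comp he.inj, ?_, ?_, ?_, ?_, ?_, ?_, ?_⟩
  · intro l; obtain ⟨l, rfl⟩ := hts l; rw [hlabels, ← he.range]
    exact exists_congr fun c => ht.eq_iff (a := e c) (b := l)
  · intro c c'; show _ ↔ L'.LabelAdj (t (e c)) (t (e c')); unfold Layout.LabelAdj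
    rw [hfe, hfe, hve', hve']; exact he.adj c c'
  · intro c c' hcc; show _ = (1, L'.slope (t (e c))); rw [hslope]
    exact he.dir_floor _ _ ((hfe _ _).1 hcc)
  · intro c c' w b hcc
    have h1 : L.VertEdge (τ.symm w) (τ.symm b) (e c) (e c') := by rw [← hve]; simpa using hcc
    rw [he.dir_vert _ _ _ _ h1, ← h.jump]; simp
  · exact fun c => (he.pos c).trans (hpos _).symm
  · exact fun c => (he.ends c).trans (hends _).symm
  · intro a; exact (congrArg t (he.mark a)).trans (hlabel (S a, S a)).symm

end FloorDiagram.IsIso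

/-- Distinct vertices on a floor are at different positions, unless they are merged. -/
def Layout.NoTies {Δ : DelPezzoDegree} {r s : ℕ} (M : Merging Δ.n r s) {D : FloorDiagram Δ}
    (L : Layout D) : Prop :=
  ∀ a b, D.IsNode a → D.IsNode b → L.label a = L.label b → b.2 = a.2 ∨ b.2 = M.partner a.2

namespace TropicalMap

variable {r s : ℕ} (Γ : TropicalMap r s)

/-- The edges which are not vertical. -/
def floorGraph : SimpleGraph (Fin Γ.nv) where
  Adj c c' := Γ.graph.Adj c c' ∧ (Γ.dir c c').1 ≠ 0
  symm := ⟨fun c c' h => ⟨h.1.symm, by rw [Γ.dir_symm _ _ h.1.symm]; simpa using h.2⟩⟩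
  loopless := ⟨fun c h => Γ.graph.loopless.irrefl c h.1⟩

theorem IsIso.floorGraph_reachable {Γ Γ' : TropicalMap r s} {φ : Fin Γ.nv ≃ Fin Γ'.nv}
    (h : IsIso Γ Γ' φ) {c c' : Fin Γ.nv} (hcc : Γ.floorGraph.Reachable c c') :
    Γ'.floorGraph.Reachable (φ c) (φ c') :=
  hcc.map (⟨φ, fun {a b} hab => ⟨(h.adj a b).2 hab.1, by rw [h.dir _ _ hab.1]; exact hab.2⟩⟩ :
    Γ.floorGraph →g Γ'.floorGraph)

end TropicalMap

namespace Layout.Realizes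

variable {Δ : DelPezzoDegree} {D : FloorDiagram Δ} {L : Layout D} {r s : ℕ} {M : Merging Δ.n r s}
  {Γ : TropicalMap r s} {e : Fin Γ.nv → Fin Δ.n × ℝ}

theorem e_mark (h : L.Realizes M.slot Γ e) (v : Fin Δ.n) :
    e (Γ.mark (M.slot.symm v)) = (L.ov v, (L.P v).1) := by
  rw [h.mark, ← L.label_diag]; simp

theorem mem_labels (h : L.Realizes M.slot Γ e) (c : Fin Γ.nv) : e c ∈ L.labels :=
  (h.range _).1 ⟨c, rfl⟩

theorem diag_inj (hov : L.ov = D.ov M) (hT : L.NoTies M) {b b' : Fin Δ.n} (hb : b ∉ D.white)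
    (hb' : b' ∉ D.white) (h : L.label (b, b) = L.label (b', b')) : b = b' := by
  rw [L.label_diag, L.label_diag] at h; have h1 : L.ov b = L.ov b' := congrArg Prod.fst h
  have h2 : (L.P b).1 = (L.P b').1 := congrArg Prod.snd h; by_cases hw : L.ov b ∈ D.white
  · have h3 := (D.ov_cases M b).resolve_left fun h3 => hb (by rw [← h3, ← hov]; exact hw)
    have h4 := (D.ov_cases M b').resolve_left fun h3 => hb' (by rw [← h3, ← hov, ← h1]; exact hw)
    rw [← hov] at h3 h4; rw [← h1] at h4
    rcases hT (L.ov b, b) (L.ov b, b') (.inr ⟨hw, h3.2.2.1⟩) (.inr ⟨hw, h4.2.2.1⟩) (by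
      rw [L.label_att h3.2.2.1.ne, L.label_att h4.2.2.1.ne, h2]) with h5 | h5
    exacts [h5.symm, absurd hw (by rw [h3.2.2.2, ← h5]; exact hb')]
  · rw [← L.ov_black hw, h1]; exact L.ov_black (h1 ▸ hw)

variable (h : L.Realizes M.slot Γ e)
include h

theorem dir_fst_eq_zero_iff {c c' : Fin Γ.nv} (hcc : Γ.graph.Adj c c') : (Γ.dir c c').1 = 0 ↔
    (∃ w b, L.VertEdge w b (e c) (e c')) ∨ ∃ w b, L.VertEdge w b (e c') (e c) := by
  have key : ∀ c c', (∃ w b, L.VertEdge w b (e c) (e c')) → (Γ.dir c c').1 = 0 := by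
    rintro c c' ⟨w, b, h1⟩; rw [h.dir_vert _ _ _ _ h1]
  constructor
  · intro h0; rcases (h.adj _ _).1 hcc with h1 | h1 | h1
    · rw [h.dir_floor _ _ h1] at h0; simp at h0
    · rw [Γ.dir_symm _ _ hcc, h.dir_floor _ _ h1] at h0; simp at h0
    · exact h1
  · rintro (h1 | h1)
    · exact key _ _ h1
    · rw [Γ.dir_symm _ _ hcc, Prod.fst_neg, key _ _ h1, neg_zero]

theorem floorGraph_adj {c c' : Fin Γ.nv} :
    Γ.floorGraph.Adj c c' ↔ L.FloorEdge (e c) (e c') ∨ L.FloorEdge (e c') (e c) := by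
  constructor
  · rintro ⟨h1, h2⟩; rw [Ne, h.dir_fst_eq_zero_iff h1] at h2
    rcases (h.adj _ _).1 h1 with h3 | h3 | h3; exacts [.inl h3, .inr h3, absurd h3 h2]
  · rintro (h1 | h1)
    · exact ⟨(h.adj _ _).2 (.inl h1), by rw [h.dir_floor _ _ h1]; simp⟩
    · have h2 := (h.adj _ _).2 (.inl h1)
      exact ⟨h2.symm, by rw [Γ.dir_symm _ _ h2.symm, h.dir_floor _ _ h1]; simp⟩

theorem floorGraph_reachable (hΔ : Δ.Valid) {c c' : Fin Γ.nv} :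
    Γ.floorGraph.Reachable c c' ↔ (e c).1 = (e c').1 := by
  constructor
  · rintro ⟨p⟩
    induction p with
    | nil => rfl
    | cons hadj _ ih =>
      rw [← ih]; exact (h.floorGraph_adj.1 hadj).elim (·.1) (·.1.symm)
  · intro hcc; by_cases hw : (e c).1 ∈ D.white
    · obtain ⟨π, hπ, hl⟩ := h.contracts hΔ L.basePlan_compatible
      obtain ⟨u, hu, hfu⟩ := FloorPlan.exists_node_of_label (F := L.basePlan) (h.mem_labels c) hw
      obtain ⟨u', hu', hfu'⟩ := FloorPlan.exists_node_of_label (F := L.basePlan)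
        (h.mem_labels c') (hcc ▸ hw)
      obtain rfl : π u = c := h.inj ((hl u).trans hu)
      obtain rfl : π u' = c' := h.inj ((hl u').trans hu')
      have key : ∀ a b : L.basePlan.Node, L.basePlan.fl a.1 = L.basePlan.fl b.1 →
          L.basePlan.key a.1 ≤ L.basePlan.key b.1 → Γ.floorGraph.Reachable (π a) (π b) := by
        intro a b hab hk; have h2 : ReflTransGen L.basePlan.Next a b :=
          ReflTransGen.mono (fun _ _ hab => hab.1) _ _ (L.basePlan.chain hab hk)
        clear hab hk
        induction h2 with
        | refl => rfl
        | @tail x y _ hxy ih =>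
          refine ih.trans ?_; by_cases hne : π x = π y
          · rw [hne]
          · refine Adj.reachable (h.floorGraph_adj.2 (.inl ?_)); rw [hl, hl]
            exact ((FloorPlan.next_label L.basePlan_compatible hxy).resolve_left fun h3 =>
              hne (h.inj (by rw [hl, hl, h3]))).1
      have h3 : L.basePlan.fl u.1 = L.basePlan.fl u'.1 := by rw [hfu, hfu', hcc]
      exact (le_total (L.basePlan.key u.1) (L.basePlan.key u'.1)).elim (key _ _ h3)
        fun hk => (key _ _ h3.symm hk).symm
    · have key : ∀ l ∈ L.labels, l.1 ∉ D.white → l = L.label (l.1, l.1) := by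
        rintro _ ⟨a, ha, rfl⟩ hl; by_cases h2 : a.1 = a.2
        · rw [L.label_diag]; simp only [Layout.label, if_pos h2] at hl ⊢
          rw [L.ov_black hl, h2, L.ov_black (h2 ▸ L.ov_black hl ▸ hl)]
        · simp only [Layout.label, if_neg h2] at hl; exact absurd (ha.resolve_left h2).1 hl
      have h1 := key _ (h.mem_labels c) hw; have h2 := key _ (h.mem_labels c') (hcc ▸ hw)
      rw [h.inj (h1.trans (by rw [hcc]; exact h2.symm))]

theorem mem_white_iff (hΔ : Δ.Valid) (c : Fin Γ.nv) :
    (e c).1 ∈ D.white ↔ (∃ c', Γ.floorGraph.Adj c c') ∨ ∃ d ∈ Γ.ends c, d.1 ≠ 0 := by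
  constructor
  · intro hw; by_cases hl : L.IsLast (e c)
    · right; refine ⟨(1, if (e c).1 ∈ D.leakPos then 1 else 0), ?_, by simp⟩
      simp [h.ends, labelEnds, hw, hl]
    · left; unfold IsLast at hl; push Not at hl; obtain ⟨l, hl, h1, h2⟩ := hl
      obtain ⟨c', rfl⟩ := (h.range l).2 hl; obtain ⟨p⟩ := (h.floorGraph_reachable hΔ).2 h1.symm
      cases p with
      | nil => exact absurd h2 (lt_irrefl _)
      | cons hadj _ => exact ⟨_, hadj⟩
  · rintro (⟨c', hc⟩ | ⟨d, hd, hd0⟩)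
    · exact (h.floorGraph_adj.1 hc).elim (·.2.1) fun h1 => h1.1 ▸ h1.2.1
    · rw [h.ends, labelEnds] at hd; by_contra hw
      simp only [hw, false_and, if_false, zero_add, Multiset.mem_sum] at hd; obtain ⟨b, _, hb⟩ := hd
      split_ifs at hb with hb'
      · rw [Multiset.mem_add, Multiset.mem_replicate, Multiset.mem_replicate] at hb
        rcases hb with hb | hb <;> exact hd0 (by rw [hb.2])
      · simp at hb

theorem ends_mark (hov : L.ov = D.ov M) (hT : L.NoTies M) {b : Fin Δ.n}
    (hb : b ∉ D.white) (k : ℤ) : Multiset.count (0, k) (Γ.ends (Γ.mark (M.slot.symm b))) =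
      Multiset.count (0, k) (.replicate (D.inEnds b) ((0, -1) : ℤ × ℤ) +
        .replicate (D.outEnds b) (0, 1)) := by
  have h1 : e (Γ.mark (M.slot.symm b)) = L.label (b, b) := by rw [h.mark]; simp
  rw [h.ends, h1]; unfold labelEnds; rw [sum_eq_single b]
  · rw [Multiset.count_add, Multiset.count_add, if_pos (c := b ∉ _ ∧ _) ⟨hb, rfl⟩, add_eq_right]
    split_ifs <;> simp
  · exact fun b' _ hne => if_neg fun h2 => hne (diag_inj hov hT h2.1 hb h2.2)
  · simp

theorem exists_first {w : Fin Δ.n} (hw : w ∈ D.white) : ∃ c, (e c).1 = w ∧ L.IsFirst (e c) := by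
  obtain ⟨c, hc, hmin⟩ := exists_min_image (univ.filter fun c => (e c).1 = w) (fun c => (e c).2)
    ⟨Γ.mark (M.slot.symm w), by simp [h.e_mark, L.ov_white hw]⟩
  simp only [mem_filter_univ] at hc hmin; refine ⟨c, hc, fun l hl h1 => ?_⟩
  obtain ⟨c', rfl⟩ := (h.range l).2 hl; exact hmin c' (h1.trans hc)

theorem exists_last {w : Fin Δ.n} (hw : w ∈ D.white) : ∃ c, (e c).1 = w ∧ L.IsLast (e c) := by
  obtain ⟨c, hc, hmin⟩ := exists_max_image (univ.filter fun c => (e c).1 = w) (fun c => (e c).2)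
    ⟨Γ.mark (M.slot.symm w), by simp [h.e_mark, L.ov_white hw]⟩
  simp only [mem_filter_univ] at hc hmin; refine ⟨c, hc, fun l hl h1 => ?_⟩
  obtain ⟨c', rfl⟩ := (h.range l).2 hl; exact hmin c' (h1.trans hc)

theorem mem_leakNeg_iff {w : Fin Δ.n} (hw : w ∈ D.white) :
    w ∈ D.leakNeg ↔ ∃ c, (e c).1 = w ∧ (-1, -1) ∈ Γ.ends c := by
  constructor
  · intro hl; obtain ⟨c, hc, hf⟩ := h.exists_first hw
    exact ⟨c, hc, by simp [h.ends, labelEnds, hc, hw, hf, hl]⟩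
  · rintro ⟨c, hc, hm⟩
    rw [h.ends, labelEnds, hc, Multiset.mem_add, Multiset.mem_add, Multiset.mem_sum] at hm
    rcases hm with (hm | hm) | ⟨b, _, hm⟩ <;> split_ifs at hm <;> simp_all [Multiset.mem_replicate]

theorem mem_leakPos_iff {w : Fin Δ.n} (hw : w ∈ D.white) :
    w ∈ D.leakPos ↔ ∃ c, (e c).1 = w ∧ (1, 1) ∈ Γ.ends c := by
  constructor
  · intro hl; obtain ⟨c, hc, hf⟩ := h.exists_last hw
    exact ⟨c, hc, by simp [h.ends, labelEnds, hc, hw, hf, hl]⟩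
  · rintro ⟨c, hc, hm⟩
    rw [h.ends, labelEnds, hc, Multiset.mem_add, Multiset.mem_add, Multiset.mem_sum] at hm
    rcases hm with (hm | hm) | ⟨b, _, hm⟩ <;> split_ifs at hm <;> simp_all [Multiset.mem_replicate]

theorem mark_eq_iff (hov : L.ov = D.ov M) (hT : L.NoTies M)
    (hP : ∀ v, L.P (M.partner v) = L.P v) {u v : Fin Δ.n} :
    Γ.mark (M.slot.symm u) = Γ.mark (M.slot.symm v) ↔
      u = v ∨ (v = M.partner u ∧ D.graph.Adj u v) := by
  rw [← h.inj.eq_iff, h.e_mark, h.e_mark]; constructor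
  · intro huv; by_cases hne : u = v
    · exact .inl hne
    right; have h1 : L.ov u = L.ov v := congrArg Prod.fst huv
    have h2 : v = M.partner u := (hT (u, u) (v, v) (.inl rfl) (.inl rfl)
      (by rw [L.label_diag, L.label_diag, huv])).resolve_left (Ne.symm hne)
    refine ⟨h2, ?_⟩; rcases D.ov_cases M u with h3 | h3
    · rcases D.ov_cases M v with h4 | h4
      · rw [hov, h3, h4] at h1; exact absurd h1 hne
      · have h5 := h4.2.2.1; rw [h4.2.2.2, h2, M.partner_partner] at h5; rw [h2]; exact h5
    · have h5 := h3.2.2.1; rw [h3.2.2.2, ← h2] at h5; exact h5.symm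
  · rintro (rfl | ⟨h1, h2⟩)
    · rfl
    have h3 : L.P v = L.P u := by rw [h1, hP]
    have key : ∀ u v, v = M.partner u → D.graph.Adj u v → u ∈ D.white → L.ov u = L.ov v := by
      intro u v h1 h2 hu; rw [L.ov_white hu, hov, FloorDiagram.ov, if_pos]
      · rw [h1, M.partner_partner]
      · rw [h1, M.partner_partner, ← h1]; exact ⟨(D.color h2).1 hu, h2⟩
    rw [h3]; congr 1; by_cases hu : u ∈ D.white
    · exact key u v h1 h2 hu
    · exact (key v u (by rw [h1, M.partner_partner]) h2.symm
        (not_not.1 fun hv => hu ((D.color h2).2 hv))).symm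

theorem mark_y_eq_iff (hov : L.ov = D.ov M) (hT : L.NoTies M)
    (hP : ∀ v, L.P (M.partner v) = L.P v) (j : Fin s) :
    Γ.mark (.y j) = Γ.mark (.z j) ↔ D.graph.Adj (M.slot (.y j)) (M.slot (.z j)) := by
  have := h.mark_eq_iff hov hT hP (u := M.slot (.y j)) (v := M.slot (.z j))
  simp only [Equiv.symm_apply_apply, M.partner_y, true_and] at this; simp [this]

theorem vertEdge_of_adj (hov : L.ov = D.ov M) (hT : L.NoTies M)
    {b : Fin Δ.n} (hb : b ∉ D.white) {c : Fin Γ.nv} (hne : (e c).1 ≠ L.ov b)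
    (hw : (e c).1 ∈ D.white) (hadj : Γ.graph.Adj c (Γ.mark (M.slot.symm b))) :
    L.VertEdge (e c).1 b (e c) (L.label (b, b)) := by
  have h1 : e (Γ.mark (M.slot.symm b)) = L.label (b, b) := by rw [h.mark]; simp
  rw [h.adj, h1] at hadj; have h2 : (L.label (b, b)).1 = L.ov b := by rw [L.label_diag]
  rcases hadj with h3 | h3 | ⟨w, b', h3⟩ | ⟨w, b', h3⟩
  · exact absurd (h3.1.trans h2) hne
  · exact absurd (h3.1.symm.trans h2) hne
  · obtain rfl : b = b' := diag_inj hov hT hb ((D.color h3.2.1).1 h3.1) h3.2.2.2.2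
    have h5 : (e c).1 = w := by rw [h3.2.2.2.1]
    rw [h5]; exact h3
  · exfalso; have h5 : L.ov b = w := by rw [← h2, h3.2.2.2.1]
    have h6 := (D.ov_cases M b).resolve_left fun h6 => hb (by rw [← h6, ← hov, h5]; exact h3.1)
    rw [← hov, h5] at h6; have h7 : (L.P b).1 = (L.P b').1 := by
      have := h3.2.2.2.1; rw [L.label_diag] at this; exact congrArg Prod.snd this
    rcases hT (w, b) (w, b') (.inr ⟨h3.1, h6.2.2.1⟩) (.inr ⟨h3.1, h3.2.1⟩) (by
      rw [L.label_att h6.2.2.1.ne, L.label_att h3.2.1.ne, h7]) with h8 | h8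
    · simp only at h8; rw [h8] at h3; exact h3.2.2.1 h5.symm
    · simp only at h8; rw [← h6.2.2.2] at h8; exact h3.2.1.ne h8.symm

end Layout.Realizes

/-- The permutation of the marked points which exchanges the points belonging to the double points
in `σ`. -/
def Mark.swapOn {r s : ℕ} (σ : Fin s → Prop) : Equiv.Perm (Mark r s) :=
  Involutive.toPerm (fun a => match a with
    | .x i => .x i
    | .y j => if σ j then .z j else .y j
    | .z j => if σ j then .y j else .z j) (by
    intro a; rcases a with i | j | j
    · rfl
    all_goals by_cases h : σ j <;> simp [h])

theorem Mark.swapOn_y {r s : ℕ} (σ : Fin s → Prop) (j : Fin s) :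
    Mark.swapOn (r := r) σ (.y j) = if σ j then .z j else .y j := rfl

theorem Mark.swapOn_z {r s : ℕ} (σ : Fin s → Prop) (j : Fin s) :
    Mark.swapOn (r := r) σ (.z j) = if σ j then .y j else .z j := rfl

theorem Mark.swapOn_swap {r s : ℕ} (σ : Fin s → Prop) (a : Mark r s) :
    Mark.swapOn σ a.swap = (Mark.swapOn σ a).swap := by
  rcases a with i | j | j
  · rfl
  all_goals simp only [Mark.swap, swapOn_y, swapOn_z]; split_ifs <;> rfl

namespace FloorDiagram

variable {Δ : DelPezzoDegree} (D : FloorDiagram Δ)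

theorem weight_eq_of_jump {D E : FloorDiagram Δ} {τ : Equiv.Perm (Fin Δ.n)}
    (hw : ∀ v, τ v ∈ E.white ↔ v ∈ D.white)
    (hj : ∀ w b, w ∈ D.white → b ∉ D.white → E.jump (τ w) (τ b) = D.jump w b) (u v : Fin Δ.n) :
    E.weight (τ u) (τ v) = D.weight u v := by
  have key : ∀ (D : FloorDiagram Δ) (u v : Fin Δ.n), D.weight u v = (-D.jump u v).toNat := by
    intro D u v; unfold jump
    rcases le_total v u with h | h <;> have := D.weight_eq_zero_of_lt h <;> omega
  have h0 : ∀ u v, E.jump (τ u) (τ v) = D.jump u v := by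
    intro u v; by_cases huv : u ∈ D.white ↔ v ∈ D.white
    · rw [D.jump_eq_zero fun h => by have := D.color h; tauto,
        E.jump_eq_zero fun h => by have := E.color h; simp only [hw] at this; tauto]
    by_cases hu : u ∈ D.white
    · exact hj u v hu (by tauto)
    · rw [E.jump_symm (τ v) (τ u), D.jump_symm v u, hj v u (by tauto) hu]
  rw [key, key, h0]

end FloorDiagram

namespace Layout.Realizes

variable {Δ : DelPezzoDegree} {D E : FloorDiagram Δ} {L : Layout D} {L' : Layout E} {r s : ℕ}
  {M : Merging Δ.n r s} {Γ Γ' : TropicalMap r s} {e : Fin Γ.nv → Fin Δ.n × ℝ}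
  {e' : Fin Γ'.nv → Fin Δ.n × ℝ}

theorem exists_perm (hΔ : Δ.Valid) (h : L.Realizes M.slot Γ e) (h' : L'.Realizes M.slot Γ' e')
    (hov : L.ov = D.ov M) (hov' : L'.ov = E.ov M) (hT : L.NoTies M) (hT' : L'.NoTies M)
    (hP : ∀ v, L.P (M.partner v) = L.P v) (hP' : ∀ v, L'.P (M.partner v) = L'.P v)
    {φ : Fin Γ.nv ≃ Fin Γ'.nv} (hφ : TropicalMap.IsIso Γ Γ' φ) :
    ∃ τ, FloorDiagram.IsIso M D E τ ∧
      ∀ v, φ (Γ.mark (M.slot.symm v)) = Γ'.mark (M.slot.symm (τ v)) := by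
  have hc : ∀ a b, (φ a = φ b) ↔ a = b := fun a b => φ.injective.eq_iff
  have hadjD := h.mark_y_eq_iff hov hT hP; have hadjE := h'.mark_y_eq_iff hov' hT' hP'
  have hDE : ∀ j, D.graph.Adj (M.slot (.y j)) (M.slot (.z j)) ↔
      E.graph.Adj (M.slot (.y j)) (M.slot (.z j)) := by
    intro j; rw [← hadjD, ← hadjE, ← hc]; rcases hφ.marks.2 j with ⟨h1, h2⟩ | ⟨h1, h2⟩
    exacts [by rw [h1, h2], by rw [h1, h2, eq_comm]]
  let σ : Fin s → Prop := fun j =>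
    ¬ (φ (Γ.mark (.y j)) = Γ'.mark (.y j) ∧ φ (Γ.mark (.z j)) = Γ'.mark (.z j)) ∨
    (D.graph.Adj (M.slot (.y j)) (M.slot (.z j)) ∧
      ¬ (M.slot (.y j) ∈ D.white ↔ M.slot (.y j) ∈ E.white))
  let f : Equiv.Perm (Mark r s) := Mark.swapOn σ; have hfm : ∀ a, φ (Γ.mark a) = Γ'.mark (f a) := by
    have key : ∀ j, if σ j then φ (Γ.mark (.y j)) = Γ'.mark (.z j) ∧
        φ (Γ.mark (.z j)) = Γ'.mark (.y j) else φ (Γ.mark (.y j)) = Γ'.mark (.y j) ∧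
        φ (Γ.mark (.z j)) = Γ'.mark (.z j) := by
      intro j
      by_cases hst : φ (Γ.mark (.y j)) = Γ'.mark (.y j) ∧ φ (Γ.mark (.z j)) = Γ'.mark (.z j)
      · split_ifs with hj
        · have h1 := hj.resolve_left (fun h1 => h1 hst); have h2 := (hadjD j).2 h1.1
          have h3 := (hadjE j).2 ((hDE j).1 h1.1); rw [← h3, h2]
          exact ⟨by rw [hst.2, h3], hst.2.trans h3.symm⟩
        · exact hst
      · rw [if_pos (.inl hst)]; exact (hφ.marks.2 j).resolve_left hst
    rintro (i | j | j)
    · exact hφ.marks.1 i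
    all_goals
      have := key j; simp only [f, Mark.swapOn_y, Mark.swapOn_z]
      split_ifs at this ⊢ <;> simp only [this]
  let τ : Equiv.Perm (Fin Δ.n) := (M.slot.symm.trans f).trans M.slot
  have hτ : ∀ a, τ (M.slot a) = M.slot (f a) := fun a => by simp [τ]
  have hτm : ∀ v, φ (Γ.mark (M.slot.symm v)) = Γ'.mark (M.slot.symm (τ v)) := by simp [hfm, τ]
  have hpart : ∀ v, M.partner (τ v) = τ (M.partner v) := by
    intro v; obtain ⟨a, rfl⟩ := M.slot.surjective v; rw [hτ, M.partner_slot, M.partner_slot, hτ]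
    exact congrArg M.slot (Mark.swapOn_swap σ a).symm
  have hadjp : ∀ v, E.graph.Adj (M.partner (τ v)) (τ v) ↔ D.graph.Adj (M.partner v) v := by
    intro v; have h1 := h.mark_eq_iff hov hT hP (u := M.partner v) (v := v)
    have h2 := h'.mark_eq_iff hov' hT' hP' (u := M.partner (τ v)) (v := τ v)
    rw [M.partner_partner] at h1 h2; rw [← hc, hτm, hτm, ← hpart, h2] at h1
    by_cases hv : M.partner v = v
    · simp [hpart, hv]
    · have h3 : M.partner (τ v) ≠ τ v := by rw [hpart]; exact fun h3 => hv (τ.injective h3)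
      simpa [hv, h3] using h1
  have hwhite0 : ∀ c, (e' (φ c)).1 ∈ E.white ↔ (e c).1 ∈ D.white := by
    intro c; rw [h.mem_white_iff hΔ, h'.mem_white_iff hΔ, hφ.ends]
    refine or_congr (φ.surjective.exists.trans (exists_congr fun c' => ?_)) Iff.rfl
    exact ⟨fun ⟨h1, h2⟩ => have h3 := (hφ.adj _ _).1 h1; ⟨h3, by rwa [hφ.dir _ _ h3] at h2⟩,
      fun ⟨h1, h2⟩ => ⟨(hφ.adj _ _).2 h1, by rwa [hφ.dir _ _ h1]⟩⟩
  have hwhite : ∀ v, τ v ∈ E.white ↔ v ∈ D.white := by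
    intro v; by_cases hv : D.graph.Adj (M.partner v) v
    · have hne : M.partner v ≠ v := hv.ne
      have key : ∀ j, D.graph.Adj (M.slot (.y j)) (M.slot (.z j)) →
          (τ (M.slot (.y j)) ∈ E.white ↔ M.slot (.y j) ∈ D.white) ∧
          (τ (M.slot (.z j)) ∈ E.white ↔ M.slot (.z j) ∈ D.white) := by
        intro j hj; have h1 := D.color hj; have h2 := E.color ((hDE j).1 hj)
        have h3 := (hadjD j).2 hj; have h4 := (hadjE j).2 ((hDE j).1 hj); rw [hτ, hτ]
        show (M.slot (Mark.swapOn σ _) ∈ _ ↔ _) ∧ (M.slot (Mark.swapOn σ _) ∈ _ ↔ _)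
        rw [Mark.swapOn_y, Mark.swapOn_z]; by_cases hs : σ j
        · rw [if_pos hs, if_pos hs]; rcases hs with h5 | h5
          · refine absurd ((hφ.marks.2 j).resolve_right fun h6 => h5 ?_) h5; rw [← h4, ← h3] at h6 ⊢
            exact ⟨by rw [h6.2], by rw [h6.2]⟩
          · tauto
        · rw [if_neg hs, if_neg hs]
          have h5 : ¬ ¬ (M.slot (.y j) ∈ D.white ↔ M.slot (.y j) ∈ E.white) := fun h5 =>
            hs (.inr ⟨hj, h5⟩)
          tauto
      obtain ⟨j, ⟨h1, h2⟩ | ⟨h1, h2⟩⟩ := M.partner_cases hne <;> rw [h2, h1] at hv <;> rw [h1]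
      exacts [(key j hv.symm).1, (key j hv).2]
    · have h1 := hwhite0 (Γ.mark (M.slot.symm v))
      rw [hτm, h.e_mark, h'.e_mark, hov, hov', D.ov_of_not_adj hv,
        E.ov_of_not_adj (by rwa [hadjp])] at h1
      exact h1
  have hovτ : ∀ v, L'.ov (τ v) = τ (L.ov v) := by
    intro v; rw [hov, hov']; unfold FloorDiagram.ov; simp only [hadjp, hwhite]
    split_ifs <;> [exact hpart v; rfl]
  have hfl : ∀ w ∈ D.white, ∀ c, (e' (φ c)).1 = τ w ↔ (e c).1 = w := by
    intro w hw c; have h1 : (e (Γ.mark (M.slot.symm w))).1 = w := by rw [h.e_mark, L.ov_white hw]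
    have h2 : (e' (φ (Γ.mark (M.slot.symm w)))).1 = τ w := by
      rw [hτm, h'.e_mark, L'.ov_white ((hwhite w).2 hw)]
    constructor
    · intro h3; rw [← h2, ← h'.floorGraph_reachable hΔ] at h3
      have h4 := hφ.symm.floorGraph_reachable h3
      rwa [φ.symm_apply_apply, φ.symm_apply_apply, h.floorGraph_reachable hΔ, h1] at h4
    · intro h3; rw [← h1, ← h.floorGraph_reachable hΔ] at h3; rw [← h2]
      exact (h'.floorGraph_reachable hΔ).1 (hφ.floorGraph_reachable h3)
  have hjump0 : ∀ w b, w ∈ D.white → b ∉ D.white → w ≠ L.ov b →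
      E.jump (τ w) (τ b) = D.jump w b := by
    intro w b hw hb hwb; have hb' : τ b ∉ E.white := mt (hwhite b).1 hb; have hw' := (hwhite w).2 hw
    have hwb' : τ w ≠ L'.ov (τ b) := by rw [hovτ]; exact fun h1 => hwb (τ.injective h1)
    have hcb : e (Γ.mark (M.slot.symm b)) = L.label (b, b) := by rw [h.mark]; simp
    have hcb' : e' (Γ'.mark (M.slot.symm (τ b))) = L'.label (τ b, τ b) := by rw [h'.mark]; simp
    by_cases hadj : D.graph.Adj w b
    · have hl : (w, (L.P b).1) ∈ L.labels := ⟨(w, b), .inr ⟨hw, hadj⟩, L.label_att hadj.ne⟩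
      obtain ⟨c, hc⟩ := (h.range _).2 hl
      have h1 : L.VertEdge w b (e c) (e (Γ.mark (M.slot.symm b))) := ⟨hw, hadj, hwb, hc, hcb⟩
      have h2 : Γ.graph.Adj c (Γ.mark (M.slot.symm b)) :=
        (h.adj _ _).2 (.inr (.inr (.inl ⟨_, _, h1⟩)))
      have h3 := h.dir_vert _ _ _ _ h1; have h4 := (hφ.adj _ _).2 h2; have h5 := hφ.dir _ _ h2
      have h6 : (e' (φ c)).1 = τ w := (hfl w hw c).2 (by rw [hc]); rw [hτm] at h4 h5
      have h7 := h'.vertEdge_of_adj hov' hT' hb' (c := φ c) (by rw [h6]; exact hwb')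
        (by rw [h6]; exact hw') h4
      rw [h6, ← hcb'] at h7; rw [h'.dir_vert _ _ _ _ h7, h3] at h5; simpa using congrArg Prod.snd h5
    · rw [D.jump_eq_zero hadj, E.jump_eq_zero fun hadj' => hadj ?_]
      have hl : (τ w, (L'.P (τ b)).1) ∈ L'.labels :=
        ⟨(τ w, τ b), .inr ⟨hw', hadj'⟩, L'.label_att hadj'.ne⟩
      obtain ⟨c, hc⟩ := (h'.range _).2 hl; obtain ⟨c, rfl⟩ := φ.surjective c
      have h1 : L'.VertEdge (τ w) (τ b) (e' (φ c)) (e' (Γ'.mark (M.slot.symm (τ b)))) :=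
        ⟨hw', hadj', hwb', hc, hcb'⟩
      have h2 := (h'.adj _ _).2 (.inr (.inr (.inl ⟨_, _, h1⟩))); rw [← hτm, hφ.adj] at h2
      have h6 : (e c).1 = w := (hfl w hw c).1 (by rw [hc])
      have h7 := h.vertEdge_of_adj hov hT hb (c := c) (by rw [h6]; exact hwb)
        (by rw [h6]; exact hw) h2
      rw [h6] at h7; exact h7.2.1
  have hcount : ∀ b, b ∉ D.white → ∀ k : ℤ, Multiset.count (0, k)
      (.replicate (E.inEnds (τ b)) ((0, -1) : ℤ × ℤ) + .replicate (E.outEnds (τ b)) (0, 1)) =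
      Multiset.count (0, k)
      (.replicate (D.inEnds b) ((0, -1) : ℤ × ℤ) + .replicate (D.outEnds b) (0, 1)) := by
    intro b hb k
    rw [← h.ends_mark hov hT hb, ← h'.ends_mark hov' hT' (mt (hwhite b).1 hb), ← hτm, hφ.ends]
  have hin : ∀ v, E.inEnds (τ v) = D.inEnds v := by
    intro v; by_cases hv : v ∈ D.white
    · rw [((D.black_white_structure hΔ).2 v hv).1,
        ((E.black_white_structure hΔ).2 _ ((hwhite v).2 hv)).1]
    · simpa [Multiset.count_replicate] using hcount v hv (-1)
  have hout : ∀ v, E.outEnds (τ v) = D.outEnds v := by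
    intro v; by_cases hv : v ∈ D.white
    · rw [((D.black_white_structure hΔ).2 v hv).2,
        ((E.black_white_structure hΔ).2 _ ((hwhite v).2 hv)).2]
    · simpa [Multiset.count_replicate] using hcount v hv 1
  have hjump : ∀ w b, w ∈ D.white → b ∉ D.white → E.jump (τ w) (τ b) = D.jump w b := by
    intro w b hw hb; by_cases hwb : w = L.ov b
    · have h1 := D.black_jump hb; have h2 := E.black_jump (b := τ b) (mt (hwhite b).1 hb)
      rw [hin, hout, ← h1, ← Equiv.sum_comp τ, ← add_sum_erase _ _ (mem_univ w),
        ← add_sum_erase _ (fun w => D.jump w b) (mem_univ w)] at h2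
      rw [sum_congr rfl (g := fun w => D.jump w b)] at h2
      · exact add_right_cancel h2
      · intro w' hw'; by_cases hww : w' ∈ D.white
        · exact hjump0 w' b hww hb fun h3 => (ne_of_mem_erase hw') (by rw [h3, hwb])
        · rw [D.jump_eq_zero fun h3 => hww ((D.color h3).2 hb), E.jump_eq_zero fun h3 =>
            hww ((hwhite w').1 ((E.color h3).2 fun h4 => hb ((hwhite b).1 h4)))]
    · exact hjump0 w b hw hb hwb
  refine ⟨τ, ⟨⟨fun i => by rw [hτ]; rfl, fun j => ?_⟩, hwhite,
    FloorDiagram.weight_eq_of_jump hwhite hjump, hin, hout, ?_, ?_⟩, hτm⟩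
  · rw [hτ, hτ]; show (M.slot (Mark.swapOn σ _) = _ ∧ M.slot (Mark.swapOn σ _) = _) ∨
      (M.slot (Mark.swapOn σ _) = _ ∧ M.slot (Mark.swapOn σ _) = _)
    rw [Mark.swapOn_y, Mark.swapOn_z]; split_ifs <;> simp
  · intro v; by_cases hv : v ∈ D.white
    · rw [h.mem_leakPos_iff hv, h'.mem_leakPos_iff ((hwhite v).2 hv)]
      simp only [φ.surjective.exists, hφ.ends, hfl v hv]
    · exact iff_of_false (E.leak_black (mt (hwhite v).1 hv)).1 (D.leak_black hv).1
  · intro v; by_cases hv : v ∈ D.white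
    · rw [h.mem_leakNeg_iff hv, h'.mem_leakNeg_iff ((hwhite v).2 hv)]
      simp only [φ.surjective.exists, hφ.ends, hfl v hv]
    · exact iff_of_false (E.leak_black (mt (hwhite v).1 hv)).2 (D.leak_black hv).2

theorem exists_isIso_of_perm (h : L.Realizes M.slot Γ e) (h' : L'.Realizes M.slot Γ' e')
    {τ : Equiv.Perm (Fin Δ.n)} (hτ : FloorDiagram.IsIso M D E τ)
    (hP : ∀ v, L'.P (τ v) = L.P v) (hov : L.ov = D.ov M) (hov' : L'.ov = E.ov M) :
    ∃ φ, TropicalMap.IsIso Γ Γ' φ ∧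
      ∀ v, φ (Γ.mark (M.slot.symm v)) = Γ'.mark (M.slot.symm (τ v)) := by
  have hovτ : ∀ v, L'.ov (τ v) = τ (L.ov v) := fun v => by rw [hov, hov', hτ.ov]
  obtain ⟨φ, h1, h2⟩ := (hτ.realizes hP hovτ h).exists_isIso h'
    ⟨fun i => hτ.marks.1 i, fun j => hτ.marks.2 j⟩
  refine ⟨φ, h1, fun v => h'.inj ?_⟩; rw [h2, h.e_mark, h'.e_mark, hovτ, hP]

end Layout.Realizes

theorem exists_offset {h : ℝ → ℝ} {K ρ c : ℝ} (hK : 1 ≤ K) (h0 : h 0 = 0)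
    (hl : ∀ x y, |h x - h y| ≤ K * |x - y|) (hc : c ≠ 0) {e : ℝ × ℝ} (he : ‖e‖ ≤ ρ) :
    ∃ (σ f : Prop) (a b y : ℝ), |a| ≤ ρ ∧ |b| ≤ 2 * ρ ∧ |y| ≤ 2 * K * ρ ∧ (f → y = h b) ∧
      (¬ f → b = 0 ∧ 0 ≤ -c * y) ∧ ((b, y) : ℝ × ℝ) - (a, h a) = if σ then -e else e := by
  obtain ⟨e1, e2⟩ := e; have he1 : |e1| ≤ ρ := (norm_fst_le (e1, e2)).trans he
  have he2 : |e2| ≤ ρ := (norm_snd_le (e1, e2)).trans he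
  have hρ : 0 ≤ ρ := (abs_nonneg _).trans he1; have hb : ∀ x, |x| ≤ ρ → |h x| ≤ K * ρ := by
    intro x hx; have := hl x 0; rw [h0, sub_zero, sub_zero] at this
    exact this.trans (mul_le_mul_of_nonneg_left hx (by linarith))
  have hρK : ρ ≤ K * ρ := le_mul_of_one_le_left hρ hK; by_cases h1 : 0 ≤ -c * (h (-e1) + e2)
  · refine ⟨False, False, -e1, 0, h (-e1) + e2, by rwa [abs_neg], by simpa using hρ, ?_,
      fun h => h.elim, fun _ => ⟨rfl, h1⟩, ?_⟩
    · refine (abs_add_le _ _).trans ?_; have := hb (-e1) (by rwa [abs_neg]); linarith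
    · ext <;> simp
  by_cases h2 : 0 ≤ -c * (h e1 - e2)
  · refine ⟨True, False, e1, 0, h e1 - e2, he1, by simpa using hρ, ?_,
      fun h => h.elim, fun _ => ⟨rfl, h2⟩, ?_⟩
    · refine (abs_sub _ _).trans ?_; have := hb e1 he1; linarith
    · ext <;> simp
  have hcont : Continuous h := by
    exact LipschitzWith.continuous (K := ⟨K, by linarith⟩) (.of_dist_le_mul hl)
  have h3 : e2 ∈ Set.uIcc (h (-e1 + e1) - h (-e1)) (h (0 + e1) - h 0) := by
    rw [neg_add_cancel, zero_add, h0, zero_sub, sub_zero, Set.mem_uIcc]; push Not at h1 h2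
    rcases lt_or_gt_of_ne hc with hc | hc
    exacts [.inr (by constructor <;> nlinarith), .inl (by constructor <;> nlinarith)]
  obtain ⟨a, ha, hae⟩ := intermediate_value_uIcc (f := fun a => h (a + e1) - h a)
    (Continuous.continuousOn (by fun_prop)) h3
  have ha' : |a| ≤ ρ := by
    refine le_trans ?_ he1; rcases Set.mem_uIcc.1 ha with h | h <;> grind
  have hae' : |a + e1| ≤ 2 * ρ := by linarith [abs_add_le a e1]
  refine ⟨False, True, a, a + e1, h (a + e1), ha', hae', ?_, fun _ => rfl, fun h => (h trivial).elim,
    ?_⟩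
  · have := hl (a + e1) 0; rw [h0, sub_zero, sub_zero] at this; refine this.trans ?_
    calc K * |a + e1| ≤ K * (2 * ρ) := mul_le_mul_of_nonneg_left hae' (by linarith)
      _ = 2 * K * ρ := by ring
  · ext <;> simp [show h (a + e1) - h a = e2 from hae]

theorem exists_pos_lower_bound {ι : Type} [Finite ι] (f : ι → ℝ) :
    ∃ κ > 0, ∀ i, 0 < f i → κ ≤ f i := by
  have := Fintype.ofFinite ι; by_cases h : ∃ i, 0 < f i
  · obtain ⟨i0, h0⟩ := h; obtain ⟨i, hi, hmin⟩ := exists_min_image (univ.filter fun i => 0 < f i) f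
      ⟨i0, by simpa using h0⟩
    simp only [mem_filter_univ] at hi hmin; exact ⟨f i, hi, fun j hj => hmin j hj⟩
  · push Not at h; exact ⟨1, one_pos, fun i hi => absurd hi (not_lt.2 (h i))⟩

theorem _root_.DelPezzoDegree.one_le_slopeBound (Δ : DelPezzoDegree) : 1 ≤ Δ.slopeBound := by
  unfold DelPezzoDegree.slopeBound; have : (0 : ℝ) ≤ Δ.n * (Δ.numIn + Δ.n) := by positivity
  linarith

theorem FloorDiagram.height_close {Δ : DelPezzoDegree} (D : FloorDiagram Δ) {Q Q' : FloorParams Δ.n}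
    {ρ : ℝ} (hρ : 0 ≤ ρ) (hX : ∀ b, |Q'.X b - Q.X b| ≤ ρ) (hxr : ∀ w, |Q'.xr w - Q.xr w| ≤ ρ)
    (hyr : ∀ w, |Q'.yr w - Q.yr w| ≤ ρ) (w : Fin Δ.n) {x x' : ℝ} (hx : |x' - x| ≤ 2 * ρ) :
    |D.height Q' w x' - D.height Q w x| ≤ 5 * Δ.slopeBound * ρ := by
  have h1 : D.height Q' w x' - D.height Q w x = (Q'.yr w - Q.yr w) +
      (if w ∈ D.leakNeg then 1 else 0) * ((x' - x) - (Q'.xr w - Q.xr w)) +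
      ∑ b, (D.jump w b : ℝ) * ((max (x' - Q'.X b) 0 - max (x - Q.X b) 0) -
        (max (Q'.xr w - Q'.X b) 0 - max (Q.xr w - Q.X b) 0)) := by
    unfold height; simp only [mul_sub, sum_sub_distrib]; ring
  rw [h1]
  have h2 : |(if w ∈ D.leakNeg then 1 else 0 : ℝ) * ((x' - x) - (Q'.xr w - Q.xr w))| ≤ 3 * ρ := by
    split_ifs
    · rw [one_mul]; exact (abs_sub _ _).trans (by linarith [hxr w])
    · simpa using hρ
  have h3 : |∑ b, (D.jump w b : ℝ) * ((max (x' - Q'.X b) 0 - max (x - Q.X b) 0) -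
        (max (Q'.xr w - Q'.X b) 0 - max (Q.xr w - Q.X b) 0))| ≤
        Δ.n * ((Δ.numIn + Δ.n) * (5 * ρ)) := by
    refine (abs_sum_le_sum_abs _ _).trans ?_
    have h4 : ∀ b ∈ univ, |(D.jump w b : ℝ) * ((max (x' - Q'.X b) 0 - max (x - Q.X b) 0) -
        (max (Q'.xr w - Q'.X b) 0 - max (Q.xr w - Q.X b) 0))| ≤ (Δ.numIn + Δ.n) * (5 * ρ) := by
      intro b _; rw [abs_mul]; have h3 := D.abs_jump_le w b
      have h4 : |(D.jump w b : ℝ)| ≤ Δ.numIn + Δ.n := by exact_mod_cast h3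
      refine mul_le_mul h4 ?_ (abs_nonneg _) (by positivity); refine (abs_sub _ _).trans ?_
      have h5 := abs_max_sub_max_le_abs (x' - Q'.X b) (x - Q.X b) 0
      have h6 := abs_max_sub_max_le_abs (Q'.xr w - Q'.X b) (Q.xr w - Q.X b) 0
      have h7 : |x' - Q'.X b - (x - Q.X b)| ≤ 3 * ρ := by
        rw [show x' - Q'.X b - (x - Q.X b) = (x' - x) - (Q'.X b - Q.X b) by ring]
        exact (abs_sub _ _).trans (by linarith [hX b])
      have h8 : |Q'.xr w - Q'.X b - (Q.xr w - Q.X b)| ≤ 2 * ρ := by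
        rw [show Q'.xr w - Q'.X b - (Q.xr w - Q.X b) = (Q'.xr w - Q.xr w) - (Q'.X b - Q.X b) by ring]
        exact (abs_sub _ _).trans (by linarith [hX b, hxr w])
      linarith
    refine (sum_le_sum h4).trans_eq ?_
    simp only [sum_const, card_univ, Fintype.card_fin, nsmul_eq_mul]
  refine (abs_add_three _ _ _).trans ?_; have h5 := hyr w
  have h6 : 5 * Δ.slopeBound * ρ = 5 * ρ + Δ.n * ((Δ.numIn + Δ.n) * (5 * ρ)) := by
    unfold DelPezzoDegree.slopeBound; ring
  rw [h6]; linarith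

theorem Layout.Realizes.pos_mark {Δ : DelPezzoDegree} {D : FloorDiagram Δ} {L : Layout D} {r s : ℕ}
    {S : Mark r s ≃ Fin Δ.n} {Γ : TropicalMap r s} {e : Fin Γ.nv → Fin Δ.n × ℝ}
    (h : L.Realizes S Γ e) (a : Mark r s) : Γ.pos (Γ.mark a) = L.P (S a) := by
  rw [h.pos, h.mark, L.labelPos_diag]

/-- The parameters `Q` are `ρ`-close to the placement `L`. -/
structure FloorPlan.Near {Δ : DelPezzoDegree} {K : Type} [LinearOrder K] (F : FloorPlan Δ K)
    (L : Layout F.D) (Q : FloorParams Δ.n) (ρ : ℝ) : Prop where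
  nonneg : 0 ≤ ρ
  X : ∀ b, |Q.X b - (L.P b).1| ≤ ρ
  xr : ∀ w, |Q.xr w - (L.P w).1| ≤ ρ
  yr : ∀ w, |Q.yr w - (L.P w).2| ≤ ρ
  xm : ∀ v, |Q.xm v - (L.P v).1| ≤ 2 * ρ
  η : ∀ v, |Q.η v - (L.P v).2| ≤ 5 * Δ.slopeBound * ρ

/-- A lower bound for the distances between different vertical lines and floors. -/
structure Layout.Separated {Δ : DelPezzoDegree} {D : FloorDiagram Δ} (L : Layout D) (κ : ℝ) : Prop where
  fst : ∀ u v, (L.P u).1 ≠ (L.P v).1 → κ ≤ |(L.P u).1 - (L.P v).1|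
  vert : ∀ w b, w ∈ D.white → D.graph.Adj w b → w ≠ L.ov b →
    κ ≤ -(D.jump w b : ℝ) * ((L.P b).2 - L.H w (L.P b).1) / |(D.jump w b : ℝ)|

theorem Layout.exists_separated {Δ : DelPezzoDegree} {D : FloorDiagram Δ} (L : Layout D) :
    ∃ κ > 0, L.Separated κ := by
  obtain ⟨κ1, h1, h2⟩ := exists_pos_lower_bound fun x : Fin Δ.n × Fin Δ.n => |(L.P x.1).1 - (L.P x.2).1|
  obtain ⟨κ2, h3, h4⟩ := exists_pos_lower_bound fun x : Fin Δ.n × Fin Δ.n =>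
    -(D.jump x.1 x.2 : ℝ) * ((L.P x.2).2 - L.H x.1 (L.P x.2).1) / |(D.jump x.1 x.2 : ℝ)|
  refine ⟨min κ1 κ2, lt_min h1 h3, ⟨fun u v huv => ?_, fun w b hw hadj hov => ?_⟩⟩
  · exact (min_le_left _ _).trans (h2 (u, v) (abs_pos.2 (sub_ne_zero.2 huv)))
  · refine (min_le_right _ _).trans (h4 (w, b) ?_)
    have h5 : (D.jump w b : ℝ) ≠ 0 := by exact_mod_cast D.jump_ne_zero_iff.2 hadj
    exact div_pos (L.vert w b hw hadj hov) (abs_pos.2 h5)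

namespace FloorPlan

variable {Δ : DelPezzoDegree} {K : Type} [LinearOrder K] {F : FloorPlan Δ K} {L : Layout F.D}
  {Q : FloorParams Δ.n} {ρ κ : ℝ}

theorem Near.xnode (h : F.Near L Q ρ) (e : F.Node) : |F.xnode Q e - (L.P e.1.2).1| ≤ 2 * ρ := by
  unfold FloorPlan.xnode; split_ifs with h1
  · rw [← h1]; exact h.xm _
  · linarith [h.X e.1.2, h.nonneg]

theorem Near.height (h : F.Near L Q ρ) (w : Fin Δ.n) {x x' : ℝ} (hx : |x' - x| ≤ 2 * ρ) :
    |F.D.height Q w x' - L.H w x| ≤ 5 * Δ.slopeBound * ρ :=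
  F.D.height_close h.nonneg h.X h.xr h.yr w hx

theorem Near.nodePos_snd (h : F.Near L Q ρ) (e : F.Node) :
    |(F.nodePos Q e).2 - (F.nodePos (.ofPoints L.P) e).2| ≤ 5 * Δ.slopeBound * ρ := by
  unfold nodePos; rw [xnode_ofPoints]; simp only; split_ifs with h1
  exacts [h.height _ (h.xnode e), h.η _]

theorem Near.le (h : F.Near L Q ρ) : 2 * ρ ≤ 5 * Δ.slopeBound * ρ := by
  have := Δ.one_le_slopeBound; nlinarith [h.nonneg]

theorem Near.vert (h : F.Near L Q ρ) (hκ : L.Separated κ) (hρ : 10 * Δ.slopeBound * ρ < κ)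
    (hc : F.Compatible L) {e e' : F.Node} (hv : F.Vert e e') (hov : e.1.1 ≠ L.ov e.1.2) :
    0 < -(F.D.jump e.1.1 e.1.2 : ℝ) * ((F.nodePos Q e').2 - (F.nodePos Q e).2) := by
  have hadj := F.adj_of_vert hv; have hw : e.1.1 ∈ F.D.white := (e.2.resolve_left hv.1).1
  have h1 := hκ.vert _ _ hw hadj hov; have h2 := h.nodePos_snd e; have h3 := h.nodePos_snd e'
  have h4 : e' = F.hub e.1.2 := Subtype.ext (Prod.ext hv.2.1 hv.2.2.1)
  have h5 : (F.nodePos (.ofPoints L.P) e').2 = (L.P e.1.2).2 := by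
    rw [nodePos_eq hc, h4, label_hub hc, L.labelPos_diag]
  have h6 : (F.nodePos (.ofPoints L.P) e).2 = L.H e.1.1 (L.P e.1.2).1 := by
    rw [nodePos_eq hc, L.label_att hadj.ne, Layout.labelPos, if_pos hw]
  have hj : (F.D.jump e.1.1 e.1.2 : ℝ) ≠ 0 := by exact_mod_cast F.D.jump_ne_zero_iff.2 hadj
  rw [h6] at h2; rw [h5] at h3; rw [le_div_iff₀ (abs_pos.2 hj)] at h1; have h7 := abs_le.1 h2
  have h8 := abs_le.1 h3; rcases lt_or_gt_of_ne hj with hj | hj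
  · rw [abs_of_neg hj] at h1; nlinarith
  · rw [abs_of_pos hj] at h1; nlinarith

theorem Near.exists_isClose (h : F.Near L Q ρ) (hκ : L.Separated κ)
    (hρ : 20 * Δ.slopeBound * ρ < κ) (hc : F.Compatible L) (hΔ : Δ.Valid) (hQ : F.Admissible Q)
    {r s : ℕ} {S S' : Mark r s ≃ Fin Δ.n} (hS : ∀ a, L.label (S' a, S' a) = L.label (S a, S a))
    {Γ : TropicalMap r s} {e : Fin Γ.nv → Fin Δ.n × ℝ} (hΓ : L.Realizes S Γ e) {η : ℝ}
    (hη : 20 * Δ.slopeBound * ρ < η) :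
    ∃ Γ' : TropicalMap r s, TropicalMap.IsClose η Γ' Γ ∧
      ∀ a, Γ'.pos (Γ'.mark a) = F.nodePos Q (F.markNode (S' a)) := by
  obtain ⟨π, hπ, hπe⟩ := hΓ.contracts hΔ hc
  obtain ⟨Γ', π', hπ'⟩ := (F.preMap hΔ Q hQ S').exists_contracts; have hle := h.le
  have hρ0 := h.nonneg; have key : ∀ {e e' : F.Node}, F.Next e e' ∨ F.Vert e e' →
      |F.nodeLen Q e e' - F.nodeLen (.ofPoints L.P) e e'| < η ∧
      (F.nodeLen Q e e' = 0 → F.nodeLen (.ofPoints L.P) e e' = 0) := by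
    intro e e' hee; rcases hee with hn | hv
    · unfold nodeLen; rw [if_pos hn.1, if_pos hn.1, xnode_ofPoints, xnode_ofPoints]
      have h1 := h.xnode e; have h2 := h.xnode e'
      have h3 : |F.xnode Q e - F.xnode Q e' - ((L.P e.1.2).1 - (L.P e'.1.2).1)| ≤ 4 * ρ := by
        rw [show F.xnode Q e - F.xnode Q e' - ((L.P e.1.2).1 - (L.P e'.1.2).1) =
          (F.xnode Q e - (L.P e.1.2).1) - (F.xnode Q e' - (L.P e'.1.2).1) by ring]
        exact (abs_sub _ _).trans (by linarith)
      constructor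
      · exact (abs_abs_sub_abs_le _ _).trans_lt (by linarith)
      · intro h4; rw [abs_eq_zero] at h4; rw [h4, zero_sub, abs_neg] at h3; by_contra h5
        have h6 := hκ.fst e.1.2 e'.1.2 (fun h6 => h5 (by rw [h6]; simp)); linarith
    · have hfl := F.vert_fl_ne hv; unfold nodeLen; rw [if_neg hfl, if_neg hfl]
      have h1 := h.nodePos_snd e; have h2 := h.nodePos_snd e'; have hadj := F.adj_of_vert hv
      have hj : (1 : ℝ) ≤ |((F.dir e e').2 : ℝ)| := by
        rw [F.dir_vert hv]; have := Int.one_le_abs (F.D.jump_ne_zero_iff.2 hadj)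
        simp only [Int.cast_neg, abs_neg]; exact_mod_cast this
      constructor
      · rw [← sub_div, abs_div, abs_abs]; refine (div_le_self (abs_nonneg _) hj).trans_lt ?_
        refine (abs_abs_sub_abs_le _ _).trans_lt ?_
        rw [show (F.nodePos Q e).2 - (F.nodePos Q e').2 - ((F.nodePos (.ofPoints L.P) e).2 -
          (F.nodePos (.ofPoints L.P) e').2) = ((F.nodePos Q e).2 - (F.nodePos (.ofPoints L.P) e).2) -
          ((F.nodePos Q e').2 - (F.nodePos (.ofPoints L.P) e').2) by ring]
        exact (abs_sub _ _).trans_lt (by linarith)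
      · intro h0; by_cases hov : e.1.1 = L.ov e.1.2
        · rw [(vert_pos hc hv).2 hov]; simp
        · have h3 := h.vert hκ (by linarith) hc hv hov; rw [div_eq_zero_iff, abs_eq_zero] at h0
          rcases h0 with h0 | h0
          · rw [show (F.nodePos Q e').2 - (F.nodePos Q e).2 = -((F.nodePos Q e).2 - (F.nodePos Q e').2)
              by ring, h0] at h3
            simp at h3
          · linarith
  have key' : ∀ u v, F.graph.Adj u v →
      |F.nodeLen Q u v - F.nodeLen (.ofPoints L.P) u v| < η ∧
      (F.nodeLen Q u v = 0 → F.nodeLen (.ofPoints L.P) u v = 0) := fun u v huv => by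
    rcases id huv with h1 | h1 | h1 | h1
    · exact key (.inl h1)
    · rw [nodeLen_symm huv, nodeLen_symm huv]; exact key (.inl h1)
    · exact key (.inr h1)
    · rw [nodeLen_symm huv, nodeLen_symm huv]; exact key (.inr h1)
  refine ⟨Γ', hπ.isClose hπ' rfl rfl rfl (fun a => ?_) (fun u v h => (key' u v h).1)
    (fun u v h => (key' u v h).2) (fun u => ?_), fun a => ?_⟩
  · exact hΓ.inj (by rw [hπe, hπe]; exact hS a)
  · show dist (F.nodePos Q u) (F.nodePos (.ofPoints L.P) u) < η; have h1 := h.nodePos_snd u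
    have h2 := h.xnode u; rw [Prod.dist_eq, Real.dist_eq, Real.dist_eq]
    refine max_lt ?_ (by linarith)
    rw [show (F.nodePos (.ofPoints L.P) u).1 = (L.P u.1.2).1 from xnode_ofPoints u]
    exact h2.trans_lt (by linarith)
  · rw [← hπ'.mark, hπ'.pos]; rfl

end FloorPlan

namespace Layout.Realizes

variable {Δ : DelPezzoDegree} {D : FloorDiagram Δ} {L : Layout D} {r s : ℕ}
  {M : Merging Δ.n r s} {Γ : TropicalMap r s} {e : Fin Γ.nv → Fin Δ.n × ℝ}

theorem inMC (hΔ : Δ.Valid) (h : L.Realizes M.slot Γ e) (hov : L.ov = D.ov M)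
    (hP : ∀ v, L.P (M.partner v) = L.P v) : Γ.InMC := by
  refine ⟨fun j => ?_, fun η hη => ?_⟩
  · rw [h.pos_mark, h.pos_mark, ← M.partner_y, hP]
  obtain ⟨κ, hκ0, hκ⟩ := L.exists_separated; have hB := Δ.one_le_slopeBound
  set B := Δ.slopeBound with hBdef; let ρ := min κ η / (25 * B)
  have hmin : 0 < min κ η := lt_min hκ0 hη; have hρ : 0 < ρ := by positivity
  have hρB : 25 * B * ρ = min κ η := mul_div_cancel₀ _ (by positivity)
  have hBρ : ρ ≤ B * ρ := le_mul_of_one_le_left hρ.le hB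
  have hρκ : 20 * B * ρ < κ := by have := min_le_left κ η; nlinarith
  have hρη : 20 * B * ρ < η := by have := min_le_right κ η; nlinarith
  refine ⟨ρ, hρ, fun ε hε => ?_⟩; let A : Fin Δ.n → Prop := fun v => D.graph.Adj (M.partner v) v
  have hA : ∀ v, A (M.partner v) ↔ A v := fun v => by
    show D.graph.Adj (M.partner (M.partner v)) (M.partner v) ↔ _
    rw [M.partner_partner]; exact D.graph.adj_comm _ _
  let ev : Fin Δ.n → ℝ × ℝ := fun v => match M.slot.symm v with
    | .x _ => 0
    | .y j => ε j
    | .z j => -ε j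
  have hevy : ∀ j, ev (M.slot (.y j)) = ε j := fun j => by simp [ev]
  have hevz : ∀ j, ev (M.slot (.z j)) = -ε j := fun j => by simp [ev]
  have hev : ∀ v, ‖ev v‖ ≤ ρ := fun v => by
    rcases M.slot_cases v with ⟨i, rfl⟩ | ⟨j, rfl⟩ | ⟨j, rfl⟩
    · simp [ev, hρ.le]
    · rw [hevy]; exact (hε j).le
    · rw [hevz, norm_neg]; exact (hε j).le
  let P' : Fin Δ.n → ℝ × ℝ := fun v => L.P v + match M.slot.symm v with
    | .x _ => 0
    | .y j => if A v then 0 else ε j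
    | .z _ => 0
  have hP'A : ∀ v, A v → P' v = L.P v := fun v hv => by
    rcases M.slot_cases v with ⟨i, rfl⟩ | ⟨j, rfl⟩ | ⟨j, rfl⟩ <;> simp [P', hv]
  have hP'y : ∀ j, ¬ A (M.slot (.y j)) → P' (M.slot (.y j)) = L.P (M.slot (.y j)) + ε j :=
    fun j hj => by simp [P', hj]
  have hP'z : ∀ j, P' (M.slot (.z j)) = L.P (M.slot (.z j)) := fun j => by simp [P']
  have hP' : ∀ v, ‖P' v - L.P v‖ ≤ ρ := fun v => by
    by_cases hv : A v
    · rw [hP'A v hv]; simpa using hρ.le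
    · rcases M.slot_cases v with ⟨i, rfl⟩ | ⟨j, rfl⟩ | ⟨j, rfl⟩
      · simp [P', hρ.le]
      · rw [hP'y j hv]; simpa using (hε j).le
      · rw [hP'z]; simpa using hρ.le
  have hP1 : ∀ v, |(P' v).1 - (L.P v).1| ≤ ρ := fun v => (norm_fst_le _).trans (hP' v)
  have hP2 : ∀ v, |(P' v).2 - (L.P v).2| ≤ ρ := fun v => (norm_snd_le _).trans (hP' v)
  let H' : Fin Δ.n → ℝ → ℝ := D.height (.ofPoints P')
  have hH'self : ∀ w, H' w (P' w).1 = (P' w).2 := fun w => D.height_ofPoints P' w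
  have hoff : ∀ b, ∃ (σ f : Prop) (a b' y : ℝ), b ∉ D.white → A b → |a| ≤ ρ ∧ |b'| ≤ 2 * ρ ∧
      |y| ≤ 2 * B * ρ ∧ (f → (L.P b).2 + y = H' (M.partner b) ((L.P b).1 + b')) ∧
      (¬ f → b' = 0 ∧ 0 ≤ -(D.jump (M.partner b) b : ℝ) * y) ∧
      (((L.P b).1 + b', (L.P b).2 + y) : ℝ × ℝ) -
        ((L.P b).1 + a, H' (M.partner b) ((L.P b).1 + a)) = if σ then -ev b else ev b := by
    intro b; by_cases hb : A b
    · have hpb : (P' (M.partner b)) = L.P b := by rw [hP'A _ ((hA b).2 hb), hP]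
      have hself := hH'self (M.partner b); rw [hpb] at hself
      obtain ⟨σ, f, a, b', y, h1, h2, h3, h4, h5, h6⟩ := exists_offset
        (h := fun x => H' (M.partner b) ((L.P b).1 + x) - (L.P b).2) (K := B) (ρ := ρ)
        (c := (D.jump (M.partner b) b : ℝ)) (e := ev b) hB (by simp [hself]) (by
          intro x y
          have := D.height_lipschitz (.ofPoints P') (M.partner b) ((L.P b).1 + x) ((L.P b).1 + y)
          rw [add_sub_add_left_eq_sub] at this; rw [sub_sub_sub_cancel_right]
          exact this) (by exact_mod_cast D.jump_ne_zero_iff.2 hb) (hev b)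
      refine ⟨σ, f, a, b', y, fun _ _ => ⟨h1, h2, h3, fun hf => by linarith [h4 hf], h5, ?_⟩⟩
      rw [← h6]; ext
      · simp
      · simp only [Prod.snd_sub]; ring
    · exact ⟨True, True, 0, 0, 0, fun _ hb' => absurd hb' hb⟩
  choose σ f oa ob oy hoff using hoff
  let host : Fin Δ.n → Fin Δ.n := fun v => if v ∉ D.white ∧ A v ∧ f v then M.partner v else v
  have hhost : ∀ v, host v = v ∨ (v ∉ D.white ∧ host v ∈ D.white ∧ D.graph.Adj (host v) v) := by
    intro v; by_cases hv : v ∉ D.white ∧ A v ∧ f v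
    · right; have : host v = M.partner v := if_pos hv; rw [this]
      exact ⟨hv.1, (D.color hv.2.1).2 hv.1, hv.2.1⟩
    · exact .inl (if_neg hv)
  let Q : FloorParams Δ.n :=
    { X := fun v => (P' v).1
      xr := fun v => (P' v).1
      yr := fun v => (P' v).2
      xm := fun v => if A v then (if v ∈ D.white then (L.P v).1 + oa (M.partner v) else
        (L.P v).1 + ob v) else (P' v).1
      η := fun v => if v ∉ D.white ∧ A v then (L.P v).2 + oy v else (P' v).2 }
  let F := planOfCoord D (fun e => if e.1 = e.2 then Q.xm e.1 else Q.X e.2) host hhost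
  have hFx : ∀ a : F.Node, F.xnode Q a = if a.1.1 = a.1.2 then Q.xm a.1.1 else Q.X a.1.2 :=
    fun a => rfl
  have hFkey : ∀ a a' : F.Node, F.key a.1 ≤ F.key a'.1 → F.xnode Q a ≤ F.xnode Q a' :=
    fun a a' hk => planOfCoord_le hk
  have hQH : D.height Q = H' := rfl
  have hwp : ∀ w, w ∈ D.white → A w → M.partner w ∉ D.white ∧ A (M.partner w) :=
    fun w hw hA' => ⟨(D.color (Adj.symm hA')).1 hw, (hA w).2 hA'⟩
  have hnear : F.Near L Q ρ := by
    refine ⟨hρ.le, hP1, hP1, hP2, fun v => ?_, fun v => ?_⟩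
    · show |(if A v then (if v ∈ D.white then (L.P v).1 + oa (M.partner v) else
        (L.P v).1 + ob v) else (P' v).1) - _| ≤ _
      split_ifs with h1 h2
      · have h3 := (hoff _ (hwp v h2 h1).1 (hwp v h2 h1).2).1; rw [add_sub_cancel_left]; linarith
      · rw [add_sub_cancel_left]; exact (hoff v h2 h1).2.1
      · linarith [hP1 v]
    · show |(if v ∉ D.white ∧ A v then (L.P v).2 + oy v else (P' v).2) - _| ≤ _; split_ifs with h1
      · rw [add_sub_cancel_left]; have := (hoff v h1.1 h1.2).2.2.1; nlinarith
      · have := hP2 v; nlinarith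
  have hc : F.Compatible L := by
    refine ⟨fun b => ?_, fun a a' hfl hk => ?_⟩
    · by_cases hv : b ∉ D.white ∧ A b ∧ f b
      · right; have h1 : F.host b = M.partner b := if_pos hv; rw [h1, hov]
        exact (if_pos ⟨hv.1, hv.2.1⟩).symm
      · exact .inl (if_neg hv)
    · by_contra hlt; push Not at hlt; have h1 := hκ.fst _ _ hlt.ne
      rw [abs_sub_comm, abs_of_nonneg (by linarith)] at h1; have h2 := abs_le.1 (hnear.xnode a)
      have h3 := abs_le.1 (hnear.xnode a'); have h4 := hFkey a a' hk; linarith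
  have hadm : F.Admissible Q := by
    refine ⟨fun a a' _ hk => hFkey a a' hk, fun b hb hh => ?_, fun a a' hv => ?_⟩
    · show (if A b then (if b ∈ D.white then (L.P b).1 + oa (M.partner b) else
        (L.P b).1 + ob b) else (P' b).1) = (P' b).1
      split_ifs with h1 h2
      · exact absurd h2 hb
      · have h3 : ¬ f b := by
          intro hf; have : F.host b = M.partner b := if_pos ⟨hb, h1, hf⟩; rw [this] at hh
          exact (Adj.ne h1) hh
        rw [((hoff b hb h1).2.2.2.2.1 h3).1, add_zero, hP'A b h1]
      · rfl
    · by_cases hov' : a.1.1 = L.ov a.1.2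
      · have hadj := F.adj_of_vert hv; have hw : a.1.1 ∈ D.white := (a.2.resolve_left hv.1).1
        have hb : a.1.2 ∉ D.white := (D.color hadj).1 hw
        have h3 : a' = F.hub a.1.2 := Subtype.ext (Prod.ext hv.2.1 hv.2.2.1)
        have h4 := (D.ov_cases M a.1.2).resolve_left (by
          rw [← hov, ← hov']; exact hv.1)
        rw [← hov, ← hov'] at h4; have hAb : A a.1.2 := by
          have h5 := h4.2.2.1; rw [h4.2.2.2] at h5; exact h5
        have hf : ¬ f a.1.2 := by
          intro hf; have h5 : F.host a.1.2 = M.partner a.1.2 := if_pos ⟨hb, hAb, hf⟩; apply hv.2.2.2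
          exact Subtype.ext (Prod.ext (by rw [hv.2.1, h5, h4.2.2.2]) hv.2.2.1.symm)
        have hhb : F.host a.1.2 = a.1.2 := if_neg fun h5 => hf h5.2.2
        have h5 := ((hoff a.1.2 hb hAb).2.2.2.2.1 hf).2; rw [← h4.2.2.2] at h5
        have h6 : (F.nodePos Q a').2 = (L.P a.1.2).2 + oy a.1.2 := by
          rw [h3]; unfold FloorPlan.nodePos; simp only
          rw [F.fl_hub, hhb, if_neg (show a.1.2 ∉ F.D.white from hb)]
          have : (F.hub a.1.2).1.1 = a.1.2 := hhb; rw [this]; exact if_pos ⟨hb, hAb⟩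
        have h7 : (F.nodePos Q a).2 = (L.P a.1.2).2 := by
          unfold FloorPlan.nodePos; simp only; have h8 : F.fl a.1 = a.1.1 := if_neg hv.1
          rw [h8, if_pos (show a.1.1 ∈ F.D.white from hw), hFx, if_neg hv.1]
          have h9 := hH'self a.1.1; rw [h4.2.2.2, hP'A _ ((hA _).2 hAb), hP] at h9; rw [h4.2.2.2]
          show H' _ (P' a.1.2).1 = _; rw [hP'A _ hAb]; exact h9
        rw [h6, h7, add_sub_cancel_left]; exact h5
      · exact (hnear.vert hκ (by nlinarith) hc hv hov').le
  have hmark : ∀ v, F.nodePos Q (F.markNode v) = (Q.xm v, if host v ∈ D.white then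
      H' (host v) (Q.xm v) else Q.η v) := by
    intro v; unfold FloorPlan.nodePos; rw [F.fl_markNode, hFx]
    simp only [FloorPlan.markNode, if_true]; rfl
  have hmarkN : ∀ v, ¬ A v → F.nodePos Q (F.markNode v) = P' v := by
    intro v hv; rw [hmark]; have h1 : Q.xm v = (P' v).1 := if_neg hv
    have h2 : host v = v := if_neg fun h2 => hv h2.2.1; rw [h1, h2]; split_ifs with h3
    · rw [hH'self]
    · have : Q.η v = (P' v).2 := if_neg fun h2 => hv h2.2; rw [this]
  have hmarkB : ∀ b, b ∉ D.white → A b → F.nodePos Q (F.markNode b) =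
      ((L.P b).1 + ob b, (L.P b).2 + oy b) := by
    intro b hb hAb; rw [hmark]
    have h1 : Q.xm b = (L.P b).1 + ob b := (if_pos hAb).trans (if_neg hb); rw [h1]
    have h0 := hoff b hb hAb; by_cases hf : f b
    · have h2 : host b = M.partner b := if_pos ⟨hb, hAb, hf⟩
      rw [h2, if_pos ((D.color hAb).2 hb), h0.2.2.2.1 hf]
    · have h2 : host b = b := if_neg fun h2 => hf h2.2.2; rw [h2, if_neg hb]
      have : Q.η b = (L.P b).2 + oy b := if_pos ⟨hb, hAb⟩; rw [this]
  have hmarkW : ∀ b, b ∉ D.white → A b → F.nodePos Q (F.markNode (M.partner b)) =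
      ((L.P b).1 + oa b, H' (M.partner b) ((L.P b).1 + oa b)) := by
    intro b hb hAb; have hw : M.partner b ∈ D.white := (D.color hAb).2 hb
    have h2 : host (M.partner b) = M.partner b := if_neg fun h2 => h2.1 hw
    have h1 : Q.xm (M.partner b) = (L.P b).1 + oa b := by
      show (if A (M.partner b) then _ else _) = _
      rw [if_pos ((hA b).2 hAb), if_pos hw, M.partner_partner, hP]
    rw [hmark, h1, h2, if_pos hw]
  have hdiff : ∀ b, b ∉ D.white → A b → F.nodePos Q (F.markNode b) -
      F.nodePos Q (F.markNode (M.partner b)) = if σ b then -ev b else ev b := by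
    intro b hb hAb; rw [hmarkB b hb hAb, hmarkW b hb hAb]; exact (hoff b hb hAb).2.2.2.2.2
  let τ : Fin s → Prop := fun j => A (M.slot (.y j)) ∧
    if M.slot (.y j) ∈ D.white then σ (M.slot (.z j)) else σ (M.slot (.y j))
  have hS : ∀ a, L.label (((Mark.swapOn τ).trans M.slot) a, ((Mark.swapOn τ).trans M.slot) a) =
      L.label (M.slot a, M.slot a) := by
    have key : ∀ j, A (M.slot (.y j)) → L.label (M.slot (.y j), M.slot (.y j)) =
        L.label (M.slot (.z j), M.slot (.z j)) := by
      intro j hj; have hj' : D.graph.Adj (M.slot (.z j)) (M.slot (.y j)) := by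
        simpa only [A, M.partner_y] using hj
      rw [L.label_diag, L.label_diag, ← M.partner_y, hP, hov]; refine Prod.ext ?_ rfl
      show D.ov M _ = D.ov M _; unfold FloorDiagram.ov; rw [M.partner_partner, M.partner_y]
      have h1 := D.color hj'; by_cases hw : M.slot (.y j) ∈ D.white
      · rw [if_neg (fun h2 => h2.1 hw), if_pos ⟨fun h2 => h1.1 h2 hw, hj'.symm⟩]
      · rw [if_pos ⟨hw, hj'⟩, if_neg (fun h2 => h2.1 (h1.2 hw))]
    intro a; simp only [Equiv.trans_apply]; rcases a with i | j | j
    · rfl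
    · rw [Mark.swapOn_y]; split_ifs with h1; exacts [(key j h1.1).symm, rfl]
    · rw [Mark.swapOn_z]; split_ifs with h1; exacts [key j h1.1, rfl]
  obtain ⟨Γ', hΓ', hpos⟩ := hnear.exists_isClose hκ hρκ hc hΔ hadm hS h hρη
  refine ⟨Γ', hΓ', fun j => ?_⟩; rw [hpos, hpos]; simp only [Equiv.trans_apply]
  rw [Mark.swapOn_y, Mark.swapOn_z]; by_cases hAj : A (M.slot (.y j))
  · by_cases hw : M.slot (.y j) ∈ D.white
    · have hAz : A (M.slot (.z j)) := by rw [← M.partner_y]; exact (hA _).2 hAj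
      have hb : M.slot (.z j) ∉ D.white := by
        rw [← M.partner_y]; exact (hwp _ hw hAj).1
      have h1 := hdiff _ hb hAz; rw [M.partner_z, hevz, neg_neg] at h1
      have hτ : τ j ↔ σ (M.slot (.z j)) := by simp only [τ, if_pos hw, hAj, true_and]
      rw [hτ]; split_ifs at h1 ⊢; exacts [h1, by rw [← neg_sub, h1, neg_neg]]
    · have h1 := hdiff _ hw hAj; rw [M.partner_y, hevy] at h1
      have hτ : τ j ↔ σ (M.slot (.y j)) := by simp only [τ, if_neg hw, hAj, true_and]
      rw [hτ]; split_ifs at h1 ⊢; exacts [by rw [← neg_sub, h1, neg_neg], h1]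
  · have hAz : ¬ A (M.slot (.z j)) := by rw [← M.partner_y]; exact fun h1 => hAj ((hA _).1 h1)
    have hτ : ¬ τ j := fun h2 => hAj h2.1
    rw [if_neg hτ, if_neg hτ, hmarkN _ hAj, hmarkN _ hAz, hP'y j hAj, hP'z, ← M.partner_y, hP]; simp

end Layout.Realizes

theorem isVertical_zero_iff {k : ℤ} : IsVertical (0, k) ↔ k ≠ 0 := by simp [IsVertical]

theorem dirWeight_zero (k : ℤ) : dirWeight (0, k) = k.natAbs := by simp [dirWeight]

namespace Layout.Realizes

variable {Δ : DelPezzoDegree} {D : FloorDiagram Δ} {L : Layout D} {r s : ℕ}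
  {M : Merging Δ.n r s} {Γ : TropicalMap r s} {e : Fin Γ.nv → Fin Δ.n × ℝ}

/-- The nodes which are mapped to a vertex. -/
def fiber (e : Fin Γ.nv → Fin Δ.n × ℝ) (L : Layout D) (c : Fin Γ.nv) : Finset (Fin Δ.n × Fin Δ.n) :=
  univ.filter fun a => D.IsNode a ∧ L.label a = e c

theorem mem_fiber {c : Fin Γ.nv} {a : Fin Δ.n × Fin Δ.n} :
    a ∈ fiber e L c ↔ D.IsNode a ∧ L.label a = e c := by simp [fiber]

theorem mem_elevatorWeights {Γ : TropicalMap r s} {c : Fin Γ.nv} {m : ℕ} :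
    m ∈ Γ.elevatorWeights c ↔ (∃ c', Γ.graph.Adj c c' ∧ IsVertical (Γ.dir c c') ∧
      dirWeight (Γ.dir c c') = m) ∨ ∃ d ∈ Γ.ends c, IsVertical d ∧ dirWeight d = m := by
  unfold TropicalMap.elevatorWeights; simp [and_assoc]

variable (hΔ : Δ.Valid) (h : L.Realizes M.slot Γ e) (hov : L.ov = D.ov M) (hT : L.NoTies M)
include h

theorem mark_of_label {c : Fin Γ.nv} {b : Fin Δ.n} (hc : e c = L.label (b, b)) : Γ.mark
    (M.slot.symm b) = c := by
  apply h.inj; rw [h.mark, hc]; simp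

theorem exists_vertex {a : Fin Δ.n × Fin Δ.n} (ha : D.IsNode a) :
    ∃ c, e c = L.label a := (h.range _).2 ⟨a, ha, rfl⟩

theorem exists_node (c : Fin Γ.nv) :
    ∃ a, D.IsNode a ∧ L.label a = e c := (h.range _).1 ⟨c, rfl⟩

theorem tangent_fst {t} (ht : t ∈ Γ.cellTangent) {a : Fin Δ.n × Fin Δ.n} (ha : D.IsNode a) {c :
    Fin Γ.nv} (hc : e c = L.label a) : (t.1 c).1 = (t.1 (Γ.mark (M.slot.symm a.2))).1 := by
  obtain ⟨w, b⟩ := a; by_cases hwb : w = b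
  · subst hwb; rw [h.mark_of_label hc]
  have hn : w ∈ D.white ∧ D.graph.Adj w b := ha.resolve_left hwb; by_cases hov : w = L.ov b
  · rw [h.mark_of_label (c := c) (b := b)]; rw [hc, L.label_att hwb, L.label_diag, hov]
  · have hm : e (Γ.mark (M.slot.symm b)) = L.label (b, b) := by rw [h.mark]; simp
    have hv : L.VertEdge w b (e c) (e (Γ.mark (M.slot.symm b))) :=
      ⟨hn.1, hn.2, hov, by rw [hc, L.label_att hwb], hm⟩
    have hadj : Γ.graph.Adj c (Γ.mark (M.slot.symm b)) :=
      (h.adj _ _).2 (.inr (.inr (.inl ⟨w, b, hv⟩)))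
    have := ht.2.2.1 _ _ hadj; rw [h.dir_vert _ _ _ _ hv] at this; rw [this]; simp [realDir]

theorem noTies (hsurj : Set.SurjOn Γ.evalTangent Γ.cellTangent Set.univ) : L.NoTies M := by
  intro a b ha hb hab; by_contra hne; push Not at hne; obtain ⟨a0, ha0⟩ := M.slot.surjective a.2
  obtain ⟨b0, hb0⟩ := M.slot.surjective b.2
  let g : Mark r s → ℝ × ℝ := fun m => if m = a0 ∨ m = a0.swap then (1, 0) else 0
  have hg : ∀ m, g m.swap = g m := by
    intro m; have h1 : m.swap = a0 ↔ m = a0.swap := by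
      constructor
      · rintro rfl; rw [Mark.swap_swap]
      · rintro rfl; rw [Mark.swap_swap]
    have h2 : m.swap = a0.swap ↔ m = a0 := by
      constructor
      · intro h2; rw [← Mark.swap_swap m, h2, Mark.swap_swap]
      · rintro rfl; rfl
    simp only [g, h1, h2, or_comm]
  obtain ⟨t, ht, hte⟩ := hsurj (Set.mem_univ ((fun i => g (.x i)), fun j => g (.y j)))
  have htm : ∀ m, t.1 (Γ.mark m) = g m := by
    intro m; have h1 := congrArg Prod.fst hte; have h2 := congrArg Prod.snd hte; cases m with
    | x i => exact congrFun h1 i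
    | y j => exact congrFun h2 j
    | z j =>
      rw [← ht.2.2.2 j]; have h3 : t.1 (Γ.mark (.y j)) = g (.y j) := congrFun h2 j; rw [h3]
      exact (hg (.y j)).symm
  obtain ⟨c, hc⟩ := h.exists_vertex ha; have h1 := h.tangent_fst ht ha hc
  rw [h.tangent_fst ht hb (hc.trans hab), ← ha0, ← hb0] at h1
  simp only [Equiv.symm_apply_apply, htm] at h1; rw [← ha0, ← hb0] at hne
  rw [M.partner_slot, Ne, M.slot.apply_eq_iff_eq, Ne, M.slot.apply_eq_iff_eq] at hne
  have h2 : g b0 = 0 := if_neg (by tauto); have h3 : g a0 = (1, 0) := if_pos (.inl rfl)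
  rw [h2, h3] at h1; simp at h1

include hΔ in
theorem valence_eq (c : Fin Γ.nv) : Γ.valence c = (fiber e L c).card + 2 := by
  obtain ⟨π, hπ, hπe⟩ := h.contracts hΔ L.basePlan_compatible; have h1 := hπ.valence c
  have h2 : ∀ u ∈ univ.filter (fun u => π u = c),
      ((∑ v, if L.basePlan.graph.Adj u v then 1 else 0) + (L.basePlan.ends u).card +
        {a | L.basePlan.markNode (M.slot a) = u}.ncard) = 3 := by
    intro u _; rw [FloorPlan.ncard_markNode]; exact L.basePlan.valence hΔ u
  have h3 : #{u | π u = c} = (fiber e L c).card := by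
    refine card_bij (fun u _ => u.1) ?_ ?_ ?_
    · intro u hu; simp only [mem_filter_univ] at hu
      exact mem_fiber.2 ⟨u.2, (hπe u).symm.trans (congrArg e hu)⟩
    · intro u _ v _ huv; exact Subtype.ext huv
    · intro a ha; rw [mem_fiber] at ha; refine ⟨⟨a, ha.1⟩, ?_, rfl⟩; simp only [mem_filter_univ]
      apply h.inj; exact (hπe _).trans ha.2
  have h4 : (∑ u with π u = c,
      ((∑ v, if L.basePlan.graph.Adj u v then 1 else 0) + (L.basePlan.ends u).card +
        {a | L.basePlan.markNode (M.slot a) = u}.ncard)) =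
      3 * #{u | π u = c} := by
    rw [sum_congr rfl h2, sum_const, smul_eq_mul, mul_comm]
  have h5 := h1.trans (congrArg (· + 2) h4); omega

theorem vertEdge_of_unmarked {c : Fin Γ.nv} (hc : Γ.Unmarked c) {a : Fin Δ.n × Fin Δ.n} (ha : a
    ∈ fiber e L c) : L.VertEdge a.1 a.2 (e c) (e (Γ.mark (M.slot.symm a.2))) := by
  rw [mem_fiber] at ha; obtain ⟨w, b⟩ := a; have hwb : w ≠ b := by
    rintro rfl; exact hc _ (h.mark_of_label ha.2.symm)
  have hn : w ∈ D.white ∧ D.graph.Adj w b := ha.1.resolve_left hwb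
  refine ⟨hn.1, hn.2, ?_, by rw [← ha.2, L.label_att hwb], by rw [h.mark]; simp⟩; intro hov
  refine hc _ (h.mark_of_label (b := b) ?_); have hov' : w = L.ov b := hov
  rw [← ha.2, L.label_att hwb, L.label_diag, ← hov']

theorem unmarked_vertical {c : Fin Γ.nv} (hc : Γ.Unmarked c) (c' : Fin Γ.nv) : (Γ.graph.Adj c c'
    ∧ IsVertical (Γ.dir c c')) ↔ ∃ a ∈ fiber e L c, Γ.mark (M.slot.symm a.2) = c' := by
  constructor
  · rintro ⟨hadj, hv⟩; rcases (h.dir_fst_eq_zero_iff hadj).1 hv.1 with ⟨w, b, h1⟩ | ⟨w, b, h1⟩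
    · refine ⟨(w, b), mem_fiber.2 ⟨.inr ⟨h1.1, h1.2.1⟩, ?_⟩, h.mark_of_label h1.2.2.2.2⟩
      rw [L.label_att h1.2.1.ne, h1.2.2.2.1]
    · exact absurd (h.mark_of_label h1.2.2.2.2) (hc _)
  · rintro ⟨a, ha, rfl⟩; have h1 := h.vertEdge_of_unmarked hc ha
    refine ⟨(h.adj _ _).2 (.inr (.inr (.inl ⟨_, _, h1⟩))), ?_⟩
    rw [h.dir_vert _ _ _ _ h1, isVertical_zero_iff, neg_ne_zero]; exact D.jump_ne_zero_iff.2 h1.2.1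

theorem vertical_end_mark {c : Fin Γ.nv} {d : ℤ × ℤ} (hd : d ∈ Γ.ends c) (hv : IsVertical d) : ∃
    b, b ∉ D.white ∧ L.label (b, b) = e c ∧ ((D.inEnds b ≠ 0 ∧ d = (0, -1)) ∨ (D.outEnds b ≠ 0 ∧ d =
    (0, 1))) := by
  rw [h.ends] at hd; unfold labelEnds at hd
  rw [Multiset.mem_add, Multiset.mem_add, Multiset.mem_sum] at hd
  rcases hd with (hd | hd) | ⟨b, -, hd⟩
  · have : d.1 = -1 := by split_ifs at hd <;> simp_all
    rw [hv.1] at this; omega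
  · have : d.1 = 1 := by split_ifs at hd <;> simp_all
    rw [hv.1] at this; omega
  · split_ifs at hd with h1
    · rw [Multiset.mem_add, Multiset.mem_replicate, Multiset.mem_replicate] at hd
      exact ⟨b, h1.1, h1.2, hd⟩
    · simp at hd

include hov hT

theorem elevatorWeights_unmarked {c : Fin Γ.nv} (hc : Γ.Unmarked c) : Γ.elevatorWeights c =
    (fiber e L c).val.map fun a => (D.jump a.1 a.2).natAbs := by
  unfold TropicalMap.elevatorWeights; have h1 : (Γ.ends c).filter IsVertical = 0 := by
    rw [Multiset.filter_eq_nil]; intro d hd hv; obtain ⟨b, -, h1, -⟩ := h.vertical_end_mark hd hv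
    exact hc _ (h.mark_of_label h1.symm)
  have h2 : (univ.filter fun u => Γ.graph.Adj c u ∧ IsVertical (Γ.dir c u)) =
      (fiber e L c).image fun a => Γ.mark (M.slot.symm a.2) := by
    ext c'; simp only [mem_filter_univ, mem_image]; exact h.unmarked_vertical hc c'
  have h3 : Set.InjOn (fun a : Fin Δ.n × Fin Δ.n => Γ.mark (M.slot.symm a.2)) (fiber e L c) := by
    intro a ha b hb hab; have h4 := h.vertEdge_of_unmarked hc ha
    have h5 := h.vertEdge_of_unmarked hc hb
    have h6 : e (Γ.mark (M.slot.symm a.2)) = e (Γ.mark (M.slot.symm b.2)) := congrArg e hab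
    rw [h4.2.2.2.2, h5.2.2.2.2] at h6
    refine Prod.ext ?_ (diag_inj hov hT ((D.color h4.2.1).1 h4.1) ((D.color h5.2.1).1 h5.1) h6)
    have h7 := h4.2.2.2.1; rw [h5.2.2.2.1] at h7; exact (congrArg Prod.fst h7).symm
  rw [h1, Multiset.map_zero, add_zero, h2, image_val_of_injOn h3, Multiset.map_map]
  refine Multiset.map_congr rfl fun a ha => ?_
  have h4 := h.vertEdge_of_unmarked hc (show a ∈ fiber e L c from ha); simp only [comp_apply]
  rw [h.dir_vert _ _ _ _ h4, dirWeight_zero, Int.natAbs_neg]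

theorem vertEdge_mark {b : Fin Δ.n} (hb : b ∉ D.white) {c : Fin Γ.nv} (hadj : Γ.graph.Adj
    (Γ.mark (M.slot.symm b)) c) (hv : IsVertical (Γ.dir (Γ.mark (M.slot.symm b)) c)) : L.VertEdge (e
    c).1 b (e c) (e (Γ.mark (M.slot.symm b))) := by
  have hm : e (Γ.mark (M.slot.symm b)) = L.label (b, b) := by rw [h.mark]; simp
  rcases (h.dir_fst_eq_zero_iff hadj).1 hv.1 with ⟨w, b', h1⟩ | ⟨w, b', h1⟩
  · exfalso; have h2 := h1.2.2.2.1; have hb' := (D.color h1.2.1).1 h1.1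
    rw [hm, ← L.label_att h1.2.1.ne] at h2; have h5 : L.ov b = w := by
      have := congrArg Prod.fst h2; rwa [L.label_diag, L.label_att h1.2.1.ne] at this
    have h6 := (D.ov_cases M b).resolve_left (by rw [← hov, h5]; rintro rfl; exact hb h1.1)
    rcases hT _ _ (.inl rfl) (.inr ⟨h1.1, h1.2.1⟩) h2 with h3 | h3
    · simp only at h3; exact h1.2.2.1 (by rw [h3, h5])
    · simp only at h3; rw [← h6.2.2.2] at h3; exact hb' (by rw [h3]; exact h6.2.1)
  · have h2 := h1.2.2.2.2; rw [hm] at h2; have h3 := diag_inj hov hT hb ((D.color h1.2.1).1 h1.1) h2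
    subst h3; have h4 : (e c).1 = w := by rw [h1.2.2.2.1]
    rw [h4]; exact h1

theorem elevatorWeights_white {w : Fin Δ.n} (hw : w ∈ D.white) (hadj : ¬ D.graph.Adj w
    (M.partner w)) : Γ.elevatorWeights (Γ.mark (M.slot.symm w)) = 0 := by
  have hm : e (Γ.mark (M.slot.symm w)) = L.label (w, w) := by rw [h.mark]; simp
  have hdiag : ∀ b, b ∉ D.white → L.label (b, b) ≠ L.label (w, w) := by
    intro b hb hbw; have h1 : L.ov b = w := by
      have := congrArg Prod.fst hbw; rwa [L.label_diag, L.label_diag, L.ov_white hw] at this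
    have h2 := (D.ov_cases M b).resolve_left (by rw [← hov, h1]; rintro rfl; exact hb hw)
    rw [← hov, h1] at h2; apply hadj; have h3 := h2.2.2.1
    rwa [h2.2.2.2, M.partner_partner, ← h2.2.2.2]
  rw [Multiset.eq_zero_iff_forall_notMem]; intro m hmem
  rcases mem_elevatorWeights.1 hmem with ⟨c, hc, hv, -⟩ | ⟨d, hd, hv, -⟩
  · rcases (h.dir_fst_eq_zero_iff hc).1 hv.1 with ⟨w', b, h1⟩ | ⟨w', b, h1⟩
    · have h2 := h1.2.2.2.1; rw [hm, ← L.label_att h1.2.1.ne] at h2; have h3 : w = w' := by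
        have := congrArg Prod.fst h2
        rwa [L.label_diag, L.ov_white hw, L.label_att h1.2.1.ne] at this
      subst h3; rcases hT _ _ (.inl rfl) (.inr ⟨h1.1, h1.2.1⟩) h2 with h4 | h4
      exacts [h1.2.1.ne h4.symm, hadj (h4 ▸ h1.2.1)]
    · exact hdiag b ((D.color h1.2.1).1 h1.1) (by rw [← hm, h1.2.2.2.2])
  · obtain ⟨b, hb, h1, -⟩ := h.vertical_end_mark hd hv; exact hdiag b hb (by rw [← hm, h1])

include hΔ

theorem eq_elevatorWeight {b : Fin Δ.n} (hb : b ∉ D.white) {m : ℕ} (hm : m ∈ Γ.elevatorWeights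
    (Γ.mark (M.slot.symm b))) : m = D.elevatorWeight b := by
  rcases mem_elevatorWeights.1 hm with ⟨c, hadj, hv, rfl⟩ | ⟨d, hd, hv, rfl⟩
  · have h1 := h.vertEdge_mark hov hT hb hadj hv; rw [Γ.dir_symm _ _ hadj, h.dir_vert _ _ _ _ h1]
    simp only [Prod.neg_mk, neg_zero, neg_neg, dirWeight_zero]; exact D.natAbs_jump hΔ hb h1.2.1
  · obtain ⟨b', hb', h1, h2⟩ := h.vertical_end_mark hd hv; have h3 : b' = b := by
      refine diag_inj hov hT hb' hb ?_; rw [h1, h.mark]; simp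
    subst h3; have h4 := (D.weight_eq_elevatorWeight hΔ hb).2.2
    rcases h2 with ⟨h2, rfl⟩ | ⟨h2, rfl⟩
    · rw [h4.1 h2]; rfl
    · rw [h4.2 h2]; rfl

theorem elevatorWeights_ne_zero {b : Fin Δ.n} (hb : b ∉ D.white) : Γ.elevatorWeights (Γ.mark
    (M.slot.symm b)) ≠ 0 := by
  have hm : e (Γ.mark (M.slot.symm b)) = L.label (b, b) := by rw [h.mark]; simp
  intro h0; have h1 := D.black_valence hΔ hb
  have hend : ∀ k : ℤ, k ≠ 0 → Multiset.count (0, k) (Γ.ends (Γ.mark (M.slot.symm b))) = 0 := by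
    intro k hk; rw [Multiset.count_eq_zero]; intro hd
    have := mem_elevatorWeights.2 (.inr ⟨_, hd, isVertical_zero_iff.2 hk, rfl⟩); rw [h0] at this
    simp at this
  have h2 : D.inEnds b = 0 := by
    have := (h.ends_mark hov hT hb (-1)).symm.trans (hend (-1) (by simp))
    simpa [Multiset.count_replicate] using this
  have h3 : D.outEnds b = 0 := by
    have := (h.ends_mark hov hT hb 1).symm.trans (hend 1 (by simp))
    simpa [Multiset.count_replicate] using this
  rw [h2, h3] at h1
  obtain ⟨w, hw, hne⟩ := exists_mem_ne (by omega) (L.ov b) (s := univ.filter fun w => D.graph.Adj w b)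
  simp only [mem_filter_univ] at hw; have hww := (D.color hw).2 hb
  obtain ⟨c, hc⟩ := h.exists_vertex (a := (w, b)) (.inr ⟨hww, hw⟩)
  have hv : L.VertEdge w b (e c) (e (Γ.mark (M.slot.symm b))) :=
    ⟨hww, hw, hne, by rw [hc, L.label_att hw.ne], hm⟩
  have hadj := (h.adj _ _).2 (.inr (.inr (.inl ⟨w, b, hv⟩)))
  have h4 := mem_elevatorWeights.2 (.inl ⟨c, hadj.symm, (by
    rw [Γ.dir_symm _ _ hadj.symm, h.dir_vert _ _ _ _ hv]; simp only [Prod.neg_mk, neg_zero, neg_neg]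
    exact isVertical_zero_iff.2 (D.jump_ne_zero_iff.2 hw)), rfl⟩)
  rw [h0] at h4; simp at h4

theorem elevatorWeight_mark {b : Fin Δ.n} (hb : b ∉ D.white) : Γ.elevatorWeight (Γ.mark
    (M.slot.symm b)) = D.elevatorWeight b := by
  obtain ⟨m, hm⟩ := Multiset.exists_mem_of_ne_zero (h.elevatorWeights_ne_zero hΔ hov hT hb)
  refine le_antisymm (Multiset.sup_le.2 fun m' hm' => (h.eq_elevatorWeight hΔ hov hT hb hm').le) ?_
  rw [← h.eq_elevatorWeight hΔ hov hT hb hm]; exact Multiset.le_sup hm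

end Layout.Realizes

section Branches

variable {V : Type} {T : SimpleGraph V} {v a b : V}

theorem SimpleGraph.IsAcyclic.common_neighbor_unique (hT : T.IsAcyclic) (hab : a ≠ b) {v' : V}
    (ha : T.Adj v a) (hb : T.Adj v b) (ha' : T.Adj v' a) (hb' : T.Adj v' b) : v' = v := by
  by_contra hne; obtain ⟨g, h1, h2, h3⟩ := hT.exists_cut ha.symm; have h4 : g v' := (h3 v' a ha' (by
    grind [ha.ne])).2 h1
  have h5 : g b := (h3 v' b hb' (by grind [hb.ne])).1 h4
  exact h2 ((h3 v b hb (by simp [ha.ne, hab.symm])).2 h5)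

theorem branch_adj_iff (hT : T.IsTree) (hva : T.Adj v a) {x y : V} (hxy : T.Adj x y)
    (hne : s(x, y) ≠ s(a, v)) : x ∈ branch T v a ↔ y ∈ branch T v a := by
  obtain ⟨g, h1, h2, h3⟩ := hT.2.exists_cut hva.symm
  rw [mem_branch_iff hT.1 hva h3 h1 h2, mem_branch_iff hT.1 hva h3 h1 h2]; exact h3 x y hxy hne

theorem self_mem_branch (hT : T.IsTree) (hva : T.Adj v a) : a ∈ branch T v a := by
  obtain ⟨g, h1, h2, h3⟩ := hT.2.exists_cut hva.symm; rwa [mem_branch_iff hT.1 hva h3 h1 h2]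

theorem root_notMem_branch (hT : T.IsTree) (hva : T.Adj v a) : v ∉ branch T v a := by
  obtain ⟨g, h1, h2, h3⟩ := hT.2.exists_cut hva.symm; rwa [mem_branch_iff hT.1 hva h3 h1 h2]

theorem branch_disjoint (hT : T.IsTree) (hva : T.Adj v a) (hvb : T.Adj v b) (hab : a ≠ b) {u : V}
    (hu : u ∈ branch T v a) : u ∉ branch T v b := by
  intro hu'
  have h := (reachable_iff_of_adj_iff (T := T) (g := fun x => x ∈ branch T v a ∧ x ∈ branch T v b)
    (fun x y hxy => ?_) (hT.1.preconnected u v)).1 ⟨hu, hu'⟩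
  · exact root_notMem_branch hT hva h.1
  have hne : ∀ {a b : V}, T.Adj v a → T.Adj v b → a ≠ b → s(x, y) = s(a, v) →
      x ∉ branch T v b ∧ y ∉ branch T v b := by
    intro a b hva hvb hab h; have h1 : a ∉ branch T v b := by
      rw [branch_adj_iff hT hvb hva.symm (by grind [hvb.ne])]
      exact root_notMem_branch hT hvb
    have h2 := root_notMem_branch hT hvb; grind
  by_cases h1 : s(x, y) = s(a, v)
  · have := hne hva hvb hab h1; tauto
  by_cases h2 : s(x, y) = s(b, v)
  · have := hne hvb hva hab.symm h2; tauto
  rw [branch_adj_iff hT hva hxy h1, branch_adj_iff hT hvb hxy h2]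

theorem branch_map (hT : T.IsTree) {T' : SimpleGraph V} (hT' : T'.IsTree) {φ : Equiv.Perm V}
    (hφ : ∀ x y, T'.Adj (φ x) (φ y) ↔ T.Adj x y) {w : V} (hva : T.Adj v a) (hwb : T'.Adj w b)
    (hv : φ v = w) (hab : φ a = b) (u : V) : u ∈ branch T v a ↔ φ u ∈ branch T' w b := by
  refine mem_branch_iff (g := fun u => φ u ∈ branch T' w b) hT.1 hva (fun x y hxy hne => ?_)
    (by simpa only [hab] using self_mem_branch hT' hwb)
    (by simpa only [hv] using root_notMem_branch hT' hwb) u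
  refine branch_adj_iff hT' hwb ((hφ _ _).2 hxy) fun h => hne ?_
  rw [← hv, ← hab, ← Sym2.map_mk, ← Sym2.map_mk] at h; exact Sym2.map.injective φ.injective h

theorem mark_ne_of_mem_twinVertices (hT : T.IsTree) {r s : ℕ} {m : Mark r s → V}
    {Aut : Set (Equiv.Perm V)} (hadj : ∀ φ ∈ Aut, ∀ x y, T.Adj (φ x) (φ y) ↔ T.Adj x y)
    (hm : ∀ φ ∈ Aut, RespectsMarks m m φ) {i j : Fin s} (h : m (.y i) ∈ twinVertices T m Aut j) :
    m (.y i) ≠ m (.z i) := by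
  obtain ⟨v, ⟨hne, hy, hz, φ, hφ, hyz⟩, hu⟩ := h; intro heq; have h1 : φ (m (.y i)) = m (.y i) := by
    grind [(hm φ hφ).2 i]
  have hzy : φ (m (.z j)) = m (.y j) := by
    grind [(hm φ hφ).2 j, φ.injective.eq_iff]
  have hv : φ v = v := by
    refine hT.2.common_neighbor_unique hne hy hz ?_ ?_
    · rw [← hzy]; exact (hadj φ hφ _ _).2 hz
    · rw [← hyz]; exact (hadj φ hφ _ _).2 hy
  rcases hu with hu | hu
  · have h2 := (branch_map hT hT (hadj φ hφ) hy hz hv hyz _).1 hu; rw [h1] at h2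
    exact branch_disjoint hT hy hz hne hu h2
  · have h2 := (branch_map hT hT (hadj φ hφ) hz hy hv hzy _).1 hu; rw [h1] at h2
    exact branch_disjoint hT hz hy hne.symm hu h2

end Branches

namespace FloorDiagram

variable {Δ : DelPezzoDegree} {D : FloorDiagram Δ} {r s : ℕ} {M : Merging Δ.n r s}

theorem IsIso.eq_or_partner {E : FloorDiagram Δ} {τ : Equiv.Perm (Fin Δ.n)} (h : IsIso M D E τ)
    (v : Fin Δ.n) : τ v = v ∨ τ v = M.partner v := by
  rcases M.slot_cases v with ⟨i, rfl⟩ | ⟨j, rfl⟩ | ⟨j, rfl⟩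
  · exact .inl (h.marks.1 i)
  · rw [M.partner_y]; grind [h.marks.2 j]
  · rw [M.partner_z]; grind [h.marks.2 j]

theorem ov_slot {j : Fin s} (h : ¬ D.graph.Adj (M.slot (.y j)) (M.slot (.z j))) :
    D.ov M (M.slot (.y j)) = M.slot (.y j) ∧ D.ov M (M.slot (.z j)) = M.slot (.z j) :=
  ⟨D.ov_of_not_adj (by rwa [M.partner_y, D.graph.adj_comm]),
    D.ov_of_not_adj (by rwa [M.partner_z])⟩

theorem root_white (hΔ : Δ.Valid) {j : Fin s} {w : Fin Δ.n}
    (h : IsTwinRoot D.graph M.slot (D.aut M) j w) :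
    w ∈ D.white ∧ M.slot (.y j) ∉ D.white ∧ M.slot (.z j) ∉ D.white := by
  obtain ⟨hne, hy, hz, -⟩ := h; have hw : w ∈ D.white := by
    by_contra hw; have h1 := (D.black_white_structure hΔ).1 w hw; have hlt := M.slot_lt j
    have h2 : ∀ u : Fin Δ.n, D.graph.Adj w u → u < w → D.weight u w ≠ 0 := by
      intro u hu hlt; rcases D.adj_iff.1 hu with h | h
      exacts [absurd (D.oriented _ _ h) (not_lt.2 hlt.le), h]
    have h3 : ∀ u : Fin Δ.n, D.graph.Adj w u → w < u → D.weight w u ≠ 0 := by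
      intro u hu hlt; rcases D.adj_iff.1 hu with h | h
      exacts [h, absurd (D.oriented _ _ h) (not_lt.2 hlt.le)]
    rcases lt_trichotomy (M.slot (.y j)) w with hl | hl | hl
    · have hl' : M.slot (.z j) < w := by
        rcases lt_trichotomy (M.slot (.z j)) w with hl' | hl' | hl'
        exacts [hl', absurd hl'.symm hz.ne, (M.not_between j hl hl').elim]
      have h4 : 1 < D.inDeg w := by
        unfold inDeg; rw [one_lt_card]
        exact ⟨_, by simpa using h2 _ hy hl, _, by simpa using h2 _ hz hl', hne⟩
      omega
    · exact hy.ne hl.symm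
    · have h4 : 1 < D.outDeg w := by
        unfold outDeg; rw [one_lt_card]
        exact ⟨_, by simpa using h3 _ hy hl, _, by simpa using h3 _ hz (hl.trans hlt), hne⟩
      omega
  exact ⟨hw, (D.color hy).1 hw, (D.color hz).1 hw⟩

theorem root_unique {j : Fin s} {w w' : Fin Δ.n}
    (h : IsTwinRoot D.graph M.slot (D.aut M) j w) (h' : IsTwinRoot D.graph M.slot (D.aut M) j w') :
    w' = w :=
  D.isTree.2.common_neighbor_unique h.1 h.2.1 h.2.2.1 h'.2.1 h'.2.2.1

theorem mem_twin_iff {j : Fin s} {w : Fin Δ.n} (h : IsTwinRoot D.graph M.slot (D.aut M) j w)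
    (u : Fin Δ.n) : u ∈ D.twin M j ↔ u ∈ branch D.graph w (M.slot (.y j)) ∨
      u ∈ branch D.graph w (M.slot (.z j)) := by
  constructor
  · rintro ⟨w', h', hu⟩; rw [root_unique h h'] at hu; exact hu
  · exact fun hu => ⟨w, h, hu⟩

theorem mem_twin_adj {j : Fin s} {x y : Fin Δ.n} (hxy : D.graph.Adj x y)
    (hne : ∀ w, IsTwinRoot D.graph M.slot (D.aut M) j w → s(x, y) ≠ s(M.slot (.y j), w) ∧
      s(x, y) ≠ s(M.slot (.z j), w)) : x ∈ D.twin M j ↔ y ∈ D.twin M j := by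
  by_cases h : ∃ w, IsTwinRoot D.graph M.slot (D.aut M) j w
  · obtain ⟨w, h⟩ := h; rw [mem_twin_iff h, mem_twin_iff h]
    exact or_congr (branch_adj_iff D.isTree h.2.1 hxy (hne w h).1)
      (branch_adj_iff D.isTree h.2.2.1 hxy (hne w h).2)
  · constructor
    · rintro ⟨w, hw, -⟩; exact absurd ⟨w, hw⟩ h
    · rintro ⟨w, hw, -⟩; exact absurd ⟨w, hw⟩ h

theorem ov_mem_twin_iff (hΔ : Δ.Valid) {j : Fin s} (v : Fin Δ.n) :
    D.ov M v ∈ D.twin M j ↔ v ∈ D.twin M j := by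
  rcases D.ov_cases M v with h | ⟨h1, h2, h3, h4⟩
  · rw [h]
  refine mem_twin_adj h3 fun w hw => ?_; have h5 := root_white hΔ hw; constructor
  · intro h; rcases Sym2.eq_iff.1 h with h | h
    · exact h5.2.1 (h.1 ▸ h2)
    · rw [h4, h.2, M.partner_y] at h2; exact h5.2.2 h2
  · intro h; rcases Sym2.eq_iff.1 h with h | h
    · exact h5.2.2 (h.1 ▸ h2)
    · rw [h4, h.2, M.partner_z] at h2; exact h5.2.1 h2

end FloorDiagram

namespace Layout.Realizes

variable {Δ : DelPezzoDegree} {D : FloorDiagram Δ} {L : Layout D} {r s : ℕ}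
  {M : Merging Δ.n r s} {Γ : TropicalMap r s} {e : Fin Γ.nv → Fin Δ.n × ℝ}
variable (hΔ : Δ.Valid) (h : L.Realizes M.slot Γ e) (hov : L.ov = D.ov M) (hT : L.NoTies M)
  (hP : ∀ v, L.P (M.partner v) = L.P v)
include h hov

theorem branch_iff {w b : Fin Δ.n} (hw : w ∈ D.white) (hb : L.ov b = b) (hwb : D.graph.Adj w b)
    {c : Fin Γ.nv} (hc : e c = (w, (L.P b).1)) (u : Fin Γ.nv) : u ∈ branch Γ.graph c (Γ.mark
    (M.slot.symm b)) ↔ (e u).1 ∈ branch D.graph w b := by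
  have hm : ∀ b, e (Γ.mark (M.slot.symm b)) = L.label (b, b) := fun b => by rw [h.mark]; simp
  have hadj : Γ.graph.Adj c (Γ.mark (M.slot.symm b)) :=
    (h.adj _ _).2 (.inr (.inr (.inl ⟨w, b, hw, hwb, by rw [hb]; exact hwb.ne, hc, hm b⟩)))
  refine mem_branch_iff (g := fun u => (e u).1 ∈ branch D.graph w b) Γ.isTree.1 hadj ?_ ?_ ?_ u
  · have key : ∀ x y w1 b1, s(x, y) ≠ s(Γ.mark (M.slot.symm b), c) → L.VertEdge w1 b1 (e x) (e y) →
        ((e x).1 ∈ branch D.graph w b ↔ (e y).1 ∈ branch D.graph w b) := by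
      intro x y w1 b1 hne h1; have hx : (e x).1 = w1 := by rw [h1.2.2.2.1]
      have hy : (e y).1 = L.ov b1 := by rw [h1.2.2.2.2, L.label_diag]
      rw [hx, hy]; have hb1 := (D.color h1.2.1).1 h1.1; have hbw := (D.color hwb).1 hw
      rcases D.ov_cases M b1 with h2 | h2
      · rw [← hov] at h2; rw [h2]; refine branch_adj_iff D.isTree hwb h1.2.1 fun h3 => hne ?_
        rcases Sym2.eq_iff.1 h3 with h3 | h3
        · exact absurd (h3.1 ▸ h1.1) hbw
        · obtain ⟨rfl, rfl⟩ := h3; have h4 : x = c := h.inj (by rw [hc, h1.2.2.2.1])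
          have h5 : y = Γ.mark (M.slot.symm b1) := h.inj (by rw [hm, h1.2.2.2.2])
          rw [h4, h5, Sym2.eq_swap]
      · rw [← hov] at h2; have hne' : b1 ≠ b := by
          rintro rfl; exact h2.1 (hb ▸ h2.2.1)
        have hs : ∀ {w'}, w' ∈ D.white → s(w', b1) ≠ s(b, w) := by
          intro w' hw' h3; rcases Sym2.eq_iff.1 h3 with h3 | h3
          exacts [hbw (h3.1 ▸ hw'), hne' h3.2]
        exact (branch_adj_iff D.isTree hwb h1.2.1 (hs h1.1)).trans
          (branch_adj_iff D.isTree hwb h2.2.2.1 (hs h2.2.1)).symm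
    intro x y hxy hne; rcases (h.adj _ _).1 hxy with h1 | h1 | ⟨w1, b1, h1⟩ | ⟨w1, b1, h1⟩
    · rw [h1.1]
    · rw [h1.1]
    · exact key x y w1 b1 hne h1
    · exact (key y x w1 b1 (by rwa [Sym2.eq_swap]) h1).symm
  · show (e (Γ.mark (M.slot.symm b))).1 ∈ _; rw [hm, L.label_diag, hb]
    exact self_mem_branch D.isTree hwb
  · show ¬ (e c).1 ∈ _; rw [hc]; exact root_notMem_branch D.isTree hwb

include hT hP

theorem mark_eq_mark_iff (j : Fin s) : Γ.mark (.y j) = Γ.mark (.z j) ↔ D.OnVertex M j := by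
  have := h.mark_eq_iff hov hT hP (u := M.slot (.y j)) (v := M.slot (.z j))
  simp only [Equiv.symm_apply_apply, M.partner_y, true_and] at this; rw [this]
  simp [FloorDiagram.OnVertex]

theorem not_onVertex_of_mem_twin {i j : Fin s} (hi : Γ.mark (.y i) ∈ Γ.twin j) : ¬ D.OnVertex M
    i := by
  rw [← h.mark_eq_mark_iff hov hT hP]
  exact mark_ne_of_mem_twinVertices Γ.isTree (fun φ hφ => hφ.adj) (fun φ hφ => hφ.marks) hi

include hΔ

theorem isTwinRoot_iff (j : Fin s) (c : Fin Γ.nv) : IsTwinRoot Γ.graph Γ.mark Γ.aut j c ↔ ∃ w,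
    IsTwinRoot D.graph M.slot (D.aut M) j w ∧ e c = (w, (L.P (M.slot (.y j))).1) := by
  have hmk : ∀ a, Γ.mark a = Γ.mark (M.slot.symm (M.slot a)) := fun a => by simp
  have hPz : L.P (M.slot (.z j)) = L.P (M.slot (.y j)) := by rw [← M.partner_y, hP]
  have hm : ∀ b, e (Γ.mark (M.slot.symm b)) = L.label (b, b) := fun b => by rw [h.mark]; simp
  constructor
  · rintro ⟨hne, hy, hz, φ, hφ, hyz⟩
    obtain ⟨τ, hτ, hφτ⟩ := h.exists_perm hΔ h hov hov hT hT hP hP hφ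
    have hnadj : ¬ D.graph.Adj (M.slot (.y j)) (M.slot (.z j)) := fun h1 =>
      hne ((h.mark_eq_mark_iff hov hT hP j).2 h1)
    have hτy : τ (M.slot (.y j)) = M.slot (.z j) := by
      have h1 := hφτ (M.slot (.y j))
      rw [M.slot.symm_apply_apply, hyz, hmk (.z j), h.mark_eq_iff hov hT hP] at h1
      grind [hτ.eq_or_partner (M.slot (.y j)), M.partner_y, D.graph.adj_comm]
    have hcol : M.slot (.z j) ∈ D.white ↔ M.slot (.y j) ∈ D.white := by rw [← hτy]; exact hτ.white _
    obtain ⟨hovy, hovz⟩ := hov ▸ D.ov_slot hnadj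
    have hey : e (Γ.mark (.y j)) = (M.slot (.y j), (L.P (M.slot (.y j))).1) := by
      rw [hmk, hm, L.label_diag, hovy]
    have hez : e (Γ.mark (.z j)) = (M.slot (.z j), (L.P (M.slot (.y j))).1) := by
      rw [hmk, hm, L.label_diag, hovz, hPz]
    have hslot : M.slot (.y j) ≠ M.slot (.z j) := (M.slot_lt j).ne
    by_cases hw : M.slot (.y j) ∈ D.white
    · exfalso; have hwz := hcol.2 hw
      have hvert : ∀ {u : Fin Δ.n} {a : Mark r s}, u = M.slot a → u ∈ D.white →
          M.partner u ∈ D.white → Γ.graph.Adj c (Γ.mark a) → (Γ.dir c (Γ.mark a)).1 ≠ 0 := by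
        rintro u a rfl hu hpu hadj h0; have hv : IsVertical (Γ.dir (Γ.mark a) c) := by
          rw [Γ.dir_symm _ _ hadj.symm]; refine ⟨by simpa using h0, fun h2 => h.len_smul hadj ?_⟩
          have h2' : (Γ.dir c (Γ.mark a)).2 = 0 := by simpa using h2
          simp [realDir, h0, h2']
        have h1 := mem_elevatorWeights.2 (.inl ⟨c, hadj.symm, hv, rfl⟩)
        have h2 := h.elevatorWeights_white hov hT hu fun h3 => (D.color h3).1 hu hpu
        rw [M.slot.symm_apply_apply] at h2; rw [h2] at h1; simp at h1
      have h1 := hvert rfl hw (by rw [M.partner_y]; exact hwz) hy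
      have h2 := hvert rfl hwz (by rw [M.partner_z]; exact hw) hz
      have h3 : (e c).1 = (e (Γ.mark (.y j))).1 :=
        (h.floorGraph_reachable hΔ).1 (Adj.reachable ⟨hy, h1⟩)
      have h4 : (e c).1 = (e (Γ.mark (.z j))).1 :=
        (h.floorGraph_reachable hΔ).1 (Adj.reachable ⟨hz, h2⟩)
      rw [hey] at h3; rw [hez] at h4; exact hslot (h3.symm.trans h4)
    · have hwz : M.slot (.z j) ∉ D.white := fun h1 => hw (hcol.1 h1)
      have key : ∀ {a : Mark r s}, M.slot a ∉ D.white → L.ov (M.slot a) = M.slot a →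
          Γ.graph.Adj c (Γ.mark a) → ∃ w, D.graph.Adj w (M.slot a) ∧ e c = (w, (L.P (M.slot a)).1) := by
        intro a ha hova hadj
        have hea : e (Γ.mark a) = L.label (M.slot a, M.slot a) := by rw [hmk, hm]
        have hb : (e (Γ.mark a)).1 ∉ D.white := by rw [hea, L.label_diag, hova]; exact ha
        rcases (h.adj _ _).1 hadj with h1 | h1 | ⟨w, b, h1⟩ | ⟨w, b, h1⟩
        · exact absurd (h1.1 ▸ h1.2.1) hb
        · exact absurd h1.2.1 hb
        · have h2 := h1.2.2.2.2; rw [hea] at h2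
          have h3 := diag_inj hov hT ha ((D.color h1.2.1).1 h1.1) h2; rw [← h3] at h1
          exact ⟨w, h1.2.1, h1.2.2.2.1⟩
        · rw [h1.2.2.2.1] at hb; exact absurd h1.1 hb
      obtain ⟨w, h1, h2⟩ := key hw hovy hy; obtain ⟨w', h3, h4⟩ := key hwz hovz hz
      have h5 : w = w' := by rw [h2] at h4; exact congrArg Prod.fst h4
      subst h5; exact ⟨w, ⟨hslot, h1, h3, τ, hτ, hτy⟩, h2⟩
  · rintro ⟨w, hroot, hc⟩; obtain ⟨hw, hby, hbz⟩ := D.root_white hΔ hroot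
    obtain ⟨hne, hy, hz, τ, hτ, hyz⟩ := hroot
    have hnadj : ¬ D.graph.Adj (M.slot (.y j)) (M.slot (.z j)) := fun h1 => hby ((D.color h1).2 hbz)
    obtain ⟨φ, hφ, hφτ⟩ := h.exists_isIso_of_perm h hτ (fun v => by
      rcases hτ.eq_or_partner v with h1 | h1 <;> rw [h1]; exact hP v) hov hov
    obtain ⟨hovy, hovz⟩ := hov ▸ D.ov_slot hnadj
    refine ⟨fun h1 => hnadj ((h.mark_eq_mark_iff hov hT hP j).1 h1), ?_, ?_, φ, hφ, ?_⟩
    · refine (h.adj _ _).2 (.inr (.inr (.inl ⟨w, M.slot (.y j), hw, hy, ?_, hc, ?_⟩)))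
      · rw [hovy]; exact hy.ne
      · rw [hmk, hm]
    · refine (h.adj _ _).2 (.inr (.inr (.inl ⟨w, M.slot (.z j), hw, hz, ?_, ?_, ?_⟩)))
      · rw [hovz]; exact hz.ne
      · rw [hc, hPz]
      · rw [hmk, hm]
    · have h1 := hφτ (M.slot (.y j))
      rwa [hyz, M.slot.symm_apply_apply, M.slot.symm_apply_apply] at h1

theorem mem_twin_iff (j : Fin s) (u : Fin Γ.nv) : u ∈ Γ.twin j ↔ (e u).1 ∈ D.twin M j := by
  have key : ∀ c w, IsTwinRoot D.graph M.slot (D.aut M) j w → e c = (w, (L.P (M.slot (.y j))).1) →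
      (u ∈ branch Γ.graph c (Γ.mark (.y j)) ∪ branch Γ.graph c (Γ.mark (.z j)) ↔
      (e u).1 ∈ branch D.graph w (M.slot (.y j)) ∪ branch D.graph w (M.slot (.z j))) := by
    intro c w hroot hc; obtain ⟨hw, hby, hbz⟩ := D.root_white hΔ hroot
    obtain ⟨hne, hy, hz, -⟩ := hroot
    have hnadj : ¬ D.graph.Adj (M.slot (.y j)) (M.slot (.z j)) := fun h1 => hby ((D.color h1).2 hbz)
    obtain ⟨hovy, hovz⟩ := hov ▸ D.ov_slot hnadj
    have hPz : L.P (M.slot (.z j)) = L.P (M.slot (.y j)) := by rw [← M.partner_y, hP]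
    have h1 := h.branch_iff hov hw hovy hy hc u
    have h2 := h.branch_iff hov hw hovz hz (by rw [hc, hPz]) u
    rw [M.slot.symm_apply_apply] at h1 h2; rw [Set.mem_union, Set.mem_union, h1, h2]
  constructor
  · rintro ⟨c, hroot, hu⟩; obtain ⟨w, hroot', hc⟩ := (h.isTwinRoot_iff hΔ hov hT hP j c).1 hroot
    exact ⟨w, hroot', (key c w hroot' hc).1 hu⟩
  · rintro ⟨w, hroot, hu⟩; obtain ⟨c, hc⟩ := h.exists_vertex (a := (w, M.slot (.y j)))
      (.inr ⟨(D.root_white hΔ hroot).1, hroot.2.1⟩)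
    rw [L.label_att hroot.2.1.ne] at hc
    exact ⟨c, (h.isTwinRoot_iff hΔ hov hT hP j c).2 ⟨w, hroot, hc⟩, (key c w hroot hc).2 hu⟩

theorem mark_mem_twin_iff (j : Fin s) (a : Mark r s) : Γ.mark a ∈ Γ.twin j ↔ M.slot a ∈ D.twin M
    j := by
  rw [h.mem_twin_iff hΔ hov hT hP, h.mark, L.label_diag, hov, D.ov_mem_twin_iff hΔ]

end Layout.Realizes

theorem GW.twinTree_congr {k : Type u} [Field k] {s : ℕ} (d : Fin s → kˣ) {T T' E E' : Finset (Fin s)}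
    {m m' : Fin s → ℕ} {m₀ m₀' : ℕ} (hT : T = T') (hE : E = E') (hm : ∀ i ∈ E, m i = m' i)
    (h₀ : m₀ = m₀') : GW.twinTree d T E m m₀ = GW.twinTree d T' E' m' m₀' := by
  subst hT hE h₀; unfold GW.twinTree; rw [prod_congr rfl fun i hi => by rw [hm i hi]]

namespace FloorDiagram

variable {Δ : DelPezzoDegree} (D : FloorDiagram Δ) {r s : ℕ} (M : Merging Δ.n r s)

/-- The pairs of an adjacent floor and elevator which are neither on a twin tree nor merged. -/
def freeNodes : Finset (Fin Δ.n × Fin Δ.n) := univ.filter fun a =>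
  a.1 ∈ D.white ∧ D.graph.Adj a.1 a.2 ∧ (∀ j, a.1 ∉ D.twin M j ∧ a.2 ∉ D.twin M j) ∧
    ¬ ∃ j, D.OnVertex M j ∧ (a.2 = M.slot (.y j) ∨ a.2 = M.slot (.z j))

theorem prod_edges {N : Type u} [CommMonoid N] (f : ℕ → N) :
    ∏ e ∈ univ.filter (fun e : Fin Δ.n × Fin Δ.n => D.weight e.1 e.2 ≠ 0 ∧
      ∀ v, (v = e.1 ∨ v = e.2) → (∀ j, v ∉ D.twin M j) ∧
        ¬ (v ∉ D.white ∧ ∃ j, D.OnVertex M j ∧ (v = M.slot (.y j) ∨ v = M.slot (.z j)))),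
      f (D.weight e.1 e.2) = ∏ a ∈ D.freeNodes M, f (D.jump a.1 a.2).natAbs := by
  symm; have hw : ∀ {u v : Fin Δ.n}, D.graph.Adj u v → u < v → D.weight u v ≠ 0 ∧
      D.weight u v = (D.jump u v).natAbs := by
    intro u v huv hlt; have h1 := D.weight_eq_zero_of_lt hlt.le
    refine ⟨(D.adj_iff.1 huv).resolve_right (by simp [h1]), ?_⟩; unfold jump; rw [h1]; simp
  have hsymm : ∀ u v, (D.jump u v).natAbs = (D.jump v u).natAbs := fun u v => by
    rw [D.jump_symm, Int.natAbs_neg]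
  refine prod_bij (fun a _ => if a.1 < a.2 then (a.1, a.2) else (a.2, a.1)) ?_ ?_ ?_ ?_
  · rintro ⟨w, b⟩ ha; simp only [freeNodes, mem_filter_univ] at ha; obtain ⟨h1, h2, h3, h4⟩ := ha
    have h5 : ∀ v, v = w ∨ v = b → (∀ j, v ∉ D.twin M j) ∧
        ¬ (v ∉ D.white ∧ ∃ j, D.OnVertex M j ∧ (v = M.slot (.y j) ∨ v = M.slot (.z j))) := by
      rintro v (rfl | rfl)
      exacts [⟨fun j => (h3 j).1, fun h => h.1 h1⟩, ⟨fun j => (h3 j).2, fun h => h4 h.2⟩]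
    simp only [mem_filter_univ]; split_ifs with hlt
    · exact ⟨(hw h2 hlt).1, h5⟩
    · exact ⟨(hw h2.symm (lt_of_le_of_ne (not_lt.1 hlt) h2.ne.symm)).1, fun v hv => h5 v hv.symm⟩
  · rintro ⟨w, b⟩ ha ⟨w', b'⟩ ha' h; simp only [freeNodes, mem_filter_univ] at ha ha'
    have hb := (D.color ha.2.1).1 ha.1; have hb' := (D.color ha'.2.1).1 ha'.1; simp only at h
    split_ifs at h <;> simp only [Prod.mk.injEq] at h ⊢
    exacts [h, absurd (h.1 ▸ ha.1) hb', absurd (h.2 ▸ ha.1) hb', h.symm]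
  · rintro ⟨u, v⟩ he; simp only [mem_filter_univ] at he; obtain ⟨h1, h2⟩ := he
    have hadj : D.graph.Adj u v := D.adj_iff.2 (.inl h1); have hlt := D.oriented _ _ h1
    have hu := h2 u (.inl rfl); have hv := h2 v (.inr rfl); simp only [freeNodes, mem_filter_univ]
    by_cases hw : u ∈ D.white
    · exact ⟨(u, v), ⟨hw, hadj, fun j => ⟨hu.1 j, hv.1 j⟩,
        fun h => hv.2 ⟨(D.color hadj).1 hw, h⟩⟩, by simp [hlt]⟩
    · exact ⟨(v, u), ⟨(D.color hadj.symm).2 hw, hadj.symm, fun j => ⟨hv.1 j, hu.1 j⟩,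
        fun h => hu.2 ⟨hw, h⟩⟩, by simp [hlt.le]⟩
  · rintro ⟨w, b⟩ ha; simp only [freeNodes, mem_filter_univ] at ha; split_ifs with hlt
    · rw [(hw ha.2.1 hlt).2]
    · rw [hsymm, (hw ha.2.1.symm (lt_of_le_of_ne (not_lt.1 hlt) ha.2.1.ne.symm)).2]

theorem jump_mul_jump_partner_pos {w b : Fin Δ.n} (h : D.graph.Adj w b)
    (h' : D.graph.Adj w (M.partner b)) (hne : M.partner b ≠ b) :
    0 < D.jump w b * D.jump w (M.partner b) := by
  have key : b < w ↔ M.partner b < w := by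
    have aux : ∀ j, w ≠ M.slot (.z j) → (M.slot (.y j) < w ↔ M.slot (.z j) < w) := fun j hz =>
      ⟨fun h3 => not_le.1 fun h4 => M.not_between j h3 (lt_of_le_of_ne h4 hz), (M.slot_lt j).trans⟩
    obtain ⟨j, ⟨h1, h2⟩ | ⟨h1, h2⟩⟩ := M.partner_cases hne <;> rw [h2] at h' ⊢ <;> rw [h1] at h ⊢
    exacts [aux j h'.ne, (aux j h.ne).symm]
  by_cases hlt : b < w
  · exact mul_pos ((D.jump_pos_iff h).2 hlt) ((D.jump_pos_iff h').2 (key.1 hlt))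
  · have h1 : w < b := lt_of_le_of_ne (not_lt.1 hlt) h.ne
    have h2 : w < M.partner b := lt_of_le_of_ne (not_lt.1 fun h3 => hlt (key.2 h3)) h'.ne
    exact mul_pos_of_neg_of_neg ((D.jump_neg_iff h).2 h1) ((D.jump_neg_iff h').2 h2)

end FloorDiagram

namespace Layout.Realizes

variable {Δ : DelPezzoDegree} {D : FloorDiagram Δ} {L : Layout D} {r s : ℕ}
  {M : Merging Δ.n r s} {Γ : TropicalMap r s} {e : Fin Γ.nv → Fin Δ.n × ℝ}

theorem fst_of_mem_fiber {c : Fin Γ.nv} {a a' : Fin Δ.n × Fin Δ.n} (ha : a ∈ fiber e L c)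
    (ha' : a' ∈ fiber e L c) (hne : a.1 ≠ a.2) (hne' : a'.1 ≠ a'.2) : a'.1 = a.1 := by
  rw [mem_fiber] at ha ha'; have h1 := ha'.2.trans ha.2.symm; obtain ⟨w, b⟩ := a
  obtain ⟨w', b'⟩ := a'; rw [L.label_att hne, L.label_att hne'] at h1; exact (Prod.mk.inj h1).1

theorem snd_of_mem_fiber (hT : L.NoTies M) {c : Fin Γ.nv} {a a' : Fin Δ.n × Fin Δ.n}
    (ha : a ∈ fiber e L c) (ha' : a' ∈ fiber e L c) : a'.2 = a.2 ∨ a'.2 = M.partner a.2 := by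
  rw [mem_fiber] at ha ha'; exact hT a a' ha.1 ha'.1 (ha.2.trans ha'.2.symm)

variable (hΔ : Δ.Valid) (h : L.Realizes M.slot Γ e) (hov : L.ov = D.ov M) (hT : L.NoTies M)
  (hP : ∀ v, L.P (M.partner v) = L.P v)
include hΔ h hov hT hP

theorem onVertex_iff (j : Fin s) : Γ.OnVertex j ↔ D.OnVertex M j := by
  unfold TropicalMap.OnVertex; rw [h.mark_eq_mark_iff hov hT hP]; constructor
  · exact fun h1 => h1.1
  intro h1; refine ⟨h1, ?_⟩; have key : ∀ b, b ∉ D.white → D.graph.Adj (M.partner b) b →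
      Γ.valence (Γ.mark (M.slot.symm b)) = 5 := by
    intro b hb hadj; have hw := (D.color hadj).2 hb
    have hovb : L.ov b = M.partner b := by rw [hov]; exact if_pos ⟨hb, hadj⟩
    have hm : e (Γ.mark (M.slot.symm b)) = L.label (b, b) := by rw [h.mark]; simp
    have hlab : L.label (b, b) = (M.partner b, (L.P b).1) := by rw [L.label_diag, hovb]
    rw [h.valence_eq hΔ]; have hf : fiber e L (Γ.mark (M.slot.symm b)) =
        {(b, b), (M.partner b, M.partner b), (M.partner b, b)} := by
      ext ⟨x, y⟩; simp only [mem_insert, mem_singleton, Prod.mk.injEq]; constructor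
      · intro ha; have h3 := (mem_fiber.1 ha).2; by_cases hxy : x = y
        · subst hxy
          rcases snd_of_mem_fiber hT (mem_fiber.2 ⟨.inl rfl, hm.symm⟩ : (b, b) ∈ _) ha with h2 | h2
          exacts [.inl ⟨h2, h2⟩, .inr (.inl ⟨h2, h2⟩)]
        · rw [hm, hlab, L.label_att hxy] at h3; obtain rfl : x = M.partner b := congrArg Prod.fst h3
          rcases snd_of_mem_fiber hT (mem_fiber.2 ⟨.inl rfl, hm.symm⟩ : (b, b) ∈ _) ha with h2 | h2
          exacts [.inr (.inr ⟨rfl, h2⟩), absurd h2.symm hxy]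
      · rintro (⟨rfl, rfl⟩ | ⟨rfl, rfl⟩ | ⟨rfl, rfl⟩)
        · exact mem_fiber.2 ⟨.inl rfl, hm.symm⟩
        · refine mem_fiber.2 ⟨.inl rfl, ?_⟩; rw [hm, hlab, L.label_diag, L.ov_white hw, hP]
        · refine mem_fiber.2 ⟨.inr ⟨hw, hadj⟩, ?_⟩; rw [hm, hlab, L.label_att hadj.ne]
    rw [hf, card_eq_three.2 ⟨(b, b), (M.partner b, M.partner b), (M.partner b, b), ?_, ?_, ?_, rfl⟩] <;>
      simp [hadj.ne, hadj.ne.symm]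
  by_cases hb : M.slot (.y j) ∈ D.white
  · have h2 := key (M.slot (.z j)) ((D.color h1).1 hb) (by rw [M.partner_z]; exact h1)
    rw [M.slot.symm_apply_apply] at h2; rwa [(h.mark_eq_mark_iff hov hT hP j).2 h1]
  · have h2 := key (M.slot (.y j)) hb (by rw [M.partner_y]; exact h1.symm)
    rwa [M.slot.symm_apply_apply] at h2

theorem gamma_weight {j : Fin s} (hj : D.OnVertex M j) :
    Γ.elevatorWeight (Γ.mark (.y j)) = D.weight (M.slot (.y j)) (M.slot (.z j)) := by
  have hw : D.weight (M.slot (.y j)) (M.slot (.z j)) ≠ 0 := by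
    refine (D.adj_iff.1 hj).resolve_right ?_; rw [D.weight_eq_zero_of_lt (M.slot_lt j).le]; simp
  by_cases hb : M.slot (.y j) ∈ D.white
  · have hz := (D.color hj).1 hb; have h1 := h.elevatorWeight_mark hΔ hov hT hz
    rw [M.slot.symm_apply_apply, ← (h.mark_eq_mark_iff hov hT hP j).2 hj] at h1
    rw [h1, (D.weight_eq_elevatorWeight hΔ hz).1 _ hw]
  · have h1 := h.elevatorWeight_mark hΔ hov hT hb; rw [M.slot.symm_apply_apply] at h1
    rw [h1, (D.weight_eq_elevatorWeight hΔ hb).2.1 _ hw]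

theorem isRoot_iff (j : Fin s) : Γ.IsRoot j ↔ D.IsRoot M j := by
  constructor
  · rintro ⟨c, hc⟩; obtain ⟨w, hw, -⟩ := (h.isTwinRoot_iff hΔ hov hT hP j c).1 hc; exact ⟨w, hw⟩
  · rintro ⟨w, hw⟩; obtain ⟨c, hc⟩ := h.exists_vertex (a := (w, M.slot (.y j)))
      (.inr ⟨(D.root_white hΔ hw).1, hw.2.1⟩)
    rw [L.label_att hw.2.1.ne] at hc; exact ⟨c, (h.isTwinRoot_iff hΔ hov hT hP j c).2 ⟨w, hw, hc⟩⟩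

theorem twinMult_eq {k : Type u} [Field k] (d : Fin s → kˣ)
    {j : Fin s} (hj : D.IsRoot M j) : Γ.twinMult d j = D.twinMult M d j := by
  have hmt : ∀ i, Γ.mark (.y i) ∈ Γ.twin j ↔ M.slot (.y i) ∈ D.twin M j := fun i =>
    h.mark_mem_twin_iff hΔ hov hT hP j _
  have hb : ∀ i, M.slot (.y i) ∈ D.twin M j →
      (Γ.elevatorWeights (Γ.mark (.y i)) ≠ 0 ↔ M.slot (.y i) ∉ D.white) := by
    intro i hi; have hnot := h.not_onVertex_of_mem_twin hov hT hP ((hmt i).2 hi); constructor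
    · intro h1 hw
      exact h1 (by simpa using h.elevatorWeights_white hov hT hw (by rwa [M.partner_y]))
    · intro hw; simpa using h.elevatorWeights_ne_zero hΔ hov hT hw
  have hm : ∀ i, M.slot (.y i) ∉ D.white →
      Γ.elevatorWeight (Γ.mark (.y i)) = D.elevatorWeight (M.slot (.y i)) := by
    intro i hi; simpa using h.elevatorWeight_mark hΔ hov hT hi
  have hends : ∀ i, M.slot (.y i) ∉ D.white → ((Γ.ends (Γ.mark (.y i))).filter IsVertical ≠ 0 ↔
      D.inEnds (M.slot (.y i)) + D.outEnds (M.slot (.y i)) ≠ 0) := by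
    intro i hi; have hc : ∀ k : ℤ, Multiset.count (0, k) (Γ.ends (Γ.mark (.y i))) =
        Multiset.count (0, k) (.replicate (D.inEnds (M.slot (.y i))) ((0, -1) : ℤ × ℤ) +
          .replicate (D.outEnds (M.slot (.y i))) (0, 1)) := by
      intro k; simpa only [M.slot.symm_apply_apply] using h.ends_mark hov hT hi k
    constructor
    · intro h1; obtain ⟨⟨x1, x2⟩, hx⟩ := Multiset.exists_mem_of_ne_zero h1
      rw [Multiset.mem_filter] at hx; obtain rfl : x1 = 0 := hx.2.1
      have h2 := Multiset.count_pos.2 hx.1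
      rw [hc, Multiset.count_pos, Multiset.mem_add, Multiset.mem_replicate,
        Multiset.mem_replicate] at h2
      rcases h2 with h2 | h2 <;> omega
    · intro h1 h2; rw [Multiset.filter_eq_nil] at h2
      have h3 : ∀ k : ℤ, k ≠ 0 → Multiset.count (0, k) (Γ.ends (Γ.mark (.y i))) = 0 := fun k hk =>
        Multiset.count_eq_zero.2 fun h3 => h2 _ h3 (isVertical_zero_iff.2 hk)
      have h4 := (hc 1).symm.trans (h3 1 (by simp))
      have h5 := (hc (-1)).symm.trans (h3 (-1) (by simp)); simp [Multiset.count_replicate] at h4 h5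
      omega
  have hTT : (univ.filter fun i => Γ.mark (.y i) ∈ Γ.twin j) =
      univ.filter fun i => M.slot (.y i) ∈ D.twin M j := filter_congr fun i _ => hmt i
  have hEE : ((univ.filter fun i => Γ.mark (.y i) ∈ Γ.twin j).filter
      fun i => Γ.elevatorWeights (Γ.mark (.y i)) ≠ 0) =
      (univ.filter fun i => M.slot (.y i) ∈ D.twin M j).filter
        fun i => M.slot (.y i) ∉ D.white := by
    rw [hTT]; exact filter_congr fun i hi => hb i (by simpa using hi)
  have hmE : ∀ i ∈ (univ.filter fun i => M.slot (.y i) ∈ D.twin M j).filter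
        fun i => M.slot (.y i) ∉ D.white,
      Γ.elevatorWeight (Γ.mark (.y i)) = D.elevatorWeight (M.slot (.y i)) := fun i hi =>
    hm i (mem_filter.1 hi).2
  obtain ⟨w, hw⟩ := hj; refine GW.twinTree_congr d hTT hEE (fun i hi => hmE i (hEE ▸ hi)) ?_
  congr 1
  · exact hm j (D.root_white hΔ hw).2.1
  · congr 1; rw [hEE]; exact filter_congr fun i hi => hends i (mem_filter.1 hi).2

theorem onTwinTree_iff {c : Fin Γ.nv}
    (hc : Γ.Unmarked c) {a : Fin Δ.n × Fin Δ.n} (ha : a ∈ fiber e L c) :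
    ¬ Γ.OnTwinTree c ↔ ∀ j, a.1 ∉ D.twin M j ∧ a.2 ∉ D.twin M j := by
  have hv := h.vertEdge_of_unmarked hc ha; have hec := hv.2.2.2.1; have hpw := (mem_fiber.1 ha).2
  have hb := (D.color hv.2.1).1 hv.1; have htw : ∀ j, c ∈ Γ.twin j ↔ a.1 ∈ D.twin M j := fun j => by
    rw [h.mem_twin_iff hΔ hov hT hP, hec]
  constructor
  · intro h1 j; have h2 : a.1 ∉ D.twin M j := fun h2 => h1 ⟨j, .inl ((htw j).2 h2)⟩
    refine ⟨h2, fun h3 => h2 ?_⟩; rw [FloorDiagram.mem_twin_adj hv.2.1]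
    · exact h3
    intro w hw; have hwc := D.root_white hΔ hw
    have h4 : ∀ m : Mark r s, (m = .y j ∨ m = .z j) → s(a.1, a.2) ≠ s(M.slot m, w) := by
      intro m hm hs
      have hmb : M.slot m ∉ D.white := by rcases hm with rfl | rfl; exacts [hwc.2.1, hwc.2.2]
      rcases Sym2.eq_iff.1 hs with h5 | h5
      · exact hmb (h5.1 ▸ hv.1)
      · apply h1; refine ⟨j, .inr ((h.isTwinRoot_iff hΔ hov hT hP j c).2 ⟨w, hw, ?_⟩)⟩
        rw [hec, h5.1, h5.2]; rcases hm with rfl | rfl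
        · rfl
        · rw [← M.partner_y, hP]
    exact ⟨h4 _ (.inl rfl), h4 _ (.inr rfl)⟩
  · rintro h1 ⟨j, h2 | h2⟩
    · exact (h1 j).1 ((htw j).1 h2)
    · obtain ⟨w, hw, h3⟩ := (h.isTwinRoot_iff hΔ hov hT hP j c).1 h2
      have h4 : (w, M.slot (.y j)) ∈ fiber e L c := by
        refine mem_fiber.2 ⟨.inr ⟨(D.root_white hΔ hw).1, hw.2.1⟩, ?_⟩
        rw [L.label_att hw.2.1.ne, h3]
      apply (h1 j).2; rcases snd_of_mem_fiber hT h4 ha with h5 | h5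
      · rw [h5, D.mem_twin_iff hw]; exact .inl (self_mem_branch D.isTree hw.2.1)
      · simp only [M.partner_y] at h5; rw [h5, D.mem_twin_iff hw]
        exact .inr (self_mem_branch D.isTree hw.2.2.1)

theorem adj_onVertex_iff {c : Fin Γ.nv}
    (hc : Γ.Unmarked c) {a : Fin Δ.n × Fin Δ.n} (ha : a ∈ fiber e L c) :
    (∃ j, Γ.OnVertex j ∧ Γ.graph.Adj c (Γ.mark (.y j)) ∧ IsVertical (Γ.dir c (Γ.mark (.y j)))) ↔
      ∃ j, D.OnVertex M j ∧ (a.2 = M.slot (.y j) ∨ a.2 = M.slot (.z j)) := by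
  simp only [h.onVertex_iff hΔ hov hT hP]; refine exists_congr fun j => and_congr_right fun hj => ?_
  rw [h.unmarked_vertical hc]
  have hmk : Γ.mark (.y j) = Γ.mark (M.slot.symm (M.slot (.y j))) := by simp
  constructor
  · rintro ⟨a', ha', h1⟩; rw [hmk, h.mark_eq_iff hov hT hP] at h1
    rcases snd_of_mem_fiber hT ha' ha with h2 | h2 <;> rw [h2] <;> rcases h1 with h1 | h1
    exacts [.inl h1, .inr (by rw [← M.partner_y, h1.1, M.partner_partner]),
      .inr (by rw [h1, M.partner_y]), .inl h1.1.symm]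
  · rintro (h1 | h1) <;> refine ⟨a, ha, ?_⟩ <;> rw [h1, M.slot.symm_apply_apply]
    exact ((h.mark_eq_mark_iff hov hT hP j).2 hj).symm

theorem prod_vertices {N : Type u} [CommMonoid N] (f : ℕ → N) :
    (∏ v with Γ.valence v = 3 ∧ Γ.Unmarked v ∧ ¬ Γ.OnTwinTree v ∧
      ¬ ∃ j, Γ.OnVertex j ∧ Γ.graph.Adj v (Γ.mark (.y j)) ∧ IsVertical (Γ.dir v (Γ.mark (.y j))),
    f (Γ.elevatorWeight v)) *
  ∏ v with Γ.valence v = 4 ∧ Γ.Unmarked v ∧ Γ.HasDoubleEdge v ∧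
      ¬ Γ.OnTwinTree v, ((Γ.elevatorWeights v).map f).prod =
    ∏ a ∈ D.freeNodes M, f (D.jump a.1 a.2).natAbs := by
  let U := univ.filter fun v => Γ.Unmarked v ∧ ¬ Γ.OnTwinTree v ∧
      ¬ ∃ j, Γ.OnVertex j ∧ Γ.graph.Adj v (Γ.mark (.y j)) ∧ IsVertical (Γ.dir v (Γ.mark (.y j)))
  have hcard : ∀ c, Γ.Unmarked c → (fiber e L c).card = 1 ∨ ((fiber e L c).card = 2 ∧
      ∃ w b, D.graph.Adj w b ∧ D.graph.Adj w (M.partner b) ∧ M.partner b ≠ b ∧ w ∈ D.white ∧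
        (w, b) ∈ fiber e L c ∧ (w, M.partner b) ∈ fiber e L c) := by
    intro c hc; obtain ⟨⟨w, b⟩, ha⟩ := h.exists_node c; rw [← mem_fiber] at ha
    have hv := h.vertEdge_of_unmarked hc ha
    have hsub : ∀ a' ∈ fiber e L c, a' = (w, b) ∨ a' = (w, M.partner b) := by
      intro a' ha'
      have h1 := fst_of_mem_fiber ha ha' hv.2.1.ne (h.vertEdge_of_unmarked hc ha').2.1.ne
      rcases snd_of_mem_fiber hT ha ha' with h2 | h2
      exacts [.inl (Prod.ext h1 h2), .inr (Prod.ext h1 h2)]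
    by_cases hp : (w, M.partner b) ∈ fiber e L c ∧ M.partner b ≠ b
    · right; have h1 : fiber e L c = {(w, b), (w, M.partner b)} :=
        Finset.Subset.antisymm (fun a' ha' => by simpa using hsub a' ha')
          (by simp [insert_subset_iff, ha, hp.1])
      refine ⟨by rw [h1, card_pair]; simpa using hp.2.symm, w, b, hv.2.1,
        (h.vertEdge_of_unmarked hc hp.1).2.1, hp.2, hv.1, ha, hp.1⟩
    · refine .inl (card_eq_one.2 ⟨(w, b), eq_singleton_iff_unique_mem.2 ⟨ha, fun a' ha' => ?_⟩⟩)
      refine (hsub a' ha').elim id fun h1 => by_contra fun h2 => hp ⟨h1 ▸ ha', fun h3 => h2 ?_⟩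
      rw [h1, h3]
  have hF3 : ∀ c, Γ.Unmarked c → Γ.valence c = 3 →
      f (Γ.elevatorWeight c) = ∏ a ∈ fiber e L c, f (D.jump a.1 a.2).natAbs := by
    intro c hc hval; rw [h.valence_eq hΔ] at hval
    obtain ⟨a, ha⟩ := card_eq_one.1 (show (fiber e L c).card = 1 by omega)
    unfold TropicalMap.elevatorWeight; rw [h.elevatorWeights_unmarked hov hT hc, ha]; simp
  have hF4 : ∀ c, Γ.Unmarked c →
      ((Γ.elevatorWeights c).map f).prod = ∏ a ∈ fiber e L c, f (D.jump a.1 a.2).natAbs := by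
    intro c hc; rw [h.elevatorWeights_unmarked hov hT hc, Multiset.map_map]; rfl
  have h3 : (univ.filter (fun v => Γ.valence v = 3 ∧ Γ.Unmarked v ∧ ¬ Γ.OnTwinTree v ∧
      ¬ ∃ j, Γ.OnVertex j ∧ Γ.graph.Adj v (Γ.mark (.y j)) ∧ IsVertical (Γ.dir v (Γ.mark (.y j))))) =
      U.filter fun v => Γ.valence v = 3 := by
    ext v; simp only [U, mem_filter, mem_univ, true_and]; tauto
  have h4 : (univ.filter (fun v => Γ.valence v = 4 ∧ Γ.Unmarked v ∧ Γ.HasDoubleEdge v ∧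
      ¬ Γ.OnTwinTree v)) = U.filter fun v => ¬ Γ.valence v = 3 := by
    ext v; simp only [U, mem_filter, mem_univ, true_and]; constructor
    · rintro ⟨hval, hum, -, hnt⟩; refine ⟨⟨hum, hnt, ?_⟩, by omega⟩; rw [h.valence_eq hΔ] at hval
      rcases hcard v hum with h1 | ⟨-, w, b, h1, h2, h3, hw, h4, h5⟩
      · omega
      · rw [h.adj_onVertex_iff hΔ hov hT hP hum h4]; rintro ⟨j, hj, hbj⟩
        have hb := (D.color h1).1 hw; have hpb := (D.color h2).1 hw
        obtain rfl | rfl : b = _ ∨ b = _ := hbj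
        exacts [hb ((D.color hj).2 (M.partner_y j ▸ hpb)), M.partner_z j ▸ hpb <| (D.color hj).2 hb]
    · rintro ⟨⟨hum, hnt, -⟩, hval⟩; rw [h.valence_eq hΔ] at hval ⊢
      rcases hcard v hum with h1 | ⟨h0, w, b, h1, h2, h3, hw, h4, h5⟩
      · omega
      · refine ⟨by omega, hum, ?_, hnt⟩; have hv4 := h.vertEdge_of_unmarked hum h4
        have hv5 := h.vertEdge_of_unmarked hum h5
        have ha4 := (h.unmarked_vertical hum _).2 ⟨_, h4, rfl⟩
        have ha5 := (h.unmarked_vertical hum _).2 ⟨_, h5, rfl⟩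
        refine ⟨_, _, ?_, ha4.1, ha5.1, ha4.2, ha5.2, ?_⟩
        · intro h6; have h7 := congrArg e h6; rw [hv4.2.2.2.2, hv5.2.2.2.2] at h7
          exact h3 (diag_inj hov hT ((D.color h1).1 hw) ((D.color h2).1 hw) h7).symm
        · rw [h.dir_vert _ _ _ _ hv4, h.dir_vert _ _ _ _ hv5, neg_mul_neg]
          exact D.jump_mul_jump_partner_pos M h1 h2 h3
  have hG : D.freeNodes M = U.biUnion (fiber e L) := by
    ext a; simp only [mem_biUnion, U, mem_filter_univ, FloorDiagram.freeNodes]; constructor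
    · rintro ⟨hw, hadj, htw, hon⟩; obtain ⟨w, b⟩ := a; simp only at hw hadj htw hon
      obtain ⟨c, hc⟩ := h.exists_vertex (a := (w, b)) (.inr ⟨hw, hadj⟩)
      have hf : (w, b) ∈ fiber e L c := mem_fiber.2 ⟨.inr ⟨hw, hadj⟩, hc.symm⟩
      have hb := (D.color hadj).1 hw; have hnm : ¬ D.graph.Adj (M.partner b) b := by
        intro h1; apply hon; obtain ⟨j, ⟨h2, h3⟩ | ⟨h2, h3⟩⟩ := M.partner_cases h1.ne
        · rw [h3, h2] at h1; exact ⟨j, h1.symm, .inl h2⟩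
        · rw [h3, h2] at h1; exact ⟨j, h1, .inr h2⟩
      have hum : Γ.Unmarked c := by
        intro m hm; have h1 : e c = L.label (M.slot m, M.slot m) := by rw [← hm, h.mark]
        have h2 : (M.slot m, M.slot m) ∈ fiber e L c := mem_fiber.2 ⟨.inl rfl, h1.symm⟩
        have h3 : L.ov (M.slot m) = w := by
          rw [hc, L.label_att hadj.ne, L.label_diag] at h1; exact (congrArg Prod.fst h1).symm
        rcases snd_of_mem_fiber hT hf h2 with h4 | h4 <;> simp only at h4
        · rw [h4, hov, D.ov_of_not_adj hnm] at h3; exact hadj.ne h3.symm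
        · rw [h4, hov, D.ov_of_not_adj (by rw [M.partner_partner]; exact fun h5 => hnm h5.symm)] at h3
          exact hnm (by rw [h3]; exact hadj)
      refine ⟨c, ⟨hum, ?_, ?_⟩, hf⟩
      · rw [h.onTwinTree_iff hΔ hov hT hP hum hf]; exact htw
      · rw [h.adj_onVertex_iff hΔ hov hT hP hum hf]; exact hon
    · rintro ⟨c, ⟨hum, htw, hon⟩, hf⟩; have hv := h.vertEdge_of_unmarked hum hf
      rw [h.onTwinTree_iff hΔ hov hT hP hum hf] at htw
      rw [h.adj_onVertex_iff hΔ hov hT hP hum hf] at hon; exact ⟨hv.1, hv.2.1, htw, hon⟩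
  rw [h3, h4, hG, prod_biUnion, ← prod_filter_mul_prod_filter_not U (fun v => Γ.valence v = 3)]
  · congr 1 <;> refine prod_congr rfl fun c hc => ?_ <;>
      simp only [U, mem_filter, mem_univ, true_and] at hc
    exacts [hF3 c hc.1.1 hc.2, hF4 c hc.1.1]
  · intro c _ c' _ hne; rw [onFun, Finset.disjoint_left]; intro a ha ha'; rw [mem_fiber] at ha ha'
    exact hne (h.inj (ha.2.symm.trans ha'.2))

theorem mult_eq {k : Type u} [Field k] (d : Fin s → kˣ) : Γ.mult d = D.mult M d := by
  unfold TropicalMap.mult FloorDiagram.mult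
  rw [mul_assoc _ (∏ v ∈ _, GW.natA1 k (Γ.elevatorWeight v)), h.prod_vertices hΔ hov hT hP,
    D.prod_edges M]
  congr 1; congr 1
  · congr 1
    · exact prod_congr (filter_congr fun j _ => h.isRoot_iff hΔ hov hT hP j)
        fun j hj => h.twinMult_eq hΔ hov hT hP d (mem_filter.1 hj).2
    · refine prod_congr (filter_congr fun j _ => h.onVertex_iff hΔ hov hT hP j) fun j hj => ?_
      rw [h.gamma_weight hΔ hov hT hP (mem_filter.1 hj).2]
  · refine prod_congr (filter_congr fun j _ => ?_) fun _ _ => rfl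
    simp only [h.onVertex_iff hΔ hov hT hP, h.mark_mem_twin_iff hΔ hov hT hP]

end Layout.Realizes

/-! ### Deformations of tropical stable maps -/

/-- The deformations of a parametrized graph with given directions of the edges. -/
def deformations {V : Type} (G : SimpleGraph V) (dir : V → V → ℤ × ℤ) : Submodule ℝ (V → ℝ × ℝ) where
  carrier := {w | ∀ u v, G.Adj u v → ∃ c : ℝ, w v = w u + c • realDir (dir u v)}
  add_mem' := fun {w w'} h h' u v huv => by
    obtain ⟨c, hc⟩ := h u v huv; obtain ⟨c', hc'⟩ := h' u v huv; refine ⟨c + c', ?_⟩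
    rw [Pi.add_apply, Pi.add_apply, hc, hc', add_smul]
    abel
  zero_mem' := fun _ _ _ => ⟨0, by simp⟩
  smul_mem' := fun a w h u v huv => by
    obtain ⟨c, hc⟩ := h u v huv; refine ⟨a * c, ?_⟩
    rw [Pi.smul_apply, Pi.smul_apply, hc, smul_add, mul_smul]

theorem finrank_deformations_le {V : Type} [Fintype V] {G : SimpleGraph V} (hG : G.Connected)
    {dir : V → V → ℤ × ℤ} (hdir : ∀ u v, G.Adj u v → dir u v = - dir v u) :
    Module.finrank ℝ (deformations G dir) ≤
      2 + (G.edgeFinset.filter fun e => ∃ u v, e = s(u, v) ∧ dir u v ≠ 0).card := by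
  obtain ⟨v₀⟩ := hG.nonempty
  set E := G.edgeFinset.filter fun e => ∃ u v, e = s(u, v) ∧ dir u v ≠ 0 with hE
  let f : deformations G dir →ₗ[ℝ] (ℝ × ℝ) × (E → ℝ) :=
    { toFun := fun w => (w.1 v₀, fun e =>
        ((w.1 (Quot.out e.1).2 - w.1 (Quot.out e.1).1).1 * (dir (Quot.out e.1).1 (Quot.out e.1).2).1 +
          (w.1 (Quot.out e.1).2 - w.1 (Quot.out e.1).1).2 * (dir (Quot.out e.1).1 (Quot.out e.1).2).2))
      map_add' := fun w w' => by
        ext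
        · rfl
        · rfl
        · simp only [Submodule.coe_add, Pi.add_apply, Prod.fst_sub, Prod.fst_add, Prod.snd_sub,
            Prod.snd_add]
          ring
      map_smul' := fun a w => by
        ext
        · rfl
        · rfl
        · simp only [Submodule.coe_smul, Pi.smul_apply, Prod.fst_sub, Prod.smul_fst, Prod.snd_sub,
            Prod.smul_snd, smul_eq_mul, RingHom.id_apply, Prod.smul_mk]
          ring }
  have hf : Injective f := by
    rw [← LinearMap.ker_eq_bot, LinearMap.ker_eq_bot']; intro w hw
    have h1 : w.1 v₀ = 0 := congrArg Prod.fst hw; have h2 : ∀ u v, G.Adj u v → w.1 u = w.1 v := by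
      intro u v huv; obtain ⟨c, hc⟩ := w.2 u v huv; by_cases hd : dir u v = 0
      · rw [hc, hd]; simp [realDir]
      have hmem : s(u, v) ∈ E := mem_filter.2
        ⟨mem_edgeFinset.2 huv, u, v, rfl, hd⟩
      have h3 := congrFun (congrArg Prod.snd hw) ⟨s(u, v), hmem⟩
      have h4 : s((Quot.out s(u, v)).1, (Quot.out s(u, v)).2) = s(u, v) := Quot.out_eq s(u, v)
      have key : ∀ a b, G.Adj a b → dir a b ≠ 0 →
          (w.1 b - w.1 a).1 * (dir a b).1 + (w.1 b - w.1 a).2 * (dir a b).2 = 0 → w.1 a = w.1 b := by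
        intro a b hab hd h5; obtain ⟨c, hc⟩ := w.2 a b hab; rw [hc] at h5
        simp only [add_sub_cancel_left, Prod.smul_fst, Prod.smul_snd, smul_eq_mul, realDir] at h5
        have h6 : (0 : ℝ) < ((dir a b).1 : ℝ) ^ 2 + ((dir a b).2 : ℝ) ^ 2 := by
          have : (0 : ℤ) < (dir a b).1 ^ 2 + (dir a b).2 ^ 2 := by
            by_contra h7; refine hd (Prod.ext ?_ ?_)
            · exact pow_eq_zero_iff (two_ne_zero) |>.1
                (by nlinarith [sq_nonneg (dir a b).1, sq_nonneg (dir a b).2])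
            · exact pow_eq_zero_iff (two_ne_zero) |>.1
                (by nlinarith [sq_nonneg (dir a b).1, sq_nonneg (dir a b).2])
          exact_mod_cast this
        have h7 : c * (((dir a b).1 : ℝ) ^ 2 + ((dir a b).2 : ℝ) ^ 2) = 0 := by linarith
        have h8 := (mul_eq_zero.1 h7).resolve_right h6.ne'; rw [hc, h8]; simp
      rcases Sym2.eq_iff.1 h4 with ⟨h5, h6⟩ | ⟨h5, h6⟩
      · refine key u v huv hd ?_; have := h3
        simp only [f, LinearMap.coe_mk, AddHom.coe_mk, h5, h6] at this; exact this
      · refine (key v u huv.symm (by rw [hdir v u huv.symm, neg_ne_zero]; exact hd) ?_).symm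
        have := h3; simp only [f, LinearMap.coe_mk, AddHom.coe_mk, h5, h6] at this; exact this
    refine Subtype.ext (funext fun v => ?_)
    have h3 := reachable_iff_of_adj_iff (g := fun a => w.1 a = 0)
      (fun a b hab => by simp only [h2 a b hab]) (hG.preconnected v₀ v)
    exact h3.1 h1
  have h1 := LinearMap.finrank_le_finrank_of_injective hf
  have h2 : Module.finrank ℝ ((ℝ × ℝ) × (E → ℝ)) = 2 + E.card := by
    rw [Module.finrank_prod, Module.finrank_prod, Module.finrank_fintype_fun_eq_card,
      Module.finrank_self, Fintype.card_coe]
  omega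

/-- Combinatorial types of marked trees with directions of edges. -/
abbrev CombType (r s : ℕ) : Type :=
  Σ N : ℕ, SimpleGraph (Fin N) × (Fin N → Fin N → ℤ × ℤ) × (Mark r s → Fin N)

instance (r s : ℕ) : Countable (CombType r s) := by
  unfold CombType; infer_instance

/-- The differences of the positions of the marked points `y_j` and `z_j`. -/
def markDifference {r s : ℕ} {V : Type} (mark : Mark r s → V) : (V → ℝ × ℝ) →ₗ[ℝ] (Fin s → ℝ × ℝ) where
  toFun w j := w (mark (.y j)) - w (mark (.z j))
  map_add' w w' := by ext j <;> simp <;> ring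
  map_smul' a w := by ext j <;> simp <;> ring

namespace TropicalMap

variable {r s : ℕ}

theorem InMC.exists_transversal {Γ : TropicalMap r s} (h : Γ.InMC) {B η : ℝ} (hη : 0 < η) :
    ∃ Γ' : TropicalMap r s, IsClose η Γ' Γ ∧
      (∀ j, B * |(Γ'.pos (Γ'.mark (.y j))).1 - (Γ'.pos (Γ'.mark (.z j))).1| <
        (Γ'.pos (Γ'.mark (.z j))).2 - (Γ'.pos (Γ'.mark (.y j))).2) ∧
      ∀ g : Fin s → ℝ × ℝ, ∃ w ∈ deformations Γ'.graph Γ'.dir,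
        ∀ j, w (Γ'.mark (.y j)) - w (Γ'.mark (.z j)) = g j := by
  obtain ⟨ρ, hρ, hex⟩ := h.2 η hη; let W : CombType r s → Submodule ℝ (Fin s → ℝ × ℝ) := fun τ =>
    (deformations τ.2.1 τ.2.2.1).map (markDifference τ.2.2.2)
  let N : Set (Fin s → ℝ × ℝ) := ⋃ τ : {τ // W τ ≠ ⊤}, (W τ.1 : Set (Fin s → ℝ × ℝ))
  have hN : MeasureTheory.volume N = 0 :=
    MeasureTheory.measure_iUnion_null fun τ =>
      MeasureTheory.Measure.addHaar_submodule MeasureTheory.volume _ τ.2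
  let U : Set (Fin s → ℝ × ℝ) := ⋂ j, {ε | ‖ε j‖ < ρ ∧ B * |(ε j).1| < -(ε j).2}
  have hU : IsOpen U := isOpen_iInter_of_finite fun j =>
    (isOpen_lt (f := fun ε : Fin s → ℝ × ℝ => ‖ε j‖) (g := fun _ => ρ)
      (by fun_prop) (by fun_prop)).and
    (isOpen_lt (f := fun ε : Fin s → ℝ × ℝ => B * |(ε j).1|) (g := fun ε => -(ε j).2)
      (by fun_prop) (by fun_prop))
  have hU' : U.Nonempty := by
    refine ⟨fun _ => (0, -(ρ / 2)), Set.mem_iInter.2 fun j => ⟨?_, ?_⟩⟩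
    · show ‖((0 : ℝ), -(ρ / 2))‖ < ρ
      rw [Prod.norm_mk, norm_zero, norm_neg, Real.norm_eq_abs, abs_of_pos (half_pos hρ)]
      exact max_lt hρ (half_lt_self hρ)
    · simp [hρ]
  obtain ⟨ε, hε, hεN⟩ : ∃ ε ∈ U, ε ∉ N := by
    by_contra! hcon
    exact (hU.measure_pos MeasureTheory.volume hU').ne' (MeasureTheory.measure_mono_null hcon hN)
  have hε' := Set.mem_iInter.1 hε; obtain ⟨Γ', hclose, hΓ'⟩ := hex ε fun j => (hε' j).1
  refine ⟨Γ', hclose, fun j => ?_, fun g => ?_⟩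
  · have h1 := (hε' j).2; rw [← hΓ' j] at h1; simpa using h1
  · let τ : CombType r s := ⟨Γ'.nv, Γ'.graph, Γ'.dir, Γ'.mark⟩
    have h1 : ε ∈ W τ := ⟨Γ'.pos, fun u v huv => ⟨_, Γ'.affine u v huv⟩, funext hΓ'⟩
    have h2 : W τ = ⊤ := by
      by_contra h2; exact hεN (Set.mem_iUnion.2 ⟨⟨τ, h2⟩, h1⟩)
    have h3 : g ∈ W τ := h2 ▸ Submodule.mem_top; obtain ⟨w, hw, hwg⟩ := h3
    exact ⟨w, hw, fun j => congrFun hwg j⟩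

/-- A regular tropical stable map: all edges have nonzero direction, all vertices are trivalent, and the
evaluation of deformations at the marked points is bijective. -/
structure Rigid (Γ : TropicalMap r s) : Prop where
  dir_ne : ∀ u v, Γ.graph.Adj u v → Γ.dir u v ≠ 0
  trivalent : ∀ v, Γ.valence v = 3
  eq_zero : ∀ w ∈ deformations Γ.graph Γ.dir, (∀ a, w (Γ.mark a) = 0) → w = 0
  exists_eq : ∀ f : Mark r s → ℝ × ℝ, ∃ w ∈ deformations Γ.graph Γ.dir, ∀ a, w (Γ.mark a) = f a
  card_nv : Γ.nv + 1 = 2 * (r + 2 * s)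

theorem sum_valence (Γ : TropicalMap r s) :
    ∑ v, Γ.valence v + 2 = 2 * Γ.nv + Multiset.card Γ.degree + (r + 2 * s) := by
  have h1 : ∑ v, (Γ.graph.neighborSet v).ncard + 2 = 2 * Γ.nv := by
    have h2 := Γ.graph.sum_degrees_eq_twice_card_edges; have h3 := Γ.isTree.card_edgeFinset
    rw [Fintype.card_fin] at h3
    have h4 : ∀ v, (Γ.graph.neighborSet v).ncard = Γ.graph.degree v := fun v => by
      rw [← card_neighborSet_eq_degree, Set.ncard_eq_toFinset_card', Set.toFinset_card]
    rw [sum_congr rfl fun v _ => h4 v, h2]; omega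
  have h2 : ∑ v, Multiset.card (Γ.ends v) = Multiset.card Γ.degree :=
    (map_sum Multiset.cardHom _ _).symm
  have h3 : ∑ v, {a | Γ.mark a = v}.ncard = r + 2 * s := by
    rw [← Mark.card r s, ← card_univ,
      card_eq_sum_card_fiberwise (f := Γ.mark) (t := univ) (fun _ _ => mem_univ _)]
    refine sum_congr rfl fun v _ => ?_; rw [Set.ncard_eq_toFinset_card']; congr 1; ext; simp
  unfold valence; rw [sum_add_distrib, sum_add_distrib]; omega

theorem rigid_of_surjective {Γ : TropicalMap r s} (hdeg : Multiset.card Γ.degree = r + 2 * s + 1)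
    (h : ∀ f : Mark r s → ℝ × ℝ, ∃ w ∈ deformations Γ.graph Γ.dir, ∀ a, w (Γ.mark a) = f a) :
    Γ.Rigid := by
  let ev : deformations Γ.graph Γ.dir →ₗ[ℝ] (Mark r s → ℝ × ℝ) :=
    { toFun := fun w a => w.1 (Γ.mark a)
      map_add' := fun _ _ => rfl
      map_smul' := fun _ _ => rfl }
  have hev : Surjective ev := fun f => by
    obtain ⟨w, hw, hwf⟩ := h f; exact ⟨⟨w, hw⟩, funext hwf⟩
  have h1 : Module.finrank ℝ (Mark r s → ℝ × ℝ) = 2 * (r + 2 * s) := by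
    rw [Module.finrank_pi_fintype]; simp [Module.finrank_prod, Mark.card]; ring
  have h2 := LinearMap.finrank_le_finrank_of_surjective hev
  have h3 : Module.finrank ℝ (deformations Γ.graph Γ.dir) ≤
      2 + (Γ.graph.edgeFinset.filter fun e => ∃ u v, e = s(u, v) ∧ Γ.dir u v ≠ 0).card := by
    convert finrank_deformations_le Γ.isTree.1 Γ.dir_symm
  have h4 := Γ.isTree.card_edgeFinset; rw [Fintype.card_fin] at h4
  have h5 := card_filter_le Γ.graph.edgeFinset fun e => ∃ u v, e = s(u, v) ∧ Γ.dir u v ≠ 0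
  have h6 := Γ.sum_valence
  have h7 : ∑ _v : Fin Γ.nv, 3 ≤ ∑ v, Γ.valence v := sum_le_sum fun v _ => Γ.stable v
  have h8 : ∑ _v : Fin Γ.nv, 3 = 3 * Γ.nv := by simp [mul_comm]
  refine ⟨fun u v huv => ?_, fun v => ?_, fun w hw hw0 => ?_, h, by omega⟩
  · have h9 : Γ.graph.edgeFinset.filter (fun e => ∃ u v, e = s(u, v) ∧ Γ.dir u v ≠ 0) =
        Γ.graph.edgeFinset := eq_of_subset_of_card_le (filter_subset _ _) (by omega)
    have h10 : s(u, v) ∈ Γ.graph.edgeFinset := mem_edgeFinset.2 huv; rw [← h9] at h10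
    obtain ⟨u', v', he, hd⟩ := (mem_filter.1 h10).2
    rcases Sym2.eq_iff.1 he with ⟨rfl, rfl⟩ | ⟨rfl, rfl⟩
    · exact hd
    · rw [Γ.dir_symm _ _ huv, neg_ne_zero]; exact hd
  · have h9 : ∑ _v : Fin Γ.nv, 3 = ∑ v, Γ.valence v := by omega
    exact ((sum_eq_sum_iff_of_le fun v _ => Γ.stable v).1 h9 v (mem_univ _)).symm
  · have h9 : Injective ev :=
      (LinearMap.injective_iff_surjective_of_finrank_eq_finrank (by omega)).2 hev
    have h10 : ev ⟨w, hw⟩ = ev 0 := funext hw0; exact congrArg Subtype.val (h9 h10)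

theorem IsClose.degree_eq {Γ Γ' : TropicalMap r s} {η : ℝ} (h : IsClose η Γ' Γ) :
    Γ'.degree = Γ.degree := by
  obtain ⟨π, -, -, -, h1, -⟩ := h; unfold degree; rw [sum_congr rfl fun v _ => h1 v]
  exact (sum_fiberwise _ _ _).symm

theorem exists_rigid {Γ : TropicalMap r s} (h : Γ.InMC)
    (hsurj : Set.SurjOn Γ.evalTangent Γ.cellTangent Set.univ)
    (hdeg : Multiset.card Γ.degree = r + 2 * s + 1) {B η : ℝ} (hη : 0 < η) :
    ∃ Γ' : TropicalMap r s, IsClose η Γ' Γ ∧ Γ'.Rigid ∧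
      (∀ j, B * |(Γ'.pos (Γ'.mark (.y j))).1 - (Γ'.pos (Γ'.mark (.z j))).1| <
        (Γ'.pos (Γ'.mark (.z j))).2 - (Γ'.pos (Γ'.mark (.y j))).2) := by
  obtain ⟨Γ', hclose, hcone, hδ⟩ := h.exists_transversal (B := B) hη
  refine ⟨Γ', hclose, rigid_of_surjective (hclose.degree_eq ▸ hdeg) fun f => ?_, hcone⟩
  obtain ⟨π, -, hadj, -, -, hmark, -⟩ := hclose
  obtain ⟨w, hw, hwδ⟩ := hδ fun j => f (.y j) - f (.z j)
  obtain ⟨t, ht, htf⟩ := hsurj (Set.mem_univ (fun i => f (.x i) - w (Γ'.mark (.x i)),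
    fun j => f (.y j) - w (Γ'.mark (.y j))))
  refine ⟨w + t.1 ∘ π, Submodule.add_mem _ hw fun u v huv => ?_, ?_⟩
  · by_cases hπ : π u = π v
    · exact ⟨0, by simp [hπ]⟩
    · obtain ⟨h1, h2, -⟩ := hadj u v huv hπ
      exact ⟨t.2 (π u) (π v), by rw [h2]; exact ht.2.2.1 _ _ h1⟩
  · have hx : ∀ i, t.1 (Γ.mark (.x i)) = f (.x i) - w (Γ'.mark (.x i)) :=
      fun i => congrFun (congrArg Prod.fst htf) i
    have hy : ∀ j, t.1 (Γ.mark (.y j)) = f (.y j) - w (Γ'.mark (.y j)) :=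
      fun j => congrFun (congrArg Prod.snd htf) j
    rintro (i | j | j)
    · rw [Pi.add_apply, comp, hmark, hx]; abel
    · rw [Pi.add_apply, comp, hmark, hy]; abel
    · rw [Pi.add_apply, comp, hmark, ← ht.2.2.2 j, hy]; have h1 := hwδ j
      rw [sub_eq_sub_iff_add_eq_add] at h1
      have h2 : w (Γ'.mark (.z j)) + f (.y j) = f (.z j) + w (Γ'.mark (.y j)) := by
        rw [add_comm, ← h1, add_comm]
      rw [add_sub_assoc', h2, add_sub_cancel_right]

end TropicalMap

/-! ### Local structure of rigid tropical stable maps -/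

theorem Finset.sum_antisymm {V : Type} {F : V → V → ℤ} (hF : ∀ u v, F u v = - F v u) (S : Finset V) :
    ∑ u ∈ S, ∑ v ∈ S, F u v = 0 := by
  have h1 : ∑ u ∈ S, ∑ v ∈ S, F u v = - ∑ u ∈ S, ∑ v ∈ S, F u v := by
    conv_lhs => rw [sum_comm]
    simp only [← sum_neg_distrib]; exact sum_congr rfl fun u _ => sum_congr rfl fun v _ => hF v u
  omega

theorem Finset.sum_antisymm_closed {V : Type} [Fintype V] {F : V → V → ℤ} (hF : ∀ u v, F u v = - F v u)
    {S : Finset V} (hS : ∀ u ∈ S, ∀ v ∉ S, F u v = 0) : ∑ u ∈ S, ∑ v, F u v = 0 := by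
  rw [← Finset.sum_antisymm hF S]; refine sum_congr rfl fun u hu => ?_
  exact (sum_subset (subset_univ S) fun v _ hv => hS u hu v hv).symm

theorem Finset.sum_antisymm_cut {V : Type} [Fintype V] {F : V → V → ℤ} (hF : ∀ u v, F u v = - F v u)
    {S : Finset V} {u₀ v₀ : V} (hu : u₀ ∈ S) (hv : v₀ ∉ S)
    (hS : ∀ u ∈ S, ∀ v ∉ S, ¬ (u = u₀ ∧ v = v₀) → F u v = 0) :
    ∑ u ∈ S, ∑ v, F u v = F u₀ v₀ := by
  have h1 : ∀ u, ∑ v, F u v = ∑ v ∈ S, F u v + ∑ v ∈ Sᶜ, F u v := fun u =>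
    (sum_add_sum_compl S _).symm
  simp only [h1, sum_add_distrib]
  rw [Finset.sum_antisymm hF S, zero_add, sum_eq_single_of_mem u₀ hu,
    sum_eq_single_of_mem v₀ (mem_compl.2 hv)]
  · exact fun v hv' hne => hS _ hu v (mem_compl.1 hv') fun h => hne h.2
  · exact fun u hu' hne => sum_eq_zero fun v hv' =>
      hS u hu' v (mem_compl.1 hv') fun h => hne h.1

theorem Multiset.filter_sign (m : Multiset (ℤ × ℤ)) : m.filter (fun a => a.1 < 0) +
    m.filter (fun a => 0 < a.1) + m.filter (fun a => a.1 = 0) = m := by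
  ext x; simp only [Multiset.count_add, Multiset.count_filter]
  rcases lt_trichotomy x.1 0 with h | h | h
  · simp [h, h.not_gt, h.ne]
  · simp [h]
  · simp [h, h.not_gt, h.ne']

theorem Multiset.card_filter_sign (m : Multiset (ℤ × ℤ)) :
    (m.filter fun a => 0 < a.1).card + (m.filter fun a => a.1 < 0).card +
      (m.filter fun a => a.1 = 0).card = m.card := by
  conv_rhs => rw [← m.filter_sign, Multiset.card_add, Multiset.card_add]
  omega

theorem Multiset.sum_sign (m : Multiset (ℤ × ℤ)) : (m.map fun a => a.1.sign).sum =
    (m.filter fun a => 0 < a.1).card - (m.filter fun a => a.1 < 0).card := by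
  induction m using Multiset.induction_on with
  | empty => simp
  | cons a m ih =>
    rw [Multiset.map_cons, Multiset.sum_cons, ih]; rcases lt_trichotomy a.1 0 with h | h | h
    · simp [h, h.not_gt, Int.sign_eq_neg_one_of_neg h]; ring
    · simp [h]
    · simp [h, h.not_gt, Int.sign_eq_one_of_pos h]; ring

theorem Multiset.eq_zero_of_sum_eq_zero {m : Multiset ℤ} (h : m.sum = 0) (h' : ∀ a ∈ m, a ≤ 0) :
    ∀ a ∈ m, a = 0 := by
  intro a ha; obtain ⟨m', rfl⟩ := Multiset.exists_cons_of_mem ha; rw [Multiset.sum_cons] at h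
  have h1 : m'.sum ≤ 0 := by
    have := Multiset.sum_le_card_nsmul m' 0 fun x hx => h' x (Multiset.mem_cons_of_mem hx)
    simpa using this
  have h2 := h' a ha; omega

theorem Multiset.abs_sum_map_le {f : ℤ × ℤ → ℤ} (m : Multiset (ℤ × ℤ)) (h : ∀ a ∈ m, |f a| ≤ 1) :
    |(m.map f).sum| ≤ m.card := by
  induction m using Multiset.induction_on with
  | empty => simp
  | cons a m ih =>
    rw [Multiset.map_cons, Multiset.sum_cons, Multiset.card_cons]
    have h4 := ih fun b hb => h b (Multiset.mem_cons_of_mem hb)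
    have h5 := h a (Multiset.mem_cons_self _ _); have h6 := abs_add_le (f a) (m.map f).sum
    push_cast; omega

theorem SimpleGraph.IsTree.card_components_add {V : Type} [Fintype V] {T A B : SimpleGraph V} (hT : T.IsTree)
    (hAB : ∀ u v, T.Adj u v ↔ A.Adj u v ∨ B.Adj u v) (hd : ∀ u v, A.Adj u v → ¬ B.Adj u v) :
    Nat.card A.ConnectedComponent + Nat.card B.ConnectedComponent = Fintype.card V + 1 := by
  rw [Nat.card_eq_fintype_card, Nat.card_eq_fintype_card]
  have key : ∀ A : SimpleGraph V, (∀ u v, A.Adj u v → T.Adj u v) →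
      2 * Fintype.card A.ConnectedComponent =
        (∑ u, ∑ v, if T.Adj u v ∧ ¬ A.Adj u v then 1 else 0) + 2 := by
    intro A hA; let π : V → A.ConnectedComponent := A.connectedComponentMk
    have hπ : ∀ u v, π u = π v ↔ A.Reachable u v := fun u v => ConnectedComponent.eq
    let G : SimpleGraph A.ConnectedComponent :=
      { Adj := fun c c' => c ≠ c' ∧ ∃ u v, π u = c ∧ π v = c' ∧ T.Adj u v
        symm := ⟨fun c c' ⟨h, u, v, hu, hv, huv⟩ => ⟨h.symm, v, u, hv, hu, huv.symm⟩⟩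
        loopless := ⟨fun c h => h.1 rfl⟩ }
    have hc : IsContraction T G π := by
      refine ⟨fun c => ?_, fun u v huv hne => ⟨hne, u, v, rfl, rfl, huv⟩, fun c c' h => h.2⟩
      obtain ⟨u, hu⟩ := c.exists_rep; exact induce_fiber_connected hA hπ c ⟨u, hu⟩
    have hG := hc.isTree hT; have h1 := hG.card_edgeFinset
    have h2 := G.sum_degrees_eq_twice_card_edges
    have h3 : ∀ c, G.degree c = ∑ u, ∑ v, if π u = c ∧ π v ≠ c ∧ T.Adj u v then 1 else 0 := by
      intro c; have h4 := hc.sum_adj hT (fun _ _ => 1) (fun _ _ => 1) (fun _ _ _ _ => rfl) c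
      rw [← card_neighborFinset_eq_degree]; refine Eq.trans ?_ h4
      have h6 : G.neighborFinset c = univ.filter (G.Adj c) := by ext x; simp
      rw [h6, card_filter]; congr!
    have h4 : ∀ u v, (∑ c, if π u = c ∧ π v ≠ c ∧ T.Adj u v then 1 else 0) =
        if T.Adj u v ∧ ¬ A.Adj u v then 1 else 0 := by
      intro u v; rw [sum_eq_single (π u) (fun c _ hne => if_neg fun h => hne h.1.symm) (by simp)]
      refine if_congr ?_ rfl rfl
      refine ⟨fun ⟨_, h5, h6⟩ => ⟨h6, fun h7 => h5 ((hπ _ _).2 h7.reachable.symm)⟩, ?_⟩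
      · rintro ⟨h5, h6⟩; refine ⟨rfl, fun h7 => ?_, h5⟩
        obtain ⟨g, hg, hg', hgg⟩ := hT.2.exists_cut h5
        have h8 := reachable_iff_of_adj_iff (T := A) (g := g) (fun a b hab => hgg a b (hA _ _ hab) ?_)
          ((hπ _ _).1 h7)
        · exact hg' (h8.2 hg)
        · intro he; rcases Sym2.eq_iff.1 he with ⟨rfl, rfl⟩ | ⟨rfl, rfl⟩
          exacts [h6 hab, h6 hab.symm]
    have h5 : ∑ c, G.degree c = ∑ u, ∑ v, if T.Adj u v ∧ ¬ A.Adj u v then 1 else 0 := by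
      rw [sum_congr rfl fun c _ => h3 c, sum_comm]; refine sum_congr rfl fun u _ => ?_
      rw [sum_comm]; exact sum_congr rfl fun v _ => h4 u v
    omega
  have h1 := key A fun u v h => (hAB u v).2 (.inl h)
  have h2 := key B fun u v h => (hAB u v).2 (.inr h)
  have h3 : (∑ u, ∑ v, if T.Adj u v ∧ ¬ A.Adj u v then 1 else 0) +
      (∑ u, ∑ v, if T.Adj u v ∧ ¬ B.Adj u v then 1 else 0) = ∑ u, T.degree u := by
    rw [← sum_add_distrib]; refine sum_congr rfl fun u _ => ?_
    rw [← sum_add_distrib, ← card_neighborFinset_eq_degree, card_eq_sum_ones]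
    have h4 : ∀ v, ((if T.Adj u v ∧ ¬ A.Adj u v then 1 else 0) +
        if T.Adj u v ∧ ¬ B.Adj u v then 1 else 0) = if T.Adj u v then 1 else 0 := by
      intro v; have := hAB u v; have := hd u v
      by_cases hA : A.Adj u v <;> by_cases hB : B.Adj u v <;> simp_all
    rw [sum_congr rfl fun v _ => h4 v, ← sum_filter]; refine sum_congr ?_ fun _ _ => rfl
    ext x; simp
  have h4 := T.sum_degrees_eq_twice_card_edges; have h5 := hT.card_edgeFinset; omega

namespace TropicalMap

variable {r s : ℕ} (Γ : TropicalMap r s)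

/-- The vertical edges. -/
def elevatorGraph : SimpleGraph (Fin Γ.nv) where
  Adj c c' := Γ.graph.Adj c c' ∧ (Γ.dir c c').1 = 0
  symm := ⟨fun c c' h => ⟨h.1.symm, by rw [Γ.dir_symm _ _ h.1.symm]; simpa using h.2⟩⟩
  loopless := ⟨fun c h => Γ.graph.loopless.irrefl c h.1⟩

/-- The directions of the bounded edges and ends at a vertex. -/
def star (v : Fin Γ.nv) : Multiset (ℤ × ℤ) :=
  (univ.filter (Γ.graph.Adj v)).val.map (Γ.dir v) + Γ.ends v

def rightDeg (v : Fin Γ.nv) : ℕ := ((Γ.star v).filter fun a => 0 < a.1).card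

def leftDeg (v : Fin Γ.nv) : ℕ := ((Γ.star v).filter fun a => a.1 < 0).card

def vertDeg (v : Fin Γ.nv) : ℕ := ((Γ.star v).filter fun a => a.1 = 0).card

variable {Γ}

theorem mem_star {v : Fin Γ.nv} {a : ℤ × ℤ} :
    a ∈ Γ.star v ↔ (∃ u, Γ.graph.Adj v u ∧ Γ.dir v u = a) ∨ a ∈ Γ.ends v := by
  simp [star]

theorem sum_star_map {M : Type} [AddCommMonoid M] (v : Fin Γ.nv) (g : ℤ × ℤ → M) :
    ((Γ.star v).map g).sum =
      (∑ u, if Γ.graph.Adj v u then g (Γ.dir v u) else 0) + ((Γ.ends v).map g).sum := by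
  rw [star, Multiset.map_add, Multiset.sum_add, Multiset.map_map, ← sum_filter]; rfl

theorem sum_star (v : Fin Γ.nv) : (Γ.star v).sum = 0 := by
  have h1 := sum_star_map (Γ := Γ) v id; rw [Multiset.map_id, Multiset.map_id] at h1
  have h2 := Γ.balanced v; rw [finsum_neighborSet] at h2; rw [h1]; exact h2

theorem sum_star_fst (v : Fin Γ.nv) : ((Γ.star v).map Prod.fst).sum = 0 :=
  (map_multiset_sum (AddMonoidHom.fst ℤ ℤ) _).symm.trans (congrArg Prod.fst (sum_star v))

theorem sum_star_snd (v : Fin Γ.nv) : ((Γ.star v).map Prod.snd).sum = 0 :=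
  (map_multiset_sum (AddMonoidHom.snd ℤ ℤ) _).symm.trans (congrArg Prod.snd (sum_star v))

theorem card_star (v : Fin Γ.nv) : (Γ.star v).card + {a | Γ.mark a = v}.ncard = Γ.valence v := by
  rw [star, valence, ncard_neighborSet, Multiset.card_add, Multiset.card_map, ← card_def,
    card_filter]

theorem deg_sum (v : Fin Γ.nv) :
    Γ.rightDeg v + Γ.leftDeg v + Γ.vertDeg v = (Γ.star v).card :=
  Multiset.card_filter_sign _

theorem rightDeg_eq_zero_iff (v : Fin Γ.nv) : Γ.rightDeg v = 0 ↔ Γ.leftDeg v = 0 := by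
  unfold rightDeg leftDeg
  rw [Multiset.card_eq_zero, Multiset.card_eq_zero, Multiset.filter_eq_nil, Multiset.filter_eq_nil]
  constructor
  · intro h a ha; have := Multiset.eq_zero_of_sum_eq_zero (sum_star_fst v) (fun b hb => by
      obtain ⟨a, ha, rfl⟩ := Multiset.mem_map.1 hb
      exact not_lt.1 (h a ha)) a.1 (Multiset.mem_map_of_mem _ ha)
    exact not_lt.2 this.ge
  · intro h a ha; have := Multiset.eq_zero_of_sum_eq_zero (m := (Γ.star v).map fun a => -a.1)
      ((Multiset.sum_map_neg (f := Prod.fst)).trans (neg_eq_zero.2 (sum_star_fst v))) (fun b hb => by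
      obtain ⟨a, ha, rfl⟩ := Multiset.mem_map.1 hb; have := h a ha
      omega) (-a.1) (Multiset.mem_map_of_mem (fun a : ℤ × ℤ => -a.1) ha)
    omega

theorem neighbor_unique {v : Fin Γ.nv} {p : ℤ × ℤ → Prop} [DecidablePred p]
    (h : ((Γ.star v).filter p).card ≤ 1) {u u' : Fin Γ.nv} (hu : Γ.graph.Adj v u)
    (hu' : Γ.graph.Adj v u') (hp : p (Γ.dir v u)) (hp' : p (Γ.dir v u')) : u = u' := by
  rw [star, Multiset.filter_add, Multiset.card_add, Multiset.filter_map, Multiset.card_map] at h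
  have h1 : #{x | Γ.graph.Adj v x ∧ p (Γ.dir v x)} ≤ 1 := by
    have h2 : (univ.filter fun x => Γ.graph.Adj v x ∧ p (Γ.dir v x)) =
        (univ.filter (Γ.graph.Adj v)).filter (p ∘ Γ.dir v) := by
      ext x; simp
    rw [h2, card_def, filter_val]; exact (Nat.le_add_right _ _).trans h
  exact card_le_one.1 h1 u (by simp [hu, hp]) u' (by simp [hu', hp'])

theorem not_end_of_neighbor {v : Fin Γ.nv} {p : ℤ × ℤ → Prop} [DecidablePred p]
    (h : ((Γ.star v).filter p).card ≤ 1) {u : Fin Γ.nv} (hu : Γ.graph.Adj v u)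
    (hp : p (Γ.dir v u)) : (Γ.ends v).filter p = 0 := by
  rw [star, Multiset.filter_add, Multiset.card_add, Multiset.filter_map, Multiset.card_map] at h
  have h1 : 0 < Multiset.card (((univ.filter (Γ.graph.Adj v)).val).filter (p ∘ Γ.dir v)) :=
    Multiset.card_pos_iff_exists_mem.2 ⟨u, by simp [hu, hp]⟩
  rw [← Multiset.card_eq_zero]; omega

theorem Rigid.mark_inj (hR : Γ.Rigid) : Injective Γ.mark := by
  intro a b hab; by_contra hne
  obtain ⟨w, -, hw⟩ := hR.exists_eq fun c => if c = a then (1, 0) else 0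
  have h1 := hw a; have h2 := hw b; rw [if_pos rfl] at h1
  rw [if_neg (Ne.symm hne), ← hab, h1] at h2; simp at h2

theorem Rigid.card_star_mark (hR : Γ.Rigid) (a : Mark r s) : (Γ.star (Γ.mark a)).card = 2 := by
  have h1 := card_star (Γ := Γ) (Γ.mark a); have h2 : {b | Γ.mark b = Γ.mark a} = {a} := by
    ext b; exact ⟨fun h => hR.mark_inj h, fun h => by rw [h]; rfl⟩
  rw [h2, Set.ncard_singleton, hR.trivalent] at h1; omega

theorem Rigid.card_star_unmarked (hR : Γ.Rigid) {v : Fin Γ.nv} (hv : Γ.Unmarked v) :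
    (Γ.star v).card = 3 := by
  have h1 := card_star (Γ := Γ) v
  have h2 : {b | Γ.mark b = v} = ∅ := Set.eq_empty_of_forall_notMem fun b => hv b
  rw [h2, Set.ncard_empty, hR.trivalent] at h1; omega

theorem Rigid.deg_mark (hR : Γ.Rigid) (a : Mark r s) :
    (Γ.rightDeg (Γ.mark a) = 1 ∧ Γ.leftDeg (Γ.mark a) = 1 ∧ Γ.vertDeg (Γ.mark a) = 0) ∨
    (Γ.rightDeg (Γ.mark a) = 0 ∧ Γ.leftDeg (Γ.mark a) = 0 ∧ Γ.vertDeg (Γ.mark a) = 2) := by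
  have h1 := hR.card_star_mark a; have h2 := deg_sum (Γ := Γ) (Γ.mark a)
  have h3 := rightDeg_eq_zero_iff (Γ := Γ) (Γ.mark a); omega

theorem vertical_smul {d : ℤ × ℤ} (h : d ≠ 0) (h' : d.1 = 0) (y : ℝ) :
    (0, y) = (y / d.2) • realDir d := by
  have h1 : (d.2 : ℝ) ≠ 0 := by
    exact_mod_cast fun h2 => h (Prod.ext h' h2)
  simp [realDir, h', h1]

theorem Rigid.exists_not_vertical (hR : Γ.Rigid) {v : Fin Γ.nv} (hv : Γ.Unmarked v) :
    Γ.vertDeg v ≠ 3 := by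
  intro h; have h1 : ∀ a ∈ Γ.star v, a.1 = 0 := by
    have h2 : ((Γ.star v).filter fun a => a.1 = 0).card = (Γ.star v).card := by
      rw [hR.card_star_unmarked hv]; exact h
    have h3 := Multiset.eq_of_le_of_card_le (Multiset.filter_le _ _) h2.ge
    exact Multiset.filter_eq_self.1 h3
  have h4 := hR.eq_zero (fun u => if u = v then (0, 1) else 0) (fun a b hab => ?_) (fun a => if_neg (hv a))
  · simpa using congrFun h4 v
  · by_cases ha : a = v
    · subst ha; have h5 := h1 _ (mem_star.2 (.inl ⟨b, hab, rfl⟩)); refine ⟨(-1) / (Γ.dir a b).2, ?_⟩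
      rw [← vertical_smul (hR.dir_ne _ _ hab) h5]; simp [hab.ne', Prod.mk_zero_zero]
    by_cases hb : b = v
    · subst hb; have h5 := h1 _ (mem_star.2 (.inl ⟨a, hab.symm, rfl⟩))
      refine ⟨1 / (Γ.dir a b).2, ?_⟩
      rw [← vertical_smul (hR.dir_ne _ _ hab) (by rw [Γ.dir_symm _ _ hab]; simpa using h5)]
      simp [ha]
    · exact ⟨0, by simp [ha, hb]⟩

theorem Rigid.deg_unmarked (hR : Γ.Rigid) {v : Fin Γ.nv} (hv : Γ.Unmarked v) :
    (Γ.rightDeg v = 1 ∧ Γ.leftDeg v = 1 ∧ Γ.vertDeg v = 1) ∨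
    (Γ.rightDeg v = 2 ∧ Γ.leftDeg v = 1 ∧ Γ.vertDeg v = 0) ∨
    (Γ.rightDeg v = 1 ∧ Γ.leftDeg v = 2 ∧ Γ.vertDeg v = 0) := by
  have h1 := hR.card_star_unmarked hv; have h2 := deg_sum (Γ := Γ) v
  have h3 := rightDeg_eq_zero_iff (Γ := Γ) v; have h4 := hR.exists_not_vertical hv; omega

/-- The ends have coordinates of absolute value at most one. -/
def SmallEnds (Γ : TropicalMap r s) : Prop := ∀ v, ∀ a ∈ Γ.ends v, |a.1| ≤ 1 ∧ |a.2| ≤ 1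

theorem smallEnds_of_degree {Δ : DelPezzoDegree} (hΔ : Δ.Valid) (h : Γ.degree = Δ.ends) : Γ.SmallEnds := by
  intro v a ha; have h1 : a ∈ Γ.degree := Multiset.mem_sum.2 ⟨v, mem_univ _, ha⟩
  rw [h, DelPezzoDegree.ends_eq hΔ] at h1
  simp only [Multiset.mem_add, Multiset.mem_replicate] at h1
  rcases h1 with ((⟨-, rfl⟩ | ⟨-, rfl⟩) | (⟨-, rfl⟩ | ⟨-, rfl⟩)) | (⟨-, rfl⟩ | ⟨-, rfl⟩) <;> simp

theorem SmallEnds.abs_dir_snd_le (hE : Γ.SmallEnds) {u v : Fin Γ.nv} (huv : Γ.graph.Adj u v) :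
    |(Γ.dir u v).2| ≤ Multiset.card Γ.degree := by
  obtain ⟨g, hgu, hgv, hg⟩ := Γ.isTree.2.exists_cut huv; let S : Finset (Fin Γ.nv) := univ.filter g
  have hS : ∀ x, x ∈ S ↔ g x := fun x => by simp [S]
  have h1 := Finset.sum_antisymm_cut (V := Fin Γ.nv)
    (F := fun a b => if Γ.graph.Adj a b then (Γ.dir a b).2 else 0) (S := S) (u₀ := u) (v₀ := v)
    (fun a b => by
      by_cases hab : Γ.graph.Adj a b
      · simp only [hab, hab.symm, if_true, Γ.dir_symm a b hab, Prod.snd_neg]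
      · rw [if_neg hab, if_neg fun h => hab h.symm, neg_zero])
    ((hS u).2 hgu) (fun h => hgv ((hS v).1 h)) (fun a ha b hb hne => if_neg fun hab => by
      have h2 := hg a b hab fun he => by
        rcases Sym2.eq_iff.1 he with ⟨rfl, rfl⟩ | ⟨rfl, rfl⟩
        exacts [hne ⟨rfl, rfl⟩, hgv ((hS _).1 ha)]
      exact hb ((hS b).2 (h2.1 ((hS a).1 ha))))
  rw [if_pos huv] at h1; have h2 : ∑ a ∈ S, ((∑ b, if Γ.graph.Adj a b then (Γ.dir a b).2 else 0) +
      ((Γ.ends a).map Prod.snd).sum) = 0 :=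
    sum_eq_zero fun a _ => by rw [← sum_star_map (g := Prod.snd), sum_star_snd]
  rw [sum_add_distrib, h1] at h2
  have h4 : |∑ a ∈ S, ((Γ.ends a).map Prod.snd).sum| ≤ ∑ a, (Multiset.card (Γ.ends a) : ℤ) := by
    refine (abs_sum_le_sum_abs _ _).trans ?_
    refine (sum_le_sum fun a _ => Multiset.abs_sum_map_le _ fun x hx => (hE a x hx).2).trans ?_
    exact sum_le_sum_of_subset_of_nonneg (subset_univ _) fun _ _ _ => by positivity
  have h5 : (Multiset.card Γ.degree : ℤ) = ∑ a, (Multiset.card (Γ.ends a) : ℤ) := by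
    rw [degree]; have h6 := map_sum (Multiset.cardHom (α := ℤ × ℤ)) (fun v => Γ.ends v) univ
    exact_mod_cast h6
  rw [h5]; have h6 : (Γ.dir u v).2 = - ∑ a ∈ S, ((Γ.ends a).map Prod.snd).sum := by omega
  rwa [h6, abs_neg]

theorem SmallEnds.abs_sub_snd_le (hE : Γ.SmallEnds) {u v : Fin Γ.nv} (huv : Γ.floorGraph.Adj u v) :
    |(Γ.pos u).2 - (Γ.pos v).2| ≤ Multiset.card Γ.degree * |(Γ.pos u).1 - (Γ.pos v).1| := by
  have h1 : |((Γ.dir u v).2 : ℝ)| ≤ Multiset.card Γ.degree := by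
    exact_mod_cast hE.abs_dir_snd_le huv.1
  have h2 : (1 : ℝ) ≤ |((Γ.dir u v).1 : ℝ)| := by exact_mod_cast Int.one_le_abs huv.2
  have h3 := Γ.len_pos u v huv.1; rw [Γ.affine u v huv.1]
  simp only [realDir, Prod.fst_add, Prod.snd_add, Prod.smul_fst, Prod.smul_snd, smul_eq_mul]
  rw [sub_add_cancel_left, sub_add_cancel_left, abs_neg, abs_neg, abs_mul, abs_mul, abs_of_pos h3]
  nlinarith [mul_le_mul_of_nonneg_left h2 h3.le, mul_le_mul_of_nonneg_left h1 h3.le,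
    mul_nonneg (Nat.cast_nonneg (α := ℝ) (Multiset.card Γ.degree)) (mul_nonneg h3.le (sub_nonneg.2 h2))]

theorem Rigid.exists_mark_extremal (hR : Γ.Rigid) (hE : Γ.SmallEnds) {σ : ℤ} (hσ : σ = 1 ∨ σ = -1) :
    ∃ a, ∀ v, σ * (Γ.pos v).1 ≤ σ * (Γ.pos (Γ.mark a)).1 := by
  have hne := Γ.isTree.1.nonempty
  obtain ⟨v₀, hv₀⟩ := Finite.exists_max fun v => (σ : ℝ) * (Γ.pos v).1; by_contra! hcon
  let S : Fin Γ.nv → Prop := fun v => (σ : ℝ) * (Γ.pos v).1 = σ * (Γ.pos v₀).1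
  have hS : ∀ v, S v → Γ.Unmarked v := by
    rintro v hv a rfl; obtain ⟨u, hu⟩ := hcon a; exact absurd (hv₀ u) (not_le.2 (hv ▸ hu))
  have hσ0 : (σ : ℝ) * σ = 1 := by rcases hσ with rfl | rfl <;> norm_num
  have hsub : ∀ u v, Γ.graph.Adj u v →
      (σ : ℝ) * (Γ.pos v).1 = σ * (Γ.pos u).1 + Γ.len u v * (σ * (Γ.dir u v).1 : ℤ) := by
    intro u v huv; rw [Γ.affine u v huv]
    simp only [realDir, Prod.fst_add, Prod.smul_fst, smul_eq_mul]
    push_cast; ring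
  have hdir : ∀ u v, Γ.graph.Adj u v → S u → σ * (Γ.dir u v).1 ≤ 0 := by
    intro u v huv hu; by_contra! h; have h1 := hv₀ v; rw [hsub u v huv, ← hu] at h1
    have h2 : (0 : ℝ) < (σ * (Γ.dir u v).1 : ℤ) := by exact_mod_cast h
    have h3 := mul_pos (Γ.len_pos u v huv) h2; linarith
  have hS' : ∀ u v, Γ.graph.Adj u v → S u → (S v ↔ (Γ.dir u v).1 = 0) := by
    intro u v huv hu; have h1 := hsub u v huv; constructor
    · intro hv; have h2 : Γ.len u v * ((σ * (Γ.dir u v).1 : ℤ) : ℝ) = 0 := by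
        have h3 : (σ : ℝ) * (Γ.pos u).1 = _ := hu; have h4 : (σ : ℝ) * (Γ.pos v).1 = _ := hv
        linarith
      have h3 := (mul_eq_zero.1 h2).resolve_left (Γ.len_pos u v huv).ne'
      have h4 : σ * (Γ.dir u v).1 = 0 := by exact_mod_cast h3
      exact (mul_eq_zero.1 h4).resolve_left (by rcases hσ with rfl | rfl <;> norm_num)
    · intro h; rw [h] at h1; show (σ : ℝ) * (Γ.pos v).1 = _
      rw [h1, ← (show (σ : ℝ) * (Γ.pos u).1 = _ from hu)]; simp
  have huniq : ∀ v, S v → ∀ u u', Γ.graph.Adj v u → Γ.graph.Adj v u' → (Γ.dir v u).1 ≠ 0 →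
      (Γ.dir v u').1 ≠ 0 → u = u' := by
    intro v hv u u' hu hu' hd hd'; by_contra hne
    have h1 := add_le_sum (f := fun x => -σ * if Γ.graph.Adj v x then (Γ.dir v x).1 else 0)
      (fun x _ => by
        split_ifs with hx
        · linarith [hdir v x hx hv]
        · simp) (mem_univ u) (mem_univ u') hne
    have h2 : 1 < #(univ.filter (Γ.graph.Adj v)) := one_lt_card.2 ⟨u, by simpa, u', by simpa, hne⟩
    have h3 := hR.card_star_unmarked (hS v hv)
    rw [star, Multiset.card_add, Multiset.card_map, ← card_def] at h3
    have h4 := sum_star_map (Γ := Γ) v Prod.fst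
    have h5 := abs_le.1 (Multiset.abs_sum_map_le (Γ.ends v) fun a ha => (hE v a ha).1)
    have h6 := hdir v u hu hv; have h7 := hdir v u' hu' hv; rw [sum_star_fst, ← sum_filter] at h4
    simp only [← mul_sum, ← sum_filter, if_pos hu, if_pos hu'] at h1
    rcases hσ with rfl | rfl <;> omega
  have hm : ∀ v, ∃ m : ℝ, S v → ∀ u, Γ.graph.Adj v u → (Γ.dir v u).1 ≠ 0 →
      ∃ c : ℝ, ((1 : ℝ), m) = c • realDir (Γ.dir v u) := by
    intro v; by_cases hv : S v; swap
    · exact ⟨0, fun h => absurd h hv⟩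
    by_cases hex : ∃ u, Γ.graph.Adj v u ∧ (Γ.dir v u).1 ≠ 0
    · obtain ⟨u, hu, hd⟩ := hex; have hd' : ((Γ.dir v u).1 : ℝ) ≠ 0 := by exact_mod_cast hd
      refine ⟨(Γ.dir v u).2 / (Γ.dir v u).1, fun _ u' hu' hd' => ?_⟩
      obtain rfl := huniq v hv u u' hu hu' hd hd'; refine ⟨1 / (Γ.dir v u).1, ?_⟩
      simp only [realDir, Prod.smul_mk, smul_eq_mul]; ext <;> field_simp
    · exact ⟨0, fun _ u hu hd => absurd ⟨u, hu, hd⟩ hex⟩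
  choose m hm using hm
  have h1 := hR.eq_zero (fun v => if S v then (1, m v) else 0) (fun u v huv => ?_)
    (fun a => if_neg fun h => hS _ h a rfl)
  · simpa [show S v₀ from rfl] using congrFun h1 v₀
  · by_cases hu : S u <;> by_cases hv : S v
    · have h2 := (hS' u v huv hu).1 hv; refine ⟨(m v - m u) / (Γ.dir u v).2, ?_⟩
      rw [← vertical_smul (hR.dir_ne _ _ huv) h2]; simp [hu, hv]
    · obtain ⟨c, hc⟩ := hm u hu v huv fun h => hv ((hS' u v huv hu).2 h); refine ⟨-c, ?_⟩
      simp [hu, hv, hc]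
    · obtain ⟨c, hc⟩ := hm v hv u huv.symm fun h => hu ((hS' v u huv.symm hv).2 h); refine ⟨-c, ?_⟩
      have h2 : realDir (Γ.dir u v) = - realDir (Γ.dir v u) := by
        rw [Γ.dir_symm _ _ huv]; simp [realDir]
      simp [hu, hv, hc, h2]
    · exact ⟨0, by simp [hu, hv]⟩

theorem Rigid.exists_marks_strip (hR : Γ.Rigid) (hE : Γ.SmallEnds) :
    ∃ a b, ∀ u v, |(Γ.pos u).1 - (Γ.pos v).1| ≤ |(Γ.pos (Γ.mark a)).1 - (Γ.pos (Γ.mark b)).1| := by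
  obtain ⟨a, ha⟩ := hR.exists_mark_extremal hE (.inl rfl)
  obtain ⟨b, hb⟩ := hR.exists_mark_extremal hE (.inr rfl); refine ⟨a, b, fun u v => ?_⟩
  push_cast at ha hb; refine le_trans ?_ (le_abs_self _); rw [abs_le]
  constructor <;> linarith [ha u, ha v, hb u, hb v]

end TropicalMap

/-! ### Floor decomposition of rigid tropical stable maps -/

theorem Relation.ReflTransGen.total_of_eqvGen {α : Type} {r : α → α → Prop}
    (hr : ∀ a b c, r a b → r a c → b = c) (hl : ∀ a b c, r b a → r c a → b = c) {a b : α}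
    (h : ReflTransGen (fun x y => r x y ∨ r y x) a b) :
    ReflTransGen r a b ∨ ReflTransGen r b a := by
  induction h with
  | refl => exact .inl .refl
  | @tail b c _ hbc ih =>
    rcases ih with ih | ih <;> rcases hbc with hbc | hbc
    · exact .inl (ih.tail hbc)
    · rcases ih.cases_tail with rfl | ⟨d, hd, hdb⟩
      exacts [.inr (.single hbc), .inl (hl _ _ _ hbc hdb ▸ hd)]
    · rcases ih.cases_head with rfl | ⟨d, hd, hdb⟩
      exacts [.inl (.single hbc), .inr (hr _ _ _ hbc hd ▸ hdb)]
    · exact .inr (.head hbc ih)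

theorem SimpleGraph.Reachable.reflTransGen {V : Type} {G : SimpleGraph V} {u v : V} (h : G.Reachable u v) :
    ReflTransGen G.Adj u v := by
  obtain ⟨p⟩ := h
  induction p with
  | nil => exact .refl
  | cons h _ ih => exact .head h ih

namespace TropicalMap

variable {r s : ℕ} {Γ : TropicalMap r s}

/-- `v` is the right neighbour of `u` on a floor. -/
def RightOf (Γ : TropicalMap r s) (u v : Fin Γ.nv) : Prop := Γ.graph.Adj u v ∧ 0 < (Γ.dir u v).1

/-- The floor of a vertex. -/
abbrev floorOf (Γ : TropicalMap r s) (v : Fin Γ.nv) := Γ.floorGraph.connectedComponentMk v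

theorem floorGraph_adj_iff {u v : Fin Γ.nv} :
    Γ.floorGraph.Adj u v ↔ Γ.RightOf u v ∨ Γ.RightOf v u := by
  constructor
  · rintro ⟨h, h'⟩; rcases lt_or_gt_of_ne h' with h1 | h1
    · exact .inr ⟨h.symm, by rw [Γ.dir_symm _ _ h.symm]; simpa using h1⟩
    · exact .inl ⟨h, h1⟩
  · rintro (h | h)
    · exact ⟨h.1, h.2.ne'⟩
    · exact ⟨h.1.symm, by rw [Γ.dir_symm _ _ h.1.symm]; simpa using h.2.ne'⟩

theorem RightOf.leftDir {u v : Fin Γ.nv} (h : Γ.RightOf u v) : (Γ.dir v u).1 < 0 := by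
  rw [Γ.dir_symm _ _ h.1.symm]; simpa using h.2

theorem RightOf.pos_lt {u v : Fin Γ.nv} (h : Γ.RightOf u v) : (Γ.pos u).1 < (Γ.pos v).1 := by
  rw [Γ.affine u v h.1]; simp only [realDir, Prod.fst_add, Prod.smul_fst, smul_eq_mul]
  have h1 : (0 : ℝ) < (Γ.dir u v).1 := by exact_mod_cast h.2
  have := mul_pos (Γ.len_pos u v h.1) h1; linarith

theorem pos_lt_of_transGen {u v : Fin Γ.nv} (h : TransGen Γ.RightOf u v) :
    (Γ.pos u).1 < (Γ.pos v).1 := by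
  induction h with
  | single h => exact h.pos_lt
  | tail _ h ih => exact ih.trans h.pos_lt

theorem pos_le_of_reflTransGen {u v : Fin Γ.nv} (h : ReflTransGen Γ.RightOf u v) :
    (Γ.pos u).1 ≤ (Γ.pos v).1 := by
  induction h with
  | refl => exact le_rfl
  | tail _ h ih => exact ih.trans h.pos_lt.le

theorem SmallEnds.abs_sub_snd_le_of_chain (hE : Γ.SmallEnds) {u v : Fin Γ.nv}
    (h : ReflTransGen Γ.RightOf u v) :
    |(Γ.pos u).2 - (Γ.pos v).2| ≤ Γ.degree.card * |(Γ.pos u).1 - (Γ.pos v).1| := by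
  rw [abs_of_nonpos (sub_nonpos.2 (pos_le_of_reflTransGen h))]
  induction h with
  | refl => simp
  | @tail b c _ hbc ih =>
    have h1 := hE.abs_sub_snd_le (floorGraph_adj_iff.2 (.inl hbc))
    rw [abs_of_nonpos (sub_nonpos.2 hbc.pos_lt.le)] at h1
    have h2 := abs_sub_le (Γ.pos u).2 (Γ.pos b).2 (Γ.pos c).2; nlinarith

theorem SmallEnds.abs_sub_snd_le_of_reachable (hE : Γ.SmallEnds) {u v : Fin Γ.nv}
    (h : Γ.floorGraph.Reachable u v) {W : ℝ} (hW : ∀ u v, |(Γ.pos u).1 - (Γ.pos v).1| ≤ W) :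
    |(Γ.pos u).2 - (Γ.pos v).2| ≤ Γ.nv * (Γ.degree.card * W) := by
  obtain ⟨p, hp⟩ := h.exists_isPath; have hW0 : 0 ≤ W := (abs_nonneg _).trans (hW u v)
  have h1 : ∀ (u v : Fin Γ.nv) (p : Γ.floorGraph.Walk u v),
      |(Γ.pos u).2 - (Γ.pos v).2| ≤ p.length * (Γ.degree.card * W) := by
    intro u v p
    induction p with
    | nil => simp
    | @cons a b c hab q ih =>
      have h2 := hE.abs_sub_snd_le hab; have h3 := abs_sub_le (Γ.pos a).2 (Γ.pos b).2 (Γ.pos c).2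
      have h4 := mul_le_mul_of_nonneg_left (hW a b) (Nat.cast_nonneg (α := ℝ) (Γ.degree.card))
      rw [Walk.length_cons]; push_cast; linarith
  refine (h1 u v p).trans (mul_le_mul_of_nonneg_right ?_ (by positivity)); have h2 := hp.length_lt
  rw [Fintype.card_fin] at h2; exact_mod_cast h2.le

/-- The marked points are in vertically stretched position. -/
structure Steep (Γ : TropicalMap r s) : Prop where
  pair : ∀ j, Γ.degree.card *
    |(Γ.pos (Γ.mark (.y j))).1 - (Γ.pos (Γ.mark (.z j))).1| <
      (Γ.pos (Γ.mark (.z j))).2 - (Γ.pos (Γ.mark (.y j))).2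
  far : ∀ a b, b ≠ a → b ≠ a.swap → ∀ c d, Γ.nv * (Γ.degree.card *
    |(Γ.pos (Γ.mark c)).1 - (Γ.pos (Γ.mark d)).1|) < |(Γ.pos (Γ.mark a)).2 - (Γ.pos (Γ.mark b)).2|

theorem Steep.pair_abs (h : Γ.Steep) {a : Mark r s} (ha : a.swap ≠ a) : Γ.degree.card *
    |(Γ.pos (Γ.mark a)).1 - (Γ.pos (Γ.mark a.swap)).1| <
      |(Γ.pos (Γ.mark a)).2 - (Γ.pos (Γ.mark a.swap)).2| := by
  cases a with
  | x i => exact absurd rfl ha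
  | y j =>
    refine (h.pair j).trans_le ?_; rw [abs_sub_comm]; exact le_abs_self _
  | z j =>
    have h1 := h.pair j; rw [abs_sub_comm] at h1; exact h1.trans_le (le_abs_self _)

theorem Rigid.mark_of_floor (hR : Γ.Rigid) (hE : Γ.SmallEnds) (hS : Γ.Steep) {a b : Mark r s}
    (h : Γ.floorGraph.Reachable (Γ.mark a) (Γ.mark b)) : b = a ∨ b = a.swap := by
  by_contra! hcon; obtain ⟨c, d, hcd⟩ := hR.exists_marks_strip hE
  exact absurd (hE.abs_sub_snd_le_of_reachable h hcd) (not_le.2 (hS.far a b hcon.1 hcon.2 c d))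

theorem Rigid.exists_mark_floor (hR : Γ.Rigid) (v : Fin Γ.nv) :
    ∃ a, Γ.floorGraph.Reachable v (Γ.mark a) := by
  by_contra! hcon
  have h1 := hR.eq_zero (fun u => if Γ.floorGraph.Reachable v u then (0, 1) else 0) (fun a b hab => ?_)
    (fun a => if_neg (hcon a))
  · have h2 := congrFun h1 v; simp at h2
  · by_cases hd : (Γ.dir a b).1 = 0
    · refine ⟨((if Γ.floorGraph.Reachable v b then 1 else 0) -
        (if Γ.floorGraph.Reachable v a then 1 else 0)) / (Γ.dir a b).2, ?_⟩
      rw [← vertical_smul (hR.dir_ne _ _ hab) hd]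
      by_cases ha : Γ.floorGraph.Reachable v a <;> by_cases hb : Γ.floorGraph.Reachable v b <;>
        simp [ha, hb, Prod.mk_zero_zero]
    · have h2 : Γ.floorGraph.Adj a b := ⟨hab, hd⟩; refine ⟨0, ?_⟩
      have h3 : Γ.floorGraph.Reachable v a ↔ Γ.floorGraph.Reachable v b :=
        ⟨fun h => h.trans h2.reachable, fun h => h.trans h2.reachable.symm⟩
      simp only [h3, zero_smul, add_zero]

theorem Rigid.mark_of_elevator (hR : Γ.Rigid) {a b : Mark r s}
    (h : Γ.elevatorGraph.Reachable (Γ.mark a) (Γ.mark b)) : a = b := by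
  by_contra hne; obtain ⟨w, hw, hwf⟩ := hR.exists_eq fun c => if c = a then (1, 0) else 0
  have h1 := reachable_iff_of_adj_iff (g := fun u => (w u).1 = (w (Γ.mark a)).1) (fun u v huv => by
    obtain ⟨c, hc⟩ := hw u v huv.1; rw [hc]; simp [realDir, huv.2]) h
  have h2 := h1.1 rfl; rw [hwf, hwf, if_pos rfl, if_neg (Ne.symm hne)] at h2; simp at h2

theorem chain_of_floor {u : Fin Γ.nv}
    (h : ∀ v, Γ.floorGraph.Reachable u v → Γ.rightDeg v ≤ 1 ∧ Γ.leftDeg v ≤ 1) {v : Fin Γ.nv}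
    (hv : Γ.floorGraph.Reachable u v) :
    ReflTransGen Γ.RightOf u v ∨ ReflTransGen Γ.RightOf v u := by
  let R : Fin Γ.nv → Fin Γ.nv → Prop := fun a b =>
    Γ.floorGraph.Reachable u a ∧ Γ.floorGraph.Reachable u b ∧ Γ.RightOf a b
  have h1 : ReflTransGen R u v ∨ ReflTransGen R v u := by
    refine ReflTransGen.total_of_eqvGen ?_ ?_ ?_
    · rintro a b c ⟨ha, -, hab⟩ ⟨-, -, hac⟩
      exact neighbor_unique (v := a) (p := fun d => 0 < d.1) (h a ha).1 hab.1 hac.1 hab.2 hac.2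
    · rintro a b c ⟨-, ha, hab⟩ ⟨-, -, hac⟩
      exact neighbor_unique (v := a) (p := fun d => d.1 < 0) (h a ha).2 hab.1.symm hac.1.symm hab.leftDir
        hac.leftDir
    · have h2 := hv.reflTransGen
      have h3 : Γ.floorGraph.Reachable u v ∧ ReflTransGen (fun x y => R x y ∨ R y x) u v := by
        clear hv
        induction h2 with
        | refl => exact ⟨.refl _, .refl⟩
        | @tail b c _ hbc ih =>
          have h4 := ih.1.trans hbc.reachable; refine ⟨h4, ih.2.tail ?_⟩
          exact (floorGraph_adj_iff.1 hbc).imp (⟨ih.1, h4, ·⟩) (⟨h4, ih.1, ·⟩)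
      exact h3.2
  have h2 := ReflTransGen.mono (r := R) fun a b hab => hab.2.2
  exact h1.imp (h2 _ _) (h2 _ _)

theorem SmallEnds.sum_tilt (hE : Γ.SmallEnds) (S : Finset (Fin Γ.nv))
    (hS : ∀ u ∈ S, ∀ v, Γ.floorGraph.Adj u v → v ∈ S) :
    ∑ v ∈ S, ((Γ.rightDeg v : ℤ) - Γ.leftDeg v) = 0 := by
  have key : ∀ g : ℤ → ℤ, (∀ x, g (-x) = - g x) → g 0 = 0 →
      ∑ v ∈ S, ((Γ.star v).map fun a => g a.1).sum = ∑ v ∈ S, ((Γ.ends v).map fun a => g a.1).sum := by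
    intro g hg hg0; have h1 := Finset.sum_antisymm_closed (V := Fin Γ.nv)
      (F := fun a b => if Γ.graph.Adj a b then g (Γ.dir a b).1 else 0) (S := S) (fun a b => by
        by_cases hab : Γ.graph.Adj a b
        · rw [if_pos hab, if_pos hab.symm, Γ.dir_symm a b hab, Prod.fst_neg, hg]
        · simp [hab, Γ.graph.adj_comm])
      (fun a ha b hb => by
        split_ifs with hab
        · have : (Γ.dir a b).1 = 0 := by
            by_contra hd; exact hb (hS a ha b ⟨hab, hd⟩)
          rw [this, hg0]
        · rfl)
    have h2 : ∀ v, ((Γ.star v).map fun a => g a.1).sum =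
      (∑ u, if Γ.graph.Adj v u then g (Γ.dir v u).1 else 0) + ((Γ.ends v).map fun a => g a.1).sum :=
      fun v => sum_star_map v fun a => g a.1
    rw [sum_congr rfl fun v _ => h2 v, sum_add_distrib, h1, zero_add]
  have h1 := key Int.sign (fun x => Int.sign_neg x) Int.sign_zero
  have h2 := key id (fun x => rfl) rfl
  have h3 : ∀ v, ((Γ.ends v).map fun a => a.1.sign).sum = ((Γ.ends v).map fun a => id a.1).sum := by
    intro v; congr 1; refine Multiset.map_congr rfl fun a ha => ?_
    have h4 := abs_le.1 (hE v a ha).1; have h5 : a.1 = -1 ∨ a.1 = 0 ∨ a.1 = 1 := by omega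
    rcases h5 with h5 | h5 | h5 <;> rw [h5] <;> rfl
  have h4 : ∀ v, (Γ.rightDeg v : ℤ) - Γ.leftDeg v = ((Γ.star v).map fun a => a.1.sign).sum :=
    fun v => (Multiset.sum_sign _).symm
  rw [sum_congr rfl fun v _ => h4 v, h1, sum_congr rfl fun v _ => h3 v, ← h2]
  exact sum_eq_zero fun v _ => sum_star_fst v

theorem Rigid.fork_unmarked (hR : Γ.Rigid) {v : Fin Γ.nv} (hv : Γ.rightDeg v ≠ Γ.leftDeg v) :
    Γ.Unmarked v := by
  rintro a rfl; have := hR.deg_mark a; omega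

theorem not_adj_of_vertDeg {v u : Fin Γ.nv} (hv : Γ.vertDeg v = 0) : ¬ Γ.elevatorGraph.Adj v u := by
  intro h; have h1 := Multiset.filter_eq_nil.1 (Multiset.card_eq_zero.1 hv)
  exact h1 _ (mem_star.2 (.inl ⟨u, h.1, rfl⟩)) h.2

theorem eq_of_elevator_of_vertDeg {v u : Fin Γ.nv} (hv : Γ.vertDeg v = 0)
    (h : Γ.elevatorGraph.Reachable v u) : v = u := by
  obtain ⟨p⟩ := h; cases p with
  | nil => rfl
  | cons hadj _ => exact absurd hadj (not_adj_of_vertDeg hv)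

theorem Rigid.card_marks_le (hR : Γ.Rigid) (hE : Γ.SmallEnds) (hS : Γ.Steep)
    (c : Γ.floorGraph.ConnectedComponent) :
    2 * #{a | Γ.floorOf (Γ.mark a) = c} ≤
      #{v | Γ.floorOf v = c ∧ Γ.rightDeg v ≠ Γ.leftDeg v} + 2 := by
  by_cases hle : #{a | Γ.floorOf (Γ.mark a) = c} ≤ 1
  · omega
  obtain ⟨a, ha, b, hb, hab⟩ := one_lt_card.1 (not_le.1 hle); simp only [mem_filter_univ] at ha hb
  have hba : b = a.swap := (hR.mark_of_floor hE hS
    (ConnectedComponent.eq.1 (ha.trans hb.symm))).resolve_left (Ne.symm hab)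
  have h2 : #{a | Γ.floorOf (Γ.mark a) = c} ≤ 2 := by
    refine (card_le_card (t := {a, b}) fun x hx => ?_).trans card_le_two
    simp only [mem_filter_univ] at hx; rw [mem_insert, mem_singleton, hba]
    exact hR.mark_of_floor hE hS (ConnectedComponent.eq.1 (ha.trans hx.symm))
  have h3 : 1 < #{v | Γ.floorOf v = c ∧ Γ.rightDeg v ≠ Γ.leftDeg v} := by
    by_contra! hcon
    have h4 : ∀ v, Γ.floorOf v = c → Γ.rightDeg v = Γ.leftDeg v := by
      by_contra! hex; obtain ⟨v, hv, hne⟩ := hex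
      have h5 := hE.sum_tilt (univ.filter fun v => Γ.floorOf v = c)
        (fun x hx y hxy => by
          simp only [mem_filter_univ] at hx ⊢; rw [← hx]
          exact (ConnectedComponent.connectedComponentMk_eq_of_adj hxy).symm)
      rw [sum_eq_single_of_mem v (by simp [hv])] at h5
      · omega
      · intro u hu hne'; simp only [mem_filter_univ] at hu; by_contra h6
        refine hne' (card_le_one.1 hcon u ?_ v ?_)
        · simp only [mem_filter_univ]; exact ⟨hu, fun h7 => h6 (by rw [h7, sub_self])⟩
        · simp [hv, hne]
    have h5 : ∀ v, Γ.floorGraph.Reachable (Γ.mark a) v → Γ.rightDeg v ≤ 1 ∧ Γ.leftDeg v ≤ 1 := by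
      intro v hv; have h6 := h4 v ((ConnectedComponent.eq.2 hv.symm).trans ha)
      by_cases hum : Γ.Unmarked v
      · have := hR.deg_unmarked hum; omega
      · unfold Unmarked at hum; push Not at hum; obtain ⟨a', rfl⟩ := hum; have := hR.deg_mark a'
        omega
    have h6 := chain_of_floor h5 (ConnectedComponent.eq.1 (ha.trans hb.symm))
    have h7 := hS.pair_abs (a := a) (fun h => hab (h.symm.trans hba.symm)); rw [← hba] at h7
    rcases h6 with h6 | h6
    · exact absurd (hE.abs_sub_snd_le_of_chain h6) (not_le.2 h7)
    · have h8 := hE.abs_sub_snd_le_of_chain h6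
      rw [abs_sub_comm, abs_sub_comm (Γ.pos (Γ.mark b)).1] at h8; exact absurd h8 (not_le.2 h7)
  omega

/-- There are no forks, and every floor and every elevator contains exactly one marked point. -/
structure FloorDecomposed (Γ : TropicalMap r s) : Prop where
  noFork : ∀ v, Γ.rightDeg v = Γ.leftDeg v
  floor_unique : ∀ a b, Γ.floorGraph.Reachable (Γ.mark a) (Γ.mark b) → a = b
  exists_elevator : ∀ v, ∃ a, Γ.elevatorGraph.Reachable v (Γ.mark a)

theorem Rigid.floorDecomposed (hR : Γ.Rigid) (hE : Γ.SmallEnds) (hS : Γ.Steep) :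
    Γ.FloorDecomposed := by
  have hcount := Γ.isTree.card_components_add (A := Γ.floorGraph) (B := Γ.elevatorGraph)
    (fun u v => ⟨fun h => by
      by_cases hd : (Γ.dir u v).1 = 0
      · exact .inr ⟨h, hd⟩
      · exact .inl ⟨h, hd⟩, fun h => h.elim And.left And.left⟩) (fun u v h h' => h.2 h'.2)
  rw [Fintype.card_fin, hR.card_nv] at hcount
  let F := univ.filter fun v => Γ.rightDeg v ≠ Γ.leftDeg v; have hF : ∀ v ∈ F, Γ.vertDeg v = 0 := by
    intro v hv; have h1 := (mem_filter.1 hv).2; have := hR.deg_unmarked (hR.fork_unmarked h1); omega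
  have hcard : Fintype.card (F ⊕ Mark r s) = F.card + (r + 2 * s) := by
    rw [Fintype.card_sum, Fintype.card_coe, Mark.card]
  let f : F ⊕ Mark r s → Γ.elevatorGraph.ConnectedComponent :=
    Sum.elim (fun v => Γ.elevatorGraph.connectedComponentMk v.1)
      (fun a => Γ.elevatorGraph.connectedComponentMk (Γ.mark a))
  have hf : Injective f := by
    rintro (v | a) (v' | a') h <;> have h1 := ConnectedComponent.eq.1 h
    · exact congrArg Sum.inl (Subtype.ext (eq_of_elevator_of_vertDeg (hF _ v.2) h1))
    · exact (hR.fork_unmarked (mem_filter.1 v.2).2 a'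
        (eq_of_elevator_of_vertDeg (hF _ v.2) h1).symm).elim
    · exact (hR.fork_unmarked (mem_filter.1 v'.2).2 a
        (eq_of_elevator_of_vertDeg (hF _ v'.2) h1.symm).symm).elim
    · exact congrArg Sum.inr (hR.mark_of_elevator h1)
  have h1 := Fintype.card_le_of_injective f hf
  have h2 := sum_le_sum fun c (_ : c ∈ univ) => hR.card_marks_le hE hS c
  have h3 : ∑ c, #{a | Γ.floorOf (Γ.mark a) = c} = r + 2 * s := by
    rw [← Mark.card r s, ← card_univ]
    exact (card_eq_sum_card_fiberwise (f := fun a => Γ.floorOf (Γ.mark a))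
      (fun _ _ => mem_univ _)).symm
  have h4 : ∑ c, #{v | Γ.floorOf v = c ∧
      Γ.rightDeg v ≠ Γ.leftDeg v} = F.card := by
    rw [card_eq_sum_card_fiberwise (f := Γ.floorOf)
      (t := univ) (fun _ _ => mem_univ _)]
    refine sum_congr rfl fun c _ => ?_; congr 1; ext v; simp [F, and_comm]
  rw [← mul_sum, h3, sum_add_distrib, h4, sum_const, card_univ,
    smul_eq_mul, ← Nat.card_eq_fintype_card] at h2
  rw [hcard, ← Nat.card_eq_fintype_card] at h1; have hF0 : F.card = 0 := by omega
  have hnoFork : ∀ v, Γ.rightDeg v = Γ.leftDeg v := by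
    intro v; by_contra hne; have h5 : v ∈ F := mem_filter.2 ⟨mem_univ _, hne⟩
    rw [card_eq_zero.1 hF0] at h5; exact absurd h5 (notMem_empty _)
  refine ⟨hnoFork, fun a b hab => ?_, fun v => ?_⟩
  · have h5 := hR.card_marks_le hE hS (Γ.floorOf (Γ.mark a))
    have h6 : (univ.filter fun v => Γ.floorOf v =
        Γ.floorOf (Γ.mark a) ∧ Γ.rightDeg v ≠ Γ.leftDeg v) = ∅ := by
      ext v; simp [hnoFork v]
    rw [h6, card_empty] at h5; have h7 : #{b | Γ.floorOf (Γ.mark b) =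
        Γ.floorOf (Γ.mark a)} ≤ 1 := by omega
    exact card_le_one.1 h7 a (by simp) b (by simpa using ConnectedComponent.eq.2 hab.symm)
  · have h5 : Surjective f := by
      refine (hf.bijective_of_nat_card_le ?_).2
      rw [Nat.card_eq_fintype_card (α := F ⊕ Mark r s), hcard]; omega
    obtain ⟨u | a, ha⟩ := h5 (Γ.elevatorGraph.connectedComponentMk v)
    exacts [absurd (hnoFork u) (mem_filter.1 u.2).2, ⟨a, ConnectedComponent.eq.1 ha.symm⟩]

end TropicalMap

/-! ### The floor and the elevator through a vertex -/

section FloorCoordinates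

variable {Δ : DelPezzoDegree} {r s : ℕ}

namespace TropicalMap

/-- The vertex of the marked point which belongs to a vertex of a floor diagram. -/
def markAt (Γ : TropicalMap r s) (M : Merging Δ.n r s) (v : Fin Δ.n) : Fin Γ.nv := Γ.mark (M.slot.symm v)

/-- The vertex `v` of the floor decomposed map `Γ` lies on the same floor as the marked point `f v`, and on
the same elevator as the marked point `g v`. -/
structure FloorCoords (M : Merging Δ.n r s) (Γ : TropicalMap r s) (f g : Fin Γ.nv → Fin Δ.n) : Prop where
  valid : Δ.Valid
  degree : Γ.degree = Δ.ends
  rigid : Γ.Rigid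
  steep : Γ.Steep
  noFork : ∀ v, Γ.rightDeg v = Γ.leftDeg v
  order : ∀ a b, M.slot a < M.slot b → (Γ.pos (Γ.mark a)).2 < (Γ.pos (Γ.mark b)).2
  f_eq : ∀ {u v}, f u = f v ↔ Γ.floorGraph.Reachable u v
  g_eq : ∀ {u v}, g u = g v ↔ Γ.elevatorGraph.Reachable u v
  f_mark : ∀ v, f (Γ.markAt M v) = v
  g_mark : ∀ v, g (Γ.markAt M v) = v

theorem Rigid.exists_floorCoords {M : Merging Δ.n r s} {Γ : TropicalMap r s} (hΔ : Δ.Valid)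
    (hdeg : Γ.degree = Δ.ends) (hR : Γ.Rigid) (hS : Γ.Steep)
    (hO : ∀ a b, M.slot a < M.slot b → (Γ.pos (Γ.mark a)).2 < (Γ.pos (Γ.mark b)).2) :
    ∃ f g, FloorCoords M Γ f g := by
  have hF := hR.floorDecomposed (smallEnds_of_degree hΔ hdeg) hS
  choose f hf using hR.exists_mark_floor; choose g hg using hF.exists_elevator
  have hf' : ∀ a, f (Γ.mark a) = a := fun a => (hF.floor_unique _ _ (hf _)).symm
  have hg' : ∀ a, g (Γ.mark a) = a := fun a => (hR.mark_of_elevator (hg _)).symm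
  refine ⟨fun v => M.slot (f v), fun v => M.slot (g v), hΔ, hdeg, hR, hS, hF.noFork, hO, ?_, ?_, ?_, ?_⟩
  · exact fun {u v} => M.slot.apply_eq_iff_eq.trans ⟨fun h => (hf u).trans (h ▸ (hf v).symm),
      fun h => hF.floor_unique _ _ ((hf u).symm.trans (h.trans (hf v)))⟩
  · exact fun {u v} => M.slot.apply_eq_iff_eq.trans ⟨fun h => (hg u).trans (h ▸ (hg v).symm),
      fun h => hR.mark_of_elevator ((hg u).symm.trans (h.trans (hg v)))⟩
  · intro v; rw [markAt, hf', M.slot.apply_symm_apply]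
  · intro v; rw [markAt, hg', M.slot.apply_symm_apply]

theorem card_filter_ends {Γ : TropicalMap r s} {v : Fin Γ.nv} {p : ℤ × ℤ → Prop} [DecidablePred p]
    (h : ((Γ.star v).filter p).card = 1) : ((Γ.ends v).filter p).card =
      if ∃ u, Γ.graph.Adj v u ∧ p (Γ.dir v u) then 0 else 1 := by
  split_ifs with hex
  · obtain ⟨u, hu, hp⟩ := hex; rw [not_end_of_neighbor h.le hu hp, Multiset.card_zero]
  · rw [star, Multiset.filter_add, Multiset.card_add, Multiset.filter_map] at h
    have h1 : Multiset.filter (p ∘ Γ.dir v) (univ.filter (Γ.graph.Adj v)).val = 0 := by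
      refine Multiset.filter_eq_nil.2 fun u hu hp => hex ⟨u, ?_, hp⟩; simpa using hu
    rw [h1, Multiset.map_zero, Multiset.card_zero, zero_add] at h; exact h

namespace FloorCoords

variable {M : Merging Δ.n r s} {Γ : TropicalMap r s} {f g : Fin Γ.nv → Fin Δ.n}

variable (h : FloorCoords M Γ f g)

local notation "μ" => Γ.markAt M

include h

theorem smallEnds : Γ.SmallEnds := smallEnds_of_degree h.valid h.degree

theorem markAt_inj {v w : Fin Δ.n} (hvw : μ v = μ w) : v = w := by rw [← h.f_mark v, hvw, h.f_mark]

theorem inj {u v : Fin Γ.nv} (hf : f u = f v) (hg : g u = g v) : u = v := by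
  by_contra hne; obtain ⟨p, hp⟩ := (h.f_eq.1 hf).exists_isPath
  obtain ⟨q, hq⟩ := (h.g_eq.1 hg).exists_isPath
  have hA : Γ.floorGraph ≤ Γ.graph := fun a b hab => hab.1
  have hB : Γ.elevatorGraph ≤ Γ.graph := fun a b hab => hab.1
  have h1 := (Γ.isTree.2.subsingleton_path u v).elim ⟨p.mapLe hA, hp.mapLe hA⟩ ⟨q.mapLe hB, hq.mapLe hB⟩
  have h2 : p.mapLe hA = q.mapLe hB := congrArg Subtype.val h1; have h3 := congrArg Walk.edges h2
  rw [Walk.edges_mapLe_eq_edges, Walk.edges_mapLe_eq_edges] at h3; cases p with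
  | nil => exact hne rfl
  | @cons _ b _ hadj p' =>
    have h4 : s(u, b) ∈ q.edges := by rw [← h3]; simp
    exact hadj.2 (q.adj_of_mem_edges h4).2

theorem eq_markAt_iff {u : Fin Γ.nv} : f u = g u ↔ u = μ (g u) := by
  refine ⟨fun h1 => h.inj (by rw [h.f_mark, h1]) (h.g_mark _).symm, fun h1 => ?_⟩
  conv_lhs => rw [h1, h.f_mark]

theorem unmarked_iff {u : Fin Γ.nv} : Γ.Unmarked u ↔ f u ≠ g u := by
  rw [Ne, h.eq_markAt_iff]; constructor
  · exact fun h1 h2 => h1 _ h2.symm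
  · rintro h1 a rfl; refine h1 ?_; have h2 := h.g_mark (M.slot a)
    rw [markAt, M.slot.symm_apply_apply] at h2; rw [h2, markAt, M.slot.symm_apply_apply]

theorem deg_markAt (v : Fin Δ.n) :
    (Γ.rightDeg (μ v) = 1 ∧ Γ.leftDeg (μ v) = 1 ∧ Γ.vertDeg (μ v) = 0) ∨
    (Γ.rightDeg (μ v) = 0 ∧ Γ.leftDeg (μ v) = 0 ∧ Γ.vertDeg (μ v) = 2) :=
  h.rigid.deg_mark _

theorem deg_unmarked {u : Fin Γ.nv} (hu : f u ≠ g u) :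
    Γ.rightDeg u = 1 ∧ Γ.leftDeg u = 1 ∧ Γ.vertDeg u = 1 := by
  have h1 := h.rigid.deg_unmarked (h.unmarked_iff.2 hu); have h2 := h.noFork u; omega

theorem eq_of_g_white {u : Fin Γ.nv} (hu : Γ.vertDeg (μ (g u)) = 0) : u = μ (g u) :=
  (eq_of_elevator_of_vertDeg hu (h.g_eq.1 (h.g_mark (g u)))).symm

theorem eq_of_f_black {u : Fin Γ.nv} (hu : Γ.vertDeg (μ (f u)) ≠ 0) : u = μ (f u) := by
  have h1 : Γ.rightDeg (μ (f u)) = 0 ∧ Γ.leftDeg (μ (f u)) = 0 := by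
    have := h.deg_markAt (f u); omega
  have h2 := h.f_eq.1 (h.f_mark (f u)); obtain ⟨p⟩ := h2
  generalize hm : μ (f u) = m at p
  cases p with
  | nil => rfl
  | cons hadj _ =>
    rw [← hm] at hadj; have h3 := mem_star.2 (.inl ⟨_, hadj.1, rfl⟩)
    exact (lt_or_gt_of_ne hadj.2).elim (Multiset.filter_eq_nil.1 (Multiset.card_eq_zero.1 h1.2) _ h3)
      (Multiset.filter_eq_nil.1 (Multiset.card_eq_zero.1 h1.1) _ h3) |>.elim

theorem f_white {u : Fin Γ.nv} (hu : f u ≠ g u) : Γ.vertDeg (μ (f u)) = 0 := by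
  by_contra h1; exact hu ((h.g_mark _).symm.trans (congrArg g (h.eq_of_f_black h1).symm))

theorem g_black {u : Fin Γ.nv} (hu : f u ≠ g u) : Γ.vertDeg (μ (g u)) ≠ 0 := fun h1 =>
  hu (h.eq_markAt_iff.2 (h.eq_of_g_white h1))

theorem side_deg {u : Fin Γ.nv} (hu : Γ.vertDeg (μ (f u)) = 0) :
    Γ.rightDeg u = 1 ∧ Γ.leftDeg u = 1 := by
  by_cases h1 : f u = g u
  · have h2 := h.eq_markAt_iff.1 h1; rw [← h1] at h2; have h3 := h.deg_markAt (f u)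
    rw [← h2] at h3 hu; omega
  · have := h.deg_unmarked h1; omega

theorem vertical_neighbor {u v : Fin Γ.nv} (hu : f u ≠ g u)
    (huv : Γ.elevatorGraph.Adj u v) : v = μ (g u) := by
  have hg : g u = g v := h.g_eq.2 huv.reachable; by_cases hv : f v = g v
  · rw [hg]; exact h.eq_markAt_iff.1 hv
  exfalso
  have key : ∀ {a b}, f a ≠ g a → Γ.elevatorGraph.Adj a b → ∀ {c}, Γ.elevatorGraph.Adj a c → c = b :=
    fun ha hab c hac => neighbor_unique (p := fun d => d.1 = 0) (h.deg_unmarked ha).2.2.le hac.1 hab.1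
      hac.2 hab.2
  have h1 : ∀ a b, Γ.elevatorGraph.Adj a b → ((a = u ∨ a = v) ↔ (b = u ∨ b = v)) := by
    have h2 : ∀ a b, Γ.elevatorGraph.Adj a b → (a = u ∨ a = v) → (b = u ∨ b = v) := by
      rintro a b hab (rfl | rfl); exacts [.inr (key hu huv hab), .inl (key hv huv.symm hab)]
    exact fun a b hab => ⟨h2 a b hab, h2 b a hab.symm⟩
  have h2 := (reachable_iff_of_adj_iff h1 (h.g_eq.1 (h.g_mark (g u)).symm)).1 (.inl rfl)
  rcases h2 with h2 | h2
  · exact hu (h.eq_markAt_iff.2 h2.symm)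
  · rw [hg] at h2; exact hv (h.eq_markAt_iff.2 h2.symm)

theorem adj_markAt {u : Fin Γ.nv} (hu : f u ≠ g u) : Γ.elevatorGraph.Adj u (μ (g u)) := by
  obtain ⟨p⟩ := h.g_eq.1 (h.g_mark (g u)).symm
  generalize hm : μ (g u) = m at p
  cases p with
  | nil => exact absurd (h.eq_markAt_iff.2 hm.symm) hu
  | cons hadj _ =>
    have h1 := h.vertical_neighbor hu hadj; rw [← hm, ← h1]; exact hadj

theorem elevator_adj_cases {u v : Fin Γ.nv} (huv : Γ.elevatorGraph.Adj u v) :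
    (f u ≠ g u ∧ v = μ (g u)) ∨ (f v ≠ g v ∧ u = μ (g v)) := by
  by_cases hu : f u = g u
  · by_cases hv : f v = g v
    · have hg : g u = g v := h.g_eq.2 huv.reachable
      exact absurd (h.inj (hu.trans (hg.trans hv.symm)) hg) huv.ne
    · exact .inr ⟨hv, h.vertical_neighbor hv huv.symm⟩
  · exact .inl ⟨hu, h.vertical_neighbor hu huv⟩

theorem x_eq (u : Fin Γ.nv) : (Γ.pos (μ (g u))).1 = (Γ.pos u).1 := by
  by_cases hu : f u = g u
  · rw [← h.eq_markAt_iff.1 hu]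
  · have h1 := h.adj_markAt hu; rw [Γ.affine _ _ h1.1]; simp [realDir, h1.2]

theorem chain {u v : Fin Γ.nv} (huv : f u = f v) :
    ReflTransGen Γ.RightOf u v ∨ ReflTransGen Γ.RightOf v u := by
  refine chain_of_floor (fun w _ => ?_) (h.f_eq.1 huv); by_cases hw : f w = g w
  · have h1 := h.deg_markAt (g w); rw [← h.eq_markAt_iff.1 hw] at h1; omega
  · have := h.deg_unmarked hw; omega

theorem f_rightOf {u v : Fin Γ.nv} (huv : Γ.RightOf u v) : f u = f v :=
  h.f_eq.2 (floorGraph_adj_iff.2 (.inl huv)).reachable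

theorem first_unique {u v : Fin Γ.nv} (huv : f u = f v)
    (hu : ¬ ∃ y, Γ.graph.Adj u y ∧ (Γ.dir u y).1 < 0) (hv : ¬ ∃ y, Γ.graph.Adj v y ∧ (Γ.dir v y).1 < 0) :
    u = v := by
  rcases h.chain huv with h1 | h1
  all_goals rcases h1.cases_tail with h2 | ⟨y, -, hy⟩
  exacts [h2.symm, absurd ⟨y, hy.1.symm, hy.leftDir⟩ hv, h2, absurd ⟨y, hy.1.symm, hy.leftDir⟩ hu]

theorem last_unique {u v : Fin Γ.nv} (huv : f u = f v)
    (hu : ¬ ∃ y, Γ.graph.Adj u y ∧ 0 < (Γ.dir u y).1) (hv : ¬ ∃ y, Γ.graph.Adj v y ∧ 0 < (Γ.dir v y).1) :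
    u = v := by
  rcases h.chain huv with h1 | h1
  all_goals rcases h1.cases_head with h2 | ⟨y, hy, -⟩
  exacts [h2, absurd ⟨y, hy⟩ hu, h2.symm, absurd ⟨y, hy⟩ hv]

theorem exists_first (w : Fin Δ.n) : ∃ u, f u = w ∧ ¬ ∃ y, Γ.graph.Adj u y ∧ (Γ.dir u y).1 < 0 := by
  obtain ⟨u, hu, hmin⟩ := exists_min_image (univ.filter fun u => f u = w)
    (fun u => (Γ.pos u).1) ⟨μ w, by simp [h.f_mark]⟩
  simp only [mem_filter_univ] at hu hmin; refine ⟨u, hu, ?_⟩; rintro ⟨y, hy, hd⟩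
  have h1 : Γ.RightOf y u := ⟨hy.symm, by rw [Γ.dir_symm _ _ hy.symm]; simpa using hd⟩
  exact absurd h1.pos_lt (not_lt.2 (hmin y ((h.f_rightOf h1).trans hu)))

theorem exists_last (w : Fin Δ.n) : ∃ u, f u = w ∧ ¬ ∃ y, Γ.graph.Adj u y ∧ 0 < (Γ.dir u y).1 := by
  obtain ⟨u, hu, hmax⟩ := exists_max_image (univ.filter fun u => f u = w)
    (fun u => (Γ.pos u).1) ⟨μ w, by simp [h.f_mark]⟩
  simp only [mem_filter_univ] at hu hmax; refine ⟨u, hu, ?_⟩; rintro ⟨y, hy, hd⟩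
  have h1 : Γ.RightOf u y := ⟨hy, hd⟩
  exact absurd h1.pos_lt (not_lt.2 (hmax y ((h.f_rightOf h1).symm.trans hu)))

omit h in
/-- The ends on a floor. -/
def _root_.TropicalMap.floorEnds (Γ : TropicalMap r s) (f : Fin Γ.nv → Fin Δ.n) (w : Fin Δ.n) :
    Multiset (ℤ × ℤ) := ∑ u with f u = w, Γ.ends u

omit h in
theorem card_filter_sum {ι α : Type} (S : Finset ι) (m : ι → Multiset α) (p : α → Prop) [DecidablePred p] :
    ((∑ i ∈ S, m i).filter p).card = ∑ i ∈ S, ((m i).filter p).card := by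
  induction S using Finset.induction_on with
  | empty => simp
  | insert i S hi ih => rw [sum_insert hi, sum_insert hi, Multiset.filter_add,
      Multiset.card_add, ih]

theorem card_sideEnds {w : Fin Δ.n} (hw : Γ.vertDeg (μ w) = 0) :
    ((Γ.floorEnds f w).filter fun a => a.1 < 0).card = 1 ∧
      ((Γ.floorEnds f w).filter fun a => 0 < a.1).card = 1 := by
  have key : ∀ (p : ℤ × ℤ → Prop) [DecidablePred p],
      (∀ u, f u = w → ((Γ.star u).filter p).card = 1) →
      (∃ u, f u = w ∧ ¬ ∃ y, Γ.graph.Adj u y ∧ p (Γ.dir u y)) →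
      (∀ u v, f u = f v → (¬ ∃ y, Γ.graph.Adj u y ∧ p (Γ.dir u y)) →
        (¬ ∃ y, Γ.graph.Adj v y ∧ p (Γ.dir v y)) → u = v) →
      ((Γ.floorEnds f w).filter p).card = 1 := by
    rintro p _ hcard ⟨u, hu, hend⟩ huniq
    rw [floorEnds, card_filter_sum, sum_eq_single_of_mem u (by simp [hu]),
      card_filter_ends (hcard u hu), if_neg hend]
    intro v hv hne; have hv' : f v = w := (mem_filter.1 hv).2
    rw [card_filter_ends (hcard v hv'), if_pos]
    exact by_contra fun h1 => hne (huniq _ _ (hv'.trans hu.symm) h1 hend)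
  exact ⟨key _ (fun u hu => (h.side_deg (hu ▸ hw)).2) (h.exists_first w)
    fun u v => h.first_unique, key _ (fun u hu => (h.side_deg (hu ▸ hw)).1) (h.exists_last w)
    fun u v => h.last_unique⟩

theorem vertical_ends {u : Fin Γ.nv} (hu : Γ.vertDeg (μ (f u)) = 0) :
    (Γ.ends u).filter (fun a => a.1 = 0) = 0 := by
  by_cases h1 : f u = g u
  · have h2 := h.eq_markAt_iff.1 h1; rw [← h1] at h2; rw [← h2] at hu
    refine Multiset.filter_eq_nil.2 fun a ha => ?_
    exact Multiset.filter_eq_nil.1 (Multiset.card_eq_zero.1 hu) a (mem_star.2 (.inr ha))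
  · have h2 := h.adj_markAt h1
    exact not_end_of_neighbor (p := fun a => a.1 = 0) (h.deg_unmarked h1).2.2.le h2.1 h2.2

theorem floorEnds_black {b : Fin Δ.n} (hb : Γ.vertDeg (μ b) ≠ 0) :
    Γ.floorEnds f b = Γ.ends (μ b) := by
  have h1 : univ.filter (fun u => f u = b) = {μ b} := by
    ext u; simp only [mem_filter_univ, mem_singleton]; constructor
    · rintro rfl; exact h.eq_of_f_black hb
    · rintro rfl; exact h.f_mark b
  rw [floorEnds, h1, sum_singleton]

theorem black_ends {b : Fin Δ.n} (hb : Γ.vertDeg (μ b) ≠ 0)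
    {a : ℤ × ℤ} (ha : a ∈ Γ.ends (μ b)) : a.1 = 0 := by
  have h1 : Γ.rightDeg (μ b) = 0 ∧ Γ.leftDeg (μ b) = 0 := by
    have := h.deg_markAt b; omega
  have h2 := Multiset.filter_eq_nil.1 (Multiset.card_eq_zero.1 h1.1) a (mem_star.2 (.inr ha))
  have h3 := Multiset.filter_eq_nil.1 (Multiset.card_eq_zero.1 h1.2) a (mem_star.2 (.inr ha)); omega

theorem sum_floorEnds : ∑ w, Γ.floorEnds f w = Δ.ends := by
  rw [← h.degree]; exact sum_fiberwise _ _ _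

theorem mem_ends {w : Fin Δ.n} {a : ℤ × ℤ} (ha : a ∈ Γ.floorEnds f w) : a ∈ Δ.ends := by
  rw [← h.sum_floorEnds]; exact Multiset.mem_sum.2 ⟨w, mem_univ _, ha⟩

end FloorCoords

end TropicalMap

end FloorCoordinates

/-! ### The floor diagram of a floor decomposed map -/

section DiagramOfMap

variable {Δ : DelPezzoDegree} {r s : ℕ}

theorem DelPezzoDegree.mem_ends_cases (hΔ : Δ.Valid) {a : ℤ × ℤ} (ha : a ∈ Δ.ends) :
    a = (-1, 0) ∨ a = (-1, -1) ∨ a = (1, 0) ∨ a = (1, 1) ∨ a = (0, -1) ∨ a = (0, 1) := by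
  rw [DelPezzoDegree.ends_eq hΔ] at ha; simp only [Multiset.mem_add, Multiset.mem_replicate] at ha
  tauto

namespace TropicalMap.FloorCoords

variable {M : Merging Δ.n r s} {Γ : TropicalMap r s} {f g : Fin Γ.nv → Fin Δ.n}

/-- The change of the slope of the floor `w` at the elevator `b`. -/
def jumpAt (M : Merging Δ.n r s) (Γ : TropicalMap r s) (f g : Fin Γ.nv → Fin Δ.n) (w b : Fin Δ.n) : ℤ :=
  ∑ u, if f u = w ∧ g u = b ∧ w ≠ b then -(Γ.dir u (Γ.markAt M b)).2 else 0

/-- The weights of the edges of the floor diagram. -/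
def edgeWeight (M : Merging Δ.n r s) (Γ : TropicalMap r s) (f g : Fin Γ.nv → Fin Δ.n) (a b : Fin Δ.n) : ℕ :=
  if a < b then (jumpAt M Γ f g a b).natAbs + (jumpAt M Γ f g b a).natAbs else 0

local notation "μ" => Γ.markAt M
local notation "jmp" => jumpAt M Γ f g
local notation "wt" => edgeWeight M Γ f g

theorem exists_of_jumpAt {w b : Fin Δ.n} (hJ : jmp w b ≠ 0) :
    ∃ u, f u = w ∧ g u = b ∧ f u ≠ g u := by
  obtain ⟨u, -, hu⟩ := exists_ne_zero_of_sum_ne_zero hJ; by_cases h1 : f u = w ∧ g u = b ∧ w ≠ b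
  · exact ⟨u, h1.1, h1.2.1, by rw [h1.1, h1.2.1]; exact h1.2.2⟩
  · exact absurd (if_neg h1) hu

theorem sum_jumpAt_row (w : Fin Δ.n) : ∑ b, jmp w b = ∑ u with f u = w,
      if f u ≠ g u then -(Γ.dir u (μ (g u))).2 else 0 := by
  unfold jumpAt; rw [sum_comm, sum_filter]; refine sum_congr rfl fun u _ => ?_
  rw [sum_eq_single (g u) (fun b _ hb => if_neg fun h => hb h.2.1.symm) (by simp)]
  by_cases h1 : f u = w <;> simp [h1]

theorem sum_jumpAt_column (b : Fin Δ.n) : ∑ w, jmp w b =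
    ∑ u, if g u = b ∧ f u ≠ g u then -(Γ.dir u (μ b)).2 else 0 := by
  unfold jumpAt; rw [sum_comm]; refine sum_congr rfl fun u _ => ?_
  rw [sum_eq_single (f u) (fun w _ hw => if_neg fun h => hw h.1.symm) (by simp)]
  refine if_congr ⟨fun h => ⟨h.2.1, ?_⟩, fun h => ⟨rfl, h.1, ?_⟩⟩ rfl rfl
  · rw [h.2.1]; exact h.2.2
  · rw [← h.1]; exact h.2

variable (h : FloorCoords M Γ f g)
include h

theorem floorEnds_white {w : Fin Δ.n} (hw : Γ.vertDeg (μ w) = 0) :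
    Γ.floorEnds f w = {(-1, -(if (-1, -1) ∈ Γ.floorEnds f w then 1 else 0))} +
      {(1, if (1, 1) ∈ Γ.floorEnds f w then 1 else 0)} := by
  obtain ⟨⟨a, ha⟩, b, hb⟩ := (h.card_sideEnds hw).imp Multiset.card_eq_one.1 Multiset.card_eq_one.1
  have h0 : (Γ.floorEnds f w).filter (fun a => a.1 = 0) = 0 := by
    rw [← Multiset.card_eq_zero, floorEnds, card_filter_sum]; refine sum_eq_zero fun u hu => ?_
    have hu' : f u = w := (mem_filter.1 hu).2
    rw [h.vertical_ends (by rw [hu']; exact hw), Multiset.card_zero]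
  have hmem : ∀ x, x ∈ Γ.floorEnds f w ↔ x = a ∨ x = b := by
    intro x
    conv_lhs => rw [← Multiset.filter_sign (Γ.floorEnds f w)]
    rw [ha, hb, h0, add_zero, Multiset.mem_add, Multiset.mem_singleton, Multiset.mem_singleton]
  have ha1 := (Multiset.mem_filter.1 (ha ▸ Multiset.mem_singleton_self a)).2
  have hb1 := (Multiset.mem_filter.1 (hb ▸ Multiset.mem_singleton_self b)).2
  have ha2 := DelPezzoDegree.mem_ends_cases h.valid (h.mem_ends ((hmem a).2 (.inl rfl)))
  have hb2 := DelPezzoDegree.mem_ends_cases h.valid (h.mem_ends ((hmem b).2 (.inr rfl)))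
  have h3 : (-1, -(if (-1, -1) ∈ Γ.floorEnds f w then 1 else 0)) = a ∧
      (1, if (1, 1) ∈ Γ.floorEnds f w then 1 else 0) = b := by
    simp only [hmem]; rcases ha2 with rfl | rfl | rfl | rfl | rfl | rfl <;>
      rcases hb2 with rfl | rfl | rfl | rfl | rfl | rfl <;> simp_all
  rw [h3.1, h3.2, ← ha, ← hb]
  conv_lhs => rw [← Multiset.filter_sign (Γ.floorEnds f w)]
  rw [h0, add_zero]

theorem floorEnds_black' {b : Fin Δ.n} (hb : Γ.vertDeg (μ b) ≠ 0) :
    Γ.floorEnds f b = .replicate ((Γ.floorEnds f b).count (0, -1)) (0, -1) +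
      .replicate ((Γ.floorEnds f b).count (0, 1)) (0, 1) := by
  ext x; rw [Multiset.count_add, Multiset.count_replicate, Multiset.count_replicate]
  by_cases hx : x ∈ Γ.floorEnds f b
  · have h1 := h.mem_ends hx; have h2 : x.1 = 0 := h.black_ends hb (h.floorEnds_black hb ▸ hx)
    rcases DelPezzoDegree.mem_ends_cases h.valid h1 with rfl | rfl | rfl | rfl | rfl | rfl <;> simp_all
  · rw [Multiset.count_eq_zero_of_notMem hx]; split_ifs with h1 h2 h2
    all_goals simp_all

theorem jumpAt_eq {u : Fin Γ.nv} (hu : f u ≠ g u) : jmp (f u) (g u) = -(Γ.dir u (μ (g u))).2 := by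
  rw [jumpAt, sum_eq_single u]
  · rw [if_pos ⟨rfl, rfl, hu⟩]
  · intro v _ hv; exact if_neg fun h1 => hv (h.inj h1.1 h1.2.1)
  · simp

theorem jumpAt_ne_zero {u : Fin Γ.nv} (hu : f u ≠ g u) : jmp (f u) (g u) ≠ 0 := by
  rw [h.jumpAt_eq hu, neg_ne_zero]; have h1 := h.adj_markAt hu
  exact fun h2 => h.rigid.dir_ne _ _ h1.1 (Prod.ext h1.2 h2)

theorem jumpAt_black {w b : Fin Δ.n} (hw : Γ.vertDeg (μ w) ≠ 0) : jmp w b = 0 := by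
  by_contra hJ; obtain ⟨u, rfl, rfl, hu⟩ := exists_of_jumpAt hJ; exact hw (h.f_white hu)

theorem jumpAt_white {w b : Fin Δ.n} (hb : Γ.vertDeg (μ b) = 0) : jmp w b = 0 := by
  by_contra hJ; obtain ⟨u, rfl, rfl, hu⟩ := exists_of_jumpAt hJ; exact h.g_black hu hb

theorem steep_lt {v w : Fin Δ.n} (hvw : v < w) : Multiset.card Γ.degree *
    |(Γ.pos (μ v)).1 - (Γ.pos (μ w)).1| < (Γ.pos (μ w)).2 - (Γ.pos (μ v)).2 := by
  obtain ⟨a, rfl⟩ := M.slot.surjective v; obtain ⟨b, rfl⟩ := M.slot.surjective w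
  simp only [markAt, Equiv.symm_apply_apply]; have h1 := h.order a b hvw
  have hab : b ≠ a := by rintro rfl; exact lt_irrefl _ hvw
  have h2 : Multiset.card Γ.degree *
      |(Γ.pos (Γ.mark a)).1 - (Γ.pos (Γ.mark b)).1| < |(Γ.pos (Γ.mark a)).2 - (Γ.pos (Γ.mark b)).2| := by
    by_cases hs : b = a.swap
    · have h3 := h.steep.pair_abs (a := a) (by rw [← hs]; exact hab); rwa [← hs] at h3
    · exact (le_mul_of_one_le_left (by positivity) (by exact_mod_cast Fin.pos (Γ.mark a))).trans_lt
        (h.steep.far a b hab hs a b)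
  rwa [abs_sub_comm (Γ.pos (Γ.mark a)).2, abs_of_pos (sub_pos.2 h1)] at h2

theorem slope_le (u : Fin Γ.nv) :
    |(Γ.pos u).2 - (Γ.pos (μ (f u))).2| ≤ Multiset.card Γ.degree *
      |(Γ.pos u).1 - (Γ.pos (μ (f u))).1| := by
  rcases h.chain (h.f_mark (f u)).symm with h1 | h1
  · exact h.smallEnds.abs_sub_snd_le_of_chain h1
  · have h2 := h.smallEnds.abs_sub_snd_le_of_chain h1; rwa [abs_sub_comm, abs_sub_comm (Γ.pos u).1]

theorem dir_sign {u : Fin Γ.nv} (hu : f u ≠ g u) : (f u < g u → 0 < (Γ.dir u (μ (g u))).2) ∧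
      (g u < f u → (Γ.dir u (μ (g u))).2 < 0) := by
  have h1 := h.adj_markAt hu; have h2 := Γ.affine _ _ h1.1; have h3 := Γ.len_pos _ _ h1.1
  have h4 : (Γ.pos (μ (g u))).2 = (Γ.pos u).2 +
      Γ.len u (μ (g u)) * ((Γ.dir u (μ (g u))).2 : ℝ) := by
    rw [h2]; rfl
  have h5 := abs_le.1 (h.slope_le u); rw [← h.x_eq u] at h5; constructor
  · intro hlt; have h6 := h.steep_lt hlt; rw [abs_sub_comm] at h6
    have h7 : 0 < Γ.len u (μ (g u)) * ((Γ.dir u (μ (g u))).2 : ℝ) := by linarith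
    exact_mod_cast (pos_iff_pos_of_mul_pos h7).1 h3
  · intro hlt; have h6 := h.steep_lt hlt
    have h7 : Γ.len u (μ (g u)) * ((Γ.dir u (μ (g u))).2 : ℝ) < 0 := by linarith
    exact_mod_cast (pos_iff_neg_of_mul_neg h7).1 h3

theorem jumpAt_sign (w b : Fin Δ.n) : (0 < jmp w b → b < w) ∧ (jmp w b < 0 → w < b) := by
  by_cases hJ : jmp w b = 0
  · simp [hJ]
  obtain ⟨u, rfl, rfl, hu⟩ := exists_of_jumpAt hJ; have h1 := h.dir_sign hu; rw [h.jumpAt_eq hu]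
  rcases lt_or_gt_of_ne hu with h2 | h2
  · exact ⟨fun h3 => absurd (h1.1 h2) (by omega), fun _ => h2⟩
  · exact ⟨fun _ => h2, fun h3 => absurd (h1.2 h2) (by omega)⟩

theorem jumpAt_swap {a b : Fin Δ.n} (hJ : jmp a b ≠ 0) : jmp b a = 0 := by
  obtain ⟨u, rfl, rfl, hu⟩ := exists_of_jumpAt hJ; exact h.jumpAt_black (h.g_black hu)

theorem edgeWeight_sub (a b : Fin Δ.n) : (wt b a : ℤ) - wt a b = jmp a b - jmp b a := by
  have h1 := h.jumpAt_sign a b; have h2 := h.jumpAt_sign b a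
  have h3 := h.jumpAt_swap (a := a) (b := b); unfold edgeWeight
  rcases lt_trichotomy a b with hab | rfl | hab
  · rw [if_pos hab, if_neg hab.not_gt]; have h4 : ¬ 0 < jmp a b := fun h => (h1.1 h).not_gt hab
    have h5 : ¬ jmp b a < 0 := fun h => (h2.2 h).not_gt hab; omega
  · simp
  · rw [if_pos hab, if_neg hab.not_gt]; have h4 : ¬ 0 < jmp b a := fun h => (h2.1 h).not_gt hab
    have h5 : ¬ jmp a b < 0 := fun h => (h1.2 h).not_gt hab; omega

theorem edgeWeight_adj {a b : Fin Δ.n} :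
    (weightGraph (wt)).Adj a b ↔ jmp a b ≠ 0 ∨ jmp b a ≠ 0 := by
  unfold weightGraph edgeWeight; rw [fromRel_adj]; rcases lt_trichotomy a b with hab | rfl | hab
  · simp [hab, hab.ne, hab.not_gt, or_iff_not_imp_left]
  · simp only [ne_eq, not_true, false_and, or_self, false_iff, not_not]; by_contra hJ
    obtain ⟨u, h1, h2, h3⟩ := exists_of_jumpAt hJ; exact h3 (h1.trans h2.symm)
  · simp [hab, hab.ne', hab.not_gt, or_iff_not_imp_left, imp_not_comm]

theorem isContraction : IsContraction Γ.graph (weightGraph (wt)) f := by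
  refine ⟨fun c => ?_, fun u v huv hne => ?_, fun a b hab => ?_⟩
  · exact induce_fiber_connected (Z := Γ.floorGraph) (fun u v huv => huv.1) (fun u v => h.f_eq) c
      ⟨μ c, h.f_mark c⟩
  · have hd : (Γ.dir u v).1 = 0 := by
      by_contra hd; exact hne (h.f_eq.2 (Adj.reachable (⟨huv, hd⟩ : Γ.floorGraph.Adj u v)))
    rw [h.edgeWeight_adj]
    refine (h.elevator_adj_cases ⟨huv, hd⟩).imp ?_ ?_ <;> rintro ⟨h1, h2⟩ <;> rw [h2, h.f_mark] <;>
      exact h.jumpAt_ne_zero h1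
  · rcases h.edgeWeight_adj.1 hab with hJ | hJ
    · obtain ⟨u, rfl, rfl, hu⟩ := exists_of_jumpAt hJ
      exact ⟨u, _, rfl, h.f_mark _, (h.adj_markAt hu).1⟩
    · obtain ⟨u, rfl, rfl, hu⟩ := exists_of_jumpAt hJ
      exact ⟨_, u, h.f_mark _, rfl, (h.adj_markAt hu).1.symm⟩

theorem sum_jumpAt_white {w : Fin Δ.n} (hw : Γ.vertDeg (μ w) = 0) :
    ∑ b, jmp w b = ((Γ.floorEnds f w).map Prod.snd).sum := by
  have h1 : ((Γ.floorEnds f w).map Prod.snd).sum =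
      ∑ u with f u = w, ((Γ.ends u).map Prod.snd).sum := by
    rw [floorEnds, ← Multiset.coe_mapAddMonoidHom, map_sum]
    exact map_sum Multiset.sumAddMonoidHom _ _
  have h2 : ∀ u ∈ univ.filter (fun u => f u = w), ((Γ.ends u).map Prod.snd).sum =
      -(∑ v, if Γ.floorGraph.Adj u v then (Γ.dir u v).2 else 0) +
        if f u ≠ g u then -(Γ.dir u (μ (g u))).2 else 0 := by
    intro u hu; have hu' : f u = w := (mem_filter.1 hu).2
    have h3 := sum_star_map (Γ := Γ) u Prod.snd; rw [sum_star_snd] at h3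
    have h4 : (∑ v, if Γ.graph.Adj u v then (Γ.dir u v).2 else 0) =
        (∑ v, if Γ.floorGraph.Adj u v then (Γ.dir u v).2 else 0) +
          if f u ≠ g u then (Γ.dir u (μ (g u))).2 else 0 := by
      have h5 : (if f u ≠ g u then (Γ.dir u (μ (g u))).2 else 0) =
          ∑ v, if Γ.elevatorGraph.Adj u v then (Γ.dir u v).2 else 0 := by
        by_cases h6 : f u = g u
        · rw [if_neg (not_not.2 h6)]; rw [← hu', h6, ← h.eq_markAt_iff.1 h6] at hw
          exact (sum_eq_zero fun v _ => if_neg (not_adj_of_vertDeg hw)).symm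
        · rw [if_pos h6, sum_eq_single (μ (g u))]
          · rw [if_pos (h.adj_markAt h6)]
          · intro v _ hv; exact if_neg fun h7 => hv (h.vertical_neighbor h6 h7)
          · simp
      rw [h5, ← sum_add_distrib]; refine sum_congr rfl fun v _ => ?_; by_cases h6 : Γ.graph.Adj u v
      · by_cases h7 : (Γ.dir u v).1 = 0 <;> simp [floorGraph, elevatorGraph, h6, h7]
      · simp [floorGraph, elevatorGraph, h6]
    rw [h4] at h3; split_ifs at h3 ⊢ <;> omega
  rw [h1, sum_congr rfl h2, sum_add_distrib, sum_jumpAt_row, sum_neg_distrib,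
    Finset.sum_antisymm_closed (V := Fin Γ.nv)
      (F := fun u v => if Γ.floorGraph.Adj u v then (Γ.dir u v).2 else 0)]
  · simp
  · intro u v; by_cases h3 : Γ.floorGraph.Adj u v
    · rw [if_pos h3, if_pos h3.symm, Γ.dir_symm _ _ h3.1]; rfl
    · rw [if_neg h3, if_neg fun h4 => h3 h4.symm, neg_zero]
  · intro u hu v hv; refine if_neg fun h3 => hv ?_; rw [mem_filter] at hu ⊢
    exact ⟨mem_univ _, (h.f_eq.2 h3.reachable).symm.trans hu.2⟩

theorem sum_jumpAt_black {b : Fin Δ.n} (hb : Γ.vertDeg (μ b) ≠ 0) :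
    ∑ w, jmp w b = -((Γ.floorEnds f b).map Prod.snd).sum := by
  have h1 := sum_star_map (Γ := Γ) (μ b) Prod.snd; rw [sum_star_snd] at h1
  have h2 : (∑ u, if Γ.graph.Adj (μ b) u then (Γ.dir (μ b) u).2 else 0) = ∑ w, jmp w b := by
    rw [sum_jumpAt_column]; refine sum_congr rfl fun u _ => ?_
    have h3 : Γ.graph.Adj (μ b) u ↔ g u = b ∧ f u ≠ g u := by
      constructor
      · intro hadj; have hd : (Γ.dir (μ b) u).1 = 0 := by
          by_contra hd; have h4 := h.f_eq.2 (Adj.reachable (⟨hadj, hd⟩ : Γ.floorGraph.Adj (μ b) u))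
          rw [h.f_mark] at h4; have h5 := h.eq_of_f_black (u := u) (by rw [← h4]; exact hb)
          rw [← h4] at h5; exact hadj.ne h5.symm
        rcases h.elevator_adj_cases ⟨hadj, hd⟩ with ⟨h4, -⟩ | ⟨h4, h5⟩
        · rw [h.f_mark, h.g_mark] at h4; exact absurd rfl h4
        · exact ⟨(h.markAt_inj h5).symm, h4⟩
      · rintro ⟨rfl, h4⟩; exact (h.adj_markAt h4).1.symm
    by_cases h4 : g u = b ∧ f u ≠ g u
    · rw [if_pos h4, if_pos (h3.2 h4), Γ.dir_symm _ _ (h3.2 h4)]; rfl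
    · rw [if_neg h4, if_neg fun h5 => h4 (h3.1 h5)]
  rw [h2, ← h.floorEnds_black hb] at h1; omega

theorem sum_count (a : ℤ × ℤ) : ∑ w, (Γ.floorEnds f w).count a = Δ.ends.count a := by
  rw [← h.sum_floorEnds, Multiset.count_sum']

theorem notMem_floorEnds {b : Fin Δ.n} (hb : Γ.vertDeg (μ b) ≠ 0) {a : ℤ × ℤ} (ha : a.1 ≠ 0) :
    a ∉ Γ.floorEnds f b := fun h1 => ha (h.black_ends hb (h.floorEnds_black hb ▸ h1))

theorem card_leak {a : ℤ × ℤ} (ha : a = (1, 1) ∨ a = (-1, -1)) :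
    #{v | a ∈ Γ.floorEnds f v} = Δ.ends.count a := by
  rw [← h.sum_count, card_filter]; refine sum_congr rfl fun w _ => ?_
  by_cases h4 : a ∈ Γ.floorEnds f w
  · have hw : Γ.vertDeg (μ w) = 0 := by_contra fun hw =>
      h.notMem_floorEnds hw (by rcases ha with rfl | rfl <;> simp) h4
    rcases ha with rfl | rfl <;> rw [if_pos h4, h.floorEnds_white hw] <;> simp [h4]
  · rw [if_neg h4, Multiset.count_eq_zero_of_notMem h4]

/-- The floor diagram of a floor decomposed tropical stable map. -/
def diagram : FloorDiagram Δ where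
  white := univ.filter fun v => Γ.vertDeg (μ v) = 0
  weight := wt
  inEnds v := (Γ.floorEnds f v).count (0, -1)
  outEnds v := (Γ.floorEnds f v).count (0, 1)
  leakPos := univ.filter fun v => (1, 1) ∈ Γ.floorEnds f v
  leakNeg := univ.filter fun v => (-1, -1) ∈ Γ.floorEnds f v
  oriented a b hab := by_contra fun h1 => hab (if_neg h1)
  bipartite a b hab := by
    have h1 : (weightGraph (wt)).Adj a b := by
      unfold weightGraph; rw [fromRel_adj]; exact ⟨fun h1 => hab (if_neg h1.not_lt), .inl hab⟩
    simp only [mem_filter_univ]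
    rcases h.edgeWeight_adj.1 h1 with hJ | hJ <;> obtain ⟨u, rfl, rfl, hu⟩ := exists_of_jumpAt hJ
    · exact iff_of_true (h.f_white hu) (h.g_black hu)
    · exact iff_of_false (h.g_black hu) (not_not.2 (h.f_white hu))
  isTree := h.isContraction.isTree Γ.isTree
  leakPos_white v hv := by
    simp only [mem_filter_univ] at hv ⊢
    exact by_contra fun hb => h.notMem_floorEnds hb (by simp) hv
  leakNeg_white v hv := by
    simp only [mem_filter_univ] at hv ⊢
    exact by_contra fun hb => h.notMem_floorEnds hb (by simp) hv
  divergence v := by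
    have h1 : ((∑ u, wt u v : ℕ) : ℤ) - (∑ u, wt v u : ℕ) = ∑ u, jmp v u - ∑ u, jmp u v := by
      push_cast; rw [← sum_sub_distrib, ← sum_sub_distrib]
      exact sum_congr rfl fun u _ => h.edgeWeight_sub v u
    simp only [mem_filter_univ]; by_cases hv : Γ.vertDeg (μ v) = 0
    · rw [h.sum_jumpAt_white hv, sum_eq_zero fun u _ => h.jumpAt_white (w := u) hv] at h1
      have h2 := h.floorEnds_white hv
      have h3 : (Γ.floorEnds f v).count (0, -1) = 0 := by rw [h2]; simp
      have h4 : (Γ.floorEnds f v).count (0, 1) = 0 := by rw [h2]; simp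
      have h5 := congrArg (fun m => (Multiset.map Prod.snd m).sum) h2
      simp only [Multiset.map_add, Multiset.sum_add, Multiset.map_singleton, Multiset.sum_singleton] at h5
      rw [h3, h4]; push_cast at h1 ⊢; omega
    · rw [h.sum_jumpAt_black hv, sum_eq_zero fun u _ => h.jumpAt_black (b := u) hv] at h1
      have h2 := h.floorEnds_black' hv
      have h5 := congrArg (fun m => (Multiset.map Prod.snd m).sum) h2
      simp only [Multiset.map_add, Multiset.sum_add, Multiset.map_replicate, Multiset.sum_replicate,
        nsmul_eq_mul] at h5
      rw [if_neg (h.notMem_floorEnds hv (a := (1, 1)) (by simp)),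
        if_neg (h.notMem_floorEnds hv (a := (-1, -1)) (by simp))]
      push_cast at h1 h5 ⊢; omega
  card_white := by
    have h1 := h.sum_count (-1, 0); have h2 := h.sum_count (-1, -1)
    rw [DelPezzoDegree.ends_eq h.valid] at h1 h2
    simp only [Multiset.count_add, Multiset.count_replicate] at h1 h2; norm_num at h1 h2
    have h3 : #{v | Γ.vertDeg (μ v) = 0} =
        ∑ w, ((Γ.floorEnds f w).count (-1, 0) + (Γ.floorEnds f w).count (-1, -1)) := by
      rw [card_filter]; refine sum_congr rfl fun w _ => ?_; by_cases hw : Γ.vertDeg (μ w) = 0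
      · rw [if_pos hw, h.floorEnds_white hw]; by_cases h4 : (-1, -1) ∈ Γ.floorEnds f w <;> simp [h4]
      · rw [if_neg hw, h.floorEnds_black' hw]; simp [Multiset.count_replicate]
    rw [h3, sum_add_distrib, h1, h2]; have := Δ.numLeakNeg_le h.valid; omega
  card_leakPos := by
    rw [h.card_leak (.inl rfl), DelPezzoDegree.ends_eq h.valid]; norm_num [Multiset.count_replicate]
  card_leakNeg := by
    rw [h.card_leak (.inr rfl), DelPezzoDegree.ends_eq h.valid]; norm_num [Multiset.count_replicate]
  sum_inEnds := by simp [h.sum_count, DelPezzoDegree.ends_eq h.valid, Multiset.count_replicate]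
  sum_outEnds := by simp [h.sum_count, DelPezzoDegree.ends_eq h.valid, Multiset.count_replicate]

end TropicalMap.FloorCoords

end DiagramOfMap

/-! ### The floor plan of a floor decomposed map -/

section PlanOfMap

variable {Δ : DelPezzoDegree} {r s : ℕ}

namespace TropicalMap.FloorCoords

variable {M : Merging Δ.n r s} {Γ : TropicalMap r s} {f g : Fin Γ.nv → Fin Δ.n}

variable (h : FloorCoords M Γ f g)
local notation "μ" => Γ.markAt M
local notation "jmp" => jumpAt M Γ f g
include h

/-- The floor plan of a floor decomposed tropical stable map. -/
def plan : FloorPlan Δ (ℝ ×ₗ (Fin Δ.n ×ₗ Fin Δ.n)) :=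
  Layout.planOfCoord h.diagram (fun e => (Γ.pos (μ e.2)).1) id fun _ => .inl rfl

theorem plan_fl (e : Fin Δ.n × Fin Δ.n) : h.plan.fl e = e.1 := by
  unfold FloorPlan.fl; split_ifs <;> rfl

theorem mem_white {v : Fin Δ.n} : v ∈ h.plan.D.white ↔ Γ.vertDeg (μ v) = 0 := by
  change v ∈ h.diagram.white ↔ _; simp [diagram]

theorem plan_adj {a b : Fin Δ.n} :
    h.plan.D.graph.Adj a b ↔ jmp a b ≠ 0 ∨ jmp b a ≠ 0 := h.edgeWeight_adj

theorem plan_jump (a b : Fin Δ.n) : h.plan.D.jump a b = jmp a b - jmp b a := h.edgeWeight_sub a b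

theorem isNode (u : Fin Γ.nv) : h.plan.D.IsNode (f u, g u) := by
  by_cases hu : f u = g u
  exacts [.inl hu, .inr ⟨h.mem_white.2 (h.f_white hu), h.plan_adj.2 (.inl (h.jumpAt_ne_zero hu))⟩]

/-- The vertices of the map are the nodes of the floor plan. -/
def nodeEquiv : Fin Γ.nv ≃ h.plan.Node :=
  Equiv.ofBijective (fun u => ⟨(f u, g u), h.isNode u⟩) ⟨fun u v huv =>
      h.inj (congrArg (fun e : h.plan.Node => e.1.1) huv) (congrArg (fun e : h.plan.Node => e.1.2) huv), by
    rintro ⟨⟨a, b⟩, he⟩; obtain rfl | ⟨hw, hadj⟩ : a = b ∨ _ := he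
    · exact ⟨μ a, Subtype.ext (Prod.ext (h.f_mark a) (h.g_mark a))⟩
    · have h1 := (h.plan_adj.1 hadj).resolve_right (not_not.2 (h.jumpAt_white (h.mem_white.1 hw)))
      obtain ⟨u, h2, h3, -⟩ := exists_of_jumpAt h1; exact ⟨u, Subtype.ext (Prod.ext h2 h3)⟩⟩

theorem nodeEquiv_val (u : Fin Γ.nv) : (h.nodeEquiv u).1 = (f u, g u) := rfl

theorem fl_nodeEquiv (u : Fin Γ.nv) : h.plan.fl (h.nodeEquiv u).1 = f u := h.plan_fl _

theorem nodeEquiv_markAt (v : Fin Δ.n) : h.nodeEquiv (μ v) = h.plan.markNode v :=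
  Subtype.ext (Prod.ext (h.f_mark v) (h.g_mark v))

theorem key_le {u v : Fin Γ.nv} (huv : h.plan.key (h.nodeEquiv u).1 ≤ h.plan.key (h.nodeEquiv v).1) :
    (Γ.pos u).1 ≤ (Γ.pos v).1 := by
  rw [← h.x_eq u, ← h.x_eq v]; exact Layout.planOfCoord_le huv

theorem key_le_iff {u v : Fin Γ.nv} (huv : f u = f v) :
    h.plan.key (h.nodeEquiv u).1 ≤ h.plan.key (h.nodeEquiv v).1 ↔ ReflTransGen Γ.RightOf u v := by
  have key : ∀ {a b}, ReflTransGen Γ.RightOf a b → 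
      a = b ∨ h.plan.key (h.nodeEquiv a).1 < h.plan.key (h.nodeEquiv b).1 := by
    intro a b hab; exact (reflTransGen_iff_eq_or_transGen.1 hab).imp Eq.symm fun h1 =>
      not_le.1 fun h2 => (h.key_le h2).not_gt (pos_lt_of_transGen h1)
  refine ⟨fun h1 => (h.chain huv).elim id fun h2 => ?_, fun h1 => (key h1).elim (by rintro rfl; rfl) le_of_lt⟩
  rcases key h2 with rfl | h3; exacts [h2, absurd h1 h3.not_ge]

theorem rightOf_unique {u v v' : Fin Γ.nv} (hv : Γ.RightOf u v)
    (hv' : Γ.RightOf u v') : v = v' := by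
  refine neighbor_unique (p := fun a => 0 < a.1) ?_ hv.1 hv'.1 hv.2 hv'.2; change Γ.rightDeg u ≤ 1
  by_cases hu : f u = g u
  · have := h.deg_markAt (g u); rw [← h.eq_markAt_iff.1 hu] at this; omega
  · exact (h.deg_unmarked hu).1.le

theorem next_iff {u v : Fin Γ.nv} : h.plan.Next (h.nodeEquiv u) (h.nodeEquiv v) ↔ Γ.RightOf u v := by
  constructor
  · rintro ⟨h1, h2, h3⟩; rw [fl_nodeEquiv, fl_nodeEquiv] at h1
    rcases ((h.key_le_iff h1).1 h2.le).cases_head with rfl | ⟨c, hc, hcv⟩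
    · exact absurd h2 (lt_irrefl _)
    · have h4 := h.f_rightOf hc
      have h5 : h.plan.key (h.nodeEquiv u).1 < h.plan.key (h.nodeEquiv c).1 :=
        not_le.1 fun h6 => (h.key_le h6).not_gt hc.pos_lt
      have h6 := h3 (h.nodeEquiv c) (by rw [fl_nodeEquiv, fl_nodeEquiv, h4]) h5
      have h7 := h.plan.ext_key (le_antisymm h6 ((h.key_le_iff (h4.symm.trans h1)).2 hcv))
      rw [h.nodeEquiv.injective h7]; exact hc
  · intro huv; have h1 := h.f_rightOf huv
    refine ⟨by rw [fl_nodeEquiv, fl_nodeEquiv, h1], not_le.1 fun h6 => (h.key_le h6).not_gt huv.pos_lt, ?_⟩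
    intro e he hlt; obtain ⟨w, rfl⟩ := h.nodeEquiv.surjective e
    rw [fl_nodeEquiv, fl_nodeEquiv] at he
    rcases ((h.key_le_iff he.symm).1 hlt.le).cases_head with rfl | ⟨c, hc, hcw⟩
    · exact absurd hlt (lt_irrefl _)
    · rw [h.rightOf_unique huv hc]; exact (h.key_le_iff ((h.f_rightOf hc).symm.trans he.symm)).2 hcw

theorem vert_iff {u v : Fin Γ.nv} :
    h.plan.Vert (h.nodeEquiv u) (h.nodeEquiv v) ↔ f u ≠ g u ∧ v = μ (g u) := by
  constructor
  · rintro ⟨h1, h2, h3 : g v = g u, -⟩; exact ⟨h1, h3 ▸ h.eq_markAt_iff.1 (Eq.trans h2 h3.symm)⟩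
  · rintro ⟨h1, rfl⟩
    exact ⟨h1, h.f_mark _, h.g_mark _, fun h2 => h1 (h.eq_markAt_iff.2 (h.nodeEquiv.injective h2))⟩

theorem plan_graph_adj {u v : Fin Γ.nv} :
    h.plan.graph.Adj (h.nodeEquiv u) (h.nodeEquiv v) ↔ Γ.graph.Adj u v := by
  change (h.plan.Next _ _ ∨ h.plan.Next _ _ ∨ h.plan.Vert _ _ ∨ h.plan.Vert _ _) ↔ _
  rw [h.next_iff, h.next_iff, h.vert_iff, h.vert_iff]; constructor
  · rintro (h1 | h1 | ⟨h1, rfl⟩ | ⟨h1, rfl⟩)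
    exacts [h1.1, h1.1.symm, (h.adj_markAt h1).1, (h.adj_markAt h1).1.symm]
  · intro h1; by_cases hd : (Γ.dir u v).1 = 0
    · exact .inr (.inr (h.elevator_adj_cases ⟨h1, hd⟩))
    · exact (floorGraph_adj_iff.1 (⟨h1, hd⟩ : Γ.floorGraph.Adj u v)).imp_right .inl

theorem first_iff {u : Fin Γ.nv} :
    h.plan.First (h.nodeEquiv u) ↔ ¬ ∃ y, Γ.graph.Adj u y ∧ (Γ.dir u y).1 < 0 := by
  constructor
  · rintro h1 ⟨y, hy, hd⟩; exact h.plan.not_first_of_next (h.next_iff.2 (⟨hy.symm, by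
      rw [Γ.dir_symm _ _ hy.symm]; simpa using hd⟩ : Γ.RightOf y u)) h1
  · refine fun h1 => by_contra fun h2 => ?_; obtain ⟨e, he⟩ := h.plan.exists_prev h2
    obtain ⟨y, rfl⟩ := h.nodeEquiv.surjective e
    exact h1 ⟨y, (h.next_iff.1 he).1.symm, (h.next_iff.1 he).leftDir⟩

theorem last_iff {u : Fin Γ.nv} :
    h.plan.Last (h.nodeEquiv u) ↔ ¬ ∃ y, Γ.graph.Adj u y ∧ 0 < (Γ.dir u y).1 := by
  constructor
  · rintro h1 ⟨y, hy, hd⟩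
    exact h.plan.not_last_of_next (h.next_iff.2 (⟨hy, hd⟩ : Γ.RightOf u y)) h1
  · refine fun h1 => by_contra fun h2 => ?_; obtain ⟨e, he⟩ := h.plan.exists_next h2
    obtain ⟨y, rfl⟩ := h.nodeEquiv.surjective e; exact h1 ⟨y, h.next_iff.1 he⟩

omit h in
theorem filter_ends_of_forall {v : Fin Γ.nv} {p : ℤ × ℤ → Prop} [DecidablePred p]
    (hp : ¬ ∃ y, Γ.graph.Adj v y ∧ p (Γ.dir v y)) : (Γ.star v).filter p = (Γ.ends v).filter p := by
  rw [star, Multiset.filter_add, Multiset.filter_eq_nil.2, zero_add]; intro a ha hpa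
  obtain ⟨y, hy, rfl⟩ := Multiset.mem_map.1 ha; exact hp ⟨y, by simpa using hy, hpa⟩

theorem leakL_eq (w : Fin Δ.n) : h.plan.leakL w = if (-1, -1) ∈ Γ.floorEnds f w then 1 else 0 := by
  change (if w ∈ h.diagram.leakNeg then (1 : ℤ) else 0) = _; simp [diagram]

theorem sum_vertical {u : Fin Γ.nv} (hw : Γ.vertDeg (μ (f u)) = 0) :
    ((Γ.star u).filter fun a => a.1 = 0).sum = (0, -h.plan.D.jump (f u) (g u)) := by
  rw [h.plan_jump]; by_cases hu : f u = g u
  · rw [hu, ← h.eq_markAt_iff.1 hu] at hw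
    rw [show (Γ.star u).filter (fun a => a.1 = 0) = 0 from Multiset.card_eq_zero.1 hw, hu]
    simp; rfl
  · obtain ⟨a, ha⟩ := Multiset.card_eq_one.1 (h.deg_unmarked hu).2.2; have h1 := h.adj_markAt hu
    have h2 : Γ.dir u (μ (g u)) ∈ (Γ.star u).filter fun a => a.1 = 0 :=
      Multiset.mem_filter.2 ⟨mem_star.2 (.inl ⟨_, h1.1, rfl⟩), h1.2⟩
    rw [ha, Multiset.mem_singleton] at h2
    rw [ha, ← h2, Multiset.sum_singleton, h.jumpAt_black (h.g_black hu), h.jumpAt_eq hu]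
    exact Prod.ext h1.2 (by simp)

theorem right_star {u : Fin Γ.nv} (hw : Γ.vertDeg (μ (f u)) = 0)
    (hL : (Γ.star u).filter (fun a => a.1 < 0) = {(-1, -h.plan.slopeL (h.nodeEquiv u))}) :
    (Γ.star u).filter (fun a => 0 < a.1) = {(1, h.plan.slopeR (h.nodeEquiv u))} := by
  obtain ⟨a, ha⟩ := Multiset.card_eq_one.1 (h.side_deg hw).1; have h1 := sum_star (Γ := Γ) u
  rw [← Multiset.filter_sign (Γ.star u), Multiset.sum_add, Multiset.sum_add, h.sum_vertical hw, hL, ha,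
    Multiset.sum_singleton, Multiset.sum_singleton] at h1
  have h2 := h.plan.slopeR_eq (h.nodeEquiv u); rw [fl_nodeEquiv, nodeEquiv_val, if_pos rfl] at h2
  rw [ha, h2, Multiset.singleton_inj]; have h3 := congrArg Prod.fst h1
  have h4 := congrArg Prod.snd h1
  simp only [Prod.fst_add, Prod.snd_add, Prod.fst_zero, Prod.snd_zero] at h3 h4
  ext <;> simp only <;> omega

theorem left_star {u : Fin Γ.nv} (hw : Γ.vertDeg (μ (f u)) = 0) :
    (Γ.star u).filter (fun a => a.1 < 0) = {(-1, -h.plan.slopeL (h.nodeEquiv u))} := by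
  obtain ⟨v, hv, hfirst⟩ := h.exists_first (f u); have hvu : ReflTransGen Γ.RightOf v u := by
    refine (h.chain hv).elim id fun h1 => ?_; rcases h1.cases_tail with h2 | ⟨y, -, hy⟩
    exacts [h2 ▸ .refl, absurd ⟨y, hy.1.symm, hy.leftDir⟩ hfirst]
  clear hv
  induction hvu with
  | refl =>
    rw [h.plan.slopeL_of_first (by rw [fl_nodeEquiv]; exact h.mem_white.2 hw) (h.first_iff.2 hfirst),
      fl_nodeEquiv, leakL_eq]
    obtain ⟨a, ha⟩ := Multiset.card_eq_one.1 (h.side_deg hw).2; rw [ha, Multiset.singleton_inj]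
    have h1 : a ∈ (Γ.ends v).filter (fun a => a.1 < 0) := by
      rw [← filter_ends_of_forall hfirst, ha]; simp
    have h2 : a ∈ Γ.floorEnds f (f v) :=
      Multiset.mem_sum.2 ⟨v, by simp, (Multiset.mem_filter.1 h1).1⟩
    rw [h.floorEnds_white hw, Multiset.mem_add, Multiset.mem_singleton, Multiset.mem_singleton] at h2
    refine h2.resolve_right fun h2 => ?_; have h3 := (Multiset.mem_filter.1 h1).2
    norm_num [h2] at h3
  | @tail b c _ hbc ih =>
    have hfb := h.f_rightOf hbc
    have hR := h.right_star (u := b) (by rw [hfb]; exact hw) (ih (by rw [hfb]; exact hw))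
    have h1 : Γ.dir b c ∈ (Γ.star b).filter (fun a => 0 < a.1) :=
      Multiset.mem_filter.2 ⟨mem_star.2 (.inl ⟨_, hbc.1, rfl⟩), hbc.2⟩
    rw [hR, Multiset.mem_singleton] at h1
    obtain ⟨a, ha⟩ := Multiset.card_eq_one.1 (h.side_deg hw).2
    have h2 : Γ.dir c b ∈ (Γ.star c).filter (fun a => a.1 < 0) :=
      Multiset.mem_filter.2 ⟨mem_star.2 (.inl ⟨_, hbc.1.symm, rfl⟩), hbc.leftDir⟩
    rw [ha, Multiset.mem_singleton] at h2
    rw [ha, ← h2, Γ.dir_symm _ _ hbc.1.symm, h1, h.plan.slopeL_of_next (h.next_iff.2 hbc)]; rfl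

theorem dir_rightOf {u v : Fin Γ.nv} (huv : Γ.RightOf u v) :
    Γ.dir u v = (1, h.plan.slopeR (h.nodeEquiv u)) := by
  have hw := h.mem_white.1 (h.plan.fl_white_of_next (h.next_iff.2 huv)); rw [fl_nodeEquiv] at hw
  have h1 : Γ.dir u v ∈ (Γ.star u).filter (fun a => 0 < a.1) :=
    Multiset.mem_filter.2 ⟨mem_star.2 (.inl ⟨_, huv.1, rfl⟩), huv.2⟩
  rwa [h.right_star hw (h.left_star hw), Multiset.mem_singleton] at h1

theorem plan_dir {u v : Fin Γ.nv} (huv : Γ.graph.Adj u v) :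
    h.plan.dir (h.nodeEquiv u) (h.nodeEquiv v) = Γ.dir u v := by
  have key : ∀ {u v}, h.plan.Next (h.nodeEquiv u) (h.nodeEquiv v) ∨
      h.plan.Vert (h.nodeEquiv u) (h.nodeEquiv v) →
      h.plan.dir (h.nodeEquiv u) (h.nodeEquiv v) = Γ.dir u v := by
    rintro u v (h1 | h1)
    · rw [h.plan.dir_next h1, h.dir_rightOf (h.next_iff.1 h1)]
    · rw [h.plan.dir_vert h1]; obtain ⟨hu, rfl⟩ := h.vert_iff.1 h1
      rw [nodeEquiv_val, h.plan_jump, h.jumpAt_black (h.g_black hu), h.jumpAt_eq hu]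
      exact Prod.ext (h.adj_markAt hu).2.symm (by simp)
  have hadj := h.plan_graph_adj.2 huv; rcases id hadj with h1 | h1 | h1 | h1
  · exact key (.inl h1)
  · rw [h.plan.dir_symm hadj, Γ.dir_symm _ _ huv, key (.inl h1)]
  · exact key (.inr h1)
  · rw [h.plan.dir_symm hadj, Γ.dir_symm _ _ huv, key (.inr h1)]

theorem plan_ends (u : Fin Γ.nv) : h.plan.ends (h.nodeEquiv u) = Γ.ends u := by
  unfold FloorPlan.ends; rw [fl_nodeEquiv, nodeEquiv_val]
  have hhost : h.plan.host (g u) = g u := rfl; simp only [hhost, h.mem_white]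
  by_cases hw : Γ.vertDeg (μ (f u)) = 0
  · have h0 : ¬ (f u = g u ∧ ¬ Γ.vertDeg (μ (g u)) = 0) := fun h1 => h1.2 (h1.1 ▸ hw)
    have hw' : h.plan.fl (h.nodeEquiv u).1 ∈ h.plan.D.white := by
      rw [fl_nodeEquiv]; exact h.mem_white.2 hw
    rw [if_neg h0, add_zero, ← Multiset.filter_sign (Γ.ends u), h.vertical_ends hw, add_zero]
    congr 1
    · by_cases hfirst : h.plan.First (h.nodeEquiv u)
      · rw [if_pos ⟨hw, hfirst⟩, ← filter_ends_of_forall (h.first_iff.1 hfirst), h.left_star hw,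
          h.plan.slopeL_of_first hw' hfirst, fl_nodeEquiv]
      · rw [if_neg fun h1 => hfirst h1.2]; rw [h.first_iff, not_not] at hfirst
        obtain ⟨y, hy, hd⟩ := hfirst
        exact (not_end_of_neighbor (p := fun a => a.1 < 0) (h.side_deg hw).2.le hy hd).symm
    · by_cases hlast : h.plan.Last (h.nodeEquiv u)
      · rw [if_pos ⟨hw, hlast⟩, ← filter_ends_of_forall (h.last_iff.1 hlast),
          h.right_star hw (h.left_star hw), h.plan.slopeR_of_last h.valid hw' hlast, fl_nodeEquiv]
      · rw [if_neg fun h1 => hlast h1.2]; rw [h.last_iff, not_not] at hlast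
        obtain ⟨y, hy, hd⟩ := hlast
        exact (not_end_of_neighbor (p := fun a => 0 < a.1) (h.side_deg hw).1.le hy hd).symm
  · have h1 := h.eq_of_f_black hw; have h2 : f u = g u := by_contra fun h3 => hw (h.f_white h3)
    rw [if_neg fun h3 => hw h3.1, if_neg fun h3 => hw h3.1, if_pos ⟨h2, h2 ▸ hw⟩, zero_add, zero_add]
    conv_rhs => rw [h1, ← h.floorEnds_black hw, h.floorEnds_black' hw, h2]
    rfl

end TropicalMap.FloorCoords

end PlanOfMap

/-! ### Tropical stable maps through stretched points are floor decomposed -/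

section RealizationOfSolutions

variable {Δ : DelPezzoDegree} {r s : ℕ}

theorem TropicalMap.Meets.pos_mark {Γ : TropicalMap r s} {p : Fin r → ℝ × ℝ} {q : Fin s → ℝ × ℝ}
    (h : Γ.Meets p q) (a : Mark r s) : Γ.pos (Γ.mark a) = markedPoint p q a := by
  cases a with
  | x i => exact h.1 i
  | y j => exact (h.2 j).1
  | z j => exact (h.2 j).2

/-- The constant of stretched configurations. -/
def DelPezzoDegree.stretchBound (Δ : DelPezzoDegree) : ℝ := max Δ.slopeBound (2 * Δ.n * (Δ.n + 1))

theorem DelPezzoDegree.card_ends_eq (hΔ : Δ.Valid) : Multiset.card Δ.ends = Δ.n + 1 := by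
  rw [DelPezzoDegree.card_ends hΔ, DelPezzoDegree.n_add_one hΔ]

theorem TropicalMap.exists_steep (hΔ : Δ.Valid) {M : Merging Δ.n r s} {p : Fin r → ℝ × ℝ}
    {q : Fin s → ℝ × ℝ} {C : ℝ} (hC : Δ.stretchBound ≤ C) (hM : M.Fits p q)
    (hv : VerticallyStretched C p q) {Γ : TropicalMap r s} (hdeg : Γ.degree = Δ.ends) (hMC : Γ.InMC)
    (hmeets : Γ.Meets p q) (hsurj : Set.SurjOn Γ.evalTangent Γ.cellTangent Set.univ) :
    ∃ (Γ' : TropicalMap r s) (η : ℝ) (f g : _), IsClose η Γ' Γ ∧ FloorCoords M Γ' f g := by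
  have hn : r + 2 * s = Δ.n := by rw [← Mark.card, Fintype.card_congr M.slot, Fintype.card_fin]
  have hcard := DelPezzoDegree.card_ends_eq hΔ; let K : ℝ := 2 * Δ.n * (Δ.n + 1)
  have hK : 0 ≤ K := by positivity
  have hKC : K ≤ C := (le_max_right _ _).trans hC
  have hgap : ∀ a b, M.slot a < M.slot b → b ≠ a.swap → ∀ c d,
      0 < (markedPoint p q b).2 - (markedPoint p q a).2 -
        K * |(markedPoint p q c).1 - (markedPoint p q d).1| := by
    intro a b hab hne c d
    have h1 := M.point_stretched hM hv hab (fun h => hne (M.slot.injective (h.trans (M.partner_slot a))))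
      (M.slot c) (M.slot d)
    simp only [M.point_slot] at h1; have h2 := mul_le_mul_of_nonneg_right hKC
      (abs_nonneg ((markedPoint p q c).1 - (markedPoint p q d).1))
    linarith
  obtain ⟨κ, hκ, hκ'⟩ := exists_pos_lower_bound fun t : (Mark r s × Mark r s) × Mark r s × Mark r s =>
    (markedPoint p q t.1.2).2 - (markedPoint p q t.1.1).2 -
        K * |(markedPoint p q t.2.1).1 - (markedPoint p q t.2.2).1|
  obtain ⟨Γ', hclose, hR, hpair⟩ := exists_rigid (B := Multiset.card Γ.degree) (η := κ / (2 * K + 3)) hMC hsurj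
    (by rw [hdeg, hcard, hn]) (by positivity)
  have hdeg' : Γ'.degree = Δ.ends := hclose.degree_eq.trans hdeg
  have hpos : ∀ a, |(Γ'.pos (Γ'.mark a)).1 - (markedPoint p q a).1| ≤ κ / (2 * K + 3) ∧
      |(Γ'.pos (Γ'.mark a)).2 - (markedPoint p q a).2| ≤ κ / (2 * K + 3) := by
    obtain ⟨π, -, -, -, -, hmark, hd⟩ := hclose; intro a; have h1 := (hd (Γ'.mark a)).le
    rw [hmark, hmeets.pos_mark, Prod.dist_eq, max_le_iff, Real.dist_eq, Real.dist_eq] at h1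
    exact h1
  have hgap' : ∀ a b, M.slot a < M.slot b → b ≠ a.swap → ∀ c d,
      K * |(Γ'.pos (Γ'.mark c)).1 - (Γ'.pos (Γ'.mark d)).1| <
        (Γ'.pos (Γ'.mark b)).2 - (Γ'.pos (Γ'.mark a)).2 := by
    intro a b hab hne c d; have h1 := hκ' ((a, b), c, d) (hgap a b hab hne c d); simp only at h1
    have hη : κ / (2 * K + 3) * (2 * K + 3) = κ := div_mul_cancel₀ _ (by positivity)
    have hη0 : 0 < κ / (2 * K + 3) := by positivity
    have ha := abs_le.1 (hpos a).2; have hb := abs_le.1 (hpos b).2; have hc := abs_le.1 (hpos c).1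
    have hd := abs_le.1 (hpos d).1; have h2 : |(Γ'.pos (Γ'.mark c)).1 - (Γ'.pos (Γ'.mark d)).1| ≤
        |(markedPoint p q c).1 - (markedPoint p q d).1| + 2 * (κ / (2 * K + 3)) := by
      have h3 := abs_le.1 (le_refl |(markedPoint p q c).1 - (markedPoint p q d).1|)
      exact abs_le.2 ⟨by linarith, by linarith⟩
    have h3 := mul_le_mul_of_nonneg_left h2 hK; linarith
  have hlt : ∀ a b, M.slot a < M.slot b → b ≠ a.swap → ∀ c d, Γ'.nv * (Multiset.card Γ'.degree *
        |(Γ'.pos (Γ'.mark c)).1 - (Γ'.pos (Γ'.mark d)).1|) <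
          (Γ'.pos (Γ'.mark b)).2 - (Γ'.pos (Γ'.mark a)).2 := by
    intro a b hab hne c d; refine lt_of_le_of_lt ?_ (hgap' a b hab hne c d)
    rw [hdeg', hcard, ← mul_assoc]; refine mul_le_mul_of_nonneg_right ?_ (abs_nonneg _); push_cast
    refine mul_le_mul_of_nonneg_right ?_ (by positivity); have h1 := hR.card_nv
    have h2 : Γ'.nv ≤ 2 * Δ.n := by omega
    exact_mod_cast h2
  have hS : Γ'.Steep := by
    refine ⟨fun j => hclose.degree_eq ▸ hpair j, fun a b hne hne' c d => ?_⟩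
    rcases lt_or_gt_of_ne fun h => hne (M.slot.injective h).symm with h1 | h1
    · have h2 := hlt a b h1 hne' c d; rw [abs_sub_comm (Γ'.pos (Γ'.mark a)).2]
      exact h2.trans_le (le_abs_self _)
    · exact (hlt b a h1 (fun h2 => hne' (by rw [h2, Mark.swap_swap])) c d).trans_le (le_abs_self _)
  have hO : ∀ a b, M.slot a < M.slot b → (Γ'.pos (Γ'.mark a)).2 < (Γ'.pos (Γ'.mark b)).2 := by
    intro a b hab; by_cases hb : b = a.swap
    · subst hb; cases a with
      | x i => exact absurd hab (lt_irrefl _)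
      | y j => exact sub_pos.1 (lt_of_le_of_lt (by positivity) (hpair j))
      | z j => exact absurd hab (M.slot_lt j).not_gt
    · exact sub_pos.1 (lt_of_le_of_lt (by positivity) (hgap' a b hab hb a b))
  obtain ⟨f, g, hfg⟩ := hR.exists_floorCoords (M := M) hΔ hdeg' hS hO
  exact ⟨Γ', _, f, g, hclose, hfg⟩

theorem TropicalMap.exists_realizes (hΔ : Δ.Valid) {M : Merging Δ.n r s} {p : Fin r → ℝ × ℝ}
    {q : Fin s → ℝ × ℝ} {C : ℝ} (hC : Δ.stretchBound ≤ C) (hM : M.Fits p q)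
    (hv : VerticallyStretched C p q) {Γ : TropicalMap r s} (hdeg : Γ.degree = Δ.ends) (hMC : Γ.InMC)
    (hmeets : Γ.Meets p q) (hsurj : Set.SurjOn Γ.evalTangent Γ.cellTangent Set.univ) :
    ∃ (D : FloorDiagram Δ) (e : _),
      (D.layout M ((le_max_left _ _).trans hC) hM hv).Realizes M.slot Γ e := by
  obtain ⟨Γ', η, f, g, ⟨π, hconn, hadj, -, hends, hmark, -⟩, h⟩ :=
    exists_steep hΔ hC hM hv hdeg hMC hmeets hsurj
  let L : Layout h.plan.D := h.plan.D.layout M ((le_max_left _ _).trans hC) hM hv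
  have hstep : ∀ {u v}, Γ'.graph.Adj u v → ∃ c : ℝ, 0 ≤ c ∧
      Γ.pos (π v) = Γ.pos (π u) + c • realDir (Γ'.dir u v) := by
    intro u v huv; by_cases hne : π u = π v
    · exact ⟨0, le_rfl, by simp [hne]⟩
    · obtain ⟨h1, h2, -⟩ := hadj u v huv hne
      exact ⟨_, (Γ.len_pos _ _ h1).le, by rw [h2]; exact Γ.affine _ _ h1⟩
  have hP : ∀ v, Γ.pos (π (Γ'.markAt M v)) = L.P v := fun v => by
    rw [markAt, hmark, hmeets.pos_mark]; rfl
  have hx : ∀ u, (Γ.pos (π u)).1 = (L.P (g u)).1 := by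
    intro u; rw [← hP]; by_cases hu : f u = g u
    · rw [← h.eq_markAt_iff.1 hu]
    · obtain ⟨c, -, hc⟩ := hstep (h.adj_markAt hu).1; rw [hc]; simp [realDir, (h.adj_markAt hu).2]
  have hcomp : h.plan.Compatible L := by
    refine ⟨fun b => .inl rfl, fun e e' hfl hkey => ?_⟩; obtain ⟨u, rfl⟩ := h.nodeEquiv.surjective e
    obtain ⟨v, rfl⟩ := h.nodeEquiv.surjective e'; rw [h.fl_nodeEquiv, h.fl_nodeEquiv] at hfl
    change (L.P (g u)).1 ≤ (L.P (g v)).1; rw [← hx, ← hx]; have hchain := (h.key_le_iff hfl).1 hkey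
    clear hfl hkey
    induction hchain with
    | refl => exact le_rfl
    | @tail a b _ hab ih =>
      refine ih.trans ?_; obtain ⟨c, hc0, hc⟩ := hstep hab.1; rw [hc]
      have h1 : (0 : ℝ) < (Γ'.dir a b).1 := by exact_mod_cast hab.2
      simp only [realDir, Prod.fst_add, Prod.smul_fst, smul_eq_mul, le_add_iff_nonneg_right]
      positivity
  let A := h.plan.preMap hΔ _ hcomp.admissible M.slot
  have haff : ∀ {u v}, Γ'.graph.Adj u v → A.pos (h.nodeEquiv v) = A.pos (h.nodeEquiv u) +
      A.len (h.nodeEquiv u) (h.nodeEquiv v) • realDir (Γ'.dir u v) := by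
    intro u v huv; rw [← h.plan_dir huv]; exact A.affine _ _ (h.plan_graph_adj.2 huv)
  have hpos : ∀ u, Γ.pos (π u) = A.pos (h.nodeEquiv u) := by
    have h0 := h.rigid.eq_zero (fun u => A.pos (h.nodeEquiv u) - Γ.pos (π u)) (fun u v huv => by
      obtain ⟨c, -, hc⟩ := hstep huv; refine ⟨A.len (h.nodeEquiv u) (h.nodeEquiv v) - c, ?_⟩
      simp only; rw [haff huv, hc, sub_smul]
      abel) (fun a => by
      have h1 : Γ'.mark a = Γ'.markAt M (M.slot a) := by rw [markAt, M.slot.symm_apply_apply]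
      rw [h1, hP, h.nodeEquiv_markAt, sub_eq_zero]; refine (FloorPlan.nodePos_eq hcomp _).trans ?_
      exact L.labelPos_diag _)
    intro u; exact (sub_eq_zero.1 (congrFun h0 u)).symm
  have hd : ∀ {u v}, Γ'.graph.Adj u v → realDir (Γ'.dir u v) ≠ 0 := fun huv h1 =>
    h.rigid.dir_ne _ _ huv (realDir_eq_zero h1)
  have hG : IsContraction Γ'.graph Γ.graph π :=
    IsContraction.of_isTree Γ'.isTree.1 Γ.isTree hconn fun u v huv hne => (hadj u v huv hne).1
  have hK : Contracts A Γ (π ∘ h.nodeEquiv.symm) := by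
    have hadjA : ∀ {u v}, A.graph.Adj (h.nodeEquiv u) (h.nodeEquiv v) ↔ Γ'.graph.Adj u v := h.plan_graph_adj
    have hlen : ∀ {u v}, Γ'.graph.Adj u v → ∀ {c : ℝ}, Γ.pos (π v) = Γ.pos (π u) + c • realDir (Γ'.dir u v) →
        c = A.len (h.nodeEquiv u) (h.nodeEquiv v) := by
      intro u v huv c hc; rw [hpos, hpos, haff huv] at hc
      exact (smul_left_injective ℝ (hd huv) (add_left_cancel hc)).symm
    refine ⟨IsContraction.of_isTree A.isTree.1 Γ.isTree (fun c => ?_) fun e e' => ?_, fun e e' => ?_,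
      fun e e' => ?_, fun e e' => ?_, fun e => ?_, fun c => ?_, fun a => ?_⟩
    · refine (hconn c).map (⟨fun u => ⟨h.nodeEquiv u.1, ?_⟩, fun {u v} huv => hadjA.2 huv⟩ :
        Γ'.graph.induce {u | π u = c} →g A.graph.induce {e | (π ∘ h.nodeEquiv.symm) e = c}) ?_
      · change π (h.nodeEquiv.symm (h.nodeEquiv u.1)) = c; rw [Equiv.symm_apply_apply]; exact u.2
      · rintro ⟨e, he⟩
        exact ⟨⟨h.nodeEquiv.symm e, he⟩, Subtype.ext (h.nodeEquiv.apply_symm_apply e)⟩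
    all_goals
      try obtain ⟨u, rfl⟩ := h.nodeEquiv.surjective e
      try obtain ⟨v, rfl⟩ := h.nodeEquiv.surjective e'
      simp only [comp, Equiv.symm_apply_apply, hadjA]
    · exact fun huv hne => (hadj u v huv hne).1
    · intro huv hne; obtain ⟨h1, h2, -⟩ := hadj u v huv hne
      exact hlen huv (by rw [h2]; exact Γ.affine _ _ h1)
    · intro huv heq; exact (hlen huv (c := 0) (by simp [heq])).symm
    · intro huv hne; rw [← (hadj u v huv hne).2.1]; exact (h.plan_dir huv).symm
    · exact hpos u
    · rw [hends c]; refine sum_equiv h.nodeEquiv (fun u => by simp) fun u _ => (h.plan_ends u).symm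
    · have h1 : h.nodeEquiv.symm (A.mark a) = Γ'.mark a := by
        rw [Equiv.symm_apply_eq, ← M.slot.symm_apply_apply a]
        exact (congrArg _ (by rw [M.slot.symm_apply_apply])).trans (h.nodeEquiv_markAt (M.slot a)).symm
      rw [h1, hmark]
  obtain ⟨e, he, -⟩ := hK.realizes (hc := hcomp); exact ⟨h.plan.D, e, he⟩

end RealizationOfSolutions

/-! ### The multiplicity of a floor diagram does not depend on the representative -/

section Invariance

variable {Δ : DelPezzoDegree} {r s : ℕ} {M : Merging Δ.n r s} {D E : FloorDiagram Δ}
  {τ : Equiv.Perm (Fin Δ.n)}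

namespace FloorDiagram

theorem IsIso.symm (h : IsIso M D E τ) : IsIso M E D τ.symm :=
  ⟨h.marks.symm, fun v => by simp [← h.white], fun u v => by simp [← h.weight],
    fun v => by simp [← h.inEnds], fun v => by simp [← h.outEnds], fun v => by simp [← h.leakPos],
    fun v => by simp [← h.leakNeg]⟩

theorem IsIso.trans {D' : FloorDiagram Δ} {σ : Equiv.Perm (Fin Δ.n)} (h : IsIso M D E τ)
    (h' : IsIso M E D' σ) : IsIso M D D' (τ.trans σ) :=
  ⟨h.marks.trans h'.marks, fun v => by simp [← h.white, ← h'.white],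
    fun u v => by simp [← h.weight, ← h'.weight], fun v => by simp [← h.inEnds, ← h'.inEnds],
    fun v => by simp [← h.outEnds, ← h'.outEnds], fun v => by simp [← h.leakPos, ← h'.leakPos],
    fun v => by simp [← h.leakNeg, ← h'.leakNeg]⟩

theorem exists_exchange {j : Fin s} {w : Fin Δ.n} (h : IsTwinRoot D.graph M.slot (D.aut M) j w) :
    ∃ φ, IsIso M D D φ ∧ φ w = w ∧ ∀ v ∈ D.twin M j, φ v = M.partner v ∧ φ v ∈ D.twin M j := by
  have hmem := mem_twin_iff h; obtain ⟨hne, hy, hz, φ, hφ, hyz⟩ := h; have hφ' : IsIso M D D φ := hφ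
  have hzy : φ (M.slot (.z j)) = M.slot (.y j) := by
    rcases hφ'.marks.2 j with h | h
    exacts [absurd (φ.injective (hyz.trans h.2.symm)) hne, h.2]
  have hw : φ w = w := D.isTree.2.common_neighbor_unique hne hy hz
    (by rw [← hzy]; exact (hφ'.adj _ _).2 hz) (by rw [← hyz]; exact (hφ'.adj _ _).2 hy)
  refine ⟨φ, hφ', hw, fun v hv => ?_⟩; have key : φ v ≠ v ∧ φ v ∈ D.twin M j := by
    rw [hmem] at hv ⊢; rcases hv with hv | hv
    · have h1 := (branch_map D.isTree D.isTree hφ'.adj hy hz hw hyz v).1 hv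
      exact ⟨fun h2 => branch_disjoint D.isTree hy hz hne hv (h2 ▸ h1), .inr h1⟩
    · have h1 := (branch_map D.isTree D.isTree hφ'.adj hz hy hw hzy v).1 hv
      exact ⟨fun h2 => branch_disjoint D.isTree hz hy hne.symm hv (h2 ▸ h1), .inl h1⟩
  exact ⟨(hφ'.eq_or_partner v).resolve_left key.1, key.2⟩

theorem partner_mem_twin_iff {j : Fin s} {v : Fin Δ.n} :
    M.partner v ∈ D.twin M j ↔ v ∈ D.twin M j := by
  have key : ∀ v, v ∈ D.twin M j → M.partner v ∈ D.twin M j := by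
    rintro v hv; obtain ⟨w, hw, -⟩ := id hv; obtain ⟨φ, -, -, hφ⟩ := exists_exchange hw
    rw [← (hφ v hv).1]; exact (hφ v hv).2
  exact ⟨fun h => M.partner_partner v ▸ key _ h, key v⟩

theorem IsIso.isTwinRoot (h : IsIso M D E τ) {j : Fin s} {w : Fin Δ.n}
    (hw : IsTwinRoot D.graph M.slot (D.aut M) j w) : IsTwinRoot E.graph M.slot (E.aut M) j (τ w) := by
  obtain ⟨φ, hφ, -, hex⟩ := exists_exchange hw
  have hy := (hex (M.slot (.y j)) ((mem_twin_iff hw _).2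
    (.inl (self_mem_branch D.isTree hw.2.1)))).1
  have hz := (hex (M.slot (.z j)) ((mem_twin_iff hw _).2
    (.inr (self_mem_branch D.isTree hw.2.2.1)))).1
  rw [M.partner_y] at hy; rw [M.partner_z] at hz; have h1 := (h.adj _ _).2 hw.2.1
  have h2 := (h.adj _ _).2 hw.2.2.1; refine ⟨hw.1, ?_, ?_, _, (h.symm.trans hφ).trans h, ?_⟩
  · rcases h.marks.2 j with h3 | h3
    · rw [← h3.1]; exact h1
    · rw [← h3.2]; exact h2
  · rcases h.marks.2 j with h3 | h3
    · rw [← h3.2]; exact h2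
    · rw [← h3.1]; exact h1
  · rcases h.marks.2 j with h3 | h3
    · rw [← h3.1, ← h3.2]; simp [hy]
    · have h4 : τ.symm (M.slot (.y j)) = M.slot (.z j) := by rw [Equiv.symm_apply_eq, h3.2]
      simp [h4, hz, h3.1]

theorem IsIso.mem_twin (h : IsIso M D E τ) {j : Fin s} {v : Fin Δ.n} :
    τ v ∈ E.twin M j ↔ v ∈ D.twin M j := by
  have key : ∀ {D E : FloorDiagram Δ} {τ : Equiv.Perm (Fin Δ.n)}, IsIso M D E τ → ∀ {v},
      v ∈ D.twin M j → τ v ∈ E.twin M j := by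
    intro D E τ h v hv; obtain ⟨w, hw, -⟩ := id hv; have hw' := h.isTwinRoot hw
    rw [mem_twin_iff hw] at hv; rw [mem_twin_iff hw']; have hb := fun a (ha : D.graph.Adj w a) =>
      branch_map D.isTree E.isTree h.adj ha ((h.adj _ _).2 ha) rfl rfl v
    rcases h.marks.2 j with h3 | h3
    · rw [← h3.1, ← h3.2]; exact hv.imp (hb _ hw.2.1).1 (hb _ hw.2.2.1).1
    · have h4 := (hv.imp (hb _ hw.2.1).1 (hb _ hw.2.2.1).1).symm; rw [h3.1, h3.2] at h4; exact h4
  refine ⟨fun hv => ?_, key h⟩; have := key h.symm hv; rwa [Equiv.symm_apply_apply] at this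

theorem IsIso.twin_eq (h : IsIso M D E τ) (j : Fin s) : E.twin M j = D.twin M j := by
  ext v; rw [← h.mem_twin]; rcases h.eq_or_partner v with h1 | h1
  · rw [h1]
  · rw [h1, partner_mem_twin_iff]

theorem IsIso.exists_fix (h : IsIso M D E τ) {j : Fin s} {v : Fin Δ.n} (hv : v ∈ D.twin M j) :
    ∃ σ, IsIso M D E σ ∧ σ v = v := by
  rcases h.eq_or_partner v with h1 | h1
  · exact ⟨τ, h, h1⟩
  · obtain ⟨w, hw, -⟩ := id hv; obtain ⟨φ, hφ, -, hex⟩ := exists_exchange hw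
    refine ⟨_, hφ.trans h, ?_⟩
    rw [Equiv.trans_apply, (hex v hv).1, ← h.partner, h1, M.partner_partner]

theorem IsIso.isRoot_iff (h : IsIso M D E τ) (j : Fin s) : E.IsRoot M j ↔ D.IsRoot M j :=
  ⟨fun ⟨_, hw⟩ => ⟨_, h.symm.isTwinRoot hw⟩, fun ⟨_, hw⟩ => ⟨_, h.isTwinRoot hw⟩⟩

theorem IsIso.elevatorWeight (h : IsIso M D E τ) (v : Fin Δ.n) :
    E.elevatorWeight (τ v) = D.elevatorWeight v := by
  unfold FloorDiagram.elevatorWeight; rw [h.inEnds, ← Equiv.sum_comp τ]; simp only [h.weight]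

theorem IsIso.twinMult_eq (h : IsIso M D E τ) {k : Type u} [Field k] (d : Fin s → kˣ) {j : Fin s}
    (hj : D.IsRoot M j) : E.twinMult M d j = D.twinMult M d j := by
  have hw : ∀ v ∈ D.twin M j, (v ∈ E.white ↔ v ∈ D.white) ∧ E.elevatorWeight v = D.elevatorWeight v ∧
      E.inEnds v = D.inEnds v ∧ E.outEnds v = D.outEnds v := by
    intro v hv; obtain ⟨σ, hσ, h1⟩ := h.exists_fix hv; have h2 := hσ.white v
    have h3 := hσ.elevatorWeight v; have h4 := hσ.inEnds v; have h5 := hσ.outEnds v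
    rw [h1] at h2 h3 h4 h5; exact ⟨h2, h3, h4, h5⟩
  have hyj : M.slot (.y j) ∈ D.twin M j := by
    obtain ⟨w, hw⟩ := hj; exact (mem_twin_iff hw _).2 (.inl (self_mem_branch D.isTree hw.2.1))
  have hT : (univ.filter fun i => M.slot (.y i) ∈ E.twin M j) =
      univ.filter fun i => M.slot (.y i) ∈ D.twin M j := by
    rw [h.twin_eq]
  have hE : (univ.filter fun i => M.slot (.y i) ∈ E.twin M j).filter (fun i => M.slot (.y i) ∉ E.white) =
      (univ.filter fun i => M.slot (.y i) ∈ D.twin M j).filter fun i => M.slot (.y i) ∉ D.white := by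
    rw [hT]; exact filter_congr fun i hi => not_congr (hw _ (mem_filter.1 hi).2).1
  refine GW.twinTree_congr d hT hE (fun i hi => ?_) ?_
  · rw [hE] at hi; exact (hw _ (mem_filter.1 (mem_filter.1 hi).1).2).2.1
  · rw [hE]; congr 1
    · exact (hw _ hyj).2.1
    · congr 1; refine filter_congr fun i hi => ?_
      have h1 := hw _ (mem_filter.1 (mem_filter.1 hi).1).2; rw [h1.2.2.1, h1.2.2.2]

theorem IsIso.onVertex_iff (h : IsIso M D E τ) (j : Fin s) : E.OnVertex M j ↔ D.OnVertex M j := by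
  unfold OnVertex; rw [← h.adj]; rcases h.marks.2 j with h1 | h1
  · rw [h1.1, h1.2]
  · rw [h1.1, h1.2, adj_comm]

theorem IsIso.weight_onVertex (h : IsIso M D E τ) {j : Fin s} (hj : D.OnVertex M j) :
    E.weight (M.slot (.y j)) (M.slot (.z j)) = D.weight (M.slot (.y j)) (M.slot (.z j)) := by
  rw [← h.weight]; rcases h.marks.2 j with h1 | h1
  · rw [h1.1, h1.2]
  · exfalso; have h2 := h.weight (M.slot (.y j)) (M.slot (.z j))
    rw [h1.1, h1.2, E.weight_eq_zero_of_lt (M.slot_lt j).le] at h2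
    refine ((D.adj_iff.1 hj).resolve_right fun h3 => h3 ?_) h2.symm
    exact D.weight_eq_zero_of_lt (M.slot_lt j).le

theorem IsIso.slot_iff (h : IsIso M D E τ) (j : Fin s) (v : Fin Δ.n) :
    (τ v = M.slot (.y j) ∨ τ v = M.slot (.z j)) ↔ (v = M.slot (.y j) ∨ v = M.slot (.z j)) := by
  rcases h.marks.2 j with h1 | h1
  · rw [← h1.1, ← h1.2, τ.apply_eq_iff_eq, τ.apply_eq_iff_eq]; rw [h1.1, h1.2]
  · have h2 : τ v = M.slot (.y j) ↔ v = M.slot (.z j) := by rw [← h1.2, τ.apply_eq_iff_eq]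
    have h3 : τ v = M.slot (.z j) ↔ v = M.slot (.y j) := by rw [← h1.1, τ.apply_eq_iff_eq]
    rw [h2, h3, or_comm]

theorem IsIso.mult_eq (h : IsIso M D E τ) {k : Type u} [Field k] (d : Fin s → kˣ) :
    E.mult M d = D.mult M d := by
  unfold FloorDiagram.mult; congr 1; congr 1
  · congr 1
    · exact prod_congr (filter_congr fun j _ => h.isRoot_iff j) fun j hj =>
        h.twinMult_eq d (mem_filter.1 hj).2
    · refine prod_congr (filter_congr fun j _ => h.onVertex_iff j) fun j hj => ?_
      rw [h.weight_onVertex (mem_filter.1 hj).2]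
  · refine prod_congr (filter_congr fun j _ => ?_) fun _ _ => rfl; rw [h.onVertex_iff]
    simp only [h.twin_eq]
  · symm; refine prod_equiv (τ.prodCongr τ) (fun e => ?_) fun e _ => ?_
    · simp only [mem_filter_univ, Equiv.prodCongr_apply, Prod.map, h.weight]
      refine and_congr_right fun _ => ?_
      conv_rhs => rw [← τ.forall_congr_right]
      simp only [τ.apply_eq_iff_eq, h.mem_twin, h.white, h.onVertex_iff, h.slot_iff]
    · exact congrArg _ (h.weight _ _).symm

end FloorDiagram

end Invariance

/-! ### The bijection between floor diagrams and solutions -/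

section Correspondence

theorem Quotient.exists_bijective {α β : Type} {sα : Setoid α} {sβ : Setoid β} (R : α → β → Prop)
    (hα : ∀ a, ∃ b, R a b) (hβ : ∀ b, ∃ a, R a b)
    (hR : ∀ {a b a' b'}, R a b → R a' b' → (sα a a' ↔ sβ b b')) :
    ∃ φ : Quotient sα → Quotient sβ, Bijective φ ∧
      ∀ a b, R a b → φ (Quotient.mk _ a) = Quotient.mk _ b := by
  choose F hF using hα
  let φ : Quotient sα → Quotient sβ := Quotient.map F fun a a' h => (hR (hF a) (hF a')).1 h
  have hφ : ∀ a b, R a b → φ (Quotient.mk _ a) = Quotient.mk _ b := fun a b h =>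
    Quotient.sound ((hR (hF a) h).1 (Setoid.refl' sα a))
  refine ⟨φ, ⟨?_, ?_⟩, hφ⟩
  · rintro ⟨a⟩ ⟨a'⟩ h; exact Quotient.sound ((hR (hF a) (hF a')).2 (Quotient.exact h))
  · rintro ⟨b⟩; obtain ⟨a, ha⟩ := hβ b; exact ⟨Quotient.mk _ a, hφ a b ha⟩

variable {Δ : DelPezzoDegree} {r s : ℕ} {M : Merging Δ.n r s} {p : Fin r → ℝ × ℝ} {q : Fin s → ℝ × ℝ}
  {C : ℝ}

theorem Layout.Realizes.isSolution (hΔ : Δ.Valid) {D : FloorDiagram Δ} {hC : Δ.slopeBound ≤ C}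
    {hM : M.Fits p q} {hv : VerticallyStretched C p q} {Γ : TropicalMap r s}
    {e : Fin Γ.nv → Fin Δ.n × ℝ} (h : (D.layout M hC hM hv).Realizes M.slot Γ e) :
    Γ.degree = Δ.ends ∧ Γ.InMC ∧ Γ.Meets p q := by
  refine ⟨?_, h.inMC hΔ rfl (M.point_partner p q), ?_⟩
  · obtain ⟨π, hπ, -⟩ := Layout.Realizes.contracts (F := (D.layout M hC hM hv).basePlan) hΔ
      (D.layout M hC hM hv).basePlan_compatible h
    rw [hπ.degree]; exact FloorPlan.sum_ends _ hΔ
  · have h1 : ∀ a, Γ.pos (Γ.mark a) = markedPoint p q a := fun a => by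
      rw [h.pos_mark]; exact M.point_slot p q a
    exact ⟨fun i => h1 _, fun j => ⟨h1 _, h1 _⟩⟩

end Correspondence

end

theorem theorem1p4 (Δ : DelPezzoDegree) (hΔ : Δ.Valid) : ∃ C : ℝ, ∀ (r s : ℕ), r + 2 * s = Δ.n →
      ∀ (p : Fin r → ℝ × ℝ) (q : Fin s → ℝ × ℝ), VerticallyStretched C p q → GeneralPosition Δ p q →
      ∀ M : Merging Δ.n r s, M.Fits p q →
        Finite (MergedFloorDiagram Δ M) ∧ Finite (TropicalSolutionClass Δ p q) ∧
        ∀ (k : Type u) [Field k],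
          (ringChar k = 0 ∨ (3 < ringChar k ∧ Metric.diam Δ.polygon < ringChar k)) →
          ∀ d : Fin s → kˣ, floorCount Δ M d = tropicalCount Δ p q d := by
  refine ⟨Δ.stretchBound, fun r s _ p q hv hgp M hM => ?_⟩
  have hC : Δ.slopeBound ≤ Δ.stretchBound := le_max_left _ _
  let R : FloorDiagram Δ → TropicalSolution Δ p q → Prop := fun D Γ =>
    ∃ e, (D.layout M hC hM hv).Realizes M.slot Γ.1 e
  have hP : ∀ v, M.point p q (M.partner v) = M.point p q v := M.point_partner p q
  have hT : ∀ {D Γ}, (h : R D Γ) → (D.layout M hC hM hv).NoTies M := fun {D Γ} ⟨e, he⟩ =>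
    he.noTies (hgp Γ.1 Γ.2.1 Γ.2.2.1 Γ.2.2.2).surjOn
  obtain ⟨φ, hφ, hφR⟩ := Quotient.exists_bijective (sα := FloorDiagram.mergeSetoid Δ M)
    (sβ := tropicalSetoid Δ p q) R (fun D => by
      obtain ⟨Γ, e, he⟩ := FloorPlan.exists_realizes hΔ M.slot (D.layout M hC hM hv).basePlan_compatible
      exact ⟨⟨Γ, Layout.Realizes.isSolution hΔ he⟩, e, he⟩) (fun Γ =>
      TropicalMap.exists_realizes hΔ le_rfl hM hv Γ.2.1 Γ.2.2.1 Γ.2.2.2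
        (hgp Γ.1 Γ.2.1 Γ.2.2.1 Γ.2.2.2).surjOn) (fun {D Γ E Γ'} hD hE => by
      obtain ⟨e, he⟩ := id hD; obtain ⟨e', he'⟩ := id hE; constructor
      · rintro ⟨τ, hτ⟩; obtain ⟨ψ, hψ, -⟩ := he.exists_isIso_of_perm he' hτ (hτ.point p q) rfl rfl
        exact ⟨ψ, hψ⟩
      · rintro ⟨ψ, hψ⟩; obtain ⟨τ, hτ, -⟩ := he.exists_perm hΔ he' rfl rfl (hT hD) (hT hE) hP hP hψ
        exact ⟨τ, hτ⟩)
  have := FloorDiagram.finite Δ; have hfin : Finite (MergedFloorDiagram Δ M) := Quotient.finite _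
  refine ⟨hfin, Finite.of_surjective φ hφ.2, fun k _ _ d => ?_⟩
  refine finsum_eq_of_bijective φ hφ fun c => ?_
  obtain ⟨E, hE⟩ := TropicalMap.exists_realizes hΔ le_rfl hM hv (Quotient.out (φ c)).2.1
    (Quotient.out (φ c)).2.2.1 (Quotient.out (φ c)).2.2.2
    (hgp _ (Quotient.out (φ c)).2.1 (Quotient.out (φ c)).2.2.1 (Quotient.out (φ c)).2.2.2).surjOn
  have hE' : R E (Quotient.out (φ c)) := hE
  have h1 : Quotient.mk _ E = c := hφ.1 ((hφR _ _ hE').trans (Quotient.out_eq _))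
  obtain ⟨e, he⟩ := hE; obtain ⟨τ, hτ⟩ := Quotient.exact (h1.trans (Quotient.out_eq c).symm)
  rw [he.mult_eq hΔ rfl (hT hE') hP d]; exact hτ.mult_eq d
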